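/- **Setting.** Let $d\in\mathbb N_0$, $\rho\in[0,1]$, $m_1,m_2\in\mathbb R$. Write $X=(x,\xi)$, $Y=(y,\eta)$, $Z=(z,\zeta)$ for points of $\mathbb R^d\times\mathbb R^d$, $\sigma(X,Y)=\xi\cdot y-x\cdot\eta$, $\langle\xi\rangle=(1+|\xi|^2)^{1/2}$, and $(\mathcal F_\sigma f)(X)=(2\pi)^{-d}\int e^{i\sigma(X,Y)}f(Y)\,dY$ (so $\mathcal F_\sigma^{-1}=\mathcal F_\sigma$). The Hörmander class $S^m_\rho$ consists of all smooth $f:\mathbb R^{2d}\to\mathbb C$ with $\|f\|_{m,a,\alpha}:=\sup_{(x,\xi)}\langle\xi\rangle^{-m+|\alpha|\rho}|\partial_x^a\partial_\xi^\alpha f(x,\xi)|<\infty$ for all multi-indices $a,\alpha$. Let $B=(B_{kl})_{1\le k,l\le d}$ be a magnetic field, i.e. a closed real two-form $\frac12\sum_{k,l} B_{kl}\,dx_k\wedge dx_l$, $B_{lk}=-B_{kl}$, whose components are smooth and bounded with bounded derivatives of all orders. For $\varepsilon>0$ let $$\gamma_\varepsilon^B(x,y,z)=\frac1\varepsilon\int_{\langle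 x-\frac\varepsilon2(y+z),\;x+\frac\varepsilon2(y-z),\;x+\frac\varepsilon2(y+z)\rangle}B$$ be $1/\varepsilon$ times the flux of $B$ through the oriented triangle with the indicated corners, and $T_{\varepsilon,\lambda}(x,Y,Z)=\frac\varepsilon2\sigma(Y,Z)-\lambda\gamma^B_\varepsilon(x,y,z)$. For $f\in S^{m_1}_\rho$, $g\in S^{m_2}_\rho$ and a kernel $K$ put $$I_K(f,g)(X)=\frac1{(2\pi)^{2d}}\int dY\int dZ\,e^{i\sigma(X,Y+Z)}\,K(x,Y,Z)\,(\mathcal F_\sigma^{-1}f)(Y)\,(\mathcal F_\sigma^{-1}g)(Z)$$ as an oscillatory integral: for any Schwartz functions $\chi_1,\chi_2$ with $\chi_1(0)=\chi_2(0)=1$ the integral with $f,g$ replaced by $\chi_1(\delta\,\cdot)f$, $\chi_2(\delta\,\cdot)g$ converges absolutely for every $\delta>0$, and its limit as $\delta\downarrow0$ exists and does not depend on $\chi_1,\chi_2$. The magnetic Moyal product is $f\sharp^B_{\varepsilon,\lambda}g=I_K(f,g)$ with $K=e^{iT_{\varepsilon,\lambda}}$. **Terms.** Put $\mathcal L_0(Y,Z)=\frac12(\eta\cdot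 z-y\cdot\zeta)$ and, for $j\ge1$, $$\mathcal L_j(x,y,z)=\frac1{j!}\sum_{k,l=1}^d\ \sum_{\mu_1,\dots,\mu_{j-1}=1}^d\partial_{x_{\mu_1}}\cdots\partial_{x_{\mu_{j-1}}}B_{kl}(x)\,y_kz_l\Bigl(-\frac12\Bigr)^{j+1}\frac1{(j+1)^2}\sum_{c=1}^j\binom{j+1}{c}\bigl((1-(-1)^{j+1})c-(1-(-1)^c)(j+1)\bigr)\,y_{\mu_1}\cdots y_{\mu_{c-1}}z_{\mu_c}\cdots z_{\mu_{j-1}}.$$ For numbers (or commuting operators) $L_0,L_1,\dots$ let $$\mathcal T_{n,k}(L)=\sum_{\substack{k_0+\sum_{j=1}^njk_j=n\\ \sum_{j=1}^nk_j=k}}\frac{i^{k+k_0}}{k_0!\,k_1!\cdots k_n!}\,L_0^{k_0}\prod_{j=1}^nL_j^{k_j},$$ and define $(f\sharp^Bg)_{(n,k)}(X)$ by applying $\mathcal T_{n,k}(L)$, with $L_0=\mathcal L_0((\partial_\eta,\partial_y),(\partial_\zeta,\partial_z))$ and $L_j=\mathcal L_j(x,-i\partial_\eta,-i\partial_\zeta)$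 ($x$ a fixed parameter), to $f(Y)g(Z)$ and setting $Y=Z=X$. **Remainder.** For $N\in\mathbb N_0$ let $T^{(N)}=\varepsilon\mathcal L_0(Y,Z)+\lambda\sum_{j=1}^N\varepsilon^j\mathcal L_j(x,y,z)$ and let $\tilde R_N=I_{K_N}(f,g)$ be the oscillatory integral with kernel $$K_N=\frac{i^{N+1}}{N!}T_{\varepsilon,\lambda}^{N+1}\int_0^1(1-\tau)^Ne^{i\tau T_{\varepsilon,\lambda}}d\tau+\sum_{n=1}^N\frac{i^n}{n!}\bigl(T_{\varepsilon,\lambda}^n-(T^{(N)})^n\bigr)+\Bigl(\sum_{n=0}^N\frac{i^n}{n!}(T^{(N)})^n-\sum_{n=0}^N\sum_{k=0}^n\varepsilon^n\lambda^k\,\mathcal T_{n,k}(\mathcal L)\Bigr),$$ where $\mathcal T_{n,k}(\mathcal L)$ is taken at the numbers $L_0=\mathcal L_0(Y,Z)$, $L_j=\mathcal L_j(x,y,z)$. **Theorem (Asymptotic expansion of the magnetic Moyal product).** Let $f\in S^{m_1}_\rho$ and $g\in S^{m_2}_\rho$. 1. For all $\varepsilon\in(0,1]$, $\lambda\in[0,1]$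 the product $f\sharp^B_{\varepsilon,\lambda}g$ exists as an oscillatory integral. 2. $(f\sharp^Bg)_{(n,k)}\in S^{m_1+m_2-(n+k)\rho}_\rho$ for all $0\le k\le n$. 3. $(\varepsilon,\lambda)\mapsto f\sharp^B_{\varepsilon,\lambda}g$ is a semiclassical two-parameter symbol of order $m:=m_1+m_2$ on $(0,1)\times[0,1)$: with $c_{n,k}:=(f\sharp^Bg)_{(n,k)}\in S^{m-(n+k)\rho}_\rho$ for all $n,k\ge0$ (which is $0$ for $k>n$), one has $f\sharp^B_{\varepsilon,\lambda}g\in S^m_\rho$, and for all $N$ the difference $D_N:=f\sharp^B_{\varepsilon,\lambda}g-\sum_{n+k\le N}\varepsilon^n\lambda^kc_{n,k}$ lies in $S^{m-(N+1)\rho}_\rho$ with $\|D_N\|_{m,a,\alpha}\le C_{N,a,\alpha}\max\{\varepsilon,\lambda\}^{N+1}$, where $C_{N,a,\alpha}$ does not depend on $\varepsilon,\lambda$. 4. There are constants $C_{N,a,\alpha}$, independent of $\varepsilon$, $\lambda$ and $\varepsilon_{\rm prec}$ below, such that for all $N\in\mathbb N_0$, $\varepsilon\in(0,1]$, $\lambda\in[0,1]$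 the oscillatory integral $\tilde R_N$ exists, $$f\sharp^B_{\varepsilon,\lambda}g=\sum_{n=0}^N\sum_{k=0}^n\varepsilon^n\lambda^k\,(f\sharp^Bg)_{(n,k)}+\tilde R_N,\qquad \tilde R_N\in S^{m_1+m_2-(N+1)\rho}_\rho,$$ and $\|\tilde R_N\|_{m_1+m_2-(N+1)\rho,\,a,\alpha}\le C_{N,a,\alpha}\,\varepsilon^{N+1}$ for all $a,\alpha$. 5. For every $\varepsilon_{\rm prec}\in(0,1]$, $\varepsilon\in(0,1)$, $\lambda\in[0,1)$ there are $n_c,k_c\in\mathbb N_0$ with $\varepsilon^{n_c+1}<\varepsilon_{\rm prec}\le\varepsilon^{n_c}$ and $\lambda^{k_c+1}<\varepsilon_{\rm prec}\le\lambda^{k_c}$ (with $0^0=1$), and for $N:=\max\{n_c,k_c\}$ the sum in 4 is $O(\varepsilon_{\rm prec})$-close to $f\sharp^B_{\varepsilon,\lambda}g$: the difference $f\sharp^B_{\varepsilon,\lambda}g-\sum_{n,k\le N}\varepsilon^n\lambda^k(f\sharp^Bg)_{(n,k)}$ lies in $S^{m_1+m_2-(N+1)\rho}_\rho$, and $\|\tilde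 R_N\|_{m_1+m_2-(N+1)\rho,\,a,\alpha}\le C_{N,a,\alpha}\,\varepsilon_{\rm prec}$ for all $a,\alpha$. -/

import Mathlib

open MeasureTheory Filter Topology
open scoped ContDiff

namespace MagneticMoyal

noncomputable section

/-- Configuration space `ℝ^d`. -/
abbrev Config (d : ℕ) := EuclideanSpace ℝ (Fin d)

/-- Phase space `ℝ^d × ℝ^d`; a point is `X = (x, ξ)`. -/
abbrev Phase (d : ℕ) := Config d × Config d

/-- The `l`-th standard basis vector of `ℝ^d`. -/
def stdVec {d : ℕ} (l : Fin d) : Config d := EuclideanSpace.single l 1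

/-! ### Hörmander symbols -/

/-- The partial derivative `∂_{x_l} f` on phase space. -/
def partialX {d : ℕ} (l : Fin d) (f : Phase d → ℂ) : Phase d → ℂ :=
  fun X => lineDeriv ℝ f X (stdVec l, 0)

/-- The partial derivative `∂_{ξ_l} f` on phase space. -/
def partialXi {d : ℕ} (l : Fin d) (f : Phase d → ℂ) : Phase d → ℂ :=
  fun X => lineDeriv ℝ f X (0, stdVec l)

/-- `∂_x^a ∂_ξ^α f` for multi-indices `a, α ∈ ℕ₀^d`. -/
def phaseDeriv {d : ℕ} (a α : Fin d → ℕ) (f : Phase d → ℂ) : Phase d → ℂ :=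
  (List.finRange d).foldr (fun l h => (partialX l)^[a l] h)
    ((List.finRange d).foldr (fun l h => (partialXi l)^[α l] h) f)

/-- The Japanese bracket `⟨ξ⟩ = (1 + |ξ|²)^{1/2}`. -/
def japanese {d : ℕ} (ξ : Config d) : ℝ := Real.sqrt (1 + ‖ξ‖ ^ 2)

/-- `‖f‖_{m a α} ≤ C` for the seminorm
`‖f‖_{m a α} = sup_{(x,ξ)} ⟨ξ⟩^{-m+|α|ρ} |∂_x^a ∂_ξ^α f(x,ξ)|`. -/
def SeminormLE {d : ℕ} (m ρ : ℝ) (a α : Fin d → ℕ) (f : Phase d → ℂ) (C : ℝ) : Prop :=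
  ∀ X : Phase d, ‖phaseDeriv a α f X‖ ≤ C * japanese X.2 ^ (m - (∑ l, (α l : ℝ)) * ρ)

/-- The Hörmander class `S^m_ρ`. -/
def IsSymbol {d : ℕ} (m ρ : ℝ) (f : Phase d → ℂ) : Prop :=
  ContDiff ℝ ∞ f ∧ ∀ a α : Fin d → ℕ, ∃ C : ℝ, 0 < C ∧ SeminormLE m ρ a α f C

/-! ### Magnetic fields and fluxes -/

/-- `B` is a magnetic field (a closed two-form `½ ∑ B_{kl} dx_k ∧ dx_l`) on `ℝ^d`. -/
structure IsMagneticField {d : ℕ} (B : Fin d → Fin d → Config d → ℝ) : Prop where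
  antisymm : ∀ k l x, B l k x = - B k l x
  closed : ∀ j k l x, fderiv ℝ (B k l) x (stdVec j) + fderiv ℝ (B l j) x (stdVec k)
    + fderiv ℝ (B j k) x (stdVec l) = 0

/-- The class `BC^∞(ℝ^d)`. -/
def IsBCInfty {d : ℕ} (b : Config d → ℝ) : Prop :=
  ContDiff ℝ ∞ b ∧ ∀ n : ℕ, ∃ C : ℝ, ∀ x, ‖iteratedFDeriv ℝ n b x‖ ≤ C

/-- The flux `Γ^B(⟨p,q,r⟩)`, the integral of the two-form `B` over the triangle with corners
`p, q, r`, parametrized by `p + u (q - p) + v (r - q)`, `0 ≤ v ≤ u ≤ 1`. -/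
def flux {d : ℕ} (B : Fin d → Fin d → Config d → ℝ) (p q r : Config d) : ℝ :=
  ∫ u in (0 : ℝ)..1, ∫ v in (0 : ℝ)..u,
    ∑ k, ∑ l, B k l (p + u • (q - p) + v • (r - q)) * (q - p) k * (r - q) l

/-- The scaled flux `γ^B_ε(x,y,z)`: `1/ε` times the flux through the triangle with corners
`x - ε/2 (y+z)`, `x + ε/2 (y-z)`, `x + ε/2 (y+z)`. -/
def scaledFlux {d : ℕ} (B : Fin d → Fin d → Config d → ℝ) (ε : ℝ) (x y z : Config d) : ℝ :=
  1 / ε * flux B (x - (ε / 2) • (y + z)) (x + (ε / 2) • (y - z)) (x + (ε / 2) • (y + z))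

/-! ### The oscillatory integrals -/

/-- The symplectic form `σ(X,Y) = ξ·y - x·η`. -/
def symp {d : ℕ} (X Y : Phase d) : ℝ := (∑ l, X.2 l * Y.1 l) - ∑ l, X.1 l * Y.2 l

/-- The symplectic Fourier transform (which is its own inverse). -/
def sympFourier {d : ℕ} (f : Phase d → ℂ) (X : Phase d) : ℂ :=
  1 / (2 * (Real.pi : ℂ)) ^ d * ∫ Y : Phase d, Complex.exp (Complex.I * symp X Y) * f Y

/-- The integrand `e^{iσ(X,Y+Z)} K(x,Y,Z) (F_σ⁻¹ f)(Y) (F_σ⁻¹ g)(Z)`. -/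
def kernelIntegrand {d : ℕ} (K : Config d → Phase d → Phase d → ℂ) (f g : Phase d → ℂ)
    (X : Phase d) (P : Phase d × Phase d) : ℂ :=
  Complex.exp (Complex.I * symp X (P.1 + P.2)) * K X.1 P.1 P.2 * sympFourier f P.1
    * sympFourier g P.2

/-- `(2π)^{-2d} ∫dY ∫dZ e^{iσ(X,Y+Z)} K(x,Y,Z) (F_σ⁻¹ f)(Y) (F_σ⁻¹ g)(Z)`, for functions `f, g`
(such as Schwartz functions) for which it converges absolutely. -/
def kernelIntegral {d : ℕ} (K : Config d → Phase d → Phase d → ℂ) (f g : Phase d → ℂ)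
    (X : Phase d) : ℂ :=
  1 / (2 * (Real.pi : ℂ)) ^ (2 * d) * ∫ P : Phase d × Phase d, kernelIntegrand K f g X P

/-- The regularization `χ(δ X) f(X)` of a symbol. -/
def cutoff {d : ℕ} (χ : SchwartzMap (Phase d) ℂ) (δ : ℝ) (f : Phase d → ℂ) : Phase d → ℂ :=
  fun X => χ (δ • X) * f X

/-- `(2π)^{-2d} ∫dY ∫dZ e^{iσ(X,Y+Z)} K(x,Y,Z) (F_σ⁻¹ f)(Y) (F_σ⁻¹ g)(Z)` exists as an oscillatory
integral and equals `h(X)`: for all Schwartz cutoffs `χ₁, χ₂` that are `1` at the origin, the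
integrals of the regularized symbols converge absolutely, and they tend to `h(X)`. -/
def HasOscIntegral {d : ℕ} (K : Config d → Phase d → Phase d → ℂ) (f g h : Phase d → ℂ) : Prop :=
  ∀ χ₁ χ₂ : SchwartzMap (Phase d) ℂ, χ₁ 0 = 1 → χ₂ 0 = 1 → ∀ X : Phase d,
    (∀ δ : ℝ, 0 < δ → Integrable (kernelIntegrand K (cutoff χ₁ δ f) (cutoff χ₂ δ g) X)) ∧
    Tendsto (fun δ : ℝ => kernelIntegral K (cutoff χ₁ δ f) (cutoff χ₂ δ g) X) (𝓝[>] 0) (𝓝 (h X))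

open Classical in
/-- The value of the oscillatory integral, where it exists. -/
def oscIntegral {d : ℕ} (K : Config d → Phase d → Phase d → ℂ) (f g : Phase d → ℂ) :
    Phase d → ℂ :=
  if h : ∃ p, HasOscIntegral K f g p then h.choose else 0

/-- The exponent `T_{ε,λ}(x,Y,Z) = ε/2 σ(Y,Z) - λ γ^B_ε(x,y,z)` of the twister. -/
def twisterPhase {d : ℕ} (B : Fin d → Fin d → Config d → ℝ) (ε lam : ℝ) (x : Config d)
    (Y Z : Phase d) : ℝ :=
  ε / 2 * symp Y Z - lam * scaledFlux B ε x Y.1 Z.1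

/-- The twister `e^{i T_{ε,λ}(x,Y,Z)}`. -/
def twister {d : ℕ} (B : Fin d → Fin d → Config d → ℝ) (ε lam : ℝ) (x : Config d)
    (Y Z : Phase d) : ℂ :=
  Complex.exp (Complex.I * twisterPhase B ε lam x Y Z)

/-- The magnetic Moyal product `f ♯^B_{ε,λ} g`. -/
def moyal {d : ℕ} (B : Fin d → Fin d → Config d → ℝ) (ε lam : ℝ) (f g : Phase d → ℂ) :
    Phase d → ℂ :=
  oscIntegral (twister B ε lam) f g

/-! ### The terms of the expansion

The polynomials `𝓛_0` and `𝓛_j` are evaluated both at numbers and at formal symbols of partial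
derivatives, so they are defined over an arbitrary commutative `ℂ`-algebra `R`. -/

/-- `𝓛_0(Y,Z) = ½ (η·z - y·ζ)`. -/
def calLZero {d : ℕ} {R : Type} [CommRing R] [Algebra ℂ R] (y η z ζ : Fin d → R) : R :=
  (1 / 2 : ℂ) • ((∑ l, η l * z l) - ∑ l, y l * ζ l)

/-- `𝓛_j(x,y,z)` for `j ≥ 1`. The index `i : Fin (j - 1)` stands for the position `i + 1` in
`(m_1, …, m_{j-1})`. -/
def calL {d : ℕ} {R : Type} [CommRing R] [Algebra ℂ R] (B : Fin d → Fin d → Config d → ℝ) (j : ℕ)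
    (x : Config d) (y z : Fin d → R) : R :=
  ∑ k, ∑ l, ∑ μ : Fin (j - 1) → Fin d, ∑ c ∈ Finset.Icc 1 j,
    (1 / (j.factorial : ℂ)
      * (iteratedFDeriv ℝ (j - 1) (B k l) x (fun i => stdVec (μ i)) : ℂ)
      * (-(1 / 2)) ^ (j + 1) * (1 / ((j : ℂ) + 1) ^ 2) * ((j + 1).choose c : ℂ)
      * ((1 - (-1) ^ (j + 1)) * (c : ℂ) - (1 - (-1) ^ c) * ((j : ℂ) + 1))) •
    (y k * z l * ∏ i : Fin (j - 1), if (i : ℕ) + 1 < c then y (μ i) else z (μ i))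

/-- The tuples `(k_0, k_1, …, k_n)` of natural numbers with `k_0 + ∑_{j=1}^n j k_j = n` and
`∑_{j=1}^n k_j = k` (all entries are at most `n`). -/
def expIndices (n k : ℕ) : Finset (Fin (n + 1) → ℕ) :=
  (Fintype.piFinset fun _ => Finset.range (n + 1)).filter fun κ =>
    κ 0 + ∑ j : Fin n, ((j : ℕ) + 1) * κ j.succ = n ∧ ∑ j : Fin n, κ j.succ = k

/-- `∑ i^{k+k_0} / (k_0! k_1! ⋯ k_n!) L_0^{k_0} ∏_{j=1}^n L_j^{k_j}`, the sum over `expIndices`. -/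
def twisterCoeff {R : Type} [CommRing R] [Algebra ℂ R] (n k : ℕ) (L : ℕ → R) : R :=
  ∑ κ ∈ expIndices n k,
    (Complex.I ^ (k + κ 0) / ((∏ j, (κ j).factorial : ℕ) : ℂ)) •
      (L 0 ^ κ 0 * ∏ j : Fin n, L ((j : ℕ) + 1) ^ κ j.succ)

/-- Formal symbols `∂_{y_l}, ∂_{η_l}, ∂_{z_l}, ∂_{ζ_l}` of the partial derivatives acting on
functions of `Y = (y,η)` and `Z = (z,ζ)`. -/
inductive DSym (d : ℕ) : Type
  | dy (l : Fin d) : DSym d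
  | deta (l : Fin d) : DSym d
  | dz (l : Fin d) : DSym d
  | dzeta (l : Fin d) : DSym d

/-- The constant coefficient differential operator with symbol `P`, applied to `f(Y) g(Z)` and
evaluated at `Y = X = Z`. -/
def applyBidiff {d : ℕ} (P : MvPolynomial (DSym d) ℂ) (f g : Phase d → ℂ) (X : Phase d) : ℂ :=
  ∑ s ∈ P.support, P.coeff s
    * phaseDeriv (fun l => s (DSym.dy l)) (fun l => s (DSym.deta l)) f X
    * phaseDeriv (fun l => s (DSym.dz l)) (fun l => s (DSym.dzeta l)) g X

/-- The differential operators `𝓛_0((∂_η,∂_y),(∂_ζ,∂_z))` and, for `j ≥ 1`,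
`𝓛_j(x,-i∂_η,-i∂_ζ)`, the point `x` being a parameter. -/
def diffOp {d : ℕ} (B : Fin d → Fin d → Config d → ℝ) (x : Config d) (j : ℕ) :
    MvPolynomial (DSym d) ℂ :=
  if j = 0 then
    calLZero (fun l => MvPolynomial.X (DSym.deta l)) (fun l => MvPolynomial.X (DSym.dy l))
      (fun l => MvPolynomial.X (DSym.dzeta l)) (fun l => MvPolynomial.X (DSym.dz l))
  else
    calL B j x (fun l => (-Complex.I) • MvPolynomial.X (DSym.deta l))
      (fun l => (-Complex.I) • MvPolynomial.X (DSym.dzeta l))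

/-- The term `(f ♯^B g)_{(n,k)}`. -/
def moyalTerm {d : ℕ} (B : Fin d → Fin d → Config d → ℝ) (f g : Phase d → ℂ) (n k : ℕ) :
    Phase d → ℂ :=
  fun X => applyBidiff (twisterCoeff n k (diffOp B X.1)) f g X

/-! ### The remainder -/

/-- The numbers `𝓛_0(Y,Z)` and, for `j ≥ 1`, `𝓛_j(x,y,z)`. -/
def calLValue {d : ℕ} (B : Fin d → Fin d → Config d → ℝ) (x : Config d) (Y Z : Phase d) (j : ℕ) :
    ℂ :=
  if j = 0 then
    calLZero (fun l => (Y.1 l : ℂ)) (fun l => (Y.2 l : ℂ)) (fun l => (Z.1 l : ℂ))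
      (fun l => (Z.2 l : ℂ))
  else calL B j x (fun l => (Y.1 l : ℂ)) (fun l => (Z.1 l : ℂ))

/-- `ε/2 σ(Y,Z) + λ ∑_{j=1}^N ε^j 𝓛_j(x,y,z)`, the expansion of `T_{ε,λ}` to order `N`. -/
def truncPhase {d : ℕ} (B : Fin d → Fin d → Config d → ℝ) (ε lam : ℝ) (N : ℕ) (x : Config d)
    (Y Z : Phase d) : ℂ :=
  ε * calLValue B x Y Z 0 + lam * ∑ j ∈ Finset.Icc 1 N, (ε : ℂ) ^ j * calLValue B x Y Z j

/-- The integral form of the remainder of the exponential series of `e^{iT}` after order `N`. -/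
def expRemainder {d : ℕ} (B : Fin d → Fin d → Config d → ℝ) (ε lam : ℝ) (N : ℕ) (x : Config d)
    (Y Z : Phase d) : ℂ :=
  Complex.I ^ (N + 1) / (N.factorial : ℂ) * (twisterPhase B ε lam x Y Z : ℂ) ^ (N + 1)
    * ∫ τ in (0 : ℝ)..1,
        (1 - (τ : ℂ)) ^ N * Complex.exp (Complex.I * τ * twisterPhase B ε lam x Y Z)

/-- The contribution `∑_{n=1}^N (i^n / n!) (T^n - (trunc T)^n)` of the remainder of the flux. -/
def fluxRemainder {d : ℕ} (B : Fin d → Fin d → Config d → ℝ) (ε lam : ℝ) (N : ℕ) (x : Config d)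
    (Y Z : Phase d) : ℂ :=
  ∑ n ∈ Finset.Icc 1 N, Complex.I ^ n / (n.factorial : ℂ)
    * ((twisterPhase B ε lam x Y Z : ℂ) ^ n - truncPhase B ε lam N x Y Z ^ n)

/-- The terms of order at least `N + 1` in `ε` of the polynomial
`∑_{n=0}^N (i^n / n!) (trunc T)^n`. -/
def surplus {d : ℕ} (B : Fin d → Fin d → Config d → ℝ) (ε lam : ℝ) (N : ℕ) (x : Config d)
    (Y Z : Phase d) : ℂ :=
  (∑ n ∈ Finset.range (N + 1), Complex.I ^ n / (n.factorial : ℂ)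
      * truncPhase B ε lam N x Y Z ^ n)
    - ∑ n ∈ Finset.range (N + 1), ∑ k ∈ Finset.range (n + 1),
        (ε : ℂ) ^ n * (lam : ℂ) ^ k * twisterCoeff n k (calLValue B x Y Z)

/-- The remainder of the twister after the terms `ε^n λ^k` with `0 ≤ k ≤ n ≤ N`. -/
def remainderKernel {d : ℕ} (B : Fin d → Fin d → Config d → ℝ) (ε lam : ℝ) (N : ℕ) (x : Config d)
    (Y Z : Phase d) : ℂ :=
  expRemainder B ε lam N x Y Z + fluxRemainder B ε lam N x Y Z + surplus B ε lam N x Y Z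

/-- The remainder `R̃_N` of the product. -/
def moyalRemainder {d : ℕ} (B : Fin d → Fin d → Config d → ℝ) (ε lam : ℝ) (f g : Phase d → ℂ)
    (N : ℕ) : Phase d → ℂ :=
  oscIntegral (remainderKernel B ε lam N) f g

/-! ### Two-parameter symbols and precision -/

/-- `F` is a semiclassical two-parameter symbol of order `m` and weight `ρ` on
`(0,ε₀) × [0,λ₀)`, with coefficients `c n k`. -/
structure IsSemiclassicalSymbol {d : ℕ} (m ρ ε₀ lam₀ : ℝ) (F : ℝ → ℝ → Phase d → ℂ)
    (c : ℕ → ℕ → Phase d → ℂ) : Prop where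
  mem : ∀ ε lam, 0 < ε → ε < ε₀ → 0 ≤ lam → lam < lam₀ → IsSymbol m ρ (F ε lam)
  coeff_mem : ∀ n k : ℕ, IsSymbol (m - ((n : ℝ) + k) * ρ) ρ (c n k)
  remainder_mem : ∀ N : ℕ, ∀ ε lam, 0 < ε → ε < ε₀ → 0 ≤ lam → lam < lam₀ →
    IsSymbol (m - ((N : ℝ) + 1) * ρ) ρ (fun X => F ε lam X
      - ∑ l ∈ Finset.range (N + 1), ∑ p ∈ Finset.HasAntidiagonal.antidiagonal l,
          (ε : ℂ) ^ p.1 * (lam : ℂ) ^ p.2 * c p.1 p.2 X)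
  remainder_le : ∀ (N : ℕ) (a α : Fin d → ℕ), ∃ C : ℝ, 0 < C ∧
    ∀ ε lam, 0 < ε → ε < ε₀ → 0 ≤ lam → lam < lam₀ →
      SeminormLE m ρ a α (fun X => F ε lam X
        - ∑ l ∈ Finset.range (N + 1), ∑ p ∈ Finset.HasAntidiagonal.antidiagonal l,
            (ε : ℂ) ^ p.1 * (lam : ℂ) ^ p.2 * c p.1 p.2 X) (C * max ε lam ^ (N + 1))

/-- `N = N(ε,λ,ε_prec) = max {n_c, k_c}`, where `ε^{n_c+1} < ε_prec ≤ ε^{n_c}` and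
`λ^{k_c+1} < ε_prec ≤ λ^{k_c}`. -/
def IsPrecisionOrder (ε lam prec : ℝ) (N : ℕ) : Prop :=
  ∃ nc kc : ℕ, ε ^ (nc + 1) < prec ∧ prec ≤ ε ^ nc ∧ lam ^ (kc + 1) < prec ∧ prec ≤ lam ^ kc ∧
    N = max nc kc

/-- The resummation `∑_{n ≤ Nε} ∑_{k ≤ Nλ} ε^n λ^k c_{n,k}` of a symbol `F` of order `m` is
`O(ε_prec)`-close to `F`, where `N = N(ε,λ,ε_prec)`. -/
def IsPrecisionClose {d : ℕ} (m ρ ε lam prec : ℝ) (F : Phase d → ℂ) (c : ℕ → ℕ → Phase d → ℂ)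
    (Nε Nlam : ℕ) : Prop :=
  ∃ N : ℕ, IsPrecisionOrder ε lam prec N ∧ N ≤ Nε ∧ N ≤ Nlam ∧
    IsSymbol (m - ((N : ℝ) + 1) * ρ) ρ (fun X => F X
      - ∑ n ∈ Finset.range (Nε + 1), ∑ k ∈ Finset.range (Nlam + 1),
          (ε : ℂ) ^ n * (lam : ℂ) ^ k * c n k X)

end

end MagneticMoyal

open MagneticMoyal

/-!
The theorem rests on one estimate for the integral `moyalInt B F G (ε, λ, X)`, the kernel integral
with kernel `e^{iT_{ε,λ}}`, for rapidly decreasing `F` and `G`, regarded as a function of all its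
parameters.

*A priori estimate.* The phase of the twister is the quadratic form `ε/2 σ(Y,Z)` plus the flux,
which only depends on the positions `w = (y,z)`. By Fourier inversion in the frequencies `θ` the
quadratic form turns into shifts of the base points (`kernelIntegral_eq_iterated`), and there
remains an oscillatory integral over `(w,θ)` with phase `e^{-i⟨w,θ⟩}` and an amplitude of
polynomial growth. Integrations by parts with the factors `1 - ∂_b`, repeated in all coordinate
directions, make it absolutely convergent (`kernelIntegral_eq_regularized`). The resulting bound
`kernelIntegral_bound` involves only the symbol seminorms of `F` and `G`, so it is uniform in
regularized symbols, and `tendsto_kernelIntegral` passes to the limit in it.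

*Derivatives in the parameters.* The flux divided by `ε²` is the average of the magnetic field
over a triangle (`scaledFlux_eq`), a smooth function of `(x, ε w)` with bounded derivatives. A
derivative of the integral in any of the parameters therefore produces another kernel of the class
`NF`. A factor `y` or `z` of the kernel acts as a frequency derivative of `F` or `G`, and such
factors appear whenever one differentiates in `ε`, in `λ` or in a frequency `ξ_l`; so each of
these derivatives lowers the symbol order by `ρ` (`moyalInt_bound`).

*The expansion.* The terms are Taylor coefficients: `(F ♯^B G)_{(n,k)}` is `∂_ε^n ∂_λ^k / (n! k!)`
of `moyalInt` at `ε = λ = 0` (`moyalTerm_eq_ddw`). To see this, one compares jets of the integrand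
at `ε = 0`, where the coefficients of `𝓛_j` arise as moments of a triangle (`integral_tri_moment`,
`iterate_dd_parExp`). The order of the terms and the bound for the error of the expansion
(`expansionError_bound`) now follow from Taylor's formula in `ε` and the gain of `ρ` in each
derivative. On the other hand, the kernel of `R̃_N` telescopes to the twister minus the terms of
its expansion (`remainderKernel_eq`), so its integral is that error.

*Symbols.* The cutoffs `χ(δ ·) f` of a symbol satisfy the symbol bounds uniformly in `δ ∈ (0,1]`,
and a pointwise limit of functions with uniform bounds for all derivatives is smooth, with the
same bounds (`LocBound.limit`). All bounds thus pass from the regularized symbols to the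
oscillatory integrals. The expansion by total degree `n + k ≤ N` differs from the one with `k ≤ n
≤ N` by finitely many terms of total degree above `N`.
-/

/-! ### Families of functions with derivative bounds -/

namespace MagneticMoyal

section Calculus

variable {E E' : Type*} [NormedAddCommGroup E] [NormedSpace ℝ E]
  [NormedAddCommGroup E'] [NormedSpace ℝ E'] {ι ι' κ κ' : Type*}

/-- The derivative of `f` in the direction `v`. -/
noncomputable def dd (v : E) (f : E → ℂ) : E → ℂ := fun x => fderiv ℝ f x v

lemma contDiff_dd {f : E → ℂ} (hf : ContDiff ℝ ∞ f) (v : E) : ContDiff ℝ ∞ (dd v f) :=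
  (hf.fderiv_right (m := ∞) (by simp)).clm_apply contDiff_const

lemma _root_.ContDiff.differentiable_infty {F : Type*} [NormedAddCommGroup F] [NormedSpace ℝ F]
    {f : E → F} (hf : ContDiff ℝ ∞ f) : Differentiable ℝ f :=
  hf.differentiable (by simp)

lemma dd_add {f g : E → ℂ} (hf : ContDiff ℝ ∞ f) (hg : ContDiff ℝ ∞ g) (v : E) :
    dd v (fun x => f x + g x) = fun x => dd v f x + dd v g x := by
  funext x
  simp only [dd]
  rw [fderiv_fun_add (hf.differentiable_infty x) (hg.differentiable_infty x)]
  rfl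

lemma dd_mul {f g : E → ℂ} (hf : ContDiff ℝ ∞ f) (hg : ContDiff ℝ ∞ g) (v : E) :
    dd v (fun x => f x * g x) = fun x => dd v f x * g x + f x * dd v g x := by
  funext x
  simp only [dd]
  rw [fderiv_fun_mul (hf.differentiable_infty x) (hg.differentiable_infty x)]
  simp only [add_apply, smul_apply, smul_eq_mul]
  ring

lemma dd_const (v : E) (c : ℂ) : dd v (fun _ : E => c) = fun _ => 0 := by
  funext x; simp [dd]

lemma dd_const_mul {f : E → ℂ} (hf : ContDiff ℝ ∞ f) (v : E) (c : ℂ) :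
    dd v (fun x => c * f x) = fun x => c * dd v f x := by
  rw [dd_mul contDiff_const hf, dd_const]; funext x; simp

lemma dd_sub {f g : E → ℂ} (hf : ContDiff ℝ ∞ f) (hg : ContDiff ℝ ∞ g) (v : E) :
    dd v (fun x => f x - g x) = fun x => dd v f x - dd v g x := by
  funext x
  simp only [dd]
  rw [fderiv_fun_sub (hf.differentiable_infty x) (hg.differentiable_infty x)]
  rfl

lemma dd_sum {α : Type*} (s : Finset α) {f : α → E → ℂ} (hf : ∀ a ∈ s, ContDiff ℝ ∞ (f a))
    (v : E) : dd v (fun x => ∑ a ∈ s, f a x) = fun x => ∑ a ∈ s, dd v (f a) x := by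
  funext x
  simp only [dd]
  rw [fderiv_fun_sum (fun a ha => (hf a ha).differentiable_infty x)]
  simp

lemma dd_cexp {f : E → ℂ} (hf : ContDiff ℝ ∞ f) (v : E) :
    dd v (fun x => Complex.exp (f x)) = fun x => dd v f x * Complex.exp (f x) := by
  funext x
  simp only [dd]
  rw [((hf.differentiable_infty x).hasFDerivAt.cexp).fderiv]
  simp [mul_comm]

/-- The derivatives in two directions of a smooth function commute. -/
lemma dd_comm {f : E → ℂ} (hf : ContDiff ℝ ∞ f) (v w : E) : dd v (dd w f) = dd w (dd v f) := by
  funext x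
  have hs : IsSymmSndFDerivAt ℝ f x :=
    hf.contDiffAt.isSymmSndFDerivAt (by
      rw [minSmoothness_of_isRCLikeNormedField]
      exact WithTop.coe_le_coe.2 le_top)
  have h1 : ∀ a b : E, dd a (dd b f) x = fderiv ℝ (fderiv ℝ f) x a b := by
    intro a b
    have hd : DifferentiableAt ℝ (fderiv ℝ f) x :=
      (hf.fderiv_right (m := ∞) (by simp)).differentiable_infty x
    have : dd b f = fun y => fderiv ℝ f y b := rfl
    rw [dd, this, fderiv_clm_apply hd (differentiableAt_const b)]
    simp
  rw [h1, h1]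
  exact hs v w

lemma dd_comp_clm {f : E' → ℂ} (hf : ContDiff ℝ ∞ f) {A : E → E'} {L : E →L[ℝ] E'}
    (hA : ∀ e, HasFDerivAt A L e) (v : E) :
    dd v (fun e => f (A e)) = fun e => dd (L v) f (A e) := by
  funext e
  simp only [dd]
  have := ((hf.differentiable_infty (A e)).hasFDerivAt.comp e (hA e)).fderiv
  simp only [Function.comp_def] at this
  rw [this]; rfl

lemma dd_sum_smul {α : Type*} (s : Finset α) (f : E → ℂ) (a : α → ℝ) (v : α → E) (x : E) :
    dd (∑ i ∈ s, a i • v i) f x = ∑ i ∈ s, (a i : ℂ) * dd (v i) f x := by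
  simp [dd, map_sum]

/-- The family `f` of functions, and its derivatives up to order `K` in the directions
`dir b`, are bounded by a multiple of the weight `w`, where each derivative in the direction
`dir b` improves the weight by the factor `g b`. The constants do not depend on the index. -/
def DerivBound (dir : κ → E) (g : κ → E → ℝ) : ℕ → (ι → E → ℝ) → (ι → E → ℂ) → Prop
  | 0, w, f => ∃ C, 0 ≤ C ∧ ∀ i e, ‖f i e‖ ≤ C * w i e
  | K + 1, w, f => (∃ C, 0 ≤ C ∧ ∀ i e, ‖f i e‖ ≤ C * w i e) ∧
      ∀ b, DerivBound dir g K (fun i e => g b e * w i e) (fun i => dd (dir b) (f i))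

namespace DerivBound

variable {dir : κ → E} {g : κ → E → ℝ} {K : ℕ} {w w₁ w₂ : ι → E → ℝ} {f f₁ f₂ : ι → E → ℂ}

lemma bound (h : DerivBound dir g K w f) : ∃ C, 0 ≤ C ∧ ∀ i e, ‖f i e‖ ≤ C * w i e := by
  cases K with
  | zero => exact h
  | succ K => exact h.1

lemma pred (h : DerivBound dir g (K + 1) w f) : DerivBound dir g K w f := by
  induction K generalizing w f with
  | zero => exact h.1
  | succ K ih => exact ⟨h.1, fun b => ih (h.2 b)⟩

lemma congr (h : DerivBound dir g K w f₁) (hf : ∀ i e, f₁ i e = f₂ i e) :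
    DerivBound dir g K w f₂ := by
  rwa [show f₂ = f₁ from funext fun i => funext fun e => (hf i e).symm]

lemma mono (h : DerivBound dir g K w₁ f) (hg : ∀ b e, 0 ≤ g b e) {A : ℝ} (hA : 0 ≤ A)
    (hw : ∀ i e, w₁ i e ≤ A * w₂ i e) : DerivBound dir g K w₂ f := by
  have base : ∀ {w₁ w₂ : ι → E → ℝ} {f : ι → E → ℂ}, (∀ i e, w₁ i e ≤ A * w₂ i e) →
      (∃ C, 0 ≤ C ∧ ∀ i e, ‖f i e‖ ≤ C * w₁ i e) → ∃ C, 0 ≤ C ∧ ∀ i e, ‖f i e‖ ≤ C * w₂ i e := by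
    rintro w₁ w₂ f hw ⟨C, hC, h⟩
    refine ⟨C * A, by positivity, fun i e => (h i e).trans ?_⟩
    rw [mul_assoc]
    exact mul_le_mul_of_nonneg_left (hw i e) hC
  induction K generalizing w₁ w₂ f with
  | zero => exact base hw h
  | succ K ih =>
    refine ⟨base hw h.1, fun b => ih (h.2 b) fun i e => ?_⟩
    calc g b e * w₁ i e ≤ g b e * (A * w₂ i e) := mul_le_mul_of_nonneg_left (hw i e) (hg b e)
      _ = _ := by ring

lemma mono_gain {g' : κ → E → ℝ} (h : DerivBound dir g K w f) (hg : ∀ b e, 0 ≤ g b e)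
    (hg' : ∀ b e, g b e ≤ g' b e) (hw : ∀ i e, 0 ≤ w i e) : DerivBound dir g' K w f := by
  induction K generalizing w f with
  | zero => exact h
  | succ K ih =>
    refine ⟨h.1, fun b => ?_⟩
    refine (ih (h.2 b) fun i e => mul_nonneg (hg b e) (hw i e)).mono (A := 1)
      (fun b e => (hg b e).trans (hg' b e)) zero_le_one fun i e => ?_
    rw [one_mul]
    exact mul_le_mul_of_nonneg_right (hg' b e) (hw i e)

lemma comp_index (h : DerivBound dir g K w f) (s : ι' → ι) :
    DerivBound dir g K (fun i => w (s i)) (fun i => f (s i)) := by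
  have base : ∀ {w : ι → E → ℝ} {f : ι → E → ℂ},
      (∃ C, 0 ≤ C ∧ ∀ i e, ‖f i e‖ ≤ C * w i e) →
      ∃ C, 0 ≤ C ∧ ∀ i e, ‖f (s i) e‖ ≤ C * w (s i) e :=
    fun ⟨C, hC, h⟩ => ⟨C, hC, fun i e => h _ e⟩
  induction K generalizing w f with
  | zero => exact base h
  | succ K ih => exact ⟨base h.1, fun b => ih (h.2 b)⟩

lemma add (hs₁ : ∀ i, ContDiff ℝ ∞ (f₁ i)) (hs₂ : ∀ i, ContDiff ℝ ∞ (f₂ i))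
    (h₁ : DerivBound dir g K w f₁) (h₂ : DerivBound dir g K w f₂) :
    DerivBound dir g K w (fun i e => f₁ i e + f₂ i e) := by
  have base : ∀ {w : ι → E → ℝ} {f₁ f₂ : ι → E → ℂ},
      (∃ C, 0 ≤ C ∧ ∀ i e, ‖f₁ i e‖ ≤ C * w i e) → (∃ C, 0 ≤ C ∧ ∀ i e, ‖f₂ i e‖ ≤ C * w i e) →
      ∃ C, 0 ≤ C ∧ ∀ i e, ‖f₁ i e + f₂ i e‖ ≤ C * w i e := by
    rintro w f₁ f₂ ⟨C, hC, h⟩ ⟨C', hC', h'⟩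
    refine ⟨C + C', by positivity, fun i e => (norm_add_le _ _).trans ?_⟩
    rw [add_mul]
    exact add_le_add (h i e) (h' i e)
  induction K generalizing w f₁ f₂ with
  | zero => exact base h₁ h₂
  | succ K ih =>
    refine ⟨base h₁.1 h₂.1, fun b => ?_⟩
    simp only [dd_add (hs₁ _) (hs₂ _)]
    exact ih (fun i => contDiff_dd (hs₁ i) _) (fun i => contDiff_dd (hs₂ i) _) (h₁.2 b) (h₂.2 b)

lemma mul (hg : ∀ b e, 0 ≤ g b e) (hw₁ : ∀ i e, 0 ≤ w₁ i e)
    (hs₁ : ∀ i, ContDiff ℝ ∞ (f₁ i)) (hs₂ : ∀ i, ContDiff ℝ ∞ (f₂ i))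
    (h₁ : DerivBound dir g K w₁ f₁) (h₂ : DerivBound dir g K w₂ f₂) :
    DerivBound dir g K (fun i e => w₁ i e * w₂ i e) (fun i e => f₁ i e * f₂ i e) := by
  have base : ∀ {w₁ w₂ : ι → E → ℝ} {f₁ f₂ : ι → E → ℂ}, (∀ i e, 0 ≤ w₁ i e) →
      (∃ C, 0 ≤ C ∧ ∀ i e, ‖f₁ i e‖ ≤ C * w₁ i e) → (∃ C, 0 ≤ C ∧ ∀ i e, ‖f₂ i e‖ ≤ C * w₂ i e) →
      ∃ C, 0 ≤ C ∧ ∀ i e, ‖f₁ i e * f₂ i e‖ ≤ C * (w₁ i e * w₂ i e) := by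
    rintro w₁ w₂ f₁ f₂ hw ⟨C, hC, h⟩ ⟨C', hC', h'⟩
    refine ⟨C * C', by positivity, fun i e => (norm_mul_le _ _).trans ?_⟩
    calc ‖f₁ i e‖ * ‖f₂ i e‖ ≤ (C * w₁ i e) * (C' * w₂ i e) :=
          mul_le_mul (h i e) (h' i e) (norm_nonneg _) (mul_nonneg hC (hw i e))
      _ = _ := by ring
  induction K generalizing w₁ w₂ f₁ f₂ with
  | zero => exact base hw₁ h₁ h₂
  | succ K ih =>
    refine ⟨base hw₁ h₁.1 h₂.1, fun b => ?_⟩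
    simp only [dd_mul (hs₁ _) (hs₂ _)]
    refine add (fun i => (contDiff_dd (hs₁ i) _).mul (hs₂ i))
      (fun i => (hs₁ i).mul (contDiff_dd (hs₂ i) _)) ?_ ?_
    · refine (ih (fun i e => mul_nonneg (hg b e) (hw₁ i e)) (fun i => contDiff_dd (hs₁ i) _) hs₂
        (h₁.2 b) h₂.pred).mono hg zero_le_one fun i e => ?_
      rw [one_mul, mul_assoc]
    · refine (ih hw₁ hs₁ (fun i => contDiff_dd (hs₂ i) _) h₁.pred (h₂.2 b)).mono hg
        zero_le_one fun i e => le_of_eq ?_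
      ring

lemma const (hg : ∀ b e, 0 ≤ g b e) (hw : ∀ i e, 0 ≤ w i e) {a : ι → ℂ} {C : ℝ} (hC : 0 ≤ C)
    (h : ∀ i e, ‖a i‖ ≤ C * w i e) : DerivBound dir g K w (fun i _ => a i) := by
  induction K generalizing w a C with
  | zero => exact ⟨C, hC, h⟩
  | succ K ih =>
    refine ⟨⟨C, hC, h⟩, fun b => ?_⟩
    simp only [dd_const]
    refine ih (fun i e => mul_nonneg (hg b e) (hw i e)) (C := 0) le_rfl fun i e => by simp

lemma zero_fun (hg : ∀ b e, 0 ≤ g b e) (hw : ∀ i e, 0 ≤ w i e) :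
    DerivBound dir g K w (fun (_ : ι) (_ : E) => (0 : ℂ)) :=
  const hg hw (C := 0) le_rfl fun i e => by simp

lemma const_mul (hs : ∀ i, ContDiff ℝ ∞ (f i)) (h : DerivBound dir g K w f)
    {a : ι → ℂ} {A : ℝ} (hA : ∀ i, ‖a i‖ ≤ A) :
    DerivBound dir g K w (fun i e => a i * f i e) := by
  have base : ∀ {w : ι → E → ℝ} {f : ι → E → ℂ},
      (∃ C, 0 ≤ C ∧ ∀ i e, ‖f i e‖ ≤ C * w i e) →
      ∃ C, 0 ≤ C ∧ ∀ i e, ‖a i * f i e‖ ≤ C * w i e := by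
    rintro w f ⟨C, hC, h⟩
    refine ⟨|A| * C, by positivity, fun i e => (norm_mul_le _ _).trans ?_⟩
    calc ‖a i‖ * ‖f i e‖ ≤ |A| * (C * w i e) :=
          mul_le_mul ((hA i).trans (le_abs_self A)) (h i e) (norm_nonneg _) (abs_nonneg _)
      _ = _ := by ring
  induction K generalizing w f with
  | zero => exact base h
  | succ K ih =>
    refine ⟨base h.1, fun b => ?_⟩
    simp only [dd_const_mul (hs _)]
    exact ih (fun i => contDiff_dd (hs i) _) (h.2 b)

lemma sum {α : Type*} (s : Finset α) {f : α → ι → E → ℂ} (hg : ∀ b e, 0 ≤ g b e)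
    (hw : ∀ i e, 0 ≤ w i e) (hs : ∀ a ∈ s, ∀ i, ContDiff ℝ ∞ (f a i))
    (h : ∀ a ∈ s, DerivBound dir g K w (f a)) :
    DerivBound dir g K w (fun i e => ∑ a ∈ s, f a i e) := by
  classical
  induction s using Finset.induction_on with
  | empty => simpa using zero_fun hg hw
  | insert a s ha ih =>
    simp only [Finset.sum_insert ha]
    refine add (hs a (Finset.mem_insert_self a s)) (fun i => ?_) (h a (Finset.mem_insert_self a s))
      (ih (fun a' h' => hs a' (Finset.mem_insert_of_mem h'))
        (fun a' h' => h a' (Finset.mem_insert_of_mem h')))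
    exact ContDiff.sum fun a' h' => hs a' (Finset.mem_insert_of_mem h') i

/-- Composition with maps whose constant derivative sends each direction to a bounded
combination of the directions. -/
lemma comp_affine [Fintype κ'] {dir' : κ' → E'} {f : ι → E' → ℂ} {w : ι → E' → ℝ}
    (hw : ∀ i e, 0 ≤ w i e) (hs : ∀ i, ContDiff ℝ ∞ (f i))
    (h : DerivBound dir' (fun _ _ => 1) K w f)
    (A : ι → E → E') (L : ι → E →L[ℝ] E') (hA : ∀ i e, HasFDerivAt (A i) (L i) e)
    (a : ι → κ → κ' → ℝ) {M : ℝ} (ha : ∀ i b b', |a i b b'| ≤ M)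
    (hL : ∀ i b, L i (dir b) = ∑ b', a i b b' • dir' b') :
    DerivBound dir (fun _ _ => 1) K (fun i e => w i (A i e)) (fun i e => f i (A i e)) := by
  have base : ∀ {f : ι → E' → ℂ}, (∃ C, 0 ≤ C ∧ ∀ i e, ‖f i e‖ ≤ C * w i e) →
      ∃ C, 0 ≤ C ∧ ∀ i e, ‖f i (A i e)‖ ≤ C * w i (A i e) := by
    rintro f ⟨C, hC, h⟩
    exact ⟨C, hC, fun i e => h i _⟩
  have hAs : ∀ i, ContDiff ℝ ∞ (A i) := by
    intro i
    have : fderiv ℝ (A i) = fun _ => L i := funext fun e => (hA i e).fderiv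
    rw [contDiff_infty_iff_fderiv, this]
    exact ⟨fun e => (hA i e).differentiableAt, contDiff_const⟩
  induction K generalizing f with
  | zero => exact base h
  | succ K ih =>
    refine ⟨base h.1, fun b => ?_⟩
    have e1 : (fun i => dd (dir b) (fun e => f i (A i e))) =
        fun i e => ∑ b', (a i b b' : ℂ) * dd (dir' b') (f i) (A i e) := by
      funext i e
      rw [dd_comp_clm (hs i) (hA i), hL]
      exact dd_sum_smul _ _ _ _ _
    rw [e1]
    simp only [one_mul]
    refine sum _ (fun _ _ => zero_le_one) (fun i e => hw i _) (fun b' _ i => ?_) fun b' _ => ?_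
    · exact contDiff_const.mul ((contDiff_dd (hs i) _).comp (hAs i))
    · refine const_mul (fun i => (contDiff_dd (hs i) _).comp (hAs i)) ?_ (A := M) (fun i => ?_)
      · refine ih (fun i => contDiff_dd (hs i) _) ?_
        simpa using h.2 b'
      · simpa using ha i b b'

end DerivBound

/-- The family `f` consists of smooth functions, and each derivative in the directions `dir b`
has a bound of polynomial growth in `τ`, uniformly in the index. -/
def PolyGrowth (dir : κ → E) (τ : E → ℝ) (f : ι → E → ℂ) : Prop :=
  (∀ i, ContDiff ℝ ∞ (f i)) ∧
    ∀ K : ℕ, ∃ p : ℕ, DerivBound dir (fun _ _ => 1) K (fun _ e => (1 + τ e) ^ p) f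

namespace PolyGrowth

variable {dir : κ → E} {τ : E → ℝ} {f f₁ f₂ : ι → E → ℂ}

lemma raise (hτ : ∀ e, 0 ≤ τ e) {K p q : ℕ} (hpq : p ≤ q)
    (h : DerivBound dir (fun _ _ => 1) K (fun (_ : ι) e => (1 + τ e) ^ p) f) :
    DerivBound dir (fun _ _ => 1) K (fun (_ : ι) e => (1 + τ e) ^ q) f := by
  refine h.mono (fun _ _ => zero_le_one) zero_le_one fun i e => ?_
  rw [one_mul]
  exact pow_le_pow_right₀ (by linarith [hτ e]) hpq

lemma add (hτ : ∀ e, 0 ≤ τ e) (h₁ : PolyGrowth dir τ f₁) (h₂ : PolyGrowth dir τ f₂) :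
    PolyGrowth dir τ (fun i e => f₁ i e + f₂ i e) := by
  refine ⟨fun i => (h₁.1 i).add (h₂.1 i), fun K => ?_⟩
  obtain ⟨p, hp⟩ := h₁.2 K
  obtain ⟨q, hq⟩ := h₂.2 K
  exact ⟨max p q, (raise hτ (le_max_left p q) hp).add h₁.1 h₂.1 (raise hτ (le_max_right p q) hq)⟩

lemma mul (hτ : ∀ e, 0 ≤ τ e) (h₁ : PolyGrowth dir τ f₁) (h₂ : PolyGrowth dir τ f₂) :
    PolyGrowth dir τ (fun i e => f₁ i e * f₂ i e) := by
  refine ⟨fun i => (h₁.1 i).mul (h₂.1 i), fun K => ?_⟩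
  obtain ⟨p, hp⟩ := h₁.2 K
  obtain ⟨q, hq⟩ := h₂.2 K
  refine ⟨p + q, ?_⟩
  simp only [pow_add]
  exact DerivBound.mul (fun _ _ => zero_le_one)
    (fun _ e => pow_nonneg (by linarith [hτ e]) _) h₁.1 h₂.1 hp hq

lemma of_bounded (hs : ∀ i, ContDiff ℝ ∞ (f i))
    (h : ∀ K, DerivBound dir (fun _ _ => 1) K (fun _ _ => 1) f) : PolyGrowth dir τ f :=
  ⟨hs, fun K => ⟨0, by simpa using h K⟩⟩

lemma const {a : ι → ℂ} {A : ℝ} (hA : ∀ i, ‖a i‖ ≤ A) :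
    PolyGrowth dir τ (fun i _ => a i) :=
  of_bounded (fun _ => contDiff_const) fun K =>
    DerivBound.const (fun _ _ => zero_le_one) (fun _ _ => zero_le_one) (C := |A|) (abs_nonneg A)
      fun i e => by rw [mul_one]; exact (hA i).trans (le_abs_self A)

lemma sum {α : Type*} (hτ : ∀ e, 0 ≤ τ e) (s : Finset α) {f : α → ι → E → ℂ}
    (h : ∀ a ∈ s, PolyGrowth dir τ (f a)) : PolyGrowth dir τ (fun i e => ∑ a ∈ s, f a i e) := by
  classical
  induction s using Finset.induction_on with
  | empty => simpa using const (ι := ι) (a := fun _ => 0) (A := 0) (by simp)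
  | insert a s ha ih =>
    simp only [Finset.sum_insert ha]
    exact add hτ (h a (Finset.mem_insert_self a s))
      (ih fun a' h' => h a' (Finset.mem_insert_of_mem h'))

/-- `e^{iu}` has derivatives of polynomial growth if the real function `u` has. -/
lemma cexp (hτ : ∀ e, 0 ≤ τ e) {u : ι → E → ℝ}
    (h : PolyGrowth dir τ (fun i e => (u i e : ℂ))) :
    PolyGrowth dir τ (fun i e => Complex.exp (Complex.I * u i e)) := by
  have hs : ∀ i, ContDiff ℝ ∞ (fun e => Complex.I * (u i e : ℂ)) :=
    fun i => contDiff_const.mul (h.1 i)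
  have hse : ∀ i, ContDiff ℝ ∞ (fun e => Complex.exp (Complex.I * (u i e : ℂ))) :=
    fun i => (hs i).cexp
  refine ⟨hse, fun K => ?_⟩
  have base : ∀ p, ∃ C : ℝ, 0 ≤ C ∧ ∀ (i : ι) e, ‖Complex.exp (Complex.I * u i e)‖
      ≤ C * (1 + τ e) ^ p := by
    intro p
    refine ⟨1, zero_le_one, fun i e => ?_⟩
    rw [mul_comm Complex.I, Complex.norm_exp_ofReal_mul_I, one_mul]
    exact one_le_pow₀ (by linarith [hτ e])
  induction K with
  | zero => exact ⟨0, base 0⟩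
  | succ K ih =>
    obtain ⟨p, hp⟩ := ih
    obtain ⟨q, hq⟩ := h.2 (K + 1)
    refine ⟨p + q, base _, fun b => ?_⟩
    simp only [dd_cexp (hs _), dd_const_mul (h.1 _), one_mul]
    have := DerivBound.mul (fun _ _ => zero_le_one) (fun _ e => pow_nonneg (by linarith [hτ e]) _)
      hse (fun i => contDiff_dd (h.1 i) (dir b)) hp (by simpa using hq.2 b)
    refine ((this.const_mul (fun i => (hse i).mul (contDiff_dd (h.1 i) _))
      (a := fun _ => Complex.I) (A := 1) (by simp)).mono (fun _ _ => zero_le_one) zero_le_one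
        fun i e => ?_).congr ?_
    · rw [one_mul, pow_add]
    · intro i e; ring

end PolyGrowth

end Calculus

end MagneticMoyal

/-! ### The symplectic Fourier transform of rapidly decreasing functions -/

namespace MagneticMoyal

section Fourier

variable {d : ℕ}

/-- The coordinate directions of `ℝ^d × ℝ^d`, those of the first factor indexed on the left. -/
noncomputable def phDir : Fin d ⊕ Fin d → Phase d :=
  Sum.elim (fun l => (stdVec l, 0)) (fun l => (0, stdVec l))

/-- The coordinates of a point of `ℝ^d × ℝ^d`. -/
def coord (b : Fin d ⊕ Fin d) (X : Phase d) : ℝ := Sum.elim (fun l => X.1 l) (fun l => X.2 l) b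

@[simp] lemma coord_inl (l : Fin d) (X : Phase d) : coord (.inl l) X = X.1 l := rfl
@[simp] lemma coord_inr (l : Fin d) (X : Phase d) : coord (.inr l) X = X.2 l := rfl

lemma norm_stdVec (l : Fin d) : ‖(stdVec l : Config d)‖ = 1 := by simp [stdVec]

lemma sum_smul_stdVec (y : Config d) : ∑ l, y l • stdVec l = y := by
  ext k
  simp [stdVec, Pi.single_apply]

lemma sum_coord_smul_phDir (X : Phase d) : ∑ b, coord b X • phDir b = X := by
  rw [Fintype.sum_sum_type]
  ext1
  · simp [phDir, Prod.fst_sum, sum_smul_stdVec]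
  · simp [phDir, Prod.snd_sum, sum_smul_stdVec]

lemma norm_phDir_le (b : Fin d ⊕ Fin d) : ‖phDir b‖ ≤ 1 := by
  cases b <;> simp [phDir, norm_stdVec]

lemma norm_le_sum_coord (X : Phase d) : ‖X‖ ≤ ∑ b, |coord b X| := by
  conv_lhs => rw [← sum_coord_smul_phDir X]
  refine (norm_sum_le _ _).trans (Finset.sum_le_sum fun b _ => ?_)
  rw [norm_smul]
  exact mul_le_of_le_one_right (norm_nonneg _) (norm_phDir_le b)

lemma abs_apply_le (y : Config d) (l : Fin d) : |y l| ≤ ‖y‖ := by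
  simpa using PiLp.norm_apply_le y l

lemma abs_coord_le (b : Fin d ⊕ Fin d) (X : Phase d) : |coord b X| ≤ ‖X‖ := by
  cases b with
  | inl l => exact (abs_apply_le _ _).trans (norm_fst_le X)
  | inr l => exact (abs_apply_le _ _).trans (norm_snd_le X)

lemma contDiff_coord (b : Fin d ⊕ Fin d) : ContDiff ℝ ∞ (coord b : Phase d → ℝ) := by
  cases b with
  | inl l => exact (contDiff_piLp_apply (p := 2)).comp contDiff_fst
  | inr l => exact (contDiff_piLp_apply (p := 2)).comp contDiff_snd

lemma symp_eq_inner (X Y : Phase d) : symp X Y = inner ℝ X.2 Y.1 - inner ℝ X.1 Y.2 := by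
  simp [symp, PiLp.inner_apply, mul_comm]

lemma symp_add_right (X Y Z : Phase d) : symp X (Y + Z) = symp X Y + symp X Z := by
  simp only [symp_eq_inner, Prod.fst_add, Prod.snd_add, inner_add_right]; ring

@[fun_prop]
lemma _root_.Continuous.symp {α : Type*} [TopologicalSpace α] {f g : α → Phase d}
    (hf : Continuous f) (hg : Continuous g) : Continuous fun a => symp (f a) (g a) := by
  simp only [symp_eq_inner]; fun_prop

instance : (volume : Measure (Phase d)).IsAddHaarMeasure :=
  inferInstanceAs ((volume : Measure (Config d)).prod volume).IsAddHaarMeasure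

lemma norm_cexp_I_mul (t : ℝ) : ‖Complex.exp (Complex.I * t)‖ = 1 := by
  rw [mul_comm, Complex.norm_exp_ofReal_mul_I]

lemma integrable_inv_one_add_norm_pow {E : Type*} [NormedAddCommGroup E] [NormedSpace ℝ E]
    [FiniteDimensional ℝ E] [MeasurableSpace E] [BorelSpace E] (μ : Measure E)
    [μ.IsAddHaarMeasure] {p : ℕ} (hp : Module.finrank ℝ E < p) :
    Integrable (fun x : E => ((1 + ‖x‖) ^ p)⁻¹) μ := by
  have := integrable_one_add_norm (μ := μ) (r := p) (by exact_mod_cast hp)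
  refine this.congr (ae_of_all _ fun x => ?_)
  simp only
  rw [Real.rpow_neg (by positivity), Real.rpow_natCast]

/-- Smooth functions on phase space all of whose derivatives decrease rapidly. -/
def Rapid (F : Phase d → ℂ) : Prop :=
  ContDiff ℝ ∞ F ∧ ∀ K p : ℕ,
    DerivBound phDir (fun _ _ => 1) K (fun (_ : Unit) X => ((1 + ‖X‖) ^ p)⁻¹) (fun _ => F)

namespace Rapid

variable {F : Phase d → ℂ}

lemma dd (h : Rapid F) (b : Fin d ⊕ Fin d) : Rapid (dd (phDir b) F) :=
  ⟨contDiff_dd h.1 _, fun K p => by simpa using (h.2 (K + 1) p).2 b⟩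

lemma bound (h : Rapid F) (p : ℕ) : ∃ C, 0 ≤ C ∧ ∀ X, ‖F X‖ ≤ C * ((1 + ‖X‖) ^ p)⁻¹ := by
  obtain ⟨C, hC, h⟩ := (h.2 0 p).bound
  exact ⟨C, hC, h ()⟩

lemma continuous (h : Rapid F) : Continuous F := h.1.continuous

lemma integrable (h : Rapid F) : Integrable F := by
  obtain ⟨C, hC, hb⟩ := h.bound (Module.finrank ℝ (Phase d) + 1)
  exact ((integrable_inv_one_add_norm_pow volume (Nat.lt_succ_self _)).const_mul C).mono'
    h.continuous.aestronglyMeasurable (ae_of_all _ hb)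

lemma integrable_snd (h : Rapid F) (x : Config d) : Integrable fun η => F (x, η) := by
  obtain ⟨C, hC, hb⟩ := h.bound (Module.finrank ℝ (Config d) + 1)
  refine ((integrable_inv_one_add_norm_pow volume (Nat.lt_succ_self _)).const_mul C).mono'
    (h.continuous.comp (by fun_prop)).aestronglyMeasurable (ae_of_all _ fun η => ?_)
  refine (hb (x, η)).trans (mul_le_mul_of_nonneg_left ?_ hC)
  have : ‖η‖ ≤ ‖(x, η)‖ := norm_snd_le (x, η)
  gcongr

lemma sub {G : Phase d → ℂ} (hF : Rapid F) (hG : Rapid G) : Rapid (fun X => F X - G X) := by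
  refine ⟨hF.1.sub hG.1, fun K p => ?_⟩
  refine ((hF.2 K p).add (fun _ => hF.1) (fun _ => contDiff_const.mul hG.1)
    ((hG.2 K p).const_mul (fun _ => hG.1) (a := fun _ => -1) (A := 1) (by simp))).congr ?_
  intro i e; ring

end Rapid

lemma continuous_sympFourier {F : Phase d → ℂ} (hF : Rapid F) : Continuous (sympFourier F) := by
  unfold sympFourier
  refine continuous_const.mul ?_
  refine continuous_of_dominated (bound := fun Y => ‖F Y‖) ?_ ?_ hF.integrable.norm ?_
  · intro X
    refine Continuous.aestronglyMeasurable ?_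
    have := hF.continuous
    fun_prop
  · intro X
    exact ae_of_all _ fun Y => by rw [norm_mul, norm_cexp_I_mul, one_mul]
  · refine ae_of_all _ fun Y => ?_
    fun_prop

/-- Up to a constant, the coordinate of `Y` by which differentiation in the direction `phDir b`
multiplies the symplectic Fourier transform. -/
def dualCoord (b : Fin d ⊕ Fin d) (Y : Phase d) : ℝ :=
  Sum.elim (fun l => - Y.2 l) (fun l => Y.1 l) b

/-- Differentiation becomes multiplication under the symplectic Fourier transform. -/
lemma sympFourier_dd {F : Phase d → ℂ} (hF : Rapid F) (b : Fin d ⊕ Fin d) (Y : Phase d) :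
    sympFourier (dd (phDir b) F) Y = Complex.I * dualCoord b Y * sympFourier F Y := by
  have hsymp : ∀ X, HasFDerivAt (fun X => symp Y X)
      ((innerSL ℝ Y.2).comp (ContinuousLinearMap.fst ℝ _ _)
        - (innerSL ℝ Y.1).comp (ContinuousLinearMap.snd ℝ _ _)) X := by
    intro X
    simp only [symp_eq_inner]
    exact (((innerSL ℝ Y.2).comp (ContinuousLinearMap.fst ℝ (Config d) (Config d))).hasFDerivAt).sub
      (((innerSL ℝ Y.1).comp (ContinuousLinearMap.snd ℝ (Config d) (Config d))).hasFDerivAt)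
  have hd : ∀ X, HasFDerivAt (fun X => Complex.exp (Complex.I * symp Y X))
      (Complex.exp (Complex.I * symp Y X) • (Complex.I • Complex.ofRealCLM.comp
        ((innerSL ℝ Y.2).comp (ContinuousLinearMap.fst ℝ _ _)
        - (innerSL ℝ Y.1).comp (ContinuousLinearMap.snd ℝ _ _)))) X := by
    intro X
    refine HasFDerivAt.cexp ?_
    exact (Complex.ofRealCLM.hasFDerivAt.comp X (hsymp X)).const_mul Complex.I
  have hval : ∀ X, fderiv ℝ (fun X => Complex.exp (Complex.I * symp Y X)) X (phDir b)
      = -(Complex.I * dualCoord b Y) * Complex.exp (Complex.I * symp Y X) := by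
    intro X
    rw [(hd X).fderiv]
    cases b <;> simp [phDir, dualCoord, stdVec, EuclideanSpace.inner_single_right] <;> ring
  have hc : Continuous fun X => Complex.exp (Complex.I * symp Y X) := by
    fun_prop
  have hint : ∀ {G : Phase d → ℂ}, Rapid G →
      Integrable fun X => Complex.exp (Complex.I * symp Y X) * G X := by
    intro G hG
    refine hG.integrable.norm.mono' (hc.mul hG.continuous).aestronglyMeasurable
      (ae_of_all _ fun X => ?_)
    rw [norm_mul, norm_cexp_I_mul, one_mul]
  -- the boundary terms vanish, because all functions involved are integrable
  have key := integral_mul_fderiv_eq_neg_fderiv_mul_of_integrable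
    (μ := (volume : Measure (Phase d)))
    (f := fun X => Complex.exp (Complex.I * symp Y X)) (g := F) (v := phDir b)
    (by simp only [hval, mul_assoc]; exact (hint hF).const_mul _)
    (hint (hF.dd b)) (hint hF) (fun X _ => (hd X).differentiableAt)
    (fun X _ => hF.1.differentiable_infty X)
  simp only [sympFourier]
  have e1 : ∀ X, dd (phDir b) F X = fderiv ℝ F X (phDir b) := fun X => rfl
  simp only [e1]
  rw [key]
  simp only [hval, mul_assoc]
  rw [integral_const_mul, ← integral_const_mul, ← integral_const_mul]
  simp only [integral_const_mul]
  ring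

lemma norm_le_sum_dualCoord (Y : Phase d) : ‖Y‖ ≤ ∑ b, |dualCoord b Y| := by
  refine (norm_le_sum_coord Y).trans (le_of_eq ?_)
  simp [Fintype.sum_sum_type, dualCoord, add_comm]

/-- The symplectic Fourier transform of a rapidly decreasing function is rapidly decreasing. -/
lemma sympFourier_bound (p : ℕ) {F : Phase d → ℂ} (hF : Rapid F) :
    ∃ C, 0 ≤ C ∧ ∀ Y, ‖sympFourier F Y‖ ≤ C * ((1 + ‖Y‖) ^ p)⁻¹ := by
  induction p generalizing F with
  | zero =>
    refine ⟨‖1 / (2 * (Real.pi : ℂ)) ^ d‖ * ∫ Y, ‖F Y‖, by positivity, fun Y => ?_⟩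
    rw [sympFourier, norm_mul]
    simp only [pow_zero, inv_one, mul_one]
    refine mul_le_mul_of_nonneg_left ((norm_integral_le_integral_norm _).trans (le_of_eq ?_))
      (norm_nonneg _)
    simp only [norm_mul, norm_cexp_I_mul, one_mul]
  | succ p ih =>
    -- each further power of `‖Y‖` is traded for one derivative of `F`
    obtain ⟨C, hC, h0⟩ := ih hF
    choose D hD h1 using fun b => ih (hF.dd b)
    refine ⟨C + ∑ b, D b, by have := Finset.sum_nonneg fun b (_ : b ∈ Finset.univ) => hD b
                             positivity, fun Y => ?_⟩
    have hpos : 0 < 1 + ‖Y‖ := by positivity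
    rw [pow_succ, mul_inv, ← mul_assoc, ← div_eq_mul_inv, le_div_iff₀ hpos, mul_add, mul_one,
      add_mul]
    refine add_le_add (h0 Y) ?_
    calc ‖sympFourier F Y‖ * ‖Y‖ ≤ ‖sympFourier F Y‖ * ∑ b, |dualCoord b Y| :=
          mul_le_mul_of_nonneg_left (norm_le_sum_dualCoord Y) (norm_nonneg _)
      _ = ∑ b, ‖sympFourier (dd (phDir b) F) Y‖ := by
          rw [Finset.mul_sum]
          refine Finset.sum_congr rfl fun b _ => ?_
          rw [sympFourier_dd hF]
          simp [mul_comm]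
      _ ≤ ∑ b, D b * ((1 + ‖Y‖) ^ p)⁻¹ := Finset.sum_le_sum fun b _ => h1 b Y
      _ = _ := by rw [Finset.sum_mul]

lemma integral_comp_inv_two_pi_smul (h : Config d → ℂ) :
    1 / (2 * (Real.pi : ℂ)) ^ d * ∫ η : Config d, h ((2 * Real.pi)⁻¹ • η) = ∫ k, h k := by
  rw [Measure.integral_comp_smul]
  simp only [finrank_euclideanSpace, Fintype.card_fin, inv_pow, inv_inv]
  rw [abs_of_pos (by positivity), Complex.real_smul, ← mul_assoc]
  push_cast
  have : (2 * (Real.pi : ℂ)) ^ d ≠ 0 :=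
    pow_ne_zero _ (mul_ne_zero two_ne_zero (by exact_mod_cast Real.pi_ne_zero))
  rw [one_div, inv_mul_cancel₀ this, one_mul]

/-- The partial Fourier transform in the second variable. -/
noncomputable def partialFourier (F : Phase d → ℂ) (x y : Config d) : ℂ :=
  ∫ η : Config d, Complex.exp (-(Complex.I * (inner ℝ y η : ℝ))) * F (x, η)

lemma norm_cexp_neg_I_mul (t : ℝ) : ‖Complex.exp (-(Complex.I * t))‖ = 1 := by
  rw [← mul_neg, ← Complex.ofReal_neg, norm_cexp_I_mul]

lemma integrable_sympFourier {F : Phase d → ℂ} (hF : Rapid F) :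
    Integrable (sympFourier F) := by
  obtain ⟨C, hC, hb⟩ := sympFourier_bound (Module.finrank ℝ (Phase d) + 1) hF
  exact ((integrable_inv_one_add_norm_pow volume (Nat.lt_succ_self _)).const_mul C).mono'
    (continuous_sympFourier hF).aestronglyMeasurable (ae_of_all _ hb)

lemma integrable_sympFourier_snd {F : Phase d → ℂ} (hF : Rapid F) (y : Config d) :
    Integrable fun η => sympFourier F (y, η) := by
  obtain ⟨C, hC, hb⟩ := sympFourier_bound (Module.finrank ℝ (Config d) + 1) hF
  refine ((integrable_inv_one_add_norm_pow volume (Nat.lt_succ_self _)).const_mul C).mono'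
    ((continuous_sympFourier hF).comp (by fun_prop)).aestronglyMeasurable (ae_of_all _ fun η => ?_)
  refine (hb (y, η)).trans (mul_le_mul_of_nonneg_left ?_ hC)
  have : ‖η‖ ≤ ‖(y, η)‖ := norm_snd_le (y, η)
  gcongr

lemma sympFourier_eq_integral_partialFourier {F : Phase d → ℂ} (hF : Rapid F) (y η : Config d) :
    sympFourier F (y, η) = 1 / (2 * (Real.pi : ℂ)) ^ d *
      ∫ x : Config d, Complex.exp (Complex.I * (inner ℝ η x : ℝ)) * partialFourier F x y := by
  rw [sympFourier, Measure.volume_eq_prod, integral_prod]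
  · congr 2
    funext x
    rw [partialFourier, ← integral_const_mul]
    congr 1
    funext ξ
    rw [← mul_assoc, ← Complex.exp_add, symp_eq_inner]
    congr 2
    push_cast
    ring
  · refine hF.integrable.norm.mono' (Continuous.aestronglyMeasurable ?_) (ae_of_all _ fun X => ?_)
    · have := hF.continuous
      fun_prop
    · rw [norm_mul, norm_cexp_I_mul, one_mul]

lemma integrable_partialFourier_left {F : Phase d → ℂ} (hF : Rapid F) (y : Config d) :
    Integrable fun x => partialFourier F x y := by
  have : Integrable (fun X : Config d × Config d =>
      Complex.exp (-(Complex.I * (inner ℝ y X.2 : ℝ))) * F X) := by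
    refine hF.integrable.norm.mono' (Continuous.aestronglyMeasurable ?_) (ae_of_all _ fun X => ?_)
    · have := hF.continuous
      fun_prop
    · rw [norm_mul, norm_cexp_neg_I_mul, one_mul]
  exact this.integral_prod_left

lemma continuous_partialFourier_left {F : Phase d → ℂ} (hF : Rapid F) (y : Config d) :
    Continuous fun x => partialFourier F x y := by
  obtain ⟨C, hC, hb⟩ := hF.bound (Module.finrank ℝ (Config d) + 1)
  have hc := hF.continuous
  refine continuous_of_dominated
    (bound := fun η => C * ((1 + ‖η‖) ^ (Module.finrank ℝ (Config d) + 1))⁻¹)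
    (fun x => Continuous.aestronglyMeasurable (by fun_prop)) (fun x => ae_of_all _ fun η => ?_)
    ((integrable_inv_one_add_norm_pow volume (Nat.lt_succ_self _)).const_mul C)
    (ae_of_all _ fun η => by fun_prop)
  rw [norm_mul, norm_cexp_neg_I_mul, one_mul]
  refine (hb (x, η)).trans (mul_le_mul_of_nonneg_left ?_ hC)
  have : ‖η‖ ≤ ‖(x, η)‖ := norm_snd_le (x, η)
  gcongr

open FourierTransform in
/-- Fourier inversion in one half of the variables. -/
lemma integral_sympFourier_snd {F : Phase d → ℂ} (hF : Rapid F) (x y : Config d) :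
    ∫ η : Config d, Complex.exp (-(Complex.I * (inner ℝ x η : ℝ))) * sympFourier F (y, η)
      = partialFourier F x y := by
  set V : Config d → ℂ := fun x => partialFourier F x y with hV
  have hpi : (2 * Real.pi) ≠ 0 := by positivity
  -- up to scaling by `2π`, `η ↦ sympFourier F (y, η)` is Mathlib's inverse Fourier transform of `V`
  have h1 : ∀ η, sympFourier F (y, η) =
      1 / (2 * (Real.pi : ℂ)) ^ d * 𝓕⁻ V ((2 * Real.pi)⁻¹ • η) := by
    intro η
    rw [sympFourier_eq_integral_partialFourier hF, Real.fourierInv_eq']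
    congr 2
    funext x
    rw [inner_smul_right, smul_eq_mul, mul_inv_cancel_left₀ hpi, real_inner_comm,
      mul_comm Complex.I]
  have h2 : ∀ k, 𝓕 V k = (2 * (Real.pi : ℂ)) ^ d * sympFourier F (y, (-(2 * Real.pi)) • k) := by
    intro k
    rw [h1, smul_smul, mul_neg, inv_mul_cancel₀ hpi, neg_one_smul, Real.fourierInv_eq_fourier_neg,
      neg_neg, ← mul_assoc, mul_one_div_cancel, one_mul]
    exact pow_ne_zero _ (by exact_mod_cast hpi)
  have h3 : Integrable (𝓕 V) := by
    rw [show 𝓕 V = fun k => (2 * (Real.pi : ℂ)) ^ d * sympFourier F (y, (-(2 * Real.pi)) • k) from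
      funext h2]
    exact ((integrable_sympFourier_snd hF y).comp_smul (neg_ne_zero.2 hpi)).const_mul _
  simp only [h1]
  have h4 : ∀ η : Config d, Complex.exp (-(Complex.I * (inner ℝ x η : ℝ))) *
      (1 / (2 * (Real.pi : ℂ)) ^ d * 𝓕⁻ V ((2 * Real.pi)⁻¹ • η)) = 1 / (2 * (Real.pi : ℂ)) ^ d *
      (fun k : Config d => Complex.exp (((-2 * Real.pi * inner ℝ k x : ℝ) : ℂ) * Complex.I) •
        𝓕⁻ V k) ((2 * Real.pi)⁻¹ • η) := by
    intro η
    simp only [smul_eq_mul]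
    have : -2 * Real.pi * inner ℝ ((2 * Real.pi)⁻¹ • η) x = - inner ℝ x η := by
      rw [inner_smul_left, real_inner_comm]
      simp
      field_simp
    rw [this]
    push_cast
    rw [show -(Complex.I * ((inner ℝ x η : ℝ) : ℂ)) = -((inner ℝ x η : ℝ) : ℂ) * Complex.I by ring]
    ring
  rw [integral_congr_ae (ae_of_all _ h4), integral_const_mul, integral_comp_inv_two_pi_smul
      (fun k : Config d =>
        Complex.exp (((-2 * Real.pi * inner ℝ k x : ℝ) : ℂ) * Complex.I) • 𝓕⁻ V k),
    ← Real.fourier_eq',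
    (integrable_partialFourier_left hF y).fourier_fourierInv_eq h3
      (continuous_partialFourier_left hF y).continuousAt]

open FourierTransform in
/-- The symplectic Fourier transform is its own inverse. -/
lemma sympFourier_sympFourier {F : Phase d → ℂ} (hF : Rapid F) (X : Phase d) :
    sympFourier (sympFourier F) X = F X := by
  obtain ⟨x, ξ⟩ := X
  have hpi : (2 * Real.pi) ≠ 0 := by positivity
  have hi : Integrable (fun Y : Config d × Config d =>
      Complex.exp (-(Complex.I * (inner ℝ x Y.2 : ℝ))) * sympFourier F Y) := by
    refine (integrable_sympFourier hF).norm.mono' (Continuous.aestronglyMeasurable ?_)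
      (ae_of_all _ fun X => ?_)
    · have := continuous_sympFourier hF
      fun_prop
    · rw [norm_mul, norm_cexp_neg_I_mul, one_mul]
  have hi' : Integrable fun y => partialFourier F x y := by
    refine hi.integral_prod_left.congr (ae_of_all _ fun y => ?_)
    exact integral_sympFourier_snd hF x y
  -- one half of the variables is inverted by `integral_sympFourier_snd`, the other half by
  -- Mathlib's inversion formula
  rw [sympFourier, Measure.volume_eq_prod, integral_prod]
  · have e1 : ∀ y : Config d, ∫ η : Config d, Complex.exp (Complex.I * symp (x, ξ) (y, η)) *
        sympFourier F (y, η) =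
          Complex.exp (Complex.I * (inner ℝ ξ y : ℝ)) * partialFourier F x y := by
      intro y
      rw [← integral_sympFourier_snd hF, ← integral_const_mul]
      congr 1
      funext η
      rw [← mul_assoc, ← Complex.exp_add, symp_eq_inner]
      congr 2
      push_cast
      ring
    simp only [e1]
    set U : Config d → ℂ := fun η => F (x, η)
    have e2 : ∀ y, partialFourier F x y = 𝓕 U ((2 * Real.pi)⁻¹ • y) := by
      intro y
      rw [partialFourier, Real.fourier_eq']
      congr 1
      funext η
      have : -2 * Real.pi * inner ℝ η ((2 * Real.pi)⁻¹ • y) = - inner ℝ y η := by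
        rw [inner_smul_right, real_inner_comm]
        field_simp
      rw [this, smul_eq_mul]
      push_cast
      congr 2
      ring
    have e3 : Integrable (𝓕 U) := by
      have h5 := hi'.comp_smul hpi
      refine h5.congr (ae_of_all _ fun k => ?_)
      simp only
      rw [e2, smul_smul, inv_mul_cancel₀ hpi, one_smul]
    have e4 : ∀ y, Complex.exp (Complex.I * (inner ℝ ξ y : ℝ)) * partialFourier F x y =
        (fun k : Config d => Complex.exp (((2 * Real.pi * inner ℝ k ξ : ℝ) : ℂ) * Complex.I) •
          𝓕 U k) ((2 * Real.pi)⁻¹ • y) := by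
      intro y
      simp only [smul_eq_mul]
      have : 2 * Real.pi * inner ℝ ((2 * Real.pi)⁻¹ • y) ξ = inner ℝ ξ y := by
        rw [inner_smul_left, real_inner_comm]
        simp
        field_simp
      rw [this, e2, mul_comm Complex.I]
    rw [integral_congr_ae (ae_of_all _ e4), integral_comp_inv_two_pi_smul
      (fun k : Config d => Complex.exp (((2 * Real.pi * inner ℝ k ξ : ℝ) : ℂ) * Complex.I) • 𝓕 U k),
      ← Real.fourierInv_eq',
      (hF.integrable_snd x).fourierInv_fourier_eq e3
        (hF.continuous.comp (by fun_prop : Continuous fun η => (x, η))).continuousAt]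
  · refine (integrable_sympFourier hF).norm.mono' (Continuous.aestronglyMeasurable ?_)
      (ae_of_all _ fun X => ?_)
    · have := continuous_sympFourier hF
      fun_prop
    · rw [norm_mul, norm_cexp_I_mul, one_mul]

end Fourier

end MagneticMoyal

/-! ### Regularization of oscillatory integrals -/

namespace MagneticMoyal

section Regularization

variable {E ι κ : Type*} [NormedAddCommGroup E] [NormedSpace ℝ E]

/-- The differential operator `∏ (1 - ∂_b)`, the product over the directions `dir b` with `b` in
the list `l`. -/
noncomputable def oneSubD (dir : κ → E) : List κ → (E → ℂ) → E → ℂ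
  | [], f => f
  | b :: l, f => fun e => oneSubD dir l f e - dd (dir b) (oneSubD dir l f) e

lemma contDiff_oneSubD (dir : κ → E) (l : List κ) {f : E → ℂ} (hf : ContDiff ℝ ∞ f) :
    ContDiff ℝ ∞ (oneSubD dir l f) := by
  induction l with
  | nil => exact hf
  | cons b l ih => exact ih.sub (contDiff_dd ih _)

lemma DerivBound.sub_dd {dir : κ → E} {K : ℕ} {w : ι → E → ℝ} {f : ι → E → ℂ}
    (hs : ∀ i, ContDiff ℝ ∞ (f i)) (h : DerivBound dir (fun _ _ => 1) (K + 1) w f) (b : κ) :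
    DerivBound dir (fun _ _ => 1) K w (fun i e => f i e - dd (dir b) (f i) e) := by
  have h2 : DerivBound dir (fun _ _ => 1) K w (fun i => dd (dir b) (f i)) := by simpa using h.2 b
  refine (h.pred.add hs (fun i => contDiff_const.mul (contDiff_dd (hs i) _))
    (h2.const_mul (fun i => contDiff_dd (hs i) _) (a := fun _ => -1) (A := 1) (by simp))).congr ?_
  intro i e
  ring

lemma DerivBound.oneSubD {dir : κ → E} {K : ℕ} {w : ι → E → ℝ} {f : ι → E → ℂ} (l : List κ)
    (hs : ∀ i, ContDiff ℝ ∞ (f i)) (h : DerivBound dir (fun _ _ => 1) (K + l.length) w f) :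
    DerivBound dir (fun _ _ => 1) K w (fun i => oneSubD dir l (f i)) := by
  induction l generalizing K with
  | nil => exact h
  | cons b l ih =>
    refine DerivBound.sub_dd (fun i => contDiff_oneSubD dir l (hs i)) (ih ?_) b
    rw [List.length_cons] at h
    convert h using 1
    omega

lemma oneSubD_comp {E' : Type*} [NormedAddCommGroup E'] [NormedSpace ℝ E'] {dir : κ → E}
    {dir' : κ → E'} {f : E' → ℂ} (hf : ContDiff ℝ ∞ f) {A : E → E'} {L : E →L[ℝ] E'}
    (hA : ∀ e, HasFDerivAt A L e) (hL : ∀ b, L (dir b) = dir' b) (l : List κ) :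
    oneSubD dir l (fun e => f (A e)) = fun e => oneSubD dir' l f (A e) := by
  induction l with
  | nil => rfl
  | cons b l ih =>
    funext e
    simp only [oneSubD, ih]
    rw [dd_comp_clm (contDiff_oneSubD dir' l hf) hA, hL]

variable {d : ℕ}

/-- The coordinate functions as continuous linear forms. -/
noncomputable def coordL (b : Fin d ⊕ Fin d) : Phase d →L[ℝ] ℝ :=
  Sum.elim (fun l => (EuclideanSpace.proj l).comp (ContinuousLinearMap.fst ℝ (Config d) (Config d)))
    (fun l => (EuclideanSpace.proj l).comp (ContinuousLinearMap.snd ℝ (Config d) (Config d))) b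

lemma coordL_apply (b : Fin d ⊕ Fin d) (X : Phase d) : coordL b X = coord b X := by
  cases b <;> rfl

lemma coord_phDir (b b' : Fin d ⊕ Fin d) : coord b (phDir b') = if b = b' then 1 else 0 := by
  cases b <;> cases b' <;> simp [coord, phDir, stdVec]

lemma contDiff_ofReal_coord (b : Fin d ⊕ Fin d) :
    ContDiff ℝ ∞ fun X : Phase d => (coord b X : ℂ) :=
  Complex.ofRealCLM.contDiff.comp (contDiff_coord b)

lemma dd_coord (b : Fin d ⊕ Fin d) (v : Phase d) :
    dd v (fun X : Phase d => (coord b X : ℂ)) = fun _ => (coord b v : ℂ) := by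
  funext X
  have : (fun X : Phase d => (coord b X : ℂ)) =
      (Complex.ofRealCLM.comp (coordL b) : Phase d → ℂ) := by
    funext X; simp [coordL_apply]
  rw [dd, this, ContinuousLinearMap.fderiv]
  simp [coordL_apply]

/-- The factor `(1 - i θ_b)⁻¹`. -/
noncomputable def recip1 (b : Fin d ⊕ Fin d) (θ : Phase d) : ℂ := (1 - Complex.I * coord b θ)⁻¹

lemma one_sub_I_mul_ne_zero (t : ℝ) : (1 - Complex.I * (t : ℂ)) ≠ 0 := by
  intro h
  have := congrArg Complex.re h
  simp at this

lemma contDiff_recip1 (b : Fin d ⊕ Fin d) : ContDiff ℝ ∞ (recip1 b : Phase d → ℂ) :=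
  (contDiff_const.sub (contDiff_const.mul (contDiff_ofReal_coord b))).inv
    fun _ => one_sub_I_mul_ne_zero _

lemma one_le_norm_one_sub_I_mul (t : ℝ) : 1 ≤ ‖1 - Complex.I * (t : ℂ)‖ := by
  have := Complex.abs_re_le_norm (1 - Complex.I * (t : ℂ))
  simpa using this

lemma abs_le_norm_one_sub_I_mul (t : ℝ) : |t| ≤ ‖1 - Complex.I * (t : ℂ)‖ := by
  have := Complex.abs_im_le_norm (1 - Complex.I * (t : ℂ))
  simpa using this

lemma norm_recip1_le (b : Fin d ⊕ Fin d) (θ : Phase d) : ‖recip1 b θ‖ ≤ 1 := by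
  rw [recip1, norm_inv]
  exact inv_le_one_of_one_le₀ (one_le_norm_one_sub_I_mul _)

lemma dd_recip1 (b b' : Fin d ⊕ Fin d) :
    dd (phDir b') (recip1 b) = fun θ => (if b = b' then Complex.I else 0) * recip1 b θ ^ 2 := by
  have hq : ContDiff ℝ ∞ fun θ : Phase d => 1 - Complex.I * (coord b θ : ℂ) :=
    contDiff_const.sub (contDiff_const.mul (contDiff_ofReal_coord b))
  have h1 : (fun θ : Phase d => recip1 b θ * (1 - Complex.I * (coord b θ : ℂ))) = fun _ => 1 := by
    funext θ
    exact inv_mul_cancel₀ (one_sub_I_mul_ne_zero _)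
  have h2 := dd_mul (contDiff_recip1 b) hq (phDir b')
  rw [h1, dd_const, dd_sub contDiff_const (contDiff_const.mul (contDiff_ofReal_coord b)), dd_const,
    dd_const_mul (contDiff_ofReal_coord b), dd_coord, coord_phDir] at h2
  funext θ
  have h3 := congrFun h2 θ
  have h4 : recip1 b θ * (1 - Complex.I * (coord b θ : ℂ)) = 1 := congrFun h1 θ
  have h5 : dd (phDir b') (recip1 b) θ = dd (phDir b') (recip1 b) θ *
      (recip1 b θ * (1 - Complex.I * (coord b θ : ℂ))) := by rw [h4, mul_one]
  simp only at h3
  rw [h5]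
  split_ifs at h3 ⊢ <;> push_cast at h3 <;> linear_combination (-(recip1 b θ)) * h3

/-- The product of the factors `(1 - i θ_b)⁻¹` with `b` in the list `l`. -/
noncomputable def recip (l : List (Fin d ⊕ Fin d)) (θ : Phase d) : ℂ :=
  (l.map fun b => recip1 b θ).prod

@[simp] lemma recip_nil (θ : Phase d) : recip [] θ = 1 := rfl

lemma recip_cons (b : Fin d ⊕ Fin d) (l : List (Fin d ⊕ Fin d)) (θ : Phase d) :
    recip (b :: l) θ = recip1 b θ * recip l θ := by simp [recip]

lemma recip_append (l l' : List (Fin d ⊕ Fin d)) (θ : Phase d) :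
    recip (l ++ l') θ = recip l θ * recip l' θ := by simp [recip]

lemma contDiff_recip (l : List (Fin d ⊕ Fin d)) : ContDiff ℝ ∞ (recip l : Phase d → ℂ) := by
  induction l with
  | nil => exact contDiff_const
  | cons b l ih =>
    have : (recip (b :: l) : Phase d → ℂ) = fun θ => recip1 b θ * recip l θ :=
      funext fun θ => recip_cons b l θ
    rw [this]
    exact (contDiff_recip1 b).mul ih

lemma derivBound_recip1_pow (b : Fin d ⊕ Fin d) (K m : ℕ) :
    DerivBound phDir (fun _ _ => 1) K (fun (_ : Unit) θ => ‖recip1 b θ‖ ^ m)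
      (fun _ θ => recip1 b θ ^ m) := by
  have base : ∀ m, ∃ C : ℝ, 0 ≤ C ∧ ∀ (_ : Unit) (θ : Phase d),
      ‖recip1 b θ ^ m‖ ≤ C * ‖recip1 b θ‖ ^ m :=
    fun m => ⟨1, zero_le_one, fun _ θ => by rw [norm_pow, one_mul]⟩
  induction K generalizing m with
  | zero => exact base m
  | succ K ih =>
    refine ⟨base m, fun b' => ?_⟩
    have key : dd (phDir b') (fun θ => recip1 b θ ^ m) =
        fun θ => (if b = b' then (m : ℂ) * Complex.I else 0) * recip1 b θ ^ (m + 1) := by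
      clear ih base
      induction m with
      | zero => simp [dd_const]
      | succ m ihm =>
        have : (fun θ : Phase d => recip1 b θ ^ (m + 1)) =
            fun θ => recip1 b θ ^ m * recip1 b θ := by
          funext θ; rw [pow_succ]
        rw [this, dd_mul ((contDiff_recip1 b).pow m) (contDiff_recip1 b), ihm, dd_recip1]
        funext θ
        split_ifs <;> push_cast <;> ring
    simp only [key, one_mul]
    refine ((ih (m + 1)).const_mul (fun _ => (contDiff_recip1 b).pow _) (A := m) (a := fun _ => _)
      fun _ => ?_).mono (fun _ _ => zero_le_one) zero_le_one fun _ θ => ?_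
    · split_ifs <;> simp
    · rw [one_mul, pow_succ]
      exact mul_le_of_le_one_right (by positivity) (norm_recip1_le b θ)

lemma derivBound_recip (l : List (Fin d ⊕ Fin d)) (K : ℕ) :
    DerivBound phDir (fun _ _ => 1) K (fun (_ : Unit) θ => ‖recip l θ‖) (fun _ => recip l) := by
  induction l with
  | nil =>
    simp only [recip_nil, norm_one]
    have : (recip [] : Phase d → ℂ) = fun _ => 1 := rfl
    rw [this]
    exact DerivBound.const (fun _ _ => zero_le_one) (fun _ _ => zero_le_one) zero_le_one
      (a := fun _ => 1) (by simp)
  | cons b l ih =>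
    have h1 := derivBound_recip1_pow b K 1
    simp only [pow_one] at h1
    have := DerivBound.mul (fun _ _ => zero_le_one) (fun _ _ => norm_nonneg _)
      (fun _ => contDiff_recip1 b) (fun _ => contDiff_recip l) h1 ih
    have e : (recip (b :: l) : Phase d → ℂ) = fun θ => recip1 b θ * recip l θ :=
      funext fun θ => recip_cons b l θ
    simpa only [e, norm_mul] using this

/-- A list of indices that contains each of `0, …, d - 1` exactly `R` times. -/
def repList (d : ℕ) : ℕ → List (Fin d)
  | 0 => []
  | R + 1 => List.finRange d ++ repList d R

/-- A list that contains each coordinate of phase space exactly `R` times. -/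
def fullList (d R : ℕ) : List (Fin d ⊕ Fin d) :=
  (repList d R).map Sum.inl ++ (repList d R).map Sum.inr

/-- Repeating every coordinate `R` times gives decay of order `R` in all directions, since one of
the coordinates is comparable to the norm. -/
lemma norm_recip_fullList_le (R : ℕ) :
    ∃ C, 0 ≤ C ∧ ∀ θ : Phase d, ‖recip (fullList d R) θ‖ ≤ C * ((1 + ‖θ‖) ^ R)⁻¹ := by
  have h1 : ∀ θ : Phase d, ‖∏ b, recip1 b θ‖ ≤
      (1 + Fintype.card (Fin d ⊕ Fin d)) * (1 + ‖θ‖)⁻¹ := by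
    intro θ
    have hP : ‖∏ b, recip1 b θ‖ = (∏ b, ‖1 - Complex.I * (coord b θ : ℂ)‖)⁻¹ := by
      simp [recip1, norm_prod]
    rw [hP]
    set P := ∏ b, ‖1 - Complex.I * (coord b θ : ℂ)‖ with hPd
    have hone : 1 ≤ P := Finset.one_le_prod fun b _ => one_le_norm_one_sub_I_mul _
    have hb : ∀ b, |coord b θ| ≤ P := by
      intro b
      refine (abs_le_norm_one_sub_I_mul _).trans ?_
      rw [hPd, ← Finset.mul_prod_erase _ _ (Finset.mem_univ b)]
      refine le_mul_of_one_le_right (norm_nonneg _) ?_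
      exact Finset.one_le_prod fun b _ => one_le_norm_one_sub_I_mul _
    have hsum : ‖θ‖ ≤ Fintype.card (Fin d ⊕ Fin d) * P := by
      refine (norm_le_sum_coord θ).trans ((Finset.sum_le_sum fun b _ => hb b).trans ?_)
      simp
    rw [← div_eq_mul_inv, le_div_iff₀ (by positivity), inv_mul_le_iff₀ (by linarith)]
    nlinarith
  have h2 : ∀ R, ∀ θ : Phase d, recip (fullList d R) θ = (∏ b, recip1 b θ) ^ R := by
    intro R θ
    induction R with
    | zero => simp [fullList, repList]
    | succ R ih =>
      rw [pow_succ, ← ih, Fintype.prod_sum_type]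
      simp only [fullList, repList, recip_append, List.map_append]
      have e1 : recip ((List.finRange d).map Sum.inl) θ = ∏ l : Fin d, recip1 (.inl l) θ := by
        rw [recip, List.map_map, ← List.ofFn_eq_map, List.prod_ofFn]; rfl
      have e2 : recip ((List.finRange d).map Sum.inr) θ = ∏ l : Fin d, recip1 (.inr l) θ := by
        rw [recip, List.map_map, ← List.ofFn_eq_map, List.prod_ofFn]; rfl
      rw [e1, e2]
      ring
  refine ⟨(1 + Fintype.card (Fin d ⊕ Fin d)) ^ R, by positivity, fun θ => ?_⟩
  rw [h2, norm_pow, ← inv_pow, ← mul_pow]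
  exact pow_le_pow_left₀ (norm_nonneg _) (h1 θ) R

/-- The pairing of two points of `ℝ^d × ℝ^d`. -/
noncomputable def pair (w θ : Phase d) : ℝ := inner ℝ w.1 θ.1 + inner ℝ w.2 θ.2

@[fun_prop]
lemma _root_.Continuous.pair {α : Type*} [TopologicalSpace α] {f g : α → Phase d}
    (hf : Continuous f) (hg : Continuous g) : Continuous fun a => pair (f a) (g a) := by
  simp only [MagneticMoyal.pair]; fun_prop

/-- Integration by parts against `e^{-i⟨w,θ⟩}`. -/
lemma integral_cexp_pair_eq (l : List (Fin d ⊕ Fin d)) {u : Phase d → ℂ} (hu : ContDiff ℝ ∞ u)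
    {w : Phase d → ℝ} (hw : Integrable w)
    (hb : DerivBound phDir (fun _ _ => 1) l.length (fun (_ : Unit) => w) (fun _ => u))
    (θ : Phase d) :
    ∫ v, Complex.exp (-(Complex.I * pair v θ)) * u v
      = recip l θ * ∫ v, Complex.exp (-(Complex.I * pair v θ)) * oneSubD phDir l u v := by
  have hc : Continuous fun v => Complex.exp (-(Complex.I * pair v θ)) := by fun_prop
  have hint : ∀ {q : Phase d → ℂ}, Continuous q → (∃ C, 0 ≤ C ∧ ∀ (_ : Unit) v, ‖q v‖ ≤ C * w v) →
      Integrable fun v => Complex.exp (-(Complex.I * pair v θ)) * q v := by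
    rintro q hq ⟨C, -, hC⟩
    refine (hw.const_mul C).mono' (hc.mul hq).aestronglyMeasurable (ae_of_all _ fun v => ?_)
    rw [norm_mul, norm_cexp_neg_I_mul, one_mul]
    exact hC () v
  induction l with
  | nil => simp [oneSubD]
  | cons b l ih =>
    rw [ih hb.pred, recip_cons]
    set q := oneSubD phDir l u with hq
    have hqs : ContDiff ℝ ∞ q := contDiff_oneSubD _ _ hu
    have hqb : DerivBound phDir (fun _ _ => 1) 1 (fun (_ : Unit) => w) (fun _ => q) :=
      DerivBound.oneSubD l (fun _ => hu) (by rw [add_comm]; exact hb)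
    have i1 := hint hqs.continuous hqb.bound
    have i2 := hint (contDiff_dd hqs (phDir b)).continuous
      (by simpa using (hqb.2 b).bound)
    have hd : ∀ v, HasFDerivAt (fun v => Complex.exp (-(Complex.I * pair v θ)))
        (Complex.exp (-(Complex.I * pair v θ)) • (-(Complex.I • Complex.ofRealCLM.comp
        ((innerSL ℝ θ.1).comp (ContinuousLinearMap.fst ℝ (Config d) (Config d))
        + (innerSL ℝ θ.2).comp (ContinuousLinearMap.snd ℝ (Config d) (Config d)))))) v := by
      intro v
      refine HasFDerivAt.cexp (HasFDerivAt.neg ?_)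
      refine HasFDerivAt.const_mul ?_ Complex.I
      have : (fun v => pair v θ) = fun v : Phase d => inner ℝ θ.1 v.1 + inner ℝ θ.2 v.2 := by
        funext v; simp only [pair, real_inner_comm]
      have hp : HasFDerivAt (fun v => pair v θ)
          ((innerSL ℝ θ.1).comp (ContinuousLinearMap.fst ℝ (Config d) (Config d))
            + (innerSL ℝ θ.2).comp (ContinuousLinearMap.snd ℝ (Config d) (Config d))) v := by
        rw [this]
        exact (((innerSL ℝ θ.1).comp
          (ContinuousLinearMap.fst ℝ (Config d) (Config d))).hasFDerivAt).add
          (((innerSL ℝ θ.2).comp (ContinuousLinearMap.snd ℝ (Config d) (Config d))).hasFDerivAt)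
      exact Complex.ofRealCLM.hasFDerivAt.comp v hp
    have hval : ∀ v, fderiv ℝ (fun v => Complex.exp (-(Complex.I * pair v θ))) v (phDir b)
        = -(Complex.I * coord b θ) * Complex.exp (-(Complex.I * pair v θ)) := by
      intro v
      rw [(hd v).fderiv]
      cases b <;> simp [phDir, coord, stdVec, EuclideanSpace.inner_single_right] <;> ring
    have key := integral_mul_fderiv_eq_neg_fderiv_mul_of_integrable
      (μ := (volume : Measure (Phase d)))
      (f := fun v => Complex.exp (-(Complex.I * pair v θ))) (g := q) (v := phDir b)
      (by simp only [hval, mul_assoc]; exact i1.const_mul _) i2 i1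
      (fun v _ => (hd v).differentiableAt) (fun v _ => hqs.differentiable_infty v)
    simp only [hval, mul_assoc] at key
    rw [integral_const_mul] at key
    have e1 : ∀ v, Complex.exp (-(Complex.I * pair v θ)) * oneSubD phDir (b :: l) u v =
        Complex.exp (-(Complex.I * pair v θ)) * q v
          - Complex.exp (-(Complex.I * pair v θ)) * fderiv ℝ q v (phDir b) := by
      intro v
      simp only [oneSubD, dd, ← hq]
      ring
    simp only [e1]
    have i2' : Integrable fun v => Complex.exp (-(Complex.I * pair v θ)) *
        fderiv ℝ q v (phDir b) := i2
    rw [integral_sub i1 i2', key]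
    have h4 : recip1 b θ * (1 - Complex.I * (coord b θ : ℂ)) = 1 :=
      inv_mul_cancel₀ (one_sub_I_mul_ne_zero _)
    linear_combination (-(recip l θ) * ∫ v, Complex.exp (-(Complex.I * pair v θ)) * q v) * h4

end Regularization

end MagneticMoyal

namespace MagneticMoyal

section Formula

variable {d : ℕ}

lemma Rapid.oneSubD {F : Phase d → ℂ} (hF : Rapid F) (l : List (Fin d ⊕ Fin d)) :
    Rapid (oneSubD phDir l F) := by
  induction l with
  | nil => exact hF
  | cons b l ih => exact ih.sub (ih.dd b)

lemma sympFourier_sub {F G : Phase d → ℂ} (hF : Rapid F) (hG : Rapid G) (Y : Phase d) :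
    sympFourier (fun X => F X - G X) Y = sympFourier F Y - sympFourier G Y := by
  have hint : ∀ {G : Phase d → ℂ}, Rapid G →
      Integrable fun X => Complex.exp (Complex.I * symp Y X) * G X := by
    intro G hG
    have := hG.continuous
    refine hG.integrable.norm.mono' (Continuous.aestronglyMeasurable (by fun_prop))
      (ae_of_all _ fun X => ?_)
    rw [norm_mul, norm_cexp_I_mul, one_mul]
  simp only [sympFourier, mul_sub]
  rw [integral_sub (hint hF) (hint hG), mul_sub]

/-- The decay of the symplectic Fourier transform in the first variable, made explicit. -/
lemma sympFourier_eq_recip_mul {F : Phase d → ℂ} (hF : Rapid F) (l : List (Fin d)) (Y : Phase d) :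
    sympFourier F Y =
      recip (l.map Sum.inl) Y * sympFourier (oneSubD phDir (l.map Sum.inr) F) Y := by
  induction l with
  | nil => simp [MagneticMoyal.oneSubD]
  | cons b l ih =>
    have hR := hF.oneSubD (l.map Sum.inr)
    rw [ih, List.map_cons, List.map_cons, recip_cons, MagneticMoyal.oneSubD,
      sympFourier_sub hR (hR.dd _), sympFourier_dd hR]
    have h4 : recip1 (.inl b) Y * (1 - Complex.I * (coord (.inl b) Y : ℂ)) = 1 :=
      inv_mul_cancel₀ (one_sub_I_mul_ne_zero _)
    simp only [coord_inl] at h4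
    simp only [dualCoord, Sum.elim_inr]
    linear_combination (-(recip (l.map Sum.inl) Y) *
      sympFourier (MagneticMoyal.oneSubD phDir (l.map Sum.inr) F) Y) * h4

lemma recip_map_inl (l : List (Fin d)) (x y y' : Config d) :
    recip (l.map Sum.inl) (x, y) = recip (l.map Sum.inl) (x, y') := by
  simp [recip, recip1, Function.comp_def]

lemma recip_map_inr (l : List (Fin d)) (x y y' : Config d) :
    recip (l.map Sum.inr) (x, y) = recip (l.map Sum.inl) (y, y') := by
  simp [recip, recip1, Function.comp_def]

lemma one_add_norm_prod_le {E F : Type*} [NormedAddCommGroup E] [NormedAddCommGroup F]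
    (P : E × F) : 1 + ‖P‖ ≤ (1 + ‖P.1‖) * (1 + ‖P.2‖) := by
  have h1 := norm_nonneg P.1
  have h2 := norm_nonneg P.2
  rcases max_cases ‖P.1‖ ‖P.2‖ with h | h <;> rw [Prod.norm_def, h.1] <;> nlinarith

/-- The product of two rapidly decreasing Fourier transforms is integrable against continuous
functions of polynomial growth. -/
lemma integrable_mul_sympFourier {F G : Phase d → ℂ} (hF : Rapid F) (hG : Rapid G)
    (p : ℕ) :
    Integrable fun P : Phase d × Phase d =>
      (1 + ‖P‖) ^ p * (‖sympFourier F P.1‖ * ‖sympFourier G P.2‖) := by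
  set n := Module.finrank ℝ (Phase d) + 1
  have key : ∀ {F : Phase d → ℂ}, Rapid F →
      Integrable fun Y : Phase d => (1 + ‖Y‖) ^ p * ‖sympFourier F Y‖ := by
    intro F hF
    obtain ⟨C, hC, hb⟩ := sympFourier_bound (p + n) hF
    have hc := continuous_sympFourier hF
    refine ((integrable_inv_one_add_norm_pow volume (Nat.lt_succ_self _)).const_mul C).mono'
      (Continuous.aestronglyMeasurable (by fun_prop)) (ae_of_all _ fun Y => ?_)
    have hpos : 0 < 1 + ‖Y‖ := by positivity
    rw [norm_mul, norm_norm, Real.norm_of_nonneg (by positivity)]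
    calc (1 + ‖Y‖) ^ p * ‖sympFourier F Y‖ ≤ (1 + ‖Y‖) ^ p * (C * ((1 + ‖Y‖) ^ (p + n))⁻¹) :=
          mul_le_mul_of_nonneg_left (hb Y) (by positivity)
      _ = C * ((1 + ‖Y‖) ^ n)⁻¹ := by
          rw [pow_add]; field_simp
  have hc := continuous_sympFourier hF
  have hc' := continuous_sympFourier hG
  refine ((key hF).mul_prod (key hG)).mono' (Continuous.aestronglyMeasurable (by fun_prop))
    (ae_of_all _ fun P => ?_)
  rw [Real.norm_of_nonneg (by positivity)]
  calc (1 + ‖P‖) ^ p * (‖sympFourier F P.1‖ * ‖sympFourier G P.2‖)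
      ≤ ((1 + ‖P.1‖) * (1 + ‖P.2‖)) ^ p * (‖sympFourier F P.1‖ * ‖sympFourier G P.2‖) := by
        gcongr
        exact one_add_norm_prod_le P
    _ = _ := by rw [mul_pow]; ring

lemma integrable_kernelIntegrand {F G : Phase d → ℂ} (hF : Rapid F) (hG : Rapid G)
    {K : Config d → Phase d → Phase d → ℂ} {X : Phase d}
    (hK : Continuous fun P : Phase d × Phase d => K X.1 P.1 P.2) {C : ℝ} {p : ℕ}
    (hKb : ∀ P : Phase d × Phase d, ‖K X.1 P.1 P.2‖ ≤ C * (1 + ‖P‖) ^ p) :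
    Integrable (kernelIntegrand K F G X) := by
  have hc := continuous_sympFourier hF
  have hc' := continuous_sympFourier hG
  refine ((integrable_mul_sympFourier hF hG p).const_mul C).mono'
    (Continuous.aestronglyMeasurable ?_) (ae_of_all _ fun P => ?_)
  · unfold kernelIntegrand
    fun_prop
  · simp only [kernelIntegrand, norm_mul, norm_cexp_I_mul, one_mul]
    calc ‖K X.1 P.1 P.2‖ * ‖sympFourier F P.1‖ * ‖sympFourier G P.2‖
        = ‖K X.1 P.1 P.2‖ * (‖sympFourier F P.1‖ * ‖sympFourier G P.2‖) := by ring
      _ ≤ (C * (1 + ‖P‖) ^ p) * (‖sympFourier F P.1‖ * ‖sympFourier G P.2‖) :=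
          mul_le_mul_of_nonneg_right (hKb P) (by positivity)
      _ = _ := by ring

/-- The exchange of the two middle factors preserves the volume. -/
lemma measurePreserving_middle {α : Type*} [MeasureSpace α] [SFinite (volume : Measure α)] :
    MeasurePreserving (fun e : (α × α) × (α × α) => ((e.1.1, e.2.1), (e.1.2, e.2.2))) := by
  have h1 := measurePreserving_prodAssoc (volume : Measure α) (volume : Measure α)
    ((volume : Measure α).prod (volume : Measure α))
  have h2 := (measurePreserving_prodAssoc (volume : Measure α) (volume : Measure α)
    (volume : Measure α)).symm
  have h3 := (Measure.measurePreserving_swap (μ := (volume : Measure α))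
    (ν := (volume : Measure α))).prod (MeasurePreserving.id (volume : Measure α))
  have h4 := measurePreserving_prodAssoc (volume : Measure α) (volume : Measure α)
    (volume : Measure α)
  have h5 := (measurePreserving_prodAssoc (volume : Measure α) (volume : Measure α)
    ((volume : Measure α).prod (volume : Measure α))).symm
  exact h5.comp (((MeasurePreserving.id (volume : Measure α)).prod (h4.comp (h3.comp h2))).comp h1)

lemma integral_middle {α : Type*} [MeasureSpace α] [SFinite (volume : Measure α)]
    (f : (α × α) × (α × α) → ℂ) :
    ∫ P, f P = ∫ e : (α × α) × (α × α), f ((e.1.1, e.2.1), (e.1.2, e.2.2)) := by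
  refine ((measurePreserving_middle (α := α)).integral_comp ?_ f).symm
  have hinv : Function.Involutive
      (fun e : (α × α) × (α × α) => ((e.1.1, e.2.1), (e.1.2, e.2.2))) := fun e => rfl
  exact (MeasurableEquiv.mk hinv.toPerm measurePreserving_middle.measurable
    measurePreserving_middle.measurable).measurableEmbedding

lemma partialFourier_shift (F : Phase d → ℂ) (x ξ y : Config d) :
    Complex.exp (Complex.I * (inner ℝ ξ y : ℝ)) * partialFourier F x y =
      ∫ η : Config d, Complex.exp (-(Complex.I * (inner ℝ y η : ℝ))) * F (x, ξ + η) := by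
  rw [partialFourier, ← integral_add_left_eq_self _ ξ, ← integral_const_mul]
  congr 1
  funext η
  rw [← mul_assoc, ← Complex.exp_add, inner_add_right, real_inner_comm ξ y]
  congr 2
  push_cast
  ring

/-- The kernel integral of rapidly decreasing functions, with the frequencies integrated out. -/
lemma kernelIntegral_eq_iterated {F G : Phase d → ℂ} (hF : Rapid F) (hG : Rapid G)
    {K : Config d → Phase d → Phase d → ℂ} {X : Phase d} {ε : ℝ} {c : Phase d → ℂ}
    (hc : Continuous c) {C : ℝ} {p : ℕ} (hcb : ∀ w, ‖c w‖ ≤ C * (1 + ‖w‖) ^ p)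
    (hK : ∀ Y Z, K X.1 Y Z = Complex.exp (Complex.I * (ε / 2 * symp Y Z : ℝ)) * c (Y.1, Z.1)) :
    kernelIntegral K F G X = 1 / (2 * (Real.pi : ℂ)) ^ (2 * d) * ∫ w : Phase d, ∫ θ : Phase d,
      Complex.exp (-(Complex.I * pair w θ)) * (c w * (F (X.1 - (ε / 2) • w.2, X.2 + θ.1)
        * G (X.1 + (ε / 2) • w.1, X.2 + θ.2))) := by
  obtain ⟨x, ξ⟩ := X
  have hC : 0 ≤ C := by
    have := (norm_nonneg _).trans (hcb 0)
    simpa using this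
  have hint : Integrable (kernelIntegrand K F G (x, ξ)) := by
    refine integrable_kernelIntegrand hF hG (C := C) (p := p) ?_ fun P => ?_
    · simp only at hK
      simp only [hK]
      fun_prop
    · simp only at hK
      simp only [hK]
      rw [norm_mul, norm_cexp_I_mul, one_mul]
      refine (hcb _).trans (mul_le_mul_of_nonneg_left ?_ hC)
      have : ‖((P.1.1, P.2.1) : Phase d)‖ ≤ ‖P‖ := by
        refine norm_prod_le_iff.2 ⟨?_, ?_⟩
        · exact (norm_fst_le P.1).trans (norm_fst_le P)
        · exact (norm_fst_le P.2).trans (norm_snd_le P)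
      gcongr
  rw [kernelIntegral, integral_middle]
  have hint2 : Integrable (fun e : Phase d × Phase d =>
      kernelIntegrand K F G (x, ξ) ((e.1.1, e.2.1), (e.1.2, e.2.2))) :=
    (measurePreserving_middle (α := Config d)).integrable_comp_of_integrable hint
  rw [Measure.volume_eq_prod (Phase d) (Phase d), integral_prod _ hint2]
  congr 2
  funext w
  -- the phase `ε/2 σ(Y,Z)` is absorbed into shifts of the base points of the frequency integrals,
  -- which then factorize
  have e1 : ∀ θ : Phase d, kernelIntegrand K F G (x, ξ) ((w.1, θ.1), (w.2, θ.2)) =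
      (Complex.exp (Complex.I * (inner ℝ ξ w.1 : ℝ)) *
        Complex.exp (Complex.I * (inner ℝ ξ w.2 : ℝ)) * c w) *
      ((Complex.exp (-(Complex.I * (inner ℝ (x - (ε / 2) • w.2) θ.1 : ℝ))) *
          sympFourier F (w.1, θ.1)) *
       (Complex.exp (-(Complex.I * (inner ℝ (x + (ε / 2) • w.1) θ.2 : ℝ))) *
          sympFourier G (w.2, θ.2))) := by
    intro θ
    simp only [kernelIntegrand]
    simp only at hK
    rw [hK]
    have : Complex.exp (Complex.I * symp (x, ξ) ((w.1, θ.1) + (w.2, θ.2))) *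
        Complex.exp (Complex.I * (ε / 2 * symp (w.1, θ.1) (w.2, θ.2) : ℝ)) =
        Complex.exp (Complex.I * (inner ℝ ξ w.1 : ℝ)) *
        Complex.exp (Complex.I * (inner ℝ ξ w.2 : ℝ)) *
        Complex.exp (-(Complex.I * (inner ℝ (x - (ε / 2) • w.2) θ.1 : ℝ))) *
        Complex.exp (-(Complex.I * (inner ℝ (x + (ε / 2) • w.1) θ.2 : ℝ))) := by
      simp only [← Complex.exp_add, symp_eq_inner]
      congr 1
      simp only [Prod.mk_add_mk, inner_add_right, inner_sub_left, inner_add_left, inner_smul_left]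
      rw [real_inner_comm w.2 θ.1]
      push_cast
      simp only [conj_trivial]
      push_cast
      ring
    linear_combination c w * sympFourier F (w.1, θ.1) * sympFourier G (w.2, θ.2) * this
  simp only [e1]
  rw [integral_const_mul, Measure.volume_eq_prod (Config d) (Config d),
    integral_prod_mul (fun η => Complex.exp (-(Complex.I * (inner ℝ (x - (ε / 2) • w.2) η : ℝ))) *
          sympFourier F (w.1, η)) (fun ζ => Complex.exp (-(Complex.I *
          (inner ℝ (x + (ε / 2) • w.1) ζ : ℝ))) * sympFourier G (w.2, ζ)),
    integral_sympFourier_snd hF, integral_sympFourier_snd hG]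
  have e2 : ∀ θ : Config d × Config d, Complex.exp (-(Complex.I * pair w θ)) *
      (c w * (F (x - (ε / 2) • w.2, ξ + θ.1) * G (x + (ε / 2) • w.1, ξ + θ.2))) =
      c w * ((Complex.exp (-(Complex.I * (inner ℝ w.1 θ.1 : ℝ))) *
          F (x - (ε / 2) • w.2, ξ + θ.1)) *
        (Complex.exp (-(Complex.I * (inner ℝ w.2 θ.2 : ℝ))) *
          G (x + (ε / 2) • w.1, ξ + θ.2))) := by
    intro θ
    have : Complex.exp (-(Complex.I * pair w θ)) =
        Complex.exp (-(Complex.I * (inner ℝ w.1 θ.1 : ℝ))) *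
          Complex.exp (-(Complex.I * (inner ℝ w.2 θ.2 : ℝ))) := by
      rw [← Complex.exp_add, pair]
      congr 1
      push_cast
      ring
    rw [this]
    ring
  simp only [e2]
  rw [integral_const_mul, integral_prod_mul (fun η => Complex.exp (-(Complex.I *
      (inner ℝ w.1 η : ℝ))) * F (x - (ε / 2) • w.2, ξ + η)) (fun ζ => Complex.exp (-(Complex.I *
      (inner ℝ w.2 ζ : ℝ))) * G (x + (ε / 2) • w.1, ξ + ζ)), ← partialFourier_shift,
      ← partialFourier_shift]
  ring

/-- The amplitude of the oscillatory integral after integrations by parts in the frequencies. -/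
noncomputable def regAmp (R : ℕ) (c F G : Phase d → ℂ) (ε : ℝ) (X : Phase d)
    (e : Phase d × Phase d) : ℂ :=
  (recip (fullList d R) e.1 * c e.1) *
    (oneSubD phDir ((repList d R).map Sum.inr) F (X.1 - (ε / 2) • e.1.2, X.2 + e.2.1) *
     oneSubD phDir ((repList d R).map Sum.inr) G (X.1 + (ε / 2) • e.1.1, X.2 + e.2.2))

/-- The coordinate directions of the first factor of `(ℝ^d × ℝ^d) × (ℝ^d × ℝ^d)`. -/
noncomputable def wDir (b : Fin d ⊕ Fin d) : Phase d × Phase d := (phDir b, 0)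

/-- The integrand of the regularized oscillatory integral. -/
noncomputable def regIntegrand (Q R : ℕ) (c F G : Phase d → ℂ) (ε : ℝ) (X : Phase d)
    (e : Phase d × Phase d) : ℂ :=
  Complex.exp (-(Complex.I * pair e.1 e.2)) *
    (recip (fullList d Q) e.2 * oneSubD wDir (fullList d Q) (regAmp R c F G ε X) e)

/-- The affine map `(w,θ) ↦ (x + a w, ξ + b θ)` for linear maps `a`, `b`. -/
lemma hasFDerivAt_affine (x ξ : Config d) (a b : Phase d →L[ℝ] Config d) (e : Phase d × Phase d) :
    HasFDerivAt (fun e : Phase d × Phase d => (x + a e.1, ξ + b e.2))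
      ((a.comp (ContinuousLinearMap.fst ℝ _ _)).prod
        (b.comp (ContinuousLinearMap.snd ℝ _ _))) e := by
  refine HasFDerivAt.prodMk ?_ ?_
  · exact ((a.comp (ContinuousLinearMap.fst ℝ (Phase d) (Phase d))).hasFDerivAt).const_add x
  · exact ((b.comp (ContinuousLinearMap.snd ℝ (Phase d) (Phase d))).hasFDerivAt).const_add ξ

/-- The linear map that selects the second half of `w` with factor `-ε/2`. -/
noncomputable def shiftF (ε : ℝ) : Phase d →L[ℝ] Config d :=
  (-(ε / 2)) • ContinuousLinearMap.snd ℝ (Config d) (Config d)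

/-- The linear map that selects the first half of `w` with factor `ε/2`. -/
noncomputable def shiftG (ε : ℝ) : Phase d →L[ℝ] Config d :=
  (ε / 2) • ContinuousLinearMap.fst ℝ (Config d) (Config d)

lemma regAmp_eq (R : ℕ) (c F G : Phase d → ℂ) (ε : ℝ) (X : Phase d) :
    regAmp R c F G ε X = fun e => (recip (fullList d R) e.1 * c e.1) *
    (oneSubD phDir ((repList d R).map Sum.inr) F (X.1 + shiftF ε e.1,
        X.2 + ContinuousLinearMap.fst ℝ _ _ e.2) *
     oneSubD phDir ((repList d R).map Sum.inr) G (X.1 + shiftG ε e.1,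
        X.2 + ContinuousLinearMap.snd ℝ _ _ e.2)) := by
  funext e
  simp [regAmp, shiftF, shiftG, sub_eq_add_neg]

lemma contDiff_regAmp (R : ℕ) {c F G : Phase d → ℂ} (hc : ContDiff ℝ ∞ c) (hF : ContDiff ℝ ∞ F)
    (hG : ContDiff ℝ ∞ G) (ε : ℝ) (X : Phase d) : ContDiff ℝ ∞ (regAmp R c F G ε X) := by
  rw [regAmp_eq]
  refine (((contDiff_recip _).comp contDiff_fst).mul (hc.comp contDiff_fst)).mul
    (((contDiff_oneSubD _ _ hF).comp ?_).mul ((contDiff_oneSubD _ _ hG).comp ?_)) <;> fun_prop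

/-- Bounds for the derivatives of the amplitude, uniform in families. -/
lemma derivBound_regAmp {I : Type*} {K R p : ℕ} {c F G : I → Phase d → ℂ} {μ ν : I → Config d → ℝ}
    {ε : I → ℝ} {X : I → Phase d} (hε : ∀ i, |ε i| ≤ 1)
    (hc : ∀ i, ContDiff ℝ ∞ (c i)) (hF : ∀ i, ContDiff ℝ ∞ (F i)) (hG : ∀ i, ContDiff ℝ ∞ (G i))
    (hμ : ∀ i ξ, 0 ≤ μ i ξ) (hν : ∀ i ξ, 0 ≤ ν i ξ)
    (bc : DerivBound phDir (fun _ _ => 1) K (fun _ w => (1 + ‖w‖) ^ p) c)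
    (bF : DerivBound phDir (fun _ _ => 1) (K + (repList d R).length) (fun i Y => μ i Y.2) F)
    (bG : DerivBound phDir (fun _ _ => 1) (K + (repList d R).length) (fun i Y => ν i Y.2) G) :
    DerivBound wDir (fun _ _ => 1) K
      (fun i e => ((1 + ‖e.1‖) ^ R)⁻¹ * (1 + ‖e.1‖) ^ p * (μ i ((X i).2 + e.2.1)
        * ν i ((X i).2 + e.2.2)))
      (fun i => regAmp R (c i) (F i) (G i) (ε i) (X i)) := by
  simp only [regAmp_eq]
  have hfst : ∀ e : Phase d × Phase d, HasFDerivAt (fun e : Phase d × Phase d => e.1)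
      (ContinuousLinearMap.fst ℝ (Phase d) (Phase d)) e := fun e => hasFDerivAt_fst
  have hid : ∀ b : Fin d ⊕ Fin d, ContinuousLinearMap.fst ℝ (Phase d) (Phase d) (wDir b) =
      ∑ b', (if b' = b then (1 : ℝ) else 0) • phDir b' := by
    intro b; simp [wDir]
  have hite : ∀ b b' : Fin d ⊕ Fin d, |if b' = b then (1 : ℝ) else 0| ≤ 1 := by
    intro b b'; split_ifs <;> simp
  have pull : ∀ {w : I → Phase d → ℝ} {u : I → Phase d → ℂ}, (∀ i v, 0 ≤ w i v) →
      (∀ i, ContDiff ℝ ∞ (u i)) → DerivBound phDir (fun _ _ => 1) K w u →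
      DerivBound wDir (fun _ _ => 1) K (fun i e => w i e.1) (fun i e => u i e.1) :=
    fun hw hu h => DerivBound.comp_affine hw hu h (fun _ e => e.1)
      (fun _ => ContinuousLinearMap.fst ℝ (Phase d) (Phase d)) (fun _ => hfst)
      (fun _ b b' => if b' = b then 1 else 0) (M := 1) (fun _ b b' => hite b b') (fun _ => hid)
  have b1 : DerivBound wDir (fun _ _ => 1) K (fun (_ : I) (e : Phase d × Phase d) =>
      ((1 + ‖e.1‖) ^ R)⁻¹) (fun _ e => recip (fullList d R) e.1) := by
    obtain ⟨A, hA, hb⟩ := norm_recip_fullList_le (d := d) R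
    have h0 := ((derivBound_recip (fullList d R) K).mono (fun _ _ => zero_le_one) hA
      (w₂ := fun _ w => ((1 + ‖w‖) ^ R)⁻¹) fun _ w => hb w).comp_index (fun _ : I => ())
    exact pull (fun _ _ => by positivity) (fun _ => contDiff_recip _) h0
  have b2 := pull (fun _ _ => by positivity) hc bc
  have hlen : K + (repList d R).length = K + ((repList d R).map (Sum.inr (α := Fin d))).length := by
    simp
  rw [hlen] at bF bG
  have hε2 : ∀ i, |ε i / 2| ≤ 1 := fun i => by
    rw [abs_div, abs_two]; linarith [hε i]
  -- differentiation in `w` only acts on the shifts of the base points, with coefficients `± ε/2`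
  have b3 := DerivBound.comp_affine (dir := wDir) (w := fun i Y => μ i Y.2) (fun i Y => hμ i Y.2)
    (fun i => contDiff_oneSubD _ _ (hF i))
    (DerivBound.oneSubD _ hF bF) (fun i e => ((X i).1 + shiftF (ε i) e.1,
        (X i).2 + ContinuousLinearMap.fst ℝ _ _ e.2)) _ (fun i => hasFDerivAt_affine _ _ _ _)
      (fun i b b' => Sum.elim (fun _ => 0) (fun l => if b' = .inl l then -(ε i / 2) else 0) b)
      (M := 1) ?_ ?_
  · have b4 := DerivBound.comp_affine (dir := wDir) (w := fun i Y => ν i Y.2) (fun i Y => hν i Y.2)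
      (fun i => contDiff_oneSubD _ _ (hG i))
      (DerivBound.oneSubD _ hG bG) (fun i e => ((X i).1 + shiftG (ε i) e.1,
        (X i).2 + ContinuousLinearMap.snd ℝ _ _ e.2)) _ (fun i => hasFDerivAt_affine _ _ _ _)
      (fun i b b' => Sum.elim (fun l => if b' = .inl l then (ε i / 2) else 0) (fun _ => 0) b)
      (M := 1) ?_ ?_
    · refine DerivBound.mul (fun _ _ => zero_le_one) (fun _ _ => by positivity) ?_ ?_
        (DerivBound.mul (fun _ _ => zero_le_one) (fun _ _ => by positivity) ?_ ?_ b1 b2)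
        (DerivBound.mul (fun _ _ => zero_le_one) (fun _ _ => hμ _ _) ?_ ?_ b3 b4)
      · exact fun i => ((contDiff_recip _).comp contDiff_fst).mul ((hc i).comp contDiff_fst)
      · intro i
        refine ((contDiff_oneSubD _ _ (hF i)).comp ?_).mul ((contDiff_oneSubD _ _ (hG i)).comp ?_)
          <;> fun_prop
      · exact fun i => (contDiff_recip _).comp contDiff_fst
      · exact fun i => (hc i).comp contDiff_fst
      · exact fun i => (contDiff_oneSubD _ _ (hF i)).comp (by fun_prop)
      · exact fun i => (contDiff_oneSubD _ _ (hG i)).comp (by fun_prop)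
    · intro i b b'
      rcases b with l | l <;> simp
      split_ifs
      · exact hε2 i
      · simp
    · intro i b
      rcases b with l | l <;> simp [wDir, phDir, shiftG]
  · intro i b b'
    rcases b with l | l <;> simp
    split_ifs
    · rw [abs_neg]; exact hε2 i
    · simp
  · intro i b
    rcases b with l | l <;> simp [wDir, phDir, shiftF]

end Formula

end MagneticMoyal

/-! ### The a priori estimate -/

namespace MagneticMoyal

section Estimate

variable {d : ℕ}

lemma one_le_japanese (ξ : Config d) : 1 ≤ japanese ξ := by
  rw [japanese, Real.one_le_sqrt]
  nlinarith [norm_nonneg ξ]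

lemma japanese_pos (ξ : Config d) : 0 < japanese ξ := lt_of_lt_of_le one_pos (one_le_japanese ξ)

lemma japanese_add_le (ξ η : Config d) : japanese (ξ + η) ≤ japanese ξ * (1 + ‖η‖) := by
  have h1 := one_le_japanese ξ
  have h2 : japanese ξ ^ 2 = 1 + ‖ξ‖ ^ 2 := Real.sq_sqrt (by positivity)
  have h3 : ‖ξ‖ ≤ japanese ξ := Real.le_sqrt_of_sq_le (by linarith)
  have h4 := norm_add_le ξ η
  have h5 := norm_nonneg η
  have h6 := norm_nonneg ξ
  refine (Real.sqrt_le_left (by positivity)).2 ?_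
  have h7 : ‖ξ + η‖ ^ 2 ≤ (‖ξ‖ + ‖η‖) ^ 2 := pow_le_pow_left₀ (norm_nonneg _) h4 2
  have h8 : ‖ξ‖ * ‖η‖ ≤ japanese ξ ^ 2 * ‖η‖ := by
    refine mul_le_mul_of_nonneg_right ?_ h5
    nlinarith
  nlinarith [mul_nonneg h5 h5, mul_nonneg (mul_nonneg h6 h6) (mul_nonneg h5 h5)]

/-- Peetre's inequality. -/
lemma japanese_add_rpow_le (s : ℝ) (ξ η : Config d) :
    japanese (ξ + η) ^ s ≤ japanese ξ ^ s * (1 + ‖η‖) ^ ⌈|s|⌉₊ := by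
  have hη : 1 ≤ 1 + ‖η‖ := by linarith [norm_nonneg η]
  have hq : (1 + ‖η‖) ^ |s| ≤ (1 + ‖η‖) ^ ⌈|s|⌉₊ := by
    rw [← Real.rpow_natCast]
    exact Real.rpow_le_rpow_of_exponent_le hη (Nat.le_ceil _)
  have hpos := japanese_pos ξ
  have hpos' := japanese_pos (ξ + η)
  refine le_trans ?_ (mul_le_mul_of_nonneg_left hq (by positivity))
  rcases le_or_gt 0 s with hs | hs
  · rw [abs_of_nonneg hs, ← Real.mul_rpow hpos.le (by positivity)]
    exact Real.rpow_le_rpow hpos'.le (japanese_add_le ξ η) hs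
  · rw [abs_of_neg hs]
    have h1 : japanese ξ ≤ japanese (ξ + η) * (1 + ‖η‖) := by
      have := japanese_add_le (ξ + η) (-η)
      rwa [add_neg_cancel_right, norm_neg] at this
    have h2 : (japanese (ξ + η) * (1 + ‖η‖)) ^ s ≤ japanese ξ ^ s :=
      Real.rpow_le_rpow_of_nonpos hpos h1 hs.le
    rw [Real.mul_rpow hpos'.le (by positivity)] at h2
    calc japanese (ξ + η) ^ s = japanese (ξ + η) ^ s * (1 + ‖η‖) ^ s * (1 + ‖η‖) ^ (-s) := by
          rw [mul_assoc, ← Real.rpow_add (by positivity)]; simp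
      _ ≤ _ := mul_le_mul_of_nonneg_right h2 (by positivity)

/-- An exponent of decay that makes powers of the norm on phase space integrable. -/
noncomputable def decayExp (d : ℕ) : ℕ := Module.finrank ℝ (Phase d) + 1

/-- An integrable weight on pairs of points of phase space. -/
noncomputable def prodWeight (e : Phase d × Phase d) : ℝ :=
  ((1 + ‖e.1‖) ^ decayExp d)⁻¹ * ((1 + ‖e.2‖) ^ decayExp d)⁻¹

lemma prodWeight_nonneg (e : Phase d × Phase d) : 0 ≤ prodWeight e := by
  unfold prodWeight; positivity

lemma integrable_prodWeight : Integrable (prodWeight : Phase d × Phase d → ℝ) :=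
  (integrable_inv_one_add_norm_pow volume (Nat.lt_succ_self _)).mul_prod
    (integrable_inv_one_add_norm_pow volume (Nat.lt_succ_self _))

lemma continuous_regIntegrand (Q R : ℕ) {c F G : Phase d → ℂ} (hc : ContDiff ℝ ∞ c)
    (hF : ContDiff ℝ ∞ F) (hG : ContDiff ℝ ∞ G) (ε : ℝ) (X : Phase d) :
    Continuous (regIntegrand Q R c F G ε X) := by
  have h1 := (contDiff_oneSubD wDir (fullList d Q) (contDiff_regAmp R hc hF hG ε X)).continuous
  have h2 := (contDiff_recip (fullList d Q)).continuous
  unfold regIntegrand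
  fun_prop

lemma inv_pow_mul_pow_le {t : ℝ} (ht : 0 ≤ t) {R p n : ℕ} (h : p + n ≤ R) :
    ((1 + t) ^ R)⁻¹ * (1 + t) ^ p ≤ ((1 + t) ^ n)⁻¹ := by
  have h1 : (1 + t) ^ (p + n) ≤ (1 + t) ^ R := pow_le_pow_right₀ (by linarith) h
  rw [pow_add] at h1
  rw [inv_mul_le_iff₀ (by positivity), ← div_eq_mul_inv, le_div_iff₀ (by positivity)]
  exact h1

/-- For rapidly decreasing functions the kernel integral is the regularized integral. -/
lemma kernelIntegral_eq_regularized {F G : Phase d → ℂ} (hF : Rapid F) (hG : Rapid G)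
    {K : Config d → Phase d → Phase d → ℂ} {X : Phase d} {ε : ℝ} (hε : |ε| ≤ 1) {c : Phase d → ℂ}
    (hc : ContDiff ℝ ∞ c) {Q R p : ℕ} (hR : p + decayExp d ≤ R)
    (hcb : DerivBound phDir (fun _ _ => 1) (fullList d Q).length
      (fun (_ : Unit) w => (1 + ‖w‖) ^ p) (fun _ => c))
    (hK : ∀ Y Z, K X.1 Y Z = Complex.exp (Complex.I * (ε / 2 * symp Y Z : ℝ)) * c (Y.1, Z.1)) :
    kernelIntegral K F G X =
      1 / (2 * (Real.pi : ℂ)) ^ (2 * d) * ∫ e, regIntegrand Q R c F G ε X e := by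
  set l := repList d R with hl
  set c' : Phase d → ℂ := fun w => recip (fullList d R) w * c w with hc'
  set K' : Config d → Phase d → Phase d → ℂ :=
    fun _ Y Z => Complex.exp (Complex.I * (ε / 2 * symp Y Z : ℝ)) * c' (Y.1, Z.1) with hK'
  set F' := oneSubD phDir (l.map Sum.inr) F with hF'
  set G' := oneSubD phDir (l.map Sum.inr) G with hG'
  -- `R` integrations by parts in the frequencies give the amplitude decay in `w`
  have s1 : kernelIntegral K F G X = kernelIntegral K' F' G' X := by
    rw [kernelIntegral, kernelIntegral]
    congr 2
    funext P
    simp only [kernelIntegrand, hK, hK', hc', fullList, recip_append]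
    rw [sympFourier_eq_recip_mul hF l, sympFourier_eq_recip_mul hG l, ← hF', ← hG', ← hl,
      recip_map_inr l P.1.1 P.2.1 P.2.2, recip_map_inl l P.1.1 P.2.1 P.1.2]
    ring
  have hc's : ContDiff ℝ ∞ c' := (contDiff_recip _).mul hc
  obtain ⟨C, hC, hcC⟩ := hcb.bound
  have hc'b : ∀ w, ‖c' w‖ ≤ C * (1 + ‖w‖) ^ p := by
    intro w
    have h1 : ∀ l : List (Fin d ⊕ Fin d), ‖recip l w‖ ≤ 1 := by
      intro l
      induction l with
      | nil => simp
      | cons b l ih =>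
        rw [recip_cons, norm_mul]
        exact mul_le_one₀ (norm_recip1_le b w) (norm_nonneg _) ih
    rw [hc', norm_mul]
    exact (mul_le_of_le_one_left (norm_nonneg _) (h1 _)).trans (hcC () w)
  rw [s1, kernelIntegral_eq_iterated (hF.oneSubD _) (hG.oneSubD _) hc's.continuous hc'b
    (fun _ _ => rfl)]
  congr 1
  set B := regAmp R c F G ε X with hB
  have hBs : ContDiff ℝ ∞ B := contDiff_regAmp R hc hF.1 hG.1 ε X
  -- `R` exceeds the growth exponent `p` by enough to be integrable in `w`; in `θ` the rapid
  -- decrease of `F` and `G` suffices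
  have hBb : DerivBound wDir (fun _ _ => 1) (fullList d Q).length (fun (_ : Unit) => prodWeight)
      (fun _ => B) := by
    have hdecay : ∀ {F : Phase d → ℂ}, Rapid F → DerivBound phDir (fun _ _ => 1)
        ((fullList d Q).length + (repList d R).length)
        (fun (_ : Unit) Y => ((1 + ‖Y.2‖) ^ decayExp d)⁻¹) (fun _ => F) := by
      intro F hF
      refine (hF.2 _ (decayExp d)).mono (fun _ _ => zero_le_one) zero_le_one fun _ Y => ?_
      rw [one_mul]
      have := norm_snd_le Y
      gcongr
    have h := derivBound_regAmp (I := Unit) (K := (fullList d Q).length) (R := R) (p := p)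
      (c := fun _ => c) (F := fun _ => F) (G := fun _ => G)
      (μ := fun _ ξ => ((1 + ‖ξ‖) ^ decayExp d)⁻¹) (ν := fun _ ξ => ((1 + ‖ξ‖) ^ decayExp d)⁻¹)
      (ε := fun _ => ε) (X := fun _ => X) (fun _ => hε) (fun _ => hc) (fun _ => hF.1)
      (fun _ => hG.1) (fun _ _ => by positivity) (fun _ _ => by positivity) hcb (hdecay hF)
      (hdecay hG)
    refine h.mono (fun _ _ => zero_le_one) (A := (1 + ‖X.2‖) ^ decayExp d) (by positivity)
      fun _ e => ?_
    have e1 := inv_pow_mul_pow_le (norm_nonneg e.1) hR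
    have e2 : ((1 + ‖X.2 + e.2.1‖) ^ decayExp d)⁻¹ * ((1 + ‖X.2 + e.2.2‖) ^ decayExp d)⁻¹ ≤
        (1 + ‖X.2‖) ^ decayExp d * ((1 + ‖e.2‖) ^ decayExp d)⁻¹ := by
      rw [← mul_inv, ← mul_pow, ← div_eq_mul_inv, le_div_iff₀ (by positivity),
        inv_mul_le_iff₀ (by positivity), ← mul_pow]
      refine pow_le_pow_left₀ (by positivity) ?_ _
      have a1 : ‖e.2‖ ≤ ‖X.2‖ + max ‖X.2 + e.2.1‖ ‖X.2 + e.2.2‖ := by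
        rw [Prod.norm_def]
        refine max_le ?_ ?_
        · have := norm_sub_le (X.2 + e.2.1) X.2
          rw [add_sub_cancel_left] at this
          linarith [le_max_left ‖X.2 + e.2.1‖ ‖X.2 + e.2.2‖]
        · have := norm_sub_le (X.2 + e.2.2) X.2
          rw [add_sub_cancel_left] at this
          linarith [le_max_right ‖X.2 + e.2.1‖ ‖X.2 + e.2.2‖]
      have a2 : 1 + max ‖X.2 + e.2.1‖ ‖X.2 + e.2.2‖ ≤
          (1 + ‖X.2 + e.2.1‖) * (1 + ‖X.2 + e.2.2‖) :=
        one_add_norm_prod_le (X.2 + e.2.1, X.2 + e.2.2)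
      have a3 := norm_nonneg X.2
      have a4 : 0 ≤ max ‖X.2 + e.2.1‖ ‖X.2 + e.2.2‖ := le_max_of_le_left (norm_nonneg _)
      calc 1 + ‖e.2‖ ≤ (1 + max ‖X.2 + e.2.1‖ ‖X.2 + e.2.2‖) * (1 + ‖X.2‖) := by nlinarith
        _ ≤ _ := mul_le_mul_of_nonneg_right a2 (by positivity)
    calc _ ≤ ((1 + ‖e.1‖) ^ decayExp d)⁻¹ * ((1 + ‖X.2‖) ^ decayExp d *
          ((1 + ‖e.2‖) ^ decayExp d)⁻¹) := mul_le_mul e1 e2 (by positivity) (by positivity)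
      _ = _ := by rw [prodWeight]; ring
  have hexp : Continuous fun e : Phase d × Phase d =>
      Complex.exp (-(Complex.I * pair e.1 e.2)) := by fun_prop
  have hint : ∀ {q : Phase d × Phase d → ℂ}, Continuous q →
      (∃ C, 0 ≤ C ∧ ∀ (_ : Unit) e, ‖q e‖ ≤ C * prodWeight e) →
      Integrable fun e => Complex.exp (-(Complex.I * pair e.1 e.2)) * q e := by
    rintro q hq ⟨C, -, hC⟩
    refine (integrable_prodWeight.const_mul C).mono' (hexp.mul hq).aestronglyMeasurable
      (ae_of_all _ fun e => ?_)
    rw [norm_mul, norm_cexp_neg_I_mul, one_mul]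
    exact hC () e
  have i1 := hint hBs.continuous hBb.bound
  set D := oneSubD wDir (fullList d Q) B with hD
  have hDs : ContDiff ℝ ∞ D := contDiff_oneSubD _ _ hBs
  have hDb : DerivBound wDir (fun _ _ => 1) 0 (fun (_ : Unit) => prodWeight) (fun _ => D) :=
    DerivBound.oneSubD _ (fun _ => hBs) (by rw [zero_add]; exact hBb)
  have i2 : Integrable (regIntegrand Q R c F G ε X) := by
    obtain ⟨C, hC, hb⟩ := hDb.bound
    obtain ⟨A, hA, hr⟩ := norm_recip_fullList_le (d := d) Q
    refine hint (q := fun e => recip (fullList d Q) e.2 * D e)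
      (((contDiff_recip _).continuous.comp continuous_snd).mul hDs.continuous)
      ⟨A * C, by positivity, fun _ e => ?_⟩
    rw [norm_mul, mul_assoc]
    refine mul_le_mul ((hr e.2).trans (mul_le_of_le_one_right hA ?_)) (hb () e) (norm_nonneg _) hA
    exact inv_le_one_of_one_le₀ (one_le_pow₀ (by linarith [norm_nonneg e.2]))
  -- after interchanging the integrations, `Q` integrations by parts in `w` give decay in `θ`
  calc _ = ∫ w : Phase d, ∫ θ : Phase d, Complex.exp (-(Complex.I * pair w θ)) * B (w, θ) := by
        rfl
    _ = ∫ θ : Phase d, ∫ w : Phase d, Complex.exp (-(Complex.I * pair w θ)) * B (w, θ) :=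
        integral_integral_swap i1
    _ = ∫ θ : Phase d, ∫ w : Phase d, regIntegrand Q R c F G ε X (w, θ) := by
        congr 1
        funext θ
        have hA : ∀ w : Phase d, HasFDerivAt (fun w => (w, θ))
            (ContinuousLinearMap.inl ℝ (Phase d) (Phase d)) w :=
          fun w => hasFDerivAt_prodMk_left w θ
        have hB1 : DerivBound phDir (fun _ _ => 1) (fullList d Q).length
            (fun (_ : Unit) w => prodWeight (w, θ)) (fun _ w => B (w, θ)) := by
          refine DerivBound.comp_affine (fun _ e => prodWeight_nonneg e) (fun _ => hBs) hBb
            (fun _ w => (w, θ)) (fun _ => ContinuousLinearMap.inl ℝ (Phase d) (Phase d))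
            (fun _ => hA) (fun _ b b' => if b' = b then 1 else 0) (M := 1) ?_ ?_
          · intro _ b b'; split_ifs <;> simp
          · intro _ b; simp [wDir]
        rw [integral_cexp_pair_eq (u := fun w => B (w, θ)) (fullList d Q) (hBs.comp (by fun_prop))
          (w := fun w => prodWeight (w, θ))
          ((integrable_inv_one_add_norm_pow (volume : Measure (Phase d))
            (Nat.lt_succ_self _)).mul_const (((1 + ‖θ‖) ^ decayExp d)⁻¹))
          hB1 θ, ← integral_const_mul]
        congr 1
        funext w
        rw [oneSubD_comp (dir := phDir) (dir' := wDir) hBs hA (fun b => rfl) (fullList d Q),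
          regIntegrand, ← hB]
        ring
    _ = _ := (integral_prod_symm _ i2).symm

/-- The number of integrations by parts for symbols of orders `s₁` and `s₂`. -/
noncomputable def regExp (d : ℕ) (s₁ s₂ : ℝ) : ℕ := ⌈|s₁|⌉₊ + ⌈|s₂|⌉₊ + decayExp d

/-- The regularized integrand decays, uniformly in families of symbols. -/
lemma regIntegrand_bound {I : Type*} {c F G : I → Phase d → ℂ} {ε : I → ℝ} {X : I → Phase d}
    {s₁ s₂ : ℝ} {p : ℕ} (hε : ∀ i, |ε i| ≤ 1) (hc : ∀ i, ContDiff ℝ ∞ (c i))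
    (hp : DerivBound phDir (fun _ _ => 1) (fullList d (regExp d s₁ s₂)).length
      (fun (_ : I) w => (1 + ‖w‖) ^ p) c)
    (hF : ∀ i, ContDiff ℝ ∞ (F i)) (hG : ∀ i, ContDiff ℝ ∞ (G i))
    (bF : ∀ K, DerivBound phDir (fun _ _ => 1) K (fun (_ : I) Y => japanese Y.2 ^ s₁) F)
    (bG : ∀ K, DerivBound phDir (fun _ _ => 1) K (fun (_ : I) Y => japanese Y.2 ^ s₂) G) :
    ∃ C, 0 ≤ C ∧ ∀ i e, ‖regIntegrand (regExp d s₁ s₂) (p + decayExp d) (c i) (F i) (G i) (ε i)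
      (X i) e‖ ≤ C * japanese (X i).2 ^ (s₁ + s₂) * prodWeight e := by
  set q₁ := ⌈|s₁|⌉₊
  set q₂ := ⌈|s₂|⌉₊
  set Q := regExp d s₁ s₂ with hQ
  have h := derivBound_regAmp (R := p + decayExp d) (X := X) (μ := fun _ ξ => japanese ξ ^ s₁)
    (ν := fun _ ξ => japanese ξ ^ s₂) hε hc hF hG
    (fun _ ξ => Real.rpow_nonneg (japanese_pos ξ).le _)
    (fun _ ξ => Real.rpow_nonneg (japanese_pos ξ).le _) hp (bF _) (bG _)
  have h0 : DerivBound wDir (fun _ _ => 1) 0 _ _ := DerivBound.oneSubD (K := 0) (fullList d Q)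
    (fun i => contDiff_regAmp (p + decayExp d) (hc i) (hF i) (hG i) (ε i) (X i))
    (by rw [zero_add]; exact h)
  obtain ⟨C, hC, hb⟩ := h0.bound
  obtain ⟨A, hA, hr⟩ := norm_recip_fullList_le (d := d) Q
  refine ⟨A * C, by positivity, fun i e => ?_⟩
  rw [regIntegrand, norm_mul, norm_cexp_neg_I_mul, one_mul, norm_mul]
  have e1 := inv_pow_mul_pow_le (norm_nonneg e.1) (le_refl (p + decayExp d))
  have e2 := inv_pow_mul_pow_le (norm_nonneg e.2) (le_refl (q₁ + q₂ + decayExp d))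
  -- Peetre's inequality: a shift by `θ` costs at most `|s₁| + |s₂|` powers of `1 + ‖θ‖`, which `Q`
  -- integrations by parts compensate
  have p1 := japanese_add_rpow_le s₁ (X i).2 e.2.1
  have p2 := japanese_add_rpow_le s₂ (X i).2 e.2.2
  have hj := japanese_pos (X i).2
  have hj1 : 0 ≤ japanese ((X i).2 + e.2.1) ^ s₁ := Real.rpow_nonneg (japanese_pos _).le _
  have hj2 : 0 ≤ japanese ((X i).2 + e.2.2) ^ s₂ := Real.rpow_nonneg (japanese_pos _).le _
  have n1 : (1 + ‖e.2.1‖) ^ q₁ ≤ (1 + ‖e.2‖) ^ q₁ := by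
    have := norm_fst_le e.2; gcongr
  have n2 : (1 + ‖e.2.2‖) ^ q₂ ≤ (1 + ‖e.2‖) ^ q₂ := by
    have := norm_snd_le e.2; gcongr
  have p3 : japanese ((X i).2 + e.2.1) ^ s₁ * japanese ((X i).2 + e.2.2) ^ s₂ ≤
      japanese (X i).2 ^ (s₁ + s₂) * (1 + ‖e.2‖) ^ (q₁ + q₂) := by
    rw [Real.rpow_add hj, pow_add]
    calc _ ≤ (japanese (X i).2 ^ s₁ * (1 + ‖e.2‖) ^ q₁) * (japanese (X i).2 ^ s₂ *
          (1 + ‖e.2‖) ^ q₂) := by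
          refine mul_le_mul (p1.trans ?_) (p2.trans ?_) hj2 (by positivity)
          · exact mul_le_mul_of_nonneg_left n1 (by positivity)
          · exact mul_le_mul_of_nonneg_left n2 (by positivity)
      _ = _ := by ring
  calc _ ≤ (A * ((1 + ‖e.2‖) ^ Q)⁻¹) * (C * (((1 + ‖e.1‖) ^ (p + decayExp d))⁻¹ *
        (1 + ‖e.1‖) ^ p * (japanese ((X i).2 + e.2.1) ^ s₁ * japanese ((X i).2 + e.2.2) ^ s₂))) :=
        mul_le_mul (hr e.2) (hb i e) (norm_nonneg _) (by positivity)
    _ ≤ (A * ((1 + ‖e.2‖) ^ Q)⁻¹) * (C * (((1 + ‖e.1‖) ^ decayExp d)⁻¹ *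
        (japanese (X i).2 ^ (s₁ + s₂) * (1 + ‖e.2‖) ^ (q₁ + q₂)))) := by
        gcongr
    _ = A * C * japanese (X i).2 ^ (s₁ + s₂) * ((1 + ‖e.1‖) ^ decayExp d)⁻¹ *
        (((1 + ‖e.2‖) ^ Q)⁻¹ * (1 + ‖e.2‖) ^ (q₁ + q₂)) := by ring
    _ ≤ A * C * japanese (X i).2 ^ (s₁ + s₂) * ((1 + ‖e.1‖) ^ decayExp d)⁻¹ *
        ((1 + ‖e.2‖) ^ decayExp d)⁻¹ := by
        refine mul_le_mul_of_nonneg_left e2 (by positivity)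
    _ = _ := by rw [prodWeight]; ring

/-- The basic a priori estimate: kernel integrals of rapidly decreasing functions are bounded by
the symbol weights, with constants that only depend on symbol bounds. -/
lemma kernelIntegral_bound {I : Type*} {c F G : I → Phase d → ℂ} {ε : I → ℝ} {X : I → Phase d}
    {K : I → Config d → Phase d → Phase d → ℂ} {s₁ s₂ : ℝ} (hε : ∀ i, |ε i| ≤ 1)
    (hc : PolyGrowth phDir (fun w => ‖w‖) c)
    (hF : ∀ i, Rapid (F i)) (hG : ∀ i, Rapid (G i))
    (bF : ∀ K, DerivBound phDir (fun _ _ => 1) K (fun (_ : I) Y => japanese Y.2 ^ s₁) F)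
    (bG : ∀ K, DerivBound phDir (fun _ _ => 1) K (fun (_ : I) Y => japanese Y.2 ^ s₂) G)
    (hK : ∀ i Y Z, K i (X i).1 Y Z =
      Complex.exp (Complex.I * (ε i / 2 * symp Y Z : ℝ)) * c i (Y.1, Z.1)) :
    ∃ C, 0 ≤ C ∧ ∀ i, ‖kernelIntegral (K i) (F i) (G i) (X i)‖ ≤
      C * japanese (X i).2 ^ (s₁ + s₂) := by
  obtain ⟨p, hp⟩ := hc.2 (fullList d (regExp d s₁ s₂)).length
  obtain ⟨C, hC, hb⟩ := regIntegrand_bound (X := X) hε hc.1 hp (fun i => (hF i).1)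
    (fun i => (hG i).1) bF bG
  refine ⟨‖1 / (2 * (Real.pi : ℂ)) ^ (2 * d)‖ * (C * ∫ e : Phase d × Phase d, prodWeight e),
    mul_nonneg (norm_nonneg _) (mul_nonneg hC (integral_nonneg prodWeight_nonneg)), fun i => ?_⟩
  rw [kernelIntegral_eq_regularized (hF i) (hG i) (hε i) (hc.1 i) le_rfl
    (hp.comp_index (fun _ : Unit => i)) (hK i), norm_mul, mul_assoc]
  refine mul_le_mul_of_nonneg_left ?_ (norm_nonneg _)
  calc _ ≤ ∫ e : Phase d × Phase d, C * japanese (X i).2 ^ (s₁ + s₂) * prodWeight e :=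
        norm_integral_le_of_norm_le (integrable_prodWeight.const_mul _) (ae_of_all _ (hb i))
    _ = _ := by rw [integral_const_mul]; ring

end Estimate

end MagneticMoyal

/-! ### Averages of a function over a family of triangles -/

namespace MagneticMoyal

section Words

variable {E κ : Type*} [NormedAddCommGroup E] [NormedSpace ℝ E]

/-- A criterion for smoothness: a class of differentiable functions that contains the derivatives
of its members in the directions of a basis consists of smooth functions. -/
lemma contDiff_of_dd_closed [Fintype κ] {dir : κ → E} {L : κ → E →L[ℝ] ℝ}
    (hL : ∀ e, ∑ b, L b e • dir b = e) {P : (E → ℂ) → Prop}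
    (hP : ∀ f, P f → Differentiable ℝ f ∧ ∀ b, P (dd (dir b) f)) {f : E → ℂ} (hf : P f) :
    ContDiff ℝ ∞ f := by
  refine contDiff_infty.2 fun n => ?_
  induction n generalizing f with
  | zero => exact contDiff_zero.2 (hP f hf).1.continuous
  | succ n ih =>
    have e1 : fderiv ℝ f = fun x => ∑ b, dd (dir b) f x • ((Complex.ofRealCLM).comp (L b)) := by
      funext x
      ext v
      conv_lhs => rw [← hL v]
      simp [dd, mul_comm]
    push_cast
    rw [contDiff_succ_iff_fderiv]
    refine ⟨(hP f hf).1, by simp, ?_⟩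
    rw [e1]
    exact ContDiff.sum fun b _ => (ih ((hP f hf).2 b)).smul contDiff_const

/-- Smooth functions that are bounded together with all their derivatives. -/
def BCInfty (f : E → ℂ) : Prop :=
  ContDiff ℝ ∞ f ∧ ∀ n : ℕ, ∃ C : ℝ, ∀ x, ‖iteratedFDeriv ℝ n f x‖ ≤ C

lemma norm_iteratedFDeriv_dd_le {f : E → ℂ} (hf : ContDiff ℝ ∞ f) (v : E) (n : ℕ) (x : E) :
    ‖iteratedFDeriv ℝ n (dd v f) x‖ ≤ ‖v‖ * ‖iteratedFDeriv ℝ (n + 1) f x‖ := by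
  have h := (ContinuousLinearMap.apply ℝ ℂ v).norm_iteratedFDeriv_comp_left (f := fderiv ℝ f)
    (x := x) (hf.fderiv_right (m := ∞) (by simp)).contDiffAt
      (n := n) (by exact_mod_cast le_top)
  rw [norm_iteratedFDeriv_fderiv] at h
  refine h.trans ?_
  gcongr
  refine ContinuousLinearMap.opNorm_le_bound _ (norm_nonneg v) fun g => ?_
  rw [mul_comm]
  exact g.le_opNorm v

lemma BCInfty.dd {f : E → ℂ} (hf : BCInfty f) (v : E) : BCInfty (dd v f) := by
  refine ⟨contDiff_dd hf.1 v, fun n => ?_⟩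
  obtain ⟨C, hC⟩ := hf.2 (n + 1)
  exact ⟨‖v‖ * C, fun x => (norm_iteratedFDeriv_dd_le hf.1 v n x).trans
    (mul_le_mul_of_nonneg_left (hC x) (norm_nonneg v))⟩

lemma BCInfty.bound {f : E → ℂ} (hf : BCInfty f) : ∃ C, 0 ≤ C ∧ ∀ x, ‖f x‖ ≤ C := by
  obtain ⟨C, hC⟩ := hf.2 0
  exact ⟨C, (norm_nonneg _).trans (hC 0), fun x => by simpa using hC x⟩

lemma BCInfty.fderiv_bound {f : E → ℂ} (hf : BCInfty f) : ∃ C, 0 ≤ C ∧ ∀ x, ‖fderiv ℝ f x‖ ≤ C := by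
  obtain ⟨C, hC⟩ := hf.2 1
  exact ⟨C, (norm_nonneg _).trans (hC 0), fun x => by
    simpa [norm_iteratedFDeriv_one] using hC x⟩

end Words

section Triangle

open unitInterval

variable {d : ℕ}

/-- The parameter space of the triangles: the triangle `0 ≤ v ≤ u ≤ 1` is parametrized by
`(u, v) = (t, t s)`. -/
abbrev Tri := I × I

/-- The coefficient `u - 1/2`. -/
noncomputable def triA (t : Tri) : ℝ := t.1 - 1 / 2

/-- The coefficient `v - 1/2`. -/
noncomputable def triB (t : Tri) : ℝ := t.1 * t.2 - 1 / 2

@[fun_prop] lemma continuous_triA : Continuous triA := by unfold triA; fun_prop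
@[fun_prop] lemma continuous_triB : Continuous triB := by unfold triB; fun_prop

/-- The affine parametrization of the triangle with centre data `q = (x, (y, z))`. -/
noncomputable def triL (t : Tri) : (Config d × Phase d) →L[ℝ] Config d :=
  ContinuousLinearMap.fst ℝ _ _ +
    (triA t • (ContinuousLinearMap.fst ℝ _ _).comp (ContinuousLinearMap.snd ℝ _ _) +
     triB t • (ContinuousLinearMap.snd ℝ _ _).comp (ContinuousLinearMap.snd ℝ _ _))

lemma triL_apply (t : Tri) (q : Config d × Phase d) :
    triL t q = q.1 + (triA t • q.2.1 + triB t • q.2.2) := rfl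

@[fun_prop]
lemma continuous_triL : Continuous (triL : Tri → (Config d × Phase d) →L[ℝ] Config d) := by
  unfold triL; fun_prop

/-- The average of `b` over a triangle, with weight `w`. -/
noncomputable def triAvg (b : Config d → ℂ) (w : Tri → ℝ) (q : Config d × Phase d) : ℂ :=
  ∫ t : Tri, (w t : ℂ) * b (triL t q)

lemma integrable_tri {F : Type*} [NormedAddCommGroup F] {h : Tri → F} (hh : Continuous h) :
    Integrable h := hh.integrable_of_hasCompactSupport (HasCompactSupport.of_compactSpace h)

lemma hasFDerivAt_triAvg {b : Config d → ℂ} (hb : BCInfty b) {w : Tri → ℝ} (hw : Continuous w)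
    (q : Config d × Phase d) :
    HasFDerivAt (triAvg b w) (∫ t : Tri, (w t : ℂ) • (fderiv ℝ b (triL t q)).comp (triL t)) q := by
  obtain ⟨C, hC, hCb⟩ := hb.fderiv_bound
  have hc := hb.1.continuous
  have hc' : Continuous (fderiv ℝ b) := (hb.1.fderiv_right (m := ∞) (by simp)).continuous
  have hcq : ∀ q : Config d × Phase d, Continuous fun t : Tri => triL t q :=
    fun q => continuous_triL.clm_apply continuous_const
  refine hasFDerivAt_integral_of_dominated_of_fderiv_le
    (F' := fun q t => (w t : ℂ) • (fderiv ℝ b (triL t q)).comp (triL t))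
    (bound := fun t => |w t| * (C * ‖(triL t : (Config d × Phase d) →L[ℝ] Config d)‖))
    Filter.univ_mem (Eventually.of_forall fun q => ?_) ?_ ?_
    (ae_of_all _ fun t q _ => ?_) ?_ (ae_of_all _ fun t q _ => ?_)
  · have := hcq q
    exact Continuous.aestronglyMeasurable (by fun_prop)
  · have := hcq q
    exact integrable_tri (by fun_prop)
  · have := hcq q
    refine Continuous.aestronglyMeasurable ?_
    refine Continuous.smul (Complex.continuous_ofReal.comp hw)
      ((hc'.comp this).clm_comp continuous_triL)
  · rw [norm_smul, Complex.norm_real, Real.norm_eq_abs]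
    refine mul_le_mul_of_nonneg_left ?_ (abs_nonneg _)
    exact (ContinuousLinearMap.opNorm_comp_le _ _).trans
      (mul_le_mul_of_nonneg_right (hCb _) (norm_nonneg _))
  · exact integrable_tri (by fun_prop)
  · exact ((hb.1.differentiable_infty _).hasFDerivAt.comp q (triL t).hasFDerivAt).const_mul _

lemma dd_triAvg {b : Config d → ℂ} (hb : BCInfty b) {w : Tri → ℝ} (hw : Continuous w)
    (v : Config d × Phase d) :
    dd v (triAvg b w) = fun q => triAvg (dd v.1 b) w q +
      (triAvg (dd v.2.1 b) (fun t => w t * triA t) q +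
       triAvg (dd v.2.2 b) (fun t => w t * triB t) q) := by
  funext q
  have hc' : Continuous (fderiv ℝ b) := (hb.1.fderiv_right (m := ∞) (by simp)).continuous
  have hcq : Continuous fun t : Tri => triL t q := continuous_triL.clm_apply continuous_const
  have hcv : ∀ v, Continuous (dd v b) := fun v => (contDiff_dd hb.1 v).continuous
  rw [dd, (hasFDerivAt_triAvg hb hw q).fderiv, ContinuousLinearMap.integral_apply]
  · simp only [triAvg]
    have i0 := integrable_tri (h := fun t => (w t : ℂ) * dd v.1 b (triL t q))
      (by have := hcv v.1; fun_prop)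
    have i1 := integrable_tri (h := fun t => ((w t * triA t : ℝ) : ℂ) * dd v.2.1 b (triL t q))
      (by have := hcv v.2.1; fun_prop)
    have i2 := integrable_tri (h := fun t => ((w t * triB t : ℝ) : ℂ) * dd v.2.2 b (triL t q))
      (by have := hcv v.2.2; fun_prop)
    rw [← integral_add i1 i2]
    refine Eq.trans ?_ (integral_add i0 (i1.add i2))
    congr 1
    funext t
    simp [dd, triL_apply]
    ring
  · exact integrable_tri (Continuous.smul (Complex.continuous_ofReal.comp hw)
      ((hc'.comp hcq).clm_comp continuous_triL))

lemma triAvg_zero (w : Tri → ℝ) (q : Config d × Phase d) :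
    triAvg (fun _ => 0) w q = 0 := by simp [triAvg]

lemma dd_zero_dir {E : Type*} [NormedAddCommGroup E] [NormedSpace ℝ E] (f : E → ℂ) :
    dd 0 f = fun _ => 0 := by funext x; simp [dd]

/-- The coordinate directions of `ℝ^d × (ℝ^d × ℝ^d)`. -/
noncomputable def triDir : Fin d ⊕ (Fin d ⊕ Fin d) → Config d × Phase d :=
  Sum.elim (fun l => (stdVec l, 0)) (fun b => (0, phDir b))

/-- The coordinates on `ℝ^d × (ℝ^d × ℝ^d)`. -/
noncomputable def triCoord : Fin d ⊕ (Fin d ⊕ Fin d) → (Config d × Phase d) →L[ℝ] ℝ :=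
  Sum.elim (fun l => (EuclideanSpace.proj l).comp (ContinuousLinearMap.fst ℝ _ _))
    (fun b => (coordL b).comp (ContinuousLinearMap.snd ℝ _ _))

lemma sum_triCoord_smul (q : Config d × Phase d) : ∑ b, triCoord b q • triDir b = q := by
  rw [Fintype.sum_sum_type]
  ext1
  · simp [triDir, triCoord, Prod.fst_sum, sum_smul_stdVec]
  · simp only [triDir, triCoord, Sum.elim_inl, Sum.elim_inr, Prod.snd_add, Prod.snd_sum,
      Prod.smul_snd, smul_zero, Finset.sum_const_zero, zero_add]
    simpa [coordL_apply] using sum_coord_smul_phDir q.2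

lemma dd_triDir_triAvg {b : Config d → ℂ} (hb : BCInfty b) {w : Tri → ℝ} (hw : Continuous w)
    (c : Fin d ⊕ (Fin d ⊕ Fin d)) : ∃ (b' : Config d → ℂ) (w' : Tri → ℝ), BCInfty b' ∧
      Continuous w' ∧ dd (triDir c) (triAvg b w) = triAvg b' w' := by
  rcases c with l | l | l
  · refine ⟨_, _, hb.dd (stdVec l), hw, ?_⟩
    rw [dd_triAvg hb hw]
    simp [triDir, dd_zero_dir, triAvg_zero]
  · refine ⟨_, fun t => w t * triA t, hb.dd (stdVec l), hw.mul continuous_triA, ?_⟩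
    rw [dd_triAvg hb hw]
    simp [triDir, phDir, dd_zero_dir, triAvg_zero]
  · refine ⟨_, fun t => w t * triB t, hb.dd (stdVec l), hw.mul continuous_triB, ?_⟩
    rw [dd_triAvg hb hw]
    simp [triDir, phDir, dd_zero_dir, triAvg_zero]

lemma contDiff_triAvg {b : Config d → ℂ} (hb : BCInfty b) {w : Tri → ℝ} (hw : Continuous w) :
    ContDiff ℝ ∞ (triAvg b w) := by
  refine contDiff_of_dd_closed (dir := triDir) sum_triCoord_smul
    (P := fun f => ∃ b w, BCInfty b ∧ Continuous w ∧ f = triAvg b w) ?_ ⟨b, w, hb, hw, rfl⟩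
  rintro f ⟨b, w, hb, hw, rfl⟩
  refine ⟨fun q => (hasFDerivAt_triAvg hb hw q).differentiableAt, fun c => ?_⟩
  exact dd_triDir_triAvg hb hw c

lemma derivBound_triAvg {b : Config d → ℂ} (hb : BCInfty b) {w : Tri → ℝ} (hw : Continuous w)
    (K : ℕ) : DerivBound triDir (fun _ _ => 1) K (fun (_ : Unit) _ => 1) (fun _ => triAvg b w) := by
  have base : ∀ {b : Config d → ℂ} {w : Tri → ℝ}, BCInfty b → Continuous w →
      ∃ C, 0 ≤ C ∧ ∀ (_ : Unit) q, ‖triAvg b w q‖ ≤ C * 1 := by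
    intro b w hb hw
    obtain ⟨C, hC, hCb⟩ := hb.bound
    refine ⟨∫ t : Tri, |w t| * C, integral_nonneg fun t => by positivity, fun _ q => ?_⟩
    rw [mul_one]
    refine norm_integral_le_of_norm_le (integrable_tri (by fun_prop)) (ae_of_all _ fun t => ?_)
    rw [norm_mul, Complex.norm_real, Real.norm_eq_abs]
    exact mul_le_mul_of_nonneg_left (hCb _) (abs_nonneg _)
  induction K generalizing b w with
  | zero => exact base hb hw
  | succ K ih =>
    refine ⟨base hb hw, fun c => ?_⟩
    obtain ⟨b', w', hb', hw', e⟩ := dd_triDir_triAvg hb hw c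
    simp only [e, mul_one]
    exact ih hb' hw'

/-- An integral over the triangle in terms of the parametrization by the unit square. -/
lemma integral_tri_eq {F : Type*} [NormedAddCommGroup F] [NormedSpace ℝ F] {h : ℝ → ℝ → F}
    (hh : Continuous fun p : ℝ × ℝ => h p.1 p.2) :
    ∫ t : Tri, (t.1 : ℝ) • h t.1 (t.1 * t.2) = ∫ u in (0 : ℝ)..1, ∫ v in (0 : ℝ)..u, h u v := by
  have hI : ∀ f : ℝ → F, ∫ s : I, f s = ∫ s in (0 : ℝ)..1, f s := by
    intro f
    rw [intervalIntegral.integral_of_le zero_le_one, ← integral_Icc_eq_integral_Ioc]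
    exact integral_subtype measurableSet_Icc f
  have hc : Continuous fun t : Tri => (t.1 : ℝ) • h t.1 (t.1 * t.2) :=
    Continuous.smul (by fun_prop) (hh.comp (f := fun t : Tri => ((t.1 : ℝ), (t.1 * t.2 : ℝ)))
      (by fun_prop))
  rw [Measure.volume_eq_prod, integral_prod _ (integrable_tri hc)]
  have h1 : ∀ u : I, ∫ s : I, (u : ℝ) • h u (u * s) = ∫ v in (0 : ℝ)..u, h u v := by
    intro u
    rw [hI (fun s => (u : ℝ) • h u (u * s)), intervalIntegral.integral_smul,
      intervalIntegral.smul_integral_comp_mul_left (fun v => h u v)]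
    simp
  simp only [h1]
  exact hI (fun u => ∫ v in (0 : ℝ)..u, h u v)

end Triangle

end MagneticMoyal

/-! ### Iterated derivatives, Taylor expansion and limits of families -/

namespace MagneticMoyal

section Words

variable {E κ ι : Type*} [NormedAddCommGroup E] [NormedSpace ℝ E]

/-- The iterated derivative along a list of directions. -/
noncomputable def ddw (dir : κ → E) (W : List κ) (f : E → ℂ) : E → ℂ :=
  W.foldr (fun b h => dd (dir b) h) f

@[simp] lemma ddw_nil (dir : κ → E) (f : E → ℂ) : ddw dir [] f = f := rfl

@[simp] lemma ddw_cons (dir : κ → E) (b : κ) (W : List κ) (f : E → ℂ) :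
    ddw dir (b :: W) f = dd (dir b) (ddw dir W f) := rfl

lemma ddw_append (dir : κ → E) (W W' : List κ) (f : E → ℂ) :
    ddw dir (W ++ W') f = ddw dir W (ddw dir W' f) := by simp [ddw]

lemma contDiff_ddw (dir : κ → E) (W : List κ) {f : E → ℂ} (hf : ContDiff ℝ ∞ f) :
    ContDiff ℝ ∞ (ddw dir W f) := by
  induction W with
  | nil => exact hf
  | cons b W ih => exact contDiff_dd ih _

lemma ddw_perm (dir : κ → E) {W W' : List κ} (h : W.Perm W') {f : E → ℂ}
    (hf : ContDiff ℝ ∞ f) : ddw dir W f = ddw dir W' f := by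
  induction h with
  | nil => rfl
  | cons b _ ih => rw [ddw_cons, ddw_cons, ih]
  | swap a b W => exact dd_comm (contDiff_ddw dir W hf) _ _
  | trans _ _ ih₁ ih₂ => exact ih₁.trans ih₂

lemma DerivBound.ddw {dir : κ → E} {g : κ → E → ℝ} {K : ℕ} {w : ι → E → ℝ} {f : ι → E → ℂ}
    (W : List κ) (h : DerivBound dir g (K + W.length) w f) :
    DerivBound dir g K (fun i e => (W.map (g · e)).prod * w i e) (fun i => ddw dir W (f i)) := by
  induction W generalizing K with
  | nil => simpa using h
  | cons b W ih =>
    have h1 := ih (K := K + 1) (by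
      rw [List.length_cons] at h; convert h using 1; omega)
    simpa [mul_assoc] using h1.2 b

lemma derivBound_of_ddw {dir : κ → E} {g : κ → E → ℝ} {K : ℕ} {w : ι → E → ℝ} {f : ι → E → ℂ}
    (h : ∀ W : List κ, ∃ C, 0 ≤ C ∧ ∀ i e,
      ‖ddw dir W (f i) e‖ ≤ C * ((W.map (g · e)).prod * w i e)) :
    DerivBound dir g K w f := by
  induction K generalizing w f with
  | zero => simpa [DerivBound] using h []
  | succ K ih =>
    refine ⟨by simpa using h [], fun b => ih fun W => ?_⟩
    obtain ⟨C, hC, hb⟩ := h (W ++ [b])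
    refine ⟨C, hC, fun i e => ?_⟩
    have := hb i e
    simpa [ddw_append, mul_assoc] using this

/-- Taylor's formula along the segment from `e` to `e + v`. -/
lemma taylor_bound {f : E → ℂ} (hf : ContDiff ℝ ∞ f) (v e : E) (N : ℕ) {C : ℝ}
    (hC : ∀ s ∈ Set.Icc (0 : ℝ) 1, ‖(dd v)^[N + 1] f (e + s • v)‖ ≤ C) {ε : ℝ}
    (hε : ε ∈ Set.Icc (0 : ℝ) 1) :
    ‖f (e + ε • v) - ∑ k ∈ Finset.range (N + 1),
      (ε : ℂ) ^ k / (k.factorial : ℂ) * (dd v)^[k] f e‖ ≤ C * ε ^ (N + 1) := by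
  have hline : ∀ {f : E → ℂ}, ContDiff ℝ ∞ f → ∀ s : ℝ,
      HasDerivAt (fun s : ℝ => f (e + s • v)) (dd v f (e + s • v)) s := by
    intro f hf s
    have h1 : HasDerivAt (fun s : ℝ => e + s • v) v s := by
      simpa using ((hasDerivAt_id s).smul_const v).const_add e
    exact (hf.differentiable_infty _).hasFDerivAt.comp_hasDerivAt s h1
  -- the estimate for a difference follows from one for its derivative that vanishes at `0`
  have mvt : ∀ {h h' : ℝ → ℂ} (N : ℕ), (∀ s, HasDerivAt h (h' s) s) → h 0 = 0 →
      (∀ s ∈ Set.Icc (0 : ℝ) 1, ‖h' s‖ ≤ C * s ^ N) →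
      ∀ s ∈ Set.Icc (0 : ℝ) 1, ‖h s‖ ≤ C * s ^ (N + 1) := by
    intro h h' N hd h0 hb s hs
    have hC0 : 0 ≤ C := by
      have := (norm_nonneg _).trans (hb 1 (by simp))
      simpa using this
    have := norm_image_sub_le_of_norm_deriv_le_segment' (f := h) (f' := h') (a := 0) (b := s)
      (C := C * s ^ N) (fun x _ => (hd x).hasDerivWithinAt) (fun x hx =>
        (hb x ⟨hx.1, hx.2.le.trans hs.2⟩).trans
          (mul_le_mul_of_nonneg_left (pow_le_pow_left₀ hx.1 hx.2.le N) hC0)) s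
      (Set.right_mem_Icc.2 hs.1)
    rw [h0, sub_zero, sub_zero] at this
    rwa [pow_succ, ← mul_assoc]
  induction N generalizing f ε with
  | zero =>
    refine mvt (h := fun s => f (e + s • v) - ∑ k ∈ Finset.range 1,
      (s : ℂ) ^ k / (k.factorial : ℂ) * (dd v)^[k] f e) 0 (h' := fun s => dd v f (e + s • v))
      (fun s => ?_) (by simp) (fun s hs => by simpa using hC s hs) ε hε
    simpa using (hline hf s).sub_const (f e)
  | succ N ih =>
    refine mvt (h := fun s => f (e + s • v) - ∑ k ∈ Finset.range (N + 2),
      (s : ℂ) ^ k / (k.factorial : ℂ) * (dd v)^[k] f e) (N + 1)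
      (h' := fun s => dd v f (e + s • v) - ∑ k ∈ Finset.range (N + 1),
        (s : ℂ) ^ k / (k.factorial : ℂ) * (dd v)^[k] (dd v f) e)
      (fun s => ?_) ?_ (fun s hs => ih (contDiff_dd hf v) hC hs) ε hε
    · refine (hline hf s).sub ?_
      simp only [Finset.sum_range_succ' _ (N + 1)]
      have h1 : ∀ k : ℕ, HasDerivAt (fun s : ℝ => (s : ℂ) ^ (k + 1) / ((k + 1).factorial : ℂ) *
          (dd v)^[k + 1] f e) ((s : ℂ) ^ k / (k.factorial : ℂ) * (dd v)^[k] (dd v f) e) s := by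
        intro k
        have h2 := ((((hasDerivAt_id s).ofReal_comp).pow (k + 1)).div_const
          ((k + 1).factorial : ℂ)).mul_const ((dd v)^[k + 1] f e)
        refine h2.congr_deriv ?_
        have hk : (k.factorial : ℂ) ≠ 0 := by exact_mod_cast k.factorial_ne_zero
        have hk' : (k : ℂ) + 1 ≠ 0 := by exact_mod_cast k.succ_ne_zero
        simp only [Nat.factorial_succ, id, Function.iterate_succ, Function.comp]
        push_cast
        simp only [mul_one]
        field_simp
      have := (HasDerivAt.fun_sum (u := Finset.range (N + 1)) fun k _ => h1 k).add_const
        ((s : ℂ) ^ 0 / ((0 : ℕ).factorial : ℂ) * (dd v)^[0] f e)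
      simpa using this
    · rw [Finset.sum_range_succ']
      simp

/-- Local bounds for all derivatives, uniform in the family. -/
def LocBound (dir : κ → E) (f : ι → E → ℂ) : Prop :=
  ∀ (W : List κ) (e₀ : E), ∃ C, 0 ≤ C ∧ ∀ i e, ‖e - e₀‖ ≤ 1 → ‖ddw dir W (f i) e‖ ≤ C

lemma LocBound.dd {dir : κ → E} {f : ι → E → ℂ} (h : LocBound dir f) (b : κ) :
    LocBound dir (fun i => dd (dir b) (f i)) := by
  intro W e₀
  obtain ⟨C, hC, hb⟩ := h (W ++ [b]) e₀
  exact ⟨C, hC, fun i e he => by simpa [ddw_append] using hb i e he⟩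

lemma LocBound.of_continuous [ProperSpace E] {dir : κ → E} {f : ι → E → ℂ}
    (h : ∀ W : List κ, ∃ M : E → ℝ, Continuous M ∧ ∀ i e, ‖ddw dir W (f i) e‖ ≤ M e) :
    LocBound dir f := by
  intro W e₀
  obtain ⟨M, hM, hb⟩ := h W
  obtain ⟨C, hC⟩ := (isCompact_closedBall e₀ 1).exists_bound_of_continuousOn hM.continuousOn
  refine ⟨|C|, abs_nonneg C, fun i e he => (hb i e).trans ?_⟩
  exact (le_abs_self _).trans ((hC e (by rwa [mem_closedBall_iff_norm])).trans (le_abs_self C))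

section Limit

variable [Fintype κ] {dir : κ → E} {L : κ → E →L[ℝ] ℝ} {f : ι → E → ℂ} {u : E → ℂ}
  {l : Filter ι} [l.NeBot]

lemma dd_eq_sum (hL : ∀ e, ∑ b, L b e • dir b = e) (h : E → ℂ) (v x : E) :
    dd v h x = ∑ b, (L b v : ℂ) * dd (dir b) h x := by
  conv_lhs => rw [← hL v]
  exact dd_sum_smul _ _ _ _ _

/-- The error of the linear approximation is quadratic, uniformly in the family. -/
lemma LocBound.second_order (hL : ∀ e, ∑ b, L b e • dir b = e) (hs : ∀ i, ContDiff ℝ ∞ (f i))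
    (h : LocBound dir f) (e₀ : E) : ∃ C, 0 ≤ C ∧ ∀ i v, ‖v‖ ≤ 1 →
      ‖f i (e₀ + v) - f i e₀ - MagneticMoyal.dd v (f i) e₀‖ ≤ C * ‖v‖ ^ 2 := by
  choose C hC hb using fun b b' => h [b, b'] e₀
  refine ⟨∑ b, ∑ b', ‖L b‖ * ‖L b'‖ * C b b',
    Finset.sum_nonneg fun b _ => Finset.sum_nonneg fun b' _ => by have := hC b b'; positivity,
    fun i v hv => ?_⟩
  have := taylor_bound (hs i) v e₀ 1 (C := (∑ b, ∑ b', ‖L b‖ * ‖L b'‖ * C b b') * ‖v‖ ^ 2)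
    (ε := 1) (fun s hs' => ?_) (by simp)
  · simpa [Finset.sum_range_succ, sub_sub] using this
  · have e1 : (MagneticMoyal.dd v)^[1 + 1] (f i) = fun x => ∑ b, ∑ b',
        ((L b v : ℂ) * (L b' v : ℂ)) *
          MagneticMoyal.dd (dir b) (MagneticMoyal.dd (dir b') (f i)) x := by
      funext x
      show MagneticMoyal.dd v (MagneticMoyal.dd v (f i)) x = _
      rw [dd_eq_sum hL]
      refine Finset.sum_congr rfl fun b _ => ?_
      have : MagneticMoyal.dd v (f i) =
          fun x => ∑ b', (L b' v : ℂ) * MagneticMoyal.dd (dir b') (f i) x :=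
        funext fun x => dd_eq_sum hL _ _ _
      rw [this, dd_sum _ (fun b' _ => contDiff_const.mul (contDiff_dd (hs i) _)), Finset.mul_sum]
      refine Finset.sum_congr rfl fun b' _ => ?_
      rw [dd_const_mul (contDiff_dd (hs i) _), mul_assoc]
    rw [e1, Finset.sum_mul]
    refine (norm_sum_le _ _).trans (Finset.sum_le_sum fun b _ => ?_)
    rw [Finset.sum_mul]
    refine (norm_sum_le _ _).trans (Finset.sum_le_sum fun b' _ => ?_)
    have h1 : ‖e₀ + s • v - e₀‖ ≤ 1 := by
      rw [add_sub_cancel_left, norm_smul, Real.norm_of_nonneg hs'.1]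
      exact mul_le_one₀ hs'.2 (norm_nonneg _) hv
    have h2 := hb b b' i _ h1
    simp only [ddw_cons, ddw_nil] at h2
    rw [norm_mul, norm_mul, Complex.norm_real, Complex.norm_real]
    calc ‖L b v‖ * ‖L b' v‖ * _ ≤ (‖L b‖ * ‖v‖) * (‖L b'‖ * ‖v‖) * C b b' := by
          gcongr
          · exact (L b).le_opNorm v
          · exact (L b').le_opNorm v
      _ = _ := by ring

/-- Pointwise limits of families with locally uniform bounds for all derivatives: the
derivatives in the coordinate directions converge to those of the limit. -/
lemma LocBound.tendsto_dd (hL : ∀ e, ∑ b, L b e • dir b = e) (hs : ∀ i, ContDiff ℝ ∞ (f i))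
    (h : LocBound dir f) (hu : ∀ e, Tendsto (fun i => f i e) l (𝓝 (u e))) :
    Differentiable ℝ u ∧ ∀ b e, Tendsto (fun i => MagneticMoyal.dd (dir b) (f i) e) l
      (𝓝 (MagneticMoyal.dd (dir b) u e)) := by
  choose C hC hb using h.second_order hL hs
  -- the derivatives are uniform limits of convergent difference quotients
  have hlim : ∀ b e, ∃ a, Tendsto (fun i => MagneticMoyal.dd (dir b) (f i) e) l (𝓝 a) := by
    intro b e
    rw [← cauchy_map_iff_exists_tendsto, Metric.cauchy_iff]
    refine ⟨inferInstance, fun ε hε => ?_⟩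
    -- a step size `t` for which the difference quotient is `ε / 4`-close to the derivative
    set A := 1 + ‖dir b‖ + 4 * C e * ‖dir b‖ ^ 2 / ε with hA
    have hA1 : 1 ≤ A := by
      have := norm_nonneg (dir b)
      have := hC e
      have : 0 ≤ 4 * C e * ‖dir b‖ ^ 2 / ε := by positivity
      linarith
    have hA0 : 0 < A := by linarith
    set t : ℝ := A⁻¹ with ht
    have ht0 : 0 < t := inv_pos.2 hA0
    have hv : ‖t • dir b‖ ≤ 1 := by
      rw [norm_smul, Real.norm_of_nonneg ht0.le, ht, inv_mul_le_iff₀ hA0]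
      have : 0 ≤ 4 * C e * ‖dir b‖ ^ 2 / ε := by have := hC e; positivity
      linarith
    have hq : Tendsto (fun i => (t : ℂ)⁻¹ * (f i (e + t • dir b) - f i e)) l
        (𝓝 ((t : ℂ)⁻¹ * (u (e + t • dir b) - u e))) := ((hu _).sub (hu _)).const_mul _
    set q := (t : ℂ)⁻¹ * (u (e + t • dir b) - u e) with hqd
    have hclose : ∀ i, ‖(t : ℂ)⁻¹ * (f i (e + t • dir b) - f i e) -
        MagneticMoyal.dd (dir b) (f i) e‖ ≤ ε / 4 := by
      intro i
      have h1 := hb e i _ hv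
      have h2 : MagneticMoyal.dd (t • dir b) (f i) e = t * MagneticMoyal.dd (dir b) (f i) e := by
        simp [MagneticMoyal.dd]
      have ht' : (t : ℂ) ≠ 0 := by exact_mod_cast ht0.ne'
      have h3 : (t : ℂ)⁻¹ * (f i (e + t • dir b) - f i e) - MagneticMoyal.dd (dir b) (f i) e =
          (t : ℂ)⁻¹ * (f i (e + t • dir b) - f i e - MagneticMoyal.dd (t • dir b) (f i) e) := by
        rw [h2]; field_simp
      rw [h3, norm_mul, norm_inv, Complex.norm_real, Real.norm_of_nonneg ht0.le,
        inv_mul_le_iff₀ ht0]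
      refine h1.trans ?_
      rw [norm_smul, Real.norm_of_nonneg ht0.le]
      have h4 : t * (4 * C e * ‖dir b‖ ^ 2 / ε) ≤ 1 := by
        rw [ht, inv_mul_le_iff₀ hA0]
        have := norm_nonneg (dir b)
        linarith
      have h5 : t * (4 * C e * ‖dir b‖ ^ 2) ≤ ε := by
        have := mul_le_mul_of_nonneg_right h4 hε.le
        field_simp at this
        linarith
      nlinarith
    refine ⟨Metric.ball q (ε / 2), ?_, fun x hx y hy => ?_⟩
    · have := (Metric.tendsto_nhds.1 hq) (ε / 4) (by positivity)
      refine mem_map.2 (this.mono fun i hi => ?_)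
      show dist (MagneticMoyal.dd (dir b) (f i) e) q < ε / 2
      refine (dist_triangle _ ((t : ℂ)⁻¹ * (f i (e + t • dir b) - f i e)) _).trans_lt ?_
      have := hclose i
      rw [← dist_eq_norm, dist_comm] at this
      linarith
    · have := dist_triangle_right x y q
      rw [Metric.mem_ball] at hx hy
      linarith
  choose ub hub using hlim
  -- the quadratic estimate passes to the limit
  have hfd : ∀ e, HasFDerivAt u (∑ b, ub b e • (Complex.ofRealCLM.comp (L b))) e := by
    intro e
    rw [hasFDerivAt_iff_isLittleO_nhds_zero]
    refine Asymptotics.IsBigO.trans_isLittleO (g := fun v => ‖v‖ ^ 2) ?_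
      (Asymptotics.isLittleO_norm_pow_id one_lt_two)
    refine Asymptotics.IsBigO.of_bound (C e) ?_
    filter_upwards [Metric.closedBall_mem_nhds (0 : E) one_pos] with v hv
    rw [mem_closedBall_zero_iff] at hv
    rw [Real.norm_of_nonneg (by positivity)]
    refine le_of_tendsto (((hu (e + v)).sub (hu e)).sub
      (tendsto_finsetSum Finset.univ fun b _ => (hub b e).const_mul (L b v : ℂ))).norm
      (Eventually.of_forall fun i => ?_) |>.trans_eq' ?_
    · rw [← dd_eq_sum hL]
      exact hb e i v hv
    · simp [mul_comm]
  refine ⟨fun e => (hfd e).differentiableAt, fun b e => ?_⟩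
  have h1 : MagneticMoyal.dd (dir b) u e = ub b e := by
    refine tendsto_nhds_unique ?_ (hub b e)
    have h2 := tendsto_finsetSum Finset.univ fun b' (_ : b' ∈ Finset.univ) =>
      (hub b' e).const_mul (L b' (dir b) : ℂ)
    simp only [← dd_eq_sum hL] at h2
    convert h2 using 2
    rw [MagneticMoyal.dd, (hfd e).fderiv]
    simp [mul_comm]
  rw [h1]
  exact hub b e

/-- Pointwise limits of families with locally uniform bounds for all derivatives are smooth, and
all derivatives converge. -/
lemma LocBound.limit (hL : ∀ e, ∑ b, L b e • dir b = e) (hs : ∀ i, ContDiff ℝ ∞ (f i))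
    (h : LocBound dir f) (hu : ∀ e, Tendsto (fun i => f i e) l (𝓝 (u e))) :
    ContDiff ℝ ∞ u ∧
      ∀ (W : List κ) e, Tendsto (fun i => ddw dir W (f i) e) l (𝓝 (ddw dir W u e)) := by
  constructor
  · refine contDiff_of_dd_closed (dir := dir) hL (P := fun u => ∃ f : ι → E → ℂ,
      (∀ i, ContDiff ℝ ∞ (f i)) ∧ LocBound dir f ∧ ∀ e, Tendsto (fun i => f i e) l (𝓝 (u e)))
      ?_ ⟨f, hs, h, hu⟩
    rintro u ⟨f, hs, h, hu⟩
    obtain ⟨h1, h2⟩ := h.tendsto_dd hL hs hu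
    exact ⟨h1, fun b => ⟨_, fun i => contDiff_dd (hs i) _, h.dd b, h2 b⟩⟩
  · intro W
    induction W with
    | nil => exact hu
    | cons b W ih =>
      refine (LocBound.tendsto_dd (f := fun i => ddw dir W (f i)) hL
        (fun i => contDiff_ddw dir W (hs i)) ?_ ih).2 b
      intro W' e₀
      obtain ⟨C, hC, hb⟩ := h (W' ++ W) e₀
      exact ⟨C, hC, fun i e he => by simpa [ddw_append] using hb i e he⟩

end Limit

end Words

end MagneticMoyal

/-! ### The phase of the twister and a class of kernels -/

namespace MagneticMoyal

section Kernels

variable {d : ℕ}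

lemma bcInfty_ofReal {b : Config d → ℝ} (hb : IsBCInfty b) : BCInfty fun x => (b x : ℂ) := by
  refine ⟨Complex.ofRealCLM.contDiff.comp hb.1, fun n => ?_⟩
  obtain ⟨C, hC⟩ := hb.2 n
  refine ⟨‖Complex.ofRealCLM‖ * C, fun x => ?_⟩
  exact (Complex.ofRealCLM.norm_iteratedFDeriv_comp_left (n := n) hb.1.contDiffAt
    (by exact_mod_cast le_top)).trans (mul_le_mul_of_nonneg_left (hC x) (norm_nonneg _))

/-- The components of the flux form, averages of the magnetic field over a triangle. -/
noncomputable def fluxH (B : Fin d → Fin d → Config d → ℝ) (k l : Fin d) :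
    Config d × Phase d → ℂ :=
  triAvg (fun x => (B k l x : ℂ)) (fun t => t.1)

/-- The flux divided by `ε²`, where the triangle has sides `ε y` and `ε z`, `w = (y,z)`. -/
noncomputable def fluxForm (B : Fin d → Fin d → Config d → ℝ) (ε : ℝ) (x : Config d)
    (w : Phase d) : ℝ :=
  ∑ k, ∑ l, w.1 k * w.2 l * ∫ t : Tri, t.1 * B k l (triL t (x, ε • w))

lemma ofReal_fluxForm (B : Fin d → Fin d → Config d → ℝ) (ε : ℝ) (x : Config d) (w : Phase d) :
    (fluxForm B ε x w : ℂ) = ∑ k, ∑ l, (w.1 k : ℂ) * w.2 l * fluxH B k l (x, ε • w) := by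
  simp [fluxForm, fluxH, triAvg, ← integral_complex_ofReal]

/-- The flux through the triangle is quadratic in `ε`, so that `scaledFlux` has the factor `ε` and
is smooth in `ε` up to `ε = 0`. -/
lemma scaledFlux_eq {B : Fin d → Fin d → Config d → ℝ} (hB : ∀ k l, Continuous (B k l))
    {ε : ℝ} (hε : ε ≠ 0) (x y z : Config d) :
    scaledFlux B ε x y z = ε * fluxForm B ε x (y, z) := by
  have e1 : x + (ε / 2) • (y - z) - (x - (ε / 2) • (y + z)) = ε • y := by module
  have e2 : x + (ε / 2) • (y + z) - (x + (ε / 2) • (y - z)) = ε • z := by module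
  have e3 : ∀ u v : ℝ, x - (ε / 2) • (y + z) + u • (ε • y) + v • (ε • z) =
      x + ((u - 1 / 2) • (ε • y) + (v - 1 / 2) • (ε • z)) := by intro u v; module
  have hc : ∀ k l, Continuous fun p : ℝ × ℝ =>
      B k l (x + ((p.1 - 1 / 2) • (ε • y) + (p.2 - 1 / 2) • (ε • z))) :=
    fun k l => (hB k l).comp (by fun_prop)
  have hcT : ∀ k l, Continuous fun t : Tri =>
      B k l (x + (((t.1 : ℝ) - 1 / 2) • (ε • y) + ((t.1 : ℝ) * t.2 - 1 / 2) • (ε • z))) :=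
    fun k l => (hB k l).comp (by fun_prop)
  rw [scaledFlux, flux, e1, e2]
  simp only [e3]
  rw [← integral_tri_eq (h := fun u v => ∑ k, ∑ l,
    B k l (x + ((u - 1 / 2) • (ε • y) + (v - 1 / 2) • (ε • z))) * (ε • y) k * (ε • z) l)]
  · simp only [fluxForm, Finset.mul_sum, smul_eq_mul]
    rw [integral_finsetSum _ (fun k _ => ?_), Finset.mul_sum]
    · refine Finset.sum_congr rfl fun k _ => ?_
      rw [integral_finsetSum _ (fun l _ => ?_), Finset.mul_sum]
      · refine Finset.sum_congr rfl fun l _ => ?_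
        rw [← integral_const_mul, ← integral_const_mul, ← integral_const_mul]
        congr 1
        funext t
        simp only [triL_apply, triA, triB, Prod.smul_mk, PiLp.smul_apply, smul_eq_mul]
        field_simp
      · have := hcT k l
        exact integrable_tri (by fun_prop)
    · have := hcT k
      exact integrable_tri (by fun_prop)
  · have := hc
    fun_prop

/-- Parameters `(ε, λ, X)`. -/
abbrev Par (d : ℕ) := ℝ × ℝ × Phase d

/-- The coordinate directions of the parameter space: `ε` (`.inl false`), `λ` (`.inl true`), and
those of phase space (`.inr`). -/
noncomputable def parDir : Bool ⊕ (Fin d ⊕ Fin d) → Par d :=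
  Sum.elim (fun b => if b then (0, 1, 0) else (1, 0, 0)) (fun b => (0, 0, phDir b))

/-- The coordinates of the parameter space. -/
noncomputable def parCoord : Bool ⊕ (Fin d ⊕ Fin d) → Par d →L[ℝ] ℝ :=
  Sum.elim (fun b => if b
      then (ContinuousLinearMap.fst ℝ _ _).comp (ContinuousLinearMap.snd ℝ _ _)
      else ContinuousLinearMap.fst ℝ _ _)
    (fun b => (coordL b).comp ((ContinuousLinearMap.snd ℝ _ _).comp
      (ContinuousLinearMap.snd ℝ _ _)))

lemma sum_parCoord_smul (e : Par d) : ∑ b, parCoord b e • parDir b = e := by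
  obtain ⟨ε, lam, X⟩ := e
  have h := sum_coord_smul_phDir X
  rw [Fintype.sum_sum_type]
  ext1
  · simp [parDir, parCoord, Prod.fst_sum]
  · ext1
    · simp [parDir, parCoord, Prod.fst_sum, Prod.snd_sum]
    · simp only [parDir, parCoord, Sum.elim_inl, Sum.elim_inr, Prod.snd_add, Prod.snd_sum]
      simpa [coordL_apply] using h

/-- The number of powers of `⟨ξ⟩^{-ρ}` that are gained by a derivative in a direction of the
parameter space. -/
def parGain : Bool ⊕ (Fin d ⊕ Fin d) → ℕ :=
  Sum.elim (fun _ => 1) (Sum.elim (fun _ => 0) (fun _ => 1))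

/-- The number of derivatives in the frequencies. -/
def freq (a : List (Fin d ⊕ Fin d)) : ℕ := (a.map (Sum.elim (fun _ => 0) (fun _ => 1))).sum

@[simp] lemma freq_nil : freq ([] : List (Fin d ⊕ Fin d)) = 0 := rfl
@[simp] lemma freq_cons_inl (l : Fin d) (a : List (Fin d ⊕ Fin d)) :
    freq (.inl l :: a) = freq a := by simp [freq]
@[simp] lemma freq_cons_inr (l : Fin d) (a : List (Fin d ⊕ Fin d)) :
    freq (.inr l :: a) = freq a + 1 := by simp [freq, add_comm]
@[simp] lemma freq_append (a a' : List (Fin d ⊕ Fin d)) : freq (a ++ a') = freq a + freq a' := by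
  simp [freq]

/-- The monomial by which a product of derivatives acts under the symplectic Fourier transform. -/
noncomputable def evw (a : List (Fin d ⊕ Fin d)) (Y : Phase d) : ℂ :=
  (a.map fun b => Complex.I * dualCoord b Y).prod

@[simp] lemma evw_nil (Y : Phase d) : evw [] Y = 1 := rfl
@[simp] lemma evw_cons (b : Fin d ⊕ Fin d) (a : List (Fin d ⊕ Fin d)) (Y : Phase d) :
    evw (b :: a) Y = Complex.I * dualCoord b Y * evw a Y := by simp [evw]
@[simp] lemma evw_append (a a' : List (Fin d ⊕ Fin d)) (Y : Phase d) :
    evw (a ++ a') Y = evw a Y * evw a' Y := by simp [evw]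

lemma Rapid.ddw {F : Phase d → ℂ} (hF : Rapid F) (a : List (Fin d ⊕ Fin d)) :
    Rapid (ddw phDir a F) := by
  induction a with
  | nil => exact hF
  | cons b a ih => exact ih.dd b

lemma sympFourier_ddw {F : Phase d → ℂ} (hF : Rapid F) (a : List (Fin d ⊕ Fin d)) (Y : Phase d) :
    sympFourier (ddw phDir a F) Y = evw a Y * sympFourier F Y := by
  induction a with
  | nil => simp
  | cons b a ih => rw [ddw_cons, sympFourier_dd (hF.ddw a), ih, evw_cons]; ring

lemma abs_dualCoord_le (b : Fin d ⊕ Fin d) (Y : Phase d) : |dualCoord b Y| ≤ ‖Y‖ := by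
  cases b with
  | inl l => simpa [dualCoord] using abs_coord_le (.inr l) Y
  | inr l => exact abs_coord_le (.inl l) Y

@[fun_prop] lemma continuous_dualCoord (b : Fin d ⊕ Fin d) :
    Continuous (dualCoord b : Phase d → ℝ) := by
  cases b with
  | inl l => exact (contDiff_coord (.inr l)).continuous.neg
  | inr l => exact (contDiff_coord (.inl l)).continuous

@[fun_prop] lemma continuous_evw (a : List (Fin d ⊕ Fin d)) :
    Continuous (evw a : Phase d → ℂ) := by
  induction a with
  | nil => exact continuous_const
  | cons b a ih => simp only [funext (evw_cons b a)]; fun_prop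

lemma norm_evw_le (a : List (Fin d ⊕ Fin d)) (Y : Phase d) :
    ‖evw a Y‖ ≤ (1 + ‖Y‖) ^ a.length := by
  induction a with
  | nil => simp
  | cons b a ih =>
    rw [evw_cons, List.length_cons, pow_succ', norm_mul, norm_mul, Complex.norm_I, one_mul,
      Complex.norm_real]
    have := abs_dualCoord_le b Y
    refine mul_le_mul ?_ ih (norm_nonneg _) (by positivity)
    rw [Real.norm_eq_abs]
    linarith

/-- Smooth functions of `(x, w)` with bounded derivatives. -/
def BoundedAmp (h : Config d × Phase d → ℂ) : Prop :=
  ContDiff ℝ ∞ h ∧ ∀ K, DerivBound triDir (fun _ _ => 1) K (fun (_ : Unit) _ => 1) (fun _ => h)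

namespace BoundedAmp

variable {h h' : Config d × Phase d → ℂ}

lemma dd (hh : BoundedAmp h) (b : Fin d ⊕ (Fin d ⊕ Fin d)) : BoundedAmp (dd (triDir b) h) :=
  ⟨contDiff_dd hh.1 _, fun K => by simpa using (hh.2 (K + 1)).2 b⟩

lemma mul (hh : BoundedAmp h) (hh' : BoundedAmp h') : BoundedAmp fun q => h q * h' q := by
  refine ⟨hh.1.mul hh'.1, fun K => ?_⟩
  simpa using DerivBound.mul (fun _ _ => zero_le_one) (fun _ _ => zero_le_one) (fun _ => hh.1)
    (fun _ => hh'.1) (hh.2 K) (hh'.2 K)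

lemma const (c : ℂ) : BoundedAmp fun (_ : Config d × Phase d) => c :=
  ⟨contDiff_const, fun K => DerivBound.const (fun _ _ => zero_le_one) (fun _ _ => zero_le_one)
    (C := ‖c‖) (norm_nonneg c) fun _ _ => by simp⟩

lemma fluxH {B : Fin d → Fin d → Config d → ℝ} (hB : ∀ k l, IsBCInfty (B k l)) (k l : Fin d) :
    BoundedAmp (fluxH B k l) :=
  ⟨contDiff_triAvg (bcInfty_ofReal (hB k l)) (by fun_prop),
    derivBound_triAvg (bcInfty_ofReal (hB k l)) (by fun_prop)⟩

end BoundedAmp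

/-- Sums of the kernels `ε^q λ^t h(x, ε w)` times monomials that act as derivatives; the number
of frequency derivatives exceeds the number of powers of `ε` and `λ` at least by `r`. -/
inductive NF : ℕ → (Par d → Phase d × Phase d → ℂ) → Prop
  | gen {r q t : ℕ} {a b : List (Fin d ⊕ Fin d)} {h : Config d × Phase d → ℂ}
      (hh : BoundedAmp h) (hr : r + q + t ≤ freq a + freq b) :
      NF r (fun e P => (e.1 : ℂ) ^ q * (e.2.1 : ℂ) ^ t * (evw a P.1 * evw b P.2) *
        h (e.2.2.1, e.1 • (P.1.1, P.2.1)))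
  | zero (r : ℕ) : NF r (fun _ _ => 0)
  | add {r : ℕ} {k k' : Par d → Phase d × Phase d → ℂ} (hk : NF r k) (hk' : NF r k') :
      NF r (fun e P => k e P + k' e P)

/-- The affine map `(ε, λ, X) ↦ (x, ε w)`. -/
noncomputable def scaleL (w : Phase d) : Par d →L[ℝ] (Config d × Phase d) :=
  ((ContinuousLinearMap.fst ℝ _ _).comp ((ContinuousLinearMap.snd ℝ _ _).comp
    (ContinuousLinearMap.snd ℝ _ _))).prod ((ContinuousLinearMap.fst ℝ _ _).smulRight w)

lemma scaleL_apply (w : Phase d) (e : Par d) : scaleL w e = (e.2.2.1, e.1 • w) := rfl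

namespace NF

variable {r r' : ℕ} {k k' : Par d → Phase d × Phase d → ℂ}

lemma congr (hk : NF r k) (h : ∀ e P, k e P = k' e P) : NF r k' := by
  rwa [show k' = k from funext fun e => funext fun P => (h e P).symm]

lemma sum {α : Type*} (s : Finset α) {k : α → Par d → Phase d × Phase d → ℂ}
    (hk : ∀ a ∈ s, NF r (k a)) : NF r (fun e P => ∑ a ∈ s, k a e P) := by
  classical
  induction s using Finset.induction_on with
  | empty => simpa using zero r
  | insert a s ha ih =>
    simp only [Finset.sum_insert ha]
    exact add (hk a (Finset.mem_insert_self a s))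
      (ih fun a' h' => hk a' (Finset.mem_insert_of_mem h'))

lemma mul (hk : NF r k) (hk' : NF r' k') : NF (r + r') (fun e P => k e P * k' e P) := by
  induction hk with
  | @gen q t a b h hh hr =>
    induction hk' with
    | @gen q' t' a' b' h' hh' hr' =>
      refine (gen (r := r + r') (q := q + q') (t := t + t') (a := a ++ a') (b := b ++ b')
        (hh.mul hh') (by simp only [freq_append]; omega)).congr fun e P => ?_
      simp only [evw_append]
      ring
    | zero => simpa using zero _
    | add _ _ ih₁ ih₂ => exact (add ih₁ ih₂).congr fun e P => by ring
  | zero => simpa using zero _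
  | add _ _ ih₁ ih₂ => exact (add ih₁ ih₂).congr fun e P => by ring

lemma monomial (c : ℂ) {a b : List (Fin d ⊕ Fin d)} (hr : r ≤ freq a + freq b) :
    NF r (fun (_ : Par d) P => c * (evw a P.1 * evw b P.2)) :=
  (gen (q := 0) (t := 0) (BoundedAmp.const c) hr).congr fun e P => by ring

lemma const_mul (hk : NF r k) (c : ℂ) : NF r (fun e P => c * k e P) := by
  have h := (monomial (d := d) (r := 0) c (a := []) (b := []) (by simp)).mul hk
  rw [zero_add] at h
  exact h.congr fun e P => by simp

lemma contDiff (hk : NF r k) (P : Phase d × Phase d) : ContDiff ℝ ∞ (fun e => k e P) := by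
  induction hk with
  | @gen q t a b h hh hr =>
    have h1 : ContDiff ℝ ∞ fun e : Par d => (e.1 : ℂ) :=
      Complex.ofRealCLM.contDiff.comp contDiff_fst
    have h2 : ContDiff ℝ ∞ fun e : Par d => (e.2.1 : ℂ) :=
      Complex.ofRealCLM.contDiff.comp (contDiff_fst.comp contDiff_snd)
    exact (((h1.pow q).mul (h2.pow t)).mul contDiff_const).mul
      (hh.1.comp (scaleL (P.1.1, P.2.1)).contDiff)
  | zero => exact contDiff_const
  | add _ _ ih₁ ih₂ => exact ih₁.add ih₂

lemma continuous (hk : NF r k) (e : Par d) : Continuous (k e) := by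
  induction hk with
  | @gen q t a b h hh hr =>
    have := hh.1.continuous
    fun_prop
  | zero => exact continuous_const
  | add _ _ ih₁ ih₂ => exact ih₁.add ih₂

lemma bound (hk : NF r k) {R : ℝ} (hR : 1 ≤ R) :
    ∃ (C : ℝ) (p : ℕ), 0 ≤ C ∧ ∀ e P, ‖e‖ ≤ R → ‖k e P‖ ≤ C * (1 + ‖P‖) ^ p := by
  induction hk with
  | @gen q t a b h hh hr =>
    obtain ⟨C, hC, hb⟩ := (hh.2 0).bound
    refine ⟨R ^ q * R ^ t * C, a.length + b.length, by positivity, fun e P he => ?_⟩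
    have h1 : |e.1| ≤ R := (norm_fst_le e).trans he
    have h2 : |e.2.1| ≤ R := (norm_fst_le e.2).trans ((norm_snd_le e).trans he)
    have h3 := (norm_evw_le a P.1).trans (pow_le_pow_left₀ (by positivity)
      (add_le_add_right (norm_fst_le P) 1) _)
    have h4 := (norm_evw_le b P.2).trans (pow_le_pow_left₀ (by positivity)
      (add_le_add_right (norm_snd_le P) 1) _)
    have h5 := hb () (e.2.2.1, e.1 • (P.1.1, P.2.1))
    rw [mul_one] at h5
    simp only [norm_mul, norm_pow, Complex.norm_real, Real.norm_eq_abs]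
    calc _ ≤ R ^ q * R ^ t * ((1 + ‖P‖) ^ a.length * (1 + ‖P‖) ^ b.length) * C := by gcongr
      _ = _ := by rw [pow_add]; ring
  | zero => exact ⟨0, 0, le_rfl, fun _ _ _ => by simp⟩
  | add _ _ ih₁ ih₂ =>
    obtain ⟨C, p, hC, hb⟩ := ih₁
    obtain ⟨C', p', hC', hb'⟩ := ih₂
    refine ⟨C + C', max p p', by positivity, fun e P he => (norm_add_le _ _).trans ?_⟩
    rw [add_mul]
    have h1 : 1 ≤ 1 + ‖P‖ := by linarith [norm_nonneg P]
    refine add_le_add ((hb e P he).trans ?_) ((hb' e P he).trans ?_)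
    · exact mul_le_mul_of_nonneg_left (pow_le_pow_right₀ h1 (le_max_left _ _)) hC
    · exact mul_le_mul_of_nonneg_left (pow_le_pow_right₀ h1 (le_max_right _ _)) hC'

end NF

lemma dd_ofReal_clm {E : Type*} [NormedAddCommGroup E] [NormedSpace ℝ E] (L : E →L[ℝ] ℝ) (v : E) :
    dd v (fun e => (L e : ℂ)) = fun _ => (L v : ℂ) := by
  have : (fun e => (L e : ℂ)) = (Complex.ofRealCLM.comp L : E → ℂ) := by funext e; simp
  rw [this]
  funext e
  simp [dd]

lemma dd_pow {E : Type*} [NormedAddCommGroup E] [NormedSpace ℝ E] {f : E → ℂ}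
    (hf : ContDiff ℝ ∞ f) (v : E) (n : ℕ) :
    dd v (fun x => f x ^ n) = fun x => n * f x ^ (n - 1) * dd v f x := by
  funext x
  simp only [dd]
  rw [((hf.differentiable_infty x).hasFDerivAt.pow n).fderiv]
  simp

/-- The kernels of the class are closed under differentiation. -/
lemma NF.dd {r : ℕ} {k : Par d → Phase d × Phase d → ℂ} (hk : NF r k) (c : Bool ⊕ (Fin d ⊕ Fin d)) :
    ∃ k', NF (r + parGain c) k' ∧ ∀ P, dd (parDir c) (fun e => k e P) = fun e => k' e P := by
  induction hk with
  | zero => exact ⟨_, zero _, fun P => dd_const _ _⟩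
  | add hk₁ hk₂ ih₁ ih₂ =>
    obtain ⟨k₁, h₁, e₁⟩ := ih₁
    obtain ⟨k₂, h₂, e₂⟩ := ih₂
    refine ⟨_, add h₁ h₂, fun P => ?_⟩
    rw [dd_add (hk₁.contDiff P) (hk₂.contDiff P), e₁, e₂]
  | @gen q t a b h hh hr =>
    have h1 : ContDiff ℝ ∞ fun e : Par d => (e.1 : ℂ) :=
      Complex.ofRealCLM.contDiff.comp contDiff_fst
    have h2 : ContDiff ℝ ∞ fun e : Par d => (e.2.1 : ℂ) :=
      Complex.ofRealCLM.contDiff.comp (contDiff_fst.comp contDiff_snd)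
    have d1 : ∀ v : Par d, MagneticMoyal.dd v (fun e : Par d => (e.1 : ℂ)) = fun _ => (v.1 : ℂ) :=
      fun v => dd_ofReal_clm (ContinuousLinearMap.fst ℝ _ _) v
    have d2 : ∀ v : Par d,
        MagneticMoyal.dd v (fun e : Par d => (e.2.1 : ℂ)) = fun _ => (v.2.1 : ℂ) :=
      fun v => dd_ofReal_clm ((ContinuousLinearMap.fst ℝ ℝ (Phase d)).comp
        (ContinuousLinearMap.snd ℝ ℝ (ℝ × Phase d))) v
    have key : ∀ P : Phase d × Phase d, MagneticMoyal.dd (parDir c) (fun e : Par d =>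
        (e.1 : ℂ) ^ q * (e.2.1 : ℂ) ^ t * (evw a P.1 * evw b P.2) *
          h (e.2.2.1, e.1 • (P.1.1, P.2.1))) = fun e =>
        ((parDir (d := d) c).1 : ℂ) * (q * (e.1 : ℂ) ^ (q - 1) * (e.2.1 : ℂ) ^ t *
          (evw a P.1 * evw b P.2) * h (e.2.2.1, e.1 • (P.1.1, P.2.1))) +
        ((parDir (d := d) c).2.1 : ℂ) * (t * (e.1 : ℂ) ^ q * (e.2.1 : ℂ) ^ (t - 1) *
          (evw a P.1 * evw b P.2) * h (e.2.2.1, e.1 • (P.1.1, P.2.1))) +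
        (e.1 : ℂ) ^ q * (e.2.1 : ℂ) ^ t * (evw a P.1 * evw b P.2) *
          MagneticMoyal.dd (scaleL (P.1.1, P.2.1) (parDir c)) h
            (e.2.2.1, e.1 • (P.1.1, P.2.1)) := by
      intro P
      have hs : ContDiff ℝ ∞ fun e : Par d => h (e.2.2.1, e.1 • (P.1.1, P.2.1)) :=
        hh.1.comp (scaleL (P.1.1, P.2.1)).contDiff
      have d3 := dd_comp_clm hh.1 (fun e => (scaleL (P.1.1, P.2.1)).hasFDerivAt (x := e)) (parDir c)
      simp only [scaleL_apply] at d3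
      rw [dd_mul (((h1.pow q).mul (h2.pow t)).mul contDiff_const) hs,
        dd_mul ((h1.pow q).mul (h2.pow t)) contDiff_const, dd_mul (h1.pow q) (h2.pow t),
        dd_pow h1, dd_pow h2, d1, d2, dd_const, d3]
      funext e
      simp only [scaleL_apply]
      ring
    rcases c with c | c | c
    · rcases c with c | c
      · -- the derivative in `ε`: it lowers the power of `ε`, or it produces a factor `y` or `z`
        refine ⟨_, add (k := fun e P => q * (e.1 : ℂ) ^ (q - 1) * (e.2.1 : ℂ) ^ t *
          (evw a P.1 * evw b P.2) * h (e.2.2.1, e.1 • (P.1.1, P.2.1))) ?_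
          (sum Finset.univ (k := fun b' e P => (e.1 : ℂ) ^ q * (e.2.1 : ℂ) ^ t *
            (evw a P.1 * evw b P.2) * ((coord b' (P.1.1, P.2.1) : ℂ) *
            MagneticMoyal.dd (triDir (.inr b')) h (e.2.2.1, e.1 • (P.1.1, P.2.1))))
            fun b' _ => ?_), fun P => ?_⟩
        · rcases q with q | q
          · simpa using zero _
          · exact ((gen (r := r + 1) (q := q) (t := t) (a := a) (b := b) hh (by omega)).const_mul
              ((q + 1 : ℕ) : ℂ)).congr fun e P => by simp; ring
        · rcases b' with b' | b'
          · refine ((gen (r := r + 1) (q := q) (t := t) (a := .inr b' :: a) (b := b)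
              (hh.dd (.inr (.inl b'))) (by rw [freq_cons_inr]; omega)).const_mul (-Complex.I)).congr
              fun e P => ?_
            simp only [evw_cons, dualCoord, Sum.elim_inr, coord_inl]
            linear_combination (-((e.1 : ℂ) ^ q * (e.2.1 : ℂ) ^ t * (evw a P.1 * evw b P.2) *
              ((P.1.1 b' : ℂ) * MagneticMoyal.dd (triDir (.inr (.inl b'))) h
                (e.2.2.1, e.1 • (P.1.1, P.2.1))))) * Complex.I_mul_I
          · refine ((gen (r := r + 1) (q := q) (t := t) (a := a) (b := .inr b' :: b)
              (hh.dd (.inr (.inr b'))) (by rw [freq_cons_inr]; omega)).const_mul (-Complex.I)).congr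
              fun e P => ?_
            simp only [evw_cons, dualCoord, Sum.elim_inr, coord_inr]
            linear_combination (-((e.1 : ℂ) ^ q * (e.2.1 : ℂ) ^ t * (evw a P.1 * evw b P.2) *
              ((P.2.1 b' : ℂ) * MagneticMoyal.dd (triDir (.inr (.inr b'))) h
                (e.2.2.1, e.1 • (P.1.1, P.2.1))))) * Complex.I_mul_I
        · rw [key]
          funext e
          have e1 : scaleL (P.1.1, P.2.1) (parDir (.inl false)) =
              ∑ b', coord b' (P.1.1, P.2.1) • (triDir (.inr b') : Config d × Phase d) := by
            ext1
            · simp [scaleL_apply, parDir, triDir, Prod.fst_sum]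
            · simp only [Prod.snd_sum, triDir, Sum.elim_inr, Prod.smul_snd, sum_coord_smul_phDir]
              simp [scaleL_apply, parDir]
          rw [e1, dd_sum_smul, Finset.mul_sum]
          simp [parDir, -coord_inl, -coord_inr, -Fintype.sum_sum_type]
      · -- the derivative in `λ`, which only acts on the power of `λ`
        rcases t with t | t
        · refine ⟨_, zero _, fun P => ?_⟩
          rw [key]
          funext e
          rw [show scaleL (P.1.1, P.2.1) (parDir (.inl true)) = 0 by
            simp [parDir, scaleL_apply, Prod.zero_eq_mk], dd_zero_dir]
          simp [parDir]
        · refine ⟨_, (gen (r := r + 1) (q := q) (t := t) (a := a) (b := b) hh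
            (by omega)).const_mul ((t + 1 : ℕ) : ℂ), fun P => ?_⟩
          rw [key]
          funext e
          rw [show scaleL (P.1.1, P.2.1) (parDir (.inl true)) = 0 by
            simp [parDir, scaleL_apply, Prod.zero_eq_mk], dd_zero_dir]
          simp [parDir]
          ring
    · -- the derivatives in `x`
      refine ⟨_, gen (r := r) (q := q) (t := t) (a := a) (b := b) (hh.dd (.inl c)) hr,
        fun P => ?_⟩
      rw [key]
      funext e
      rw [show scaleL (P.1.1, P.2.1) (parDir (.inr (.inl c))) = triDir (.inl c) by
        simp [parDir, scaleL_apply, triDir, phDir, Prod.zero_eq_mk]]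
      simp [parDir]
    · -- the derivatives in `ξ`, of which these kernels are independent
      refine ⟨_, zero _, fun P => ?_⟩
      rw [key]
      funext e
      rw [show scaleL (P.1.1, P.2.1) (parDir (.inr (.inr c))) = 0 by
        simp [parDir, scaleL_apply, phDir, Prod.zero_eq_mk], dd_zero_dir]
      simp [parDir]

end Kernels

end MagneticMoyal

/-! ### Kernel integrals as functions of the parameters -/

namespace MagneticMoyal

section ParInt

variable {d : ℕ} {B : Fin d → Fin d → Config d → ℝ}

lemma symp_eq_sum (X Y : Phase d) : symp X Y = ∑ b, coord b X * dualCoord b Y := by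
  simp [symp, dualCoord, Fintype.sum_sum_type, sub_eq_add_neg, add_comm]

/-- The phase `σ(X, Y + Z) + T_{ε,λ}(x, Y, Z)`, in a form that makes sense for all `ε`. -/
noncomputable def parPhase (B : Fin d → Fin d → Config d → ℝ) (e : Par d) (P : Phase d × Phase d) :
    ℝ :=
  symp e.2.2 (P.1 + P.2) + (e.1 / 2 * symp P.1 P.2 -
    e.2.1 * e.1 * fluxForm B e.1 e.2.2.1 (P.1.1, P.2.1))

/-- The oscillating factor of the kernel integrals. -/
noncomputable def parExp (B : Fin d → Fin d → Config d → ℝ) (e : Par d) (P : Phase d × Phase d) :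
    ℂ :=
  Complex.exp (Complex.I * parPhase B e P)

lemma norm_parExp (e : Par d) (P : Phase d × Phase d) : ‖parExp B e P‖ = 1 :=
  norm_cexp_I_mul _

/-- The part of the phase that is linear in the parameters. -/
noncomputable def linPhase (P : Phase d × Phase d) : Par d →L[ℝ] ℝ :=
  (∑ b, dualCoord b (P.1 + P.2) • (coordL b).comp ((ContinuousLinearMap.snd ℝ _ _).comp
    (ContinuousLinearMap.snd ℝ _ _))) + (symp P.1 P.2 / 2) • ContinuousLinearMap.fst ℝ _ _

/-- The magnetic part of the phase. -/
noncomputable def fluxKer (B : Fin d → Fin d → Config d → ℝ) (e : Par d) (P : Phase d × Phase d) :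
    ℂ :=
  ∑ k, ∑ l, (-1 : ℂ) * ((e.1 : ℂ) ^ 1 * (e.2.1 : ℂ) ^ 1 * (evw [.inr k] P.1 * evw [.inr l] P.2) *
    fluxH B k l (e.2.2.1, e.1 • (P.1.1, P.2.1)))

lemma NF.fluxKer (hB : ∀ k l, IsBCInfty (B k l)) : NF 0 (fluxKer B) :=
  NF.sum _ fun k _ => NF.sum _ fun l _ =>
    NF.const_mul (NF.gen (BoundedAmp.fluxH hB k l) (by simp)) (-1)

lemma I_mul_parPhase (e : Par d) (P : Phase d × Phase d) :
    Complex.I * parPhase B e P = Complex.I * linPhase P e + -Complex.I * fluxKer B e P := by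
  have h1 : symp e.2.2 (P.1 + P.2) + e.1 / 2 * symp P.1 P.2 = linPhase P e := by
    simp only [symp_eq_sum e.2.2, linPhase, add_apply, _root_.sum_apply, smul_apply,
      ContinuousLinearMap.comp_apply, ContinuousLinearMap.coe_fst', ContinuousLinearMap.coe_snd',
      coordL_apply, smul_eq_mul]
    congr 1
    · exact Finset.sum_congr rfl fun b _ => mul_comm _ _
    · ring
  have h2 : ((e.2.1 * e.1 * fluxForm B e.1 e.2.2.1 (P.1.1, P.2.1) : ℝ) : ℂ) = fluxKer B e P := by
    push_cast
    rw [ofReal_fluxForm, MagneticMoyal.fluxKer]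
    simp only [Finset.mul_sum]
    refine Finset.sum_congr rfl fun k _ => Finset.sum_congr rfl fun l _ => ?_
    simp only [evw_cons, evw_nil, dualCoord, Sum.elim_inr]
    linear_combination ((e.2.1 : ℂ) * e.1 * ((P.1.1 k : ℂ) * P.2.1 l *
      fluxH B k l (e.2.2.1, e.1 • (P.1.1, P.2.1)))) * Complex.I_mul_I
  rw [← h1, ← h2, parPhase]
  push_cast
  ring

lemma contDiff_I_mul_parPhase (hB : ∀ k l, IsBCInfty (B k l)) (P : Phase d × Phase d) :
    ContDiff ℝ ∞ fun e => Complex.I * (parPhase B e P : ℂ) := by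
  simp only [I_mul_parPhase]
  exact (contDiff_const.mul (Complex.ofRealCLM.contDiff.comp (linPhase P).contDiff)).add
    (contDiff_const.mul ((NF.fluxKer hB).contDiff P))

lemma contDiff_parExp (hB : ∀ k l, IsBCInfty (B k l)) (P : Phase d × Phase d) :
    ContDiff ℝ ∞ fun e => parExp B e P := (contDiff_I_mul_parPhase hB P).cexp

lemma continuous_parExp (hB : ∀ k l, IsBCInfty (B k l)) (e : Par d) : Continuous (parExp B e) := by
  have h1 := (NF.fluxKer hB).continuous e
  have h2 : Continuous fun P : Phase d × Phase d => linPhase P e := by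
    have : ∀ b, Continuous fun P : Phase d × Phase d => dualCoord b (P.1 + P.2) := fun b =>
      (continuous_dualCoord b).comp (by fun_prop)
    simp only [linPhase, add_apply, _root_.sum_apply, smul_apply, smul_eq_mul]
    fun_prop
  unfold parExp
  simp only [I_mul_parPhase]
  fun_prop

/-- The derivatives of the linear part of the phase are kernels with the right gain. -/
lemma NF.linPhase (c : Bool ⊕ (Fin d ⊕ Fin d)) :
    NF (parGain c) (fun (_ : Par d) P => Complex.I * linPhase P (parDir c)) := by
  rcases c with c | c
  · cases c with
    | true => exact (zero _).congr fun e P => by simp [MagneticMoyal.linPhase, parDir, coordL_apply]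
    | false =>
      refine ((add (sum Finset.univ fun l _ => monomial (r := 1) (1 : ℂ) (a := [.inl l])
        (b := [.inr l]) (by simp)) (sum Finset.univ fun l _ => monomial (r := 1) (-1 : ℂ)
        (a := [.inr l]) (b := [.inl l]) (by simp))).const_mul (Complex.I / 2)).congr fun e P => ?_
      have h1 : MagneticMoyal.linPhase P (parDir (.inl false)) = symp P.1 P.2 / 2 := by
        simp [MagneticMoyal.linPhase, parDir, coordL_apply]
      rw [h1, symp]
      simp only [evw_cons, evw_nil, dualCoord, Sum.elim_inr, Sum.elim_inl]
      push_cast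
      rw [← Finset.sum_add_distrib, ← Finset.sum_sub_distrib, Finset.sum_div, Finset.mul_sum,
        Finset.mul_sum]
      refine Finset.sum_congr rfl fun l _ => ?_
      linear_combination (Complex.I / 2 * ((P.1.1 l : ℂ) * P.2.2 l - (P.1.2 l : ℂ) * P.2.1 l)) *
        Complex.I_mul_I
  · have hg : parGain (.inr c : Bool ⊕ (Fin d ⊕ Fin d)) = freq [c] := by
      cases c <;> rfl
    refine (add (monomial (1 : ℂ) (a := [c]) (b := []) (by rw [hg]; simp))
      (monomial (1 : ℂ) (a := []) (b := [c]) (by rw [hg]; simp))).congr fun e P => ?_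
    have h1 : MagneticMoyal.linPhase P (parDir (.inr c)) =
        dualCoord c P.1 + dualCoord c P.2 := by
      have h2 : ∀ b, coord b (phDir c : Phase d) = if b = c then 1 else 0 := by
        intro b
        exact coord_phDir b c
      have h3 : dualCoord c (P.1 + P.2) = dualCoord c P.1 + dualCoord c P.2 := by
        cases c <;> simp [dualCoord, add_comm]
      simp [MagneticMoyal.linPhase, parDir, coordL_apply, h2, h3, -Fintype.sum_sum_type]
    rw [h1]
    simp
    ring

/-- A derivative of the oscillating factor produces the derivative of its phase, which is again a
kernel of the class. -/
lemma NF.dd_mul_parExp (hB : ∀ k l, IsBCInfty (B k l)) {r : ℕ}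
    {k : Par d → Phase d × Phase d → ℂ} (hk : NF r k) (c : Bool ⊕ (Fin d ⊕ Fin d)) :
    ∃ k', NF (r + parGain c) k' ∧
      ∀ P, MagneticMoyal.dd (parDir c) (fun e => k e P * parExp B e P) =
        fun e => k' e P * parExp B e P := by
  obtain ⟨k₁, h₁, e₁⟩ := hk.dd c
  obtain ⟨k₂, h₂, e₂⟩ := (NF.fluxKer hB).dd c
  rw [zero_add] at h₂
  refine ⟨_, add h₁ (hk.mul (add (NF.linPhase c) (h₂.const_mul (-Complex.I)))), fun P => ?_⟩
  have hl : ContDiff ℝ ∞ fun e => Complex.I * (MagneticMoyal.linPhase P e : ℂ) :=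
    contDiff_const.mul (Complex.ofRealCLM.contDiff.comp (MagneticMoyal.linPhase P).contDiff)
  have hl' : ContDiff ℝ ∞ fun e => (MagneticMoyal.linPhase P e : ℂ) :=
    Complex.ofRealCLM.contDiff.comp (MagneticMoyal.linPhase P).contDiff
  have h3 : MagneticMoyal.dd (parDir c) (fun e => parExp B e P) = fun e =>
      (Complex.I * MagneticMoyal.linPhase P (parDir c) + -Complex.I * k₂ e P) * parExp B e P := by
    have hp := contDiff_I_mul_parPhase hB P
    unfold parExp
    rw [dd_cexp hp]
    simp only [I_mul_parPhase]
    rw [dd_add hl (contDiff_const.mul ((NF.fluxKer hB).contDiff P)), dd_const_mul hl',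
      dd_ofReal_clm, dd_const_mul ((NF.fluxKer hB).contDiff P), e₂]
  rw [dd_mul (hk.contDiff P) (contDiff_parExp hB P), e₁, h3]
  funext e
  ring

/-- The kernel integral with kernel `k`, as a function of the parameters `(ε, λ, X)`. -/
noncomputable def parInt (B : Fin d → Fin d → Config d → ℝ) (F G : Phase d → ℂ)
    (k : Par d → Phase d × Phase d → ℂ) (e : Par d) : ℂ :=
  1 / (2 * (Real.pi : ℂ)) ^ (2 * d) * ∫ P : Phase d × Phase d,
    k e P * parExp B e P * (sympFourier F P.1 * sympFourier G P.2)

section Smooth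

variable {F G : Phase d → ℂ} {r : ℕ} {k : Par d → Phase d × Phase d → ℂ}

lemma norm_parInt_integrand (e : Par d) (P : Phase d × Phase d) :
    ‖k e P * parExp B e P * (sympFourier F P.1 * sympFourier G P.2)‖ =
      ‖k e P‖ * (‖sympFourier F P.1‖ * ‖sympFourier G P.2‖) := by
  rw [norm_mul, norm_mul, norm_parExp, mul_one, norm_mul]

lemma integrable_parInt (hB : ∀ k l, IsBCInfty (B k l)) (hF : Rapid F) (hG : Rapid G)
    (hk : NF r k) (e : Par d) : Integrable fun P : Phase d × Phase d =>
      k e P * parExp B e P * (sympFourier F P.1 * sympFourier G P.2) := by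
  obtain ⟨C, p, hC, hb⟩ := hk.bound (R := max 1 ‖e‖) (le_max_left _ _)
  have h1 := hk.continuous e
  have h2 := continuous_parExp hB e
  have h3 := continuous_sympFourier hF
  have h4 := continuous_sympFourier hG
  refine ((integrable_mul_sympFourier hF hG p).const_mul C).mono'
    (Continuous.aestronglyMeasurable (by fun_prop)) (ae_of_all _ fun P => ?_)
  rw [norm_parInt_integrand, ← mul_assoc C]
  exact mul_le_mul_of_nonneg_right (hb e P (le_max_right _ _))
    (mul_nonneg (norm_nonneg _) (norm_nonneg _))

/-- The derivative of the integrand of a kernel integral with respect to the parameters. -/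
noncomputable def parIntDeriv (B : Fin d → Fin d → Config d → ℝ) (F G : Phase d → ℂ)
    (k₁ : Bool ⊕ (Fin d ⊕ Fin d) → Par d → Phase d × Phase d → ℂ) (e : Par d)
    (P : Phase d × Phase d) : Par d →L[ℝ] ℂ :=
  ∑ c, (k₁ c e P * parExp B e P * (sympFourier F P.1 * sympFourier G P.2)) •
    (Complex.ofRealCLM.comp (parCoord c))

lemma parIntDeriv_apply
    {k₁ : Bool ⊕ (Fin d ⊕ Fin d) → Par d → Phase d × Phase d → ℂ}
    (e₁ : ∀ c P, dd (parDir c) (fun e => k e P * parExp B e P) = fun e => k₁ c e P * parExp B e P)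
    (e : Par d) (P : Phase d × Phase d) (v : Par d) :
    parIntDeriv B F G k₁ e P v = dd v (fun e => k e P * parExp B e P) e *
      (sympFourier F P.1 * sympFourier G P.2) := by
  rw [dd_eq_sum sum_parCoord_smul (fun e => k e P * parExp B e P) v e, parIntDeriv, Finset.sum_mul,
    _root_.sum_apply]
  refine Finset.sum_congr rfl fun c _ => ?_
  rw [e₁, smul_apply, smul_eq_mul, ContinuousLinearMap.comp_apply, Complex.ofRealCLM_apply]
  ring

lemma hasFDerivAt_parInt_integrand (hB : ∀ k l, IsBCInfty (B k l)) (hk : NF r k)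
    {k₁ : Bool ⊕ (Fin d ⊕ Fin d) → Par d → Phase d × Phase d → ℂ}
    (e₁ : ∀ c P, dd (parDir c) (fun e => k e P * parExp B e P) = fun e => k₁ c e P * parExp B e P)
    (e : Par d) (P : Phase d × Phase d) :
    HasFDerivAt (fun e => k e P * parExp B e P * (sympFourier F P.1 * sympFourier G P.2))
      (parIntDeriv B F G k₁ e P) e := by
  have hs : ContDiff ℝ ∞ fun e => k e P * parExp B e P :=
    (hk.contDiff P).mul (contDiff_parExp hB P)
  refine (((hs.differentiable_infty e).hasFDerivAt).mul_const
    (sympFourier F P.1 * sympFourier G P.2)).congr_fderiv (ContinuousLinearMap.ext fun v => ?_)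
  rw [parIntDeriv_apply e₁, smul_apply, smul_eq_mul, mul_comm]
  rfl

lemma norm_parIntDeriv_le {k₁ : Bool ⊕ (Fin d ⊕ Fin d) → Par d → Phase d × Phase d → ℂ} {R : ℝ}
    {C : Bool ⊕ (Fin d ⊕ Fin d) → ℝ} {p : Bool ⊕ (Fin d ⊕ Fin d) → ℕ}
    (hb : ∀ c e P, ‖e‖ ≤ R → ‖k₁ c e P‖ ≤ C c * (1 + ‖P‖) ^ p c) {e : Par d} (he : ‖e‖ ≤ R)
    (P : Phase d × Phase d) : ‖parIntDeriv B F G k₁ e P‖ ≤ ∑ c, C c * ((1 + ‖P‖) ^ p c *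
      (‖sympFourier F P.1‖ * ‖sympFourier G P.2‖)) *
        ‖Complex.ofRealCLM.comp (parCoord (d := d) c)‖ := by
  refine (norm_sum_le _ _).trans (Finset.sum_le_sum fun c _ => ?_)
  rw [norm_smul, norm_parInt_integrand, ← mul_assoc (C c)]
  exact mul_le_mul_of_nonneg_right (mul_le_mul_of_nonneg_right (hb c e P he)
    (mul_nonneg (norm_nonneg _) (norm_nonneg _))) (norm_nonneg _)

/-- Kernel integrals are differentiable under the integral sign: the transforms of `F` and `G`
decrease rapidly, whereas the kernels grow polynomially. -/
lemma hasFDerivAt_parInt (hB : ∀ k l, IsBCInfty (B k l)) (hF : Rapid F) (hG : Rapid G)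
    (hk : NF r k) {k₁ : Bool ⊕ (Fin d ⊕ Fin d) → Par d → Phase d × Phase d → ℂ}
    {r₁ : Bool ⊕ (Fin d ⊕ Fin d) → ℕ} (hk₁ : ∀ c, NF (r₁ c) (k₁ c))
    (e₁ : ∀ c P, dd (parDir c) (fun e => k e P * parExp B e P) = fun e => k₁ c e P * parExp B e P)
    (e₀ : Par d) : Integrable (parIntDeriv B F G k₁ e₀) ∧ HasFDerivAt (parInt B F G k)
      ((1 / (2 * (Real.pi : ℂ)) ^ (2 * d)) • ∫ P, parIntDeriv B F G k₁ e₀ P) e₀ := by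
  choose C p hC hb using fun c => (hk₁ c).bound (R := ‖e₀‖ + 1) (by linarith [norm_nonneg e₀])
  have hbound : Integrable fun P : Phase d × Phase d => ∑ c, C c * ((1 + ‖P‖) ^ p c *
      (‖sympFourier F P.1‖ * ‖sympFourier G P.2‖)) *
        ‖Complex.ofRealCLM.comp (parCoord (d := d) c)‖ := by
    refine integrable_finsetSum _ fun c _ => ?_
    exact ((integrable_mul_sympFourier hF hG (p c)).const_mul (C c)).mul_const
      ‖Complex.ofRealCLM.comp (parCoord (d := d) c)‖
  have hcont : Continuous (parIntDeriv B F G k₁ e₀) := by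
    have h1 := continuous_sympFourier hF
    have h2 := continuous_sympFourier hG
    have h3 := continuous_parExp hB e₀
    refine continuous_finsetSum _ fun c _ => ?_
    have h4 := (hk₁ c).continuous e₀
    have h5 : Continuous fun P : Phase d × Phase d =>
        k₁ c e₀ P * parExp B e₀ P * (sympFourier F P.1 * sympFourier G P.2) := by fun_prop
    exact h5.smul continuous_const
  have hSint : Integrable (parIntDeriv B F G k₁ e₀) :=
    hbound.mono' hcont.aestronglyMeasurable
      (ae_of_all _ fun P => norm_parIntDeriv_le hb (by linarith) P)
  refine ⟨hSint, ?_⟩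
  have h := hasFDerivAt_integral_of_dominated_of_fderiv_le (F' := parIntDeriv B F G k₁)
    (F := fun e P => k e P * parExp B e P * (sympFourier F P.1 * sympFourier G P.2))
    (μ := (volume : Measure (Phase d × Phase d)))
    (Metric.ball_mem_nhds e₀ one_pos)
    (Eventually.of_forall fun e => (integrable_parInt hB hF hG hk e).aestronglyMeasurable)
    (integrable_parInt hB hF hG hk e₀) hSint.aestronglyMeasurable
    (ae_of_all _ fun P e he => norm_parIntDeriv_le hb (by
      have := norm_le_norm_add_norm_sub' e e₀
      rw [mem_ball_iff_norm] at he
      linarith) P)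
    hbound
    (ae_of_all _ fun P e _ => hasFDerivAt_parInt_integrand hB hk e₁ e P)
  exact h.const_mul _

/-- Differentiation of kernel integrals under the integral sign. -/
lemma dd_parInt (hB : ∀ k l, IsBCInfty (B k l)) (hF : Rapid F) (hG : Rapid G) (hk : NF r k) :
    Differentiable ℝ (parInt B F G k) ∧ ∀ c k',
      (∀ P, dd (parDir c) (fun e => k e P * parExp B e P) = fun e => k' e P * parExp B e P) →
      dd (parDir c) (parInt B F G k) = parInt B F G k' := by
  choose k₁ hk₁ e₁ using fun c => hk.dd_mul_parExp hB c
  have h := hasFDerivAt_parInt hB hF hG hk hk₁ e₁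
  refine ⟨fun e => (h e).2.differentiableAt, fun c k' e' => ?_⟩
  funext e
  rw [dd, (h e).2.fderiv, smul_apply, ContinuousLinearMap.integral_apply (h e).1, parInt,
    smul_eq_mul]
  congr 2
  funext P
  rw [parIntDeriv_apply e₁, e']

lemma contDiff_parInt (hB : ∀ k l, IsBCInfty (B k l)) (hF : Rapid F) (hG : Rapid G)
    (hk : NF r k) : ContDiff ℝ ∞ (parInt B F G k) := by
  refine contDiff_of_dd_closed (dir := parDir) sum_parCoord_smul
    (P := fun f => ∃ r k, NF r k ∧ f = parInt B F G k) ?_ ⟨r, k, hk, rfl⟩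
  rintro f ⟨r, k, hk, rfl⟩
  obtain ⟨h1, h2⟩ := dd_parInt hB hF hG hk
  refine ⟨h1, fun c => ?_⟩
  obtain ⟨k', hk', e'⟩ := hk.dd_mul_parExp hB c
  exact ⟨_, k', hk', h2 c k' e'⟩

/-- Derivatives of kernel integrals are kernel integrals, for a kernel with additional gain. -/
lemma NF.ddw_parInt (hB : ∀ k l, IsBCInfty (B k l)) (hk : NF r k)
    (W : List (Bool ⊕ (Fin d ⊕ Fin d))) :
    ∃ k', NF (r + (W.map parGain).sum) k' ∧
      (∀ P, ddw parDir W (fun e => k e P * parExp B e P) = fun e => k' e P * parExp B e P) ∧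
      ∀ F G, Rapid F → Rapid G → ddw parDir W (parInt B F G k) = parInt B F G k' := by
  induction W with
  | nil => exact ⟨k, by simpa using hk, fun P => rfl, fun F G _ _ => rfl⟩
  | cons c W ih =>
    obtain ⟨k₁, hk₁, e₁, h₁⟩ := ih
    obtain ⟨k₂, hk₂, e₂⟩ := hk₁.dd_mul_parExp hB c
    refine ⟨k₂, ?_, fun P => ?_, fun F G hF hG => ?_⟩
    · convert hk₂ using 1
      simp only [List.map_cons, List.sum_cons]
      ring
    · rw [ddw_cons, e₁, e₂]
    · rw [ddw_cons, h₁ F G hF hG]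
      exact (dd_parInt hB hF hG hk₁).2 c k₂ e₂

end Smooth

end ParInt

end MagneticMoyal

/-! ### Symbol bounds for kernel integrals -/

namespace MagneticMoyal

section SymbolBounds

variable {d : ℕ} {B : Fin d → Fin d → Config d → ℝ}

/-- The gain of a derivative of a symbol of type `ρ`. -/
noncomputable def symGain (ρ : ℝ) (b : Fin d ⊕ Fin d) (Y : Phase d) : ℝ :=
  Sum.elim (fun _ => 1) (fun _ => japanese Y.2 ^ (-ρ)) b

lemma symGain_nonneg (ρ : ℝ) (b : Fin d ⊕ Fin d) (Y : Phase d) : 0 ≤ symGain ρ b Y := by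
  cases b
  · exact zero_le_one
  · exact Real.rpow_nonneg (japanese_pos _).le _

lemma symGain_le_one {ρ : ℝ} (hρ : 0 ≤ ρ) (b : Fin d ⊕ Fin d) (Y : Phase d) :
    symGain ρ b Y ≤ 1 := by
  cases b
  · exact le_rfl
  · exact Real.rpow_le_one_of_one_le_of_nonpos (one_le_japanese _) (by linarith)

lemma prod_symGain (ρ : ℝ) (a : List (Fin d ⊕ Fin d)) (Y : Phase d) :
    (a.map (symGain ρ · Y)).prod = japanese Y.2 ^ (-(freq a * ρ)) := by
  induction a with
  | nil => simp
  | cons b a ih =>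
    rw [List.map_cons, List.prod_cons, ih]
    cases b with
    | inl l => simp [symGain]
    | inr l =>
      rw [symGain, Sum.elim_inr, ← Real.rpow_add (japanese_pos _), freq_cons_inr]
      congr 1
      push_cast
      ring

/-- Families of smooth functions with uniform bounds in the symbol class of order `m`. -/
def SymFamily {I : Type*} (ρ m : ℝ) (F : I → Phase d → ℂ) : Prop :=
  (∀ i, ContDiff ℝ ∞ (F i)) ∧
    ∀ K, DerivBound phDir (symGain ρ) K (fun _ Y => japanese Y.2 ^ m) F

lemma SymFamily.ddw {I : Type*} {ρ m : ℝ} {F : I → Phase d → ℂ} (hF : SymFamily ρ m F)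
    (a : List (Fin d ⊕ Fin d)) : SymFamily ρ (m - freq a * ρ) (fun i => ddw phDir a (F i)) := by
  refine ⟨fun i => contDiff_ddw phDir a (hF.1 i), fun K => ?_⟩
  have h := (hF.2 (K + a.length)).ddw a
  refine h.mono (symGain_nonneg ρ) zero_le_one fun i Y => le_of_eq ?_
  rw [prod_symGain, ← Real.rpow_add (japanese_pos _)]
  ring_nf

lemma SymFamily.flat {I : Type*} {ρ m : ℝ} (hρ : 0 ≤ ρ) {F : I → Phase d → ℂ}
    (hF : SymFamily ρ m F) (K : ℕ) :
    DerivBound phDir (fun _ _ => 1) K (fun (_ : I) Y => japanese Y.2 ^ m) F :=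
  (hF.2 K).mono_gain (symGain_nonneg ρ) (symGain_le_one hρ)
    (fun _ _ => Real.rpow_nonneg (japanese_pos _).le _)

lemma SymFamily.bound {I : Type*} {ρ m : ℝ} {F : I → Phase d → ℂ} (hF : SymFamily ρ m F)
    (a : List (Fin d ⊕ Fin d)) : ∃ C, 0 ≤ C ∧ ∀ i Y,
      ‖MagneticMoyal.ddw phDir a (F i) Y‖ ≤ C * japanese Y.2 ^ (m - freq a * ρ) :=
  ((hF.ddw a).2 0).bound

lemma symFamily_of_bound {I : Type*} {ρ m : ℝ} {F : I → Phase d → ℂ}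
    (hs : ∀ i, ContDiff ℝ ∞ (F i)) (h : ∀ a : List (Fin d ⊕ Fin d), ∃ C, 0 ≤ C ∧ ∀ i Y,
      ‖MagneticMoyal.ddw phDir a (F i) Y‖ ≤ C * japanese Y.2 ^ (m - freq a * ρ)) :
    SymFamily ρ m F := by
  refine ⟨hs, fun K => derivBound_of_ddw fun a => ?_⟩
  obtain ⟨C, hC, hb⟩ := h a
  refine ⟨C, hC, fun i Y => (hb i Y).trans_eq ?_⟩
  rw [prod_symGain, ← Real.rpow_add (japanese_pos _)]
  ring_nf

lemma polyGrowth_coord {I : Type*} (b : Fin d ⊕ Fin d) :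
    PolyGrowth phDir (fun w : Phase d => ‖w‖) (fun (_ : I) w => (coord b w : ℂ)) := by
  refine ⟨fun _ => contDiff_ofReal_coord b, fun K => ⟨1, ?_⟩⟩
  have base : ∃ C : ℝ, 0 ≤ C ∧ ∀ (_ : I) (w : Phase d), ‖(coord b w : ℂ)‖ ≤ C * (1 + ‖w‖) ^ 1 :=
    ⟨1, zero_le_one, fun _ w => by
      rw [Complex.norm_real, Real.norm_eq_abs]
      linarith [abs_coord_le b w]⟩
  cases K with
  | zero => exact base
  | succ K =>
    refine ⟨base, fun c => ?_⟩
    have h1 : ∀ c : Fin d ⊕ Fin d, dd (phDir c) (fun w : Phase d => (coord b w : ℂ)) =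
        fun _ => (coord b (phDir c) : ℂ) := by
      intro c
      have := dd_ofReal_clm (coordL b) (phDir c : Phase d)
      simpa only [coordL_apply] using this
    simp only [h1, one_mul]
    refine DerivBound.const (fun _ _ => zero_le_one) (fun _ w => by positivity)
      (C := ‖(coord b (phDir c : Phase d) : ℂ)‖) (norm_nonneg _) fun _ w => ?_
    refine le_mul_of_one_le_right (norm_nonneg _) ?_
    linarith [norm_nonneg w]

lemma polyGrowth_boundedAmp {I : Type*} {h : Config d × Phase d → ℂ} (hh : BoundedAmp h)
    {ε : I → ℝ} (hε : ∀ i, |ε i| ≤ 1) (x : I → Config d) :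
    PolyGrowth phDir (fun w : Phase d => ‖w‖) (fun i w => h (x i, ε i • w)) := by
  have hA : ∀ i (w : Phase d), HasFDerivAt (fun w : Phase d => (x i, ε i • w))
      (ε i • ContinuousLinearMap.inr ℝ (Config d) (Phase d)) w := by
    intro i w
    have := ((ε i • ContinuousLinearMap.inr ℝ (Config d) (Phase d)).hasFDerivAt (x := w)).const_add
      ((x i, 0) : Config d × Phase d)
    refine this.congr_of_eventuallyEq (Eventually.of_forall fun w => ?_)
    simp
  refine PolyGrowth.of_bounded (fun i => hh.1.comp (by fun_prop)) fun K => ?_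
  refine DerivBound.comp_affine (dir := phDir) (dir' := triDir) (f := fun (_ : I) => h)
    (w := fun _ _ => 1)
    (fun _ _ => zero_le_one) (fun _ => hh.1) ((hh.2 K).comp_index (fun _ : I => ()))
    (fun i w => (x i, ε i • w)) _ hA
    (fun i b b' => if b' = Sum.inr b then ε i else 0) (M := 1) ?_ ?_
  · intro i b b'
    split_ifs
    · exact hε i
    · simp
  · intro i b
    simp [triDir, -Fintype.sum_sum_type]

/-- The amplitude of the twister, with the quadratic phase removed. -/
noncomputable def magAmp (B : Fin d → Fin d → Config d → ℝ) (h : Config d × Phase d → ℂ)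
    (ε lam : ℝ) (x : Config d) (w : Phase d) : ℂ :=
  Complex.exp (Complex.I * (-(lam * ε * fluxForm B ε x w) : ℝ)) * h (x, ε • w)

lemma polyGrowth_magAmp (hB : ∀ k l, IsBCInfty (B k l)) {I : Type*} {h : Config d × Phase d → ℂ}
    (hh : BoundedAmp h) {ε lam : I → ℝ} (hε : ∀ i, |ε i| ≤ 1) (hlam : ∀ i, |lam i| ≤ 1)
    (x : I → Config d) :
    PolyGrowth phDir (fun w : Phase d => ‖w‖) (fun i => magAmp B h (ε i) (lam i) (x i)) := by
  have hτ : ∀ w : Phase d, 0 ≤ ‖w‖ := fun w => norm_nonneg w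
  refine PolyGrowth.mul hτ (PolyGrowth.cexp hτ ?_) (polyGrowth_boundedAmp hh hε x)
  have h1 : PolyGrowth phDir (fun w : Phase d => ‖w‖) (fun i w => (-(lam i * ε i : ℝ) : ℂ) *
      ∑ k, ∑ l, (coord (.inl k) w : ℂ) * coord (.inr l) w * fluxH B k l (x i, ε i • w)) := by
    refine PolyGrowth.mul hτ (PolyGrowth.const (A := 1) fun i => ?_) ?_
    · rw [norm_neg, Complex.norm_real, norm_mul]
      exact mul_le_one₀ (hlam i) (norm_nonneg _) (hε i)
    · refine PolyGrowth.sum hτ _ fun k _ => PolyGrowth.sum hτ _ fun l _ => ?_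
      exact PolyGrowth.mul hτ (PolyGrowth.mul hτ (polyGrowth_coord _) (polyGrowth_coord _))
        (polyGrowth_boundedAmp (BoundedAmp.fluxH hB k l) hε x)
  convert h1 using 3
  push_cast
  rw [ofReal_fluxForm]
  simp

lemma parInt_gen (B : Fin d → Fin d → Config d → ℝ) {F G : Phase d → ℂ} (hF : Rapid F)
    (hG : Rapid G) (q t : ℕ) (a b : List (Fin d ⊕ Fin d)) (h : Config d × Phase d → ℂ) (e : Par d) :
    parInt B F G (fun e P => (e.1 : ℂ) ^ q * (e.2.1 : ℂ) ^ t * (evw a P.1 * evw b P.2) *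
        h (e.2.2.1, e.1 • (P.1.1, P.2.1))) e =
      (e.1 : ℂ) ^ q * (e.2.1 : ℂ) ^ t * kernelIntegral (fun x Y Z =>
        Complex.exp (Complex.I * (e.1 / 2 * symp Y Z : ℝ)) * magAmp B h e.1 e.2.1 x (Y.1, Z.1))
        (ddw phDir a F) (ddw phDir b G) e.2.2 := by
  rw [parInt, kernelIntegral, mul_left_comm]
  congr 1
  rw [← integral_const_mul]
  congr 1
  funext P
  have h1 : parExp B e P = Complex.exp (Complex.I * symp e.2.2 (P.1 + P.2)) *
      (Complex.exp (Complex.I * (e.1 / 2 * symp P.1 P.2 : ℝ)) *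
        Complex.exp (Complex.I *
          (-(e.2.1 * e.1 * fluxForm B e.1 e.2.2.1 (P.1.1, P.2.1)) : ℝ))) := by
    rw [parExp, parPhase, ← Complex.exp_add, ← Complex.exp_add]
    congr 1
    push_cast
    ring
  simp only [kernelIntegrand, sympFourier_ddw hF, sympFourier_ddw hG, magAmp, h1]
  ring

/-- Kernel integrals satisfy the symbol bounds, with the gain of their kernels. -/
lemma parInt_bound (hB : ∀ k l, IsBCInfty (B k l)) {I : Type*} {F G : I → Phase d → ℂ}
    {ρ m₁ m₂ : ℝ} (hρ : 0 ≤ ρ) (hF : ∀ i, Rapid (F i)) (hG : ∀ i, Rapid (G i))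
    (bF : SymFamily ρ m₁ F) (bG : SymFamily ρ m₂ G)
    {r : ℕ} {k : Par d → Phase d × Phase d → ℂ} (hk : NF r k) :
    ∃ C, 0 ≤ C ∧ ∀ i e, |e.1| ≤ 1 → |e.2.1| ≤ 1 →
      ‖parInt B (F i) (G i) k e‖ ≤ C * japanese e.2.2.2 ^ (m₁ + m₂ - r * ρ) := by
  induction hk with
  | @gen q t a b h hh hr =>
    -- the factors `evw` are derivatives of `F` and `G`; their number `≥ r` of frequency derivatives
    -- lowers the order by `r ρ`
    obtain ⟨C, hC, hb⟩ := kernelIntegral_bound (I := I × {e : Par d // |e.1| ≤ 1 ∧ |e.2.1| ≤ 1})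
      (c := fun j => magAmp B h j.2.1.1 j.2.1.2.1 j.2.1.2.2.1)
      (F := fun j => ddw phDir a (F j.1)) (G := fun j => ddw phDir b (G j.1))
      (ε := fun j => j.2.1.1) (X := fun j => j.2.1.2.2)
      (K := fun j x Y Z => Complex.exp (Complex.I * (j.2.1.1 / 2 * symp Y Z : ℝ)) *
        magAmp B h j.2.1.1 j.2.1.2.1 x (Y.1, Z.1))
      (fun j => j.2.2.1) (polyGrowth_magAmp hB hh (fun j => j.2.2.1) (fun j => j.2.2.2) _)
      (fun j => (hF j.1).ddw a) (fun j => (hG j.1).ddw b)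
      (fun K => ((bF.ddw a).flat hρ K).comp_index _) (fun K => ((bG.ddw b).flat hρ K).comp_index _)
      (fun j Y Z => rfl)
    refine ⟨C, hC, fun i e h1 h2 => ?_⟩
    rw [parInt_gen B (hF i) (hG i), norm_mul, norm_mul, norm_pow, norm_pow, Complex.norm_real,
      Complex.norm_real]
    have h3 : ‖e.1‖ ^ q * ‖e.2.1‖ ^ t ≤ 1 :=
      mul_le_one₀ (pow_le_one₀ (norm_nonneg _) h1) (by positivity) (pow_le_one₀ (norm_nonneg _) h2)
    refine (mul_le_of_le_one_left (norm_nonneg _) h3).trans ((hb (i, ⟨e, h1, h2⟩)).trans ?_)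
    refine mul_le_mul_of_nonneg_left (Real.rpow_le_rpow_of_exponent_le (one_le_japanese _) ?_) hC
    have : (r : ℝ) ≤ freq a + freq b := by exact_mod_cast (by omega : r ≤ freq a + freq b)
    nlinarith
  | zero => exact ⟨0, le_rfl, fun i e _ _ => by simp [parInt]⟩
  | @add k k' hk hk' ih₁ ih₂ =>
    obtain ⟨C, hC, hb⟩ := ih₁
    obtain ⟨C', hC', hb'⟩ := ih₂
    refine ⟨C + C', by positivity, fun i e h1 h2 => ?_⟩
    have h3 : parInt B (F i) (G i) (fun e P => k e P + k' e P) e =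
        parInt B (F i) (G i) k e + parInt B (F i) (G i) k' e := by
      simp only [parInt]
      rw [← mul_add, ← integral_add (integrable_parInt hB (hF i) (hG i) hk e)
        (integrable_parInt hB (hF i) (hG i) hk' e)]
      congr 2
      funext P
      ring
    rw [h3, add_mul]
    exact (norm_add_le _ _).trans (add_le_add (hb i e h1 h2) (hb' i e h1 h2))

/-- The kernel integral of the twister, as a function of `(ε, λ, X)`. -/
noncomputable def moyalInt (B : Fin d → Fin d → Config d → ℝ) (F G : Phase d → ℂ) : Par d → ℂ :=
  parInt B F G (fun _ _ => 1)

lemma NF.one : NF 0 (fun (_ : Par d) (_ : Phase d × Phase d) => (1 : ℂ)) :=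
  (NF.monomial (1 : ℂ) (a := []) (b := []) (by simp)).congr fun e P => by simp

lemma contDiff_moyalInt (hB : ∀ k l, IsBCInfty (B k l)) {F G : Phase d → ℂ} (hF : Rapid F)
    (hG : Rapid G) : ContDiff ℝ ∞ (moyalInt B F G) :=
  contDiff_parInt hB hF hG NF.one

lemma moyalInt_bound (hB : ∀ k l, IsBCInfty (B k l)) {I : Type*} {F G : I → Phase d → ℂ}
    {ρ m₁ m₂ : ℝ} (hρ : 0 ≤ ρ) (hF : ∀ i, Rapid (F i)) (hG : ∀ i, Rapid (G i))
    (bF : SymFamily ρ m₁ F) (bG : SymFamily ρ m₂ G) (W : List (Bool ⊕ (Fin d ⊕ Fin d))) :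
    ∃ C, 0 ≤ C ∧ ∀ i e, |e.1| ≤ 1 → |e.2.1| ≤ 1 →
      ‖ddw parDir W (moyalInt B (F i) (G i)) e‖ ≤
        C * japanese e.2.2.2 ^ (m₁ + m₂ - (W.map parGain).sum * ρ) := by
  obtain ⟨k, hk, -, h⟩ := NF.one.ddw_parInt hB W
  rw [zero_add] at hk
  obtain ⟨C, hC, hb⟩ := parInt_bound hB hρ hF hG bF bG hk
  exact ⟨C, hC, fun i e h1 h2 => by rw [moyalInt, h _ _ (hF i) (hG i)]; exact hb i e h1 h2⟩

lemma moyalInt_eq (hB : ∀ k l, IsBCInfty (B k l)) (F G : Phase d → ℂ) {ε : ℝ} (hε : ε ≠ 0)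
    (lam : ℝ) (X : Phase d) :
    moyalInt B F G (ε, lam, X) = kernelIntegral (twister B ε lam) F G X := by
  rw [moyalInt, parInt, kernelIntegral]
  congr 2
  funext P
  rw [kernelIntegrand, parExp, parPhase, twister, twisterPhase,
    scaledFlux_eq (fun k l => (hB k l).1.continuous) hε, ← Complex.exp_add, one_mul, ← mul_assoc]
  congr 3
  push_cast
  ring

end SymbolBounds

end MagneticMoyal

/-! ### Jets of functions of one variable -/

namespace MagneticMoyal

section Jets

/-- The derivatives of `f` and `g` at `0` agree up to order `n`. -/
def JetEq : ℕ → (ℝ → ℂ) → (ℝ → ℂ) → Prop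
  | 0, f, g => f 0 = g 0
  | n + 1, f, g => f 0 = g 0 ∧ JetEq n (dd 1 f) (dd 1 g)

namespace JetEq

variable {n : ℕ} {f f' g g' h : ℝ → ℂ}

lemma refl (n : ℕ) (f : ℝ → ℂ) : JetEq n f f := by
  induction n generalizing f with
  | zero => exact Eq.refl _
  | succ n ih => exact ⟨Eq.refl _, ih _⟩

lemma trans (h₁ : JetEq n f g) (h₂ : JetEq n g h) : JetEq n f h := by
  induction n generalizing f g h with
  | zero => exact Eq.trans h₁ h₂
  | succ n ih => exact ⟨h₁.1.trans h₂.1, ih h₁.2 h₂.2⟩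

lemma pred (hj : JetEq (n + 1) f g) : JetEq n f g := by
  induction n generalizing f g with
  | zero => exact hj.1
  | succ n ih => exact ⟨hj.1, ih hj.2⟩

lemma iterate (hj : JetEq n f g) : (dd 1)^[n] f 0 = (dd 1)^[n] g 0 := by
  induction n generalizing f g with
  | zero => exact hj
  | succ n ih => exact ih hj.2

lemma add (hf : ContDiff ℝ ∞ f) (hg : ContDiff ℝ ∞ g) (hf' : ContDiff ℝ ∞ f')
    (hg' : ContDiff ℝ ∞ g') (h₁ : JetEq n f f') (h₂ : JetEq n g g') :
    JetEq n (fun x => f x + g x) (fun x => f' x + g' x) := by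
  induction n generalizing f f' g g' with
  | zero => exact congrArg₂ (· + ·) h₁ h₂
  | succ n ih =>
    refine ⟨congrArg₂ (· + ·) h₁.1 h₂.1, ?_⟩
    rw [dd_add hf hg, dd_add hf' hg']
    exact ih (contDiff_dd hf _) (contDiff_dd hg _) (contDiff_dd hf' _) (contDiff_dd hg' _) h₁.2 h₂.2

lemma mul (hf : ContDiff ℝ ∞ f) (hg : ContDiff ℝ ∞ g) (hf' : ContDiff ℝ ∞ f')
    (hg' : ContDiff ℝ ∞ g') (h₁ : JetEq n f f') (h₂ : JetEq n g g') :
    JetEq n (fun x => f x * g x) (fun x => f' x * g' x) := by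
  induction n generalizing f f' g g' with
  | zero => exact congrArg₂ (· * ·) h₁ h₂
  | succ n ih =>
    refine ⟨congrArg₂ (· * ·) h₁.1 h₂.1, ?_⟩
    rw [dd_mul hf hg, dd_mul hf' hg']
    have df := contDiff_dd hf 1
    have dg := contDiff_dd hg 1
    have df' := contDiff_dd hf' 1
    have dg' := contDiff_dd hg' 1
    exact add (df.mul hg) (hf.mul dg) (df'.mul hg') (hf'.mul dg')
      (ih df hg df' hg' h₁.2 h₂.pred) (ih hf dg hf' dg' h₁.pred h₂.2)

lemma prod {α : Type*} (s : Finset α) {f g : α → ℝ → ℂ} (hf : ∀ a, ContDiff ℝ ∞ (f a))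
    (hg : ∀ a, ContDiff ℝ ∞ (g a)) (h : ∀ a, JetEq n (f a) (g a)) :
    JetEq n (fun x => ∏ a ∈ s, f a x) (fun x => ∏ a ∈ s, g a x) := by
  classical
  induction s using Finset.induction_on with
  | empty => simpa using refl n _
  | insert a s ha ih =>
    simp only [Finset.prod_insert ha]
    exact mul (hf a) (contDiff_prod fun a _ => hf a) (hg a) (contDiff_prod fun a _ => hg a) (h a) ih

lemma cexp (hf : ContDiff ℝ ∞ f) (hg : ContDiff ℝ ∞ g) (h : JetEq n f g) :
    JetEq n (fun x => Complex.exp (f x)) (fun x => Complex.exp (g x)) := by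
  induction n with
  | zero => exact congrArg Complex.exp h
  | succ n ih =>
    refine ⟨congrArg Complex.exp h.1, ?_⟩
    rw [dd_cexp hf, dd_cexp hg]
    exact mul (contDiff_dd hf 1) hf.cexp (contDiff_dd hg 1) hg.cexp h.2 (ih h.pred)

/-- The exponential series, truncated, of a function that vanishes at `0`. -/
lemma cexp_series (hf : ContDiff ℝ ∞ f) (h0 : f 0 = 0) (n : ℕ) :
    JetEq n (fun x => Complex.exp (f x))
      (fun x => ∑ k ∈ Finset.range (n + 1), f x ^ k / (k.factorial : ℂ)) := by
  have hs : ∀ n, ContDiff ℝ ∞ fun x => ∑ k ∈ Finset.range n, f x ^ k / (k.factorial : ℂ) :=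
    fun n => ContDiff.sum fun k _ => (hf.pow k).div_const _
  have hz : ∀ n : ℕ, Complex.exp (f 0) =
      ∑ k ∈ Finset.range (n + 1), f 0 ^ k / (k.factorial : ℂ) := by
    intro n
    rw [Finset.sum_range_succ']
    simp [h0]
  induction n with
  | zero => exact hz 0
  | succ n ih =>
    refine ⟨hz _, ?_⟩
    have e1 : dd 1 (fun x => ∑ k ∈ Finset.range (n + 1 + 1), f x ^ k / (k.factorial : ℂ)) =
        fun x => dd 1 f x * ∑ k ∈ Finset.range (n + 1), f x ^ k / (k.factorial : ℂ) := by
      rw [dd_sum _ (fun k _ => (hf.pow k).div_const _)]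
      funext x
      rw [Finset.sum_range_succ', Finset.mul_sum]
      have e2 : ∀ k : ℕ, dd 1 (fun x => f x ^ k / (k.factorial : ℂ)) =
          fun x => (k.factorial : ℂ)⁻¹ * (k * f x ^ (k - 1) * dd 1 f x) := by
        intro k
        simp only [div_eq_inv_mul]
        rw [dd_const_mul (hf.pow k), dd_pow hf]
      simp only [e2]
      simp only [Nat.factorial_succ, Nat.add_sub_cancel, Nat.cast_zero, zero_mul, mul_zero,
        add_zero]
      refine Finset.sum_congr rfl fun k _ => ?_
      have hk : (k.factorial : ℂ) ≠ 0 := by exact_mod_cast k.factorial_ne_zero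
      have hk' : (k : ℂ) + 1 ≠ 0 := by exact_mod_cast k.succ_ne_zero
      push_cast
      field_simp
    rw [dd_cexp hf, e1]
    exact mul (contDiff_dd hf 1) hf.cexp (contDiff_dd hf 1) (hs _) (refl n _) ih

end JetEq

lemma contDiff_ofReal_id : ContDiff ℝ ∞ fun x : ℝ => (x : ℂ) := Complex.ofRealCLM.contDiff

lemma dd_ofReal_pow (a : ℂ) (m : ℕ) :
    dd 1 (fun x : ℝ => a * (x : ℂ) ^ m) = fun x : ℝ => (a * m) * (x : ℂ) ^ (m - 1) := by
  rw [dd_const_mul (contDiff_ofReal_id.pow m), dd_pow contDiff_ofReal_id]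
  have := dd_ofReal_clm (ContinuousLinearMap.id ℝ ℝ) 1
  simp only [ContinuousLinearMap.id_apply] at this
  rw [this]
  funext x
  simp
  ring

lemma iterate_dd_ofReal_pow (n m : ℕ) (a : ℂ) :
    (dd 1)^[n] (fun x : ℝ => a * (x : ℂ) ^ m) 0 = if m = n then n.factorial * a else 0 := by
  induction n generalizing m a with
  | zero => cases m <;> simp
  | succ n ih =>
    rw [Function.iterate_succ, Function.comp, dd_ofReal_pow, ih]
    rcases m with m | m
    · simp
    · simp only [Nat.add_sub_cancel, Nat.add_right_cancel_iff]
      split_ifs with h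
      · subst h
        rw [Nat.factorial_succ]
        push_cast
        ring
      · rfl

lemma iterate_dd_sum {E α : Type*} [NormedAddCommGroup E] [NormedSpace ℝ E] (v : E) (n : ℕ)
    (s : Finset α) {f : α → E → ℂ} (hf : ∀ a ∈ s, ContDiff ℝ ∞ (f a)) :
    (dd v)^[n] (fun x => ∑ a ∈ s, f a x) = fun x => ∑ a ∈ s, (dd v)^[n] (f a) x := by
  induction n generalizing f with
  | zero => rfl
  | succ n ih =>
    rw [Function.iterate_succ, Function.comp, dd_sum s hf]
    exact ih fun a ha => contDiff_dd (hf a ha) v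

/-- The Taylor polynomial has the same jet. -/
lemma JetEq.taylor {f : ℝ → ℂ} (hf : ContDiff ℝ ∞ f) (n : ℕ) :
    JetEq n f (fun x => ∑ k ∈ Finset.range (n + 1),
      ((dd 1)^[k] f 0 / (k.factorial : ℂ)) * (x : ℂ) ^ k) := by
  induction n generalizing f with
  | zero => simp [JetEq]
  | succ n ih =>
    refine ⟨?_, ?_⟩
    · beta_reduce
      rw [Finset.sum_range_succ']
      simp
    · rw [dd_sum _ (fun k _ => contDiff_const.mul (contDiff_ofReal_id.pow k))]
      simp only [dd_ofReal_pow]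
      convert ih (contDiff_dd hf 1) using 1
      funext x
      rw [Finset.sum_range_succ']
      simp only [Nat.cast_zero, mul_zero, zero_mul, add_zero, Nat.add_sub_cancel,
        Nat.factorial_succ]
      refine Finset.sum_congr rfl fun k _ => ?_
      have hk : (k.factorial : ℂ) ≠ 0 := by exact_mod_cast k.factorial_ne_zero
      have hk' : (k : ℂ) + 1 ≠ 0 := by exact_mod_cast k.succ_ne_zero
      rw [Function.iterate_succ, Function.comp]
      push_cast
      field_simp

/-- The Taylor coefficients of `e^{iS}`, where `S` has the Taylor expansion
`ε L₀ + λ ∑ ε^j L_j`. -/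
lemma iterate_dd_cexp {S : ℝ → ℂ} (hS : ContDiff ℝ ∞ S) (lam : ℂ) (L : ℕ → ℂ) (n : ℕ)
    (hj : JetEq n S (fun ε => (ε : ℂ) * L 0 +
      lam * ∑ j : Fin n, (ε : ℂ) ^ ((j : ℕ) + 1) * L ((j : ℕ) + 1))) :
    (dd 1)^[n] (fun ε => Complex.exp (Complex.I * S ε)) 0 =
      n.factorial * ∑ k ∈ Finset.range (n + 1), lam ^ k * twisterCoeff n k L := by
  set a : Fin (n + 1) → ℂ := Fin.cons (Complex.I * L 0)
    (fun j => Complex.I * lam * L ((j : ℕ) + 1)) with ha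
  set e : Fin (n + 1) → ℕ := Fin.cons 1 (fun j => (j : ℕ) + 1) with he
  have ha0 : a 0 = Complex.I * L 0 := rfl
  have has : ∀ j : Fin n, a j.succ = Complex.I * lam * L ((j : ℕ) + 1) := fun j => rfl
  have he0 : e 0 = 1 := rfl
  have hes : ∀ j : Fin n, e j.succ = (j : ℕ) + 1 := fun j => rfl
  have hp : ∀ j, ContDiff ℝ ∞ fun ε : ℝ => a j * (ε : ℂ) ^ e j :=
    fun j => contDiff_const.mul (contDiff_ofReal_id.pow _)
  have hq : ContDiff ℝ ∞ (fun ε : ℝ => (ε : ℂ) * L 0 +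
      lam * ∑ j : Fin n, (ε : ℂ) ^ ((j : ℕ) + 1) * L ((j : ℕ) + 1)) :=
    (contDiff_ofReal_id.mul contDiff_const).add (contDiff_const.mul
      (ContDiff.sum fun j _ => (contDiff_ofReal_id.pow _).mul contDiff_const))
  -- the exponential of the Taylor polynomial is a product, of which each factor is expanded
  have h1 : JetEq n (fun ε => Complex.exp (Complex.I * S ε))
      (fun ε => ∏ j, Complex.exp (a j * (ε : ℂ) ^ e j)) := by
    refine (JetEq.cexp (contDiff_const.mul hS) (contDiff_const.mul hq)
      (JetEq.mul contDiff_const hS contDiff_const hq (JetEq.refl n _) hj)).trans ?_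
    convert JetEq.refl n _ using 1
    funext ε
    rw [← Complex.exp_sum, Fin.sum_univ_succ, ha0, he0]
    simp only [has, hes]
    rw [mul_add, Finset.mul_sum, Finset.mul_sum]
    congr 2
    · ring
    · exact Finset.sum_congr rfl fun j _ => by ring
  have h2 : JetEq n (fun ε => ∏ j, Complex.exp (a j * (ε : ℂ) ^ e j))
      (fun ε => ∏ j, ∑ k ∈ Finset.range (n + 1),
        (a j * (ε : ℂ) ^ e j) ^ k / (k.factorial : ℂ)) := by
    refine JetEq.prod _ (fun j => (hp j).cexp)
      (fun j => ContDiff.sum fun k _ => ((hp j).pow k).div_const _) fun j => ?_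
    refine JetEq.cexp_series (hp j) ?_ n
    have : e j ≠ 0 := by
      refine Fin.cases ?_ (fun j => ?_) j
      · simp [he0]
      · simp [hes]
    simp [this]
  rw [(h1.trans h2).iterate]
  simp only [Finset.prod_univ_sum]
  have h3 : ∀ (ε : ℝ) (κ : Fin (n + 1) → ℕ),
      ∏ j, (a j * (ε : ℂ) ^ e j) ^ κ j / ((κ j).factorial : ℂ) =
      (∏ j, a j ^ κ j / ((κ j).factorial : ℂ)) * (ε : ℂ) ^ (∑ j, e j * κ j) := by
    intro ε κ
    rw [← Finset.prod_pow_eq_pow_sum, ← Finset.prod_mul_distrib]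
    refine Finset.prod_congr rfl fun j _ => ?_
    rw [mul_pow, ← pow_mul]
    ring
  simp only [h3]
  rw [iterate_dd_sum _ _ _ (fun κ _ => contDiff_const.mul (contDiff_ofReal_id.pow _))]
  simp only [iterate_dd_ofReal_pow]
  rw [← Finset.sum_filter, ← Finset.mul_sum]
  congr 1
  -- the tuples of weight `n` are sorted by the number `k` of factors `λ`
  have hw : ∀ κ : Fin (n + 1) → ℕ,
      ∑ j, e j * κ j = κ 0 + ∑ j : Fin n, ((j : ℕ) + 1) * κ j.succ := by
    intro κ
    rw [Fin.sum_univ_succ, he0, one_mul]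
    simp only [hes]
  rw [← Finset.sum_fiberwise_of_maps_to (g := fun κ : Fin (n + 1) → ℕ => ∑ j : Fin n, κ j.succ)
    (t := Finset.range (n + 1))]
  · refine Finset.sum_congr rfl fun k _ => ?_
    rw [twisterCoeff, Finset.mul_sum, expIndices, Finset.filter_filter]
    simp only [hw]
    refine Finset.sum_congr (Finset.filter_congr fun κ _ => Iff.rfl) fun κ hκ => ?_
    have hk : ∑ j : Fin n, κ j.succ = k := (Finset.mem_filter.1 hκ).2.2
    rw [Finset.prod_div_distrib, Fin.prod_univ_succ (fun j => a j ^ κ j), ha0]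
    simp only [has, mul_pow]
    rw [Finset.prod_mul_distrib, Finset.prod_mul_distrib, Finset.prod_pow_eq_pow_sum,
      Finset.prod_pow_eq_pow_sum, hk, smul_eq_mul, Nat.cast_prod, pow_add]
    ring
  · intro κ hκ
    rw [Finset.mem_filter, hw] at hκ
    have h5 : ∑ j : Fin n, κ j.succ ≤ ∑ j : Fin n, ((j : ℕ) + 1) * κ j.succ :=
      Finset.sum_le_sum fun j _ => Nat.le_mul_of_pos_left _ (Nat.succ_pos _)
    have h6 := hκ.2
    rw [Finset.mem_range]
    omega

end Jets

end MagneticMoyal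

/-! ### The Taylor coefficients of the twister -/

namespace MagneticMoyal

section TaylorCoefficients

variable {E : Type*} [NormedAddCommGroup E] [NormedSpace ℝ E]

lemma iterate_dd_const_mul {f : E → ℂ} (hf : ContDiff ℝ ∞ f) (v : E) (n : ℕ) (c : ℂ) :
    (dd v)^[n] (fun x => c * f x) = fun x => c * (dd v)^[n] f x := by
  induction n generalizing f with
  | zero => rfl
  | succ n ih =>
    rw [Function.iterate_succ, Function.comp, dd_const_mul hf, ih (contDiff_dd hf v)]
    rfl

lemma dd_iterate_comm {f : E → ℂ} (hf : ContDiff ℝ ∞ f) (v w : E) (n : ℕ) :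
    dd v ((dd w)^[n] f) = (dd w)^[n] (dd v f) := by
  induction n generalizing f with
  | zero => rfl
  | succ n ih =>
    rw [Function.iterate_succ, Function.comp, Function.comp, ih (contDiff_dd hf w), dd_comm hf]

/-- The binomial formula for a derivative that acts as a sum of two commuting shifts. -/
lemma iterate_dd_binomial (v : E) {G : ℕ → ℕ → E → ℂ} (hs : ∀ c c', ContDiff ℝ ∞ (G c c'))
    (h : ∀ c c', dd v (G c c') = fun x => G (c + 1) c' x + G c (c' + 1) x) (m : ℕ) :
    (dd v)^[m] (G 0 0) =
      fun x => ∑ p ∈ Finset.HasAntidiagonal.antidiagonal m, (m.choose p.1 : ℂ) * G p.1 p.2 x := by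
  induction m with
  | zero => simp
  | succ m ih =>
    rw [Function.iterate_succ', Function.comp, ih,
      dd_sum _ (fun p _ => contDiff_const.mul (hs p.1 p.2))]
    funext x
    rw [Finset.sum_antidiagonal_choose_succ_mul (fun c c' => G c c' x), ← Finset.sum_add_distrib]
    refine Finset.sum_congr rfl fun p hp => ?_
    rw [dd_const_mul (hs _ _), h,
      ← Nat.choose_symm_of_eq_add (Finset.HasAntidiagonal.mem_antidiagonal.1 hp).symm]
    ring

lemma iteratedFDeriv_eq_ddw {f : E → ℂ} (hf : ContDiff ℝ ∞ f) (n : ℕ) (v : Fin n → E) (x : E) :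
    iteratedFDeriv ℝ n f x v = ddw id (List.ofFn v) f x := by
  induction n generalizing x with
  | zero => simp
  | succ n ih =>
    rw [iteratedFDeriv_succ_apply_left, List.ofFn_succ, ddw_cons]
    have h1 : ddw id (List.ofFn fun i => v i.succ) f =
        fun x => iteratedFDeriv ℝ n f x (Fin.tail v) := funext fun x => (ih _ x).symm
    have hd : DifferentiableAt ℝ (iteratedFDeriv ℝ n f) x :=
      (hf.differentiable_iteratedFDeriv (m := n) (by exact_mod_cast WithTop.coe_lt_top n)) x
    rw [h1, dd, fderiv_continuousMultilinear_apply_const_apply hd]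
    rfl

lemma ddw_replicate {κ : Type*} (dir : κ → E) (n : ℕ) (b : κ) (f : E → ℂ) :
    ddw dir (List.replicate n b) f = (dd (dir b))^[n] f := by
  induction n with
  | zero => rfl
  | succ n ih => rw [List.replicate_succ, ddw_cons, ih, Function.iterate_succ']; rfl

variable {d : ℕ}

/-- Repeated derivatives in two directions, in terms of the partial derivatives. -/
lemma iterate_dd_eq_sum {b : Config d → ℝ} (hb : ContDiff ℝ ∞ b) (y z : Config d) (c c' : ℕ)
    (x : Config d) :
    (dd y)^[c] ((dd z)^[c'] (fun x => (b x : ℂ))) x = ∑ μ : Fin (c + c') → Fin d,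
      (iteratedFDeriv ℝ (c + c') b x (fun i => stdVec (μ i)) : ℂ) *
        ∏ i : Fin (c + c'), if (i : ℕ) < c then (y (μ i) : ℂ) else (z (μ i) : ℂ) := by
  have hbc : ContDiff ℝ ∞ fun x => (b x : ℂ) := Complex.ofRealCLM.contDiff.comp hb
  set v : Fin (c + c') → Config d := fun i => if (i : ℕ) < c then y else z with hv
  have h1 : (dd y)^[c] ((dd z)^[c'] (fun x => (b x : ℂ))) x =
      (iteratedFDeriv ℝ (c + c') b x v : ℂ) := by
    have h2 : (iteratedFDeriv ℝ (c + c') b x v : ℂ) =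
        iteratedFDeriv ℝ (c + c') (fun x => (b x : ℂ)) x v := by
      have := Complex.ofRealCLM.iteratedFDeriv_comp_left (f := b) (x := x) (i := c + c')
        hb.contDiffAt (by exact_mod_cast le_top)
      exact (congrArg (fun A => A v) this).symm
    have h3 : v = Fin.append (fun _ => y) (fun _ => z) := by
      funext i
      refine Fin.addCases (fun i => ?_) (fun i => ?_) i <;> simp [hv]
    rw [h2, iteratedFDeriv_eq_ddw hbc, h3, List.ofFn_fin_append, List.ofFn_const, List.ofFn_const,
      ddw_append, ddw_replicate, ddw_replicate]
    rfl
  have h4 : v = fun i => ∑ k : Fin d, v i k • stdVec k := by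
    funext i
    exact (sum_smul_stdVec (v i)).symm
  rw [h1, h4, ContinuousMultilinearMap.map_sum, Complex.ofReal_sum]
  refine Finset.sum_congr rfl fun μ _ => ?_
  rw [ContinuousMultilinearMap.map_smul_univ, smul_eq_mul, Complex.ofReal_mul, mul_comm,
    Complex.ofReal_prod]
  congr 1
  refine Finset.prod_congr rfl fun i _ => ?_
  simp only [hv]
  split_ifs <;> rfl

/-- The moments of the triangle. -/
lemma integral_tri_moment (c c' : ℕ) :
    ∫ t : Tri, (t.1 : ℝ) * triA t ^ c * triB t ^ c' = 1 / ((c' : ℝ) + 1) *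
      (((1 / 2) ^ (c + c' + 2) - (-(1 / 2)) ^ (c + c' + 2)) / ((c : ℝ) + c' + 2) -
        (-(1 / 2)) ^ (c' + 1) * (((1 / 2) ^ (c + 1) - (-(1 / 2)) ^ (c + 1)) / ((c : ℝ) + 1))) := by
  have h1 := integral_tri_eq (h := fun u v : ℝ => (u - 1 / 2) ^ c * (v - 1 / 2) ^ c')
    (by fun_prop)
  have h2 : ∀ u : ℝ, ∫ v in (0 : ℝ)..u, (u - 1 / 2) ^ c * (v - 1 / 2) ^ c' =
      1 / ((c' : ℝ) + 1) * (u - 1 / 2) ^ (c + c' + 1) -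
        1 / ((c' : ℝ) + 1) * (-(1 / 2)) ^ (c' + 1) * (u - 1 / 2) ^ c := by
    intro u
    rw [intervalIntegral.integral_const_mul,
      intervalIntegral.integral_comp_sub_right (fun v => v ^ c'), integral_pow, zero_sub]
    ring
  have h3 : ∀ n : ℕ, ∫ u in (0 : ℝ)..1, (u - 1 / 2) ^ n =
      ((1 / 2) ^ (n + 1) - (-(1 / 2)) ^ (n + 1)) / ((n : ℝ) + 1) := by
    intro n
    rw [intervalIntegral.integral_comp_sub_right (fun u => u ^ n), integral_pow]
    norm_num
  have h4 : ∀ (a : ℝ) (n : ℕ), IntervalIntegrable (fun u : ℝ => a * (u - 1 / 2) ^ n) volume 0 1 :=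
    fun a n => Continuous.intervalIntegrable (by fun_prop) _ _
  simp only [h2] at h1
  rw [intervalIntegral.integral_sub (h4 _ _) (h4 _ _), intervalIntegral.integral_const_mul,
    intervalIntegral.integral_const_mul, h3, h3] at h1
  refine Eq.trans ?_ (h1.trans ?_)
  · simp only [triA, triB, smul_eq_mul, mul_assoc]
  · push_cast
    ring

/-- The moments give the coefficients of `𝓛_j`. -/
lemma choose_mul_moment (c c' m : ℕ) (hm : c + c' = m) :
    (m.choose c : ℂ) * ((∫ t : Tri, (t.1 : ℝ) * triA t ^ c * triB t ^ c' : ℝ) : ℂ) =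
      -(m.factorial * (1 / ((m + 1).factorial : ℂ) * (-(1 / 2)) ^ (m + 1 + 1) *
        (1 / (((m + 1 : ℕ) : ℂ) + 1) ^ 2) * ((m + 1 + 1).choose (c + 1) : ℂ) *
        ((1 - (-1) ^ (m + 1 + 1)) * ((c + 1 : ℕ) : ℂ) -
          (1 - (-1) ^ (c + 1)) * (((m + 1 : ℕ) : ℂ) + 1)))) := by
  subst hm
  have hch : ((c + c' + 1 + 1).choose (c + 1) : ℂ) * ((c + 1) * (c' + 1)) =
      (c + c').choose c * ((c + c' + 2) * (c + c' + 1)) := by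
    have h1 := Nat.add_choose_mul_factorial_mul_factorial c c'
    have h2 := Nat.add_choose_mul_factorial_mul_factorial (c + 1) (c' + 1)
    have h3 : c + 1 + (c' + 1) = c + c' + 1 + 1 := by ring
    rw [h3, Nat.factorial_succ (c + c' + 1), Nat.factorial_succ (c + c'), ← h1,
      Nat.factorial_succ c, Nat.factorial_succ c'] at h2
    have hc := Nat.factorial_pos c
    have hc' := Nat.factorial_pos c'
    have h5 : (c + c' + 1 + 1).choose (c + 1) * ((c + 1) * (c' + 1)) =
        (c + c').choose c * ((c + c' + 2) * (c + c' + 1)) := by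
      refine Nat.eq_of_mul_eq_mul_right (Nat.mul_pos hc hc') ?_
      rw [← h3, Nat.choose_symm_add, h3, Nat.choose_symm_add]
      linarith
    exact_mod_cast h5
  have n1 : ((c : ℂ) + 1) ≠ 0 := by exact_mod_cast c.succ_ne_zero
  have n2 : ((c' : ℂ) + 1) ≠ 0 := by exact_mod_cast c'.succ_ne_zero
  have n3 : ((c : ℂ) + c' + 1) ≠ 0 := by exact_mod_cast (c + c').succ_ne_zero
  have n4 : ((c : ℂ) + c' + 2) ≠ 0 := by exact_mod_cast (c + c' + 1).succ_ne_zero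
  have n4' : ((c : ℂ) + c' + 1 + 1) ≠ 0 := by exact_mod_cast (c + c' + 1).succ_ne_zero
  have n5 : ((c + c').factorial : ℂ) ≠ 0 := by exact_mod_cast (c + c').factorial_ne_zero
  have hch' : ((c + c' + 1 + 1).choose (c + 1) : ℂ) =
      (c + c').choose c * ((c + c' + 2) * (c + c' + 1)) / ((c + 1) * (c' + 1)) := by
    rw [eq_div_iff (mul_ne_zero n1 n2), hch]
  rw [integral_tri_moment, hch', Nat.factorial_succ]
  push_cast
  have e1 : ∀ n : ℕ, (-(1 / 2) : ℂ) ^ n = (-1) ^ n * (1 / 2) ^ n := fun n => by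
    rw [← mul_pow]; norm_num
  have e2 : ((c : ℂ) + c' + 1 + 1) = c + c' + 2 := by ring
  have e3 : c + c' + 1 + 1 = (c + 1) + (c' + 1) := by ring
  have s1 : ((-1 : ℂ) ^ (c + 1)) ^ 2 = 1 := by rw [← pow_mul, mul_comm, pow_mul]; norm_num
  have s2 : ((-1 : ℂ) ^ (c' + 1)) ^ 2 = 1 := by rw [← pow_mul, mul_comm, pow_mul]; norm_num
  rw [e2, e3]
  simp only [e1, pow_add _ (c + 1) (c' + 1)]
  -- what remains is an identity between rational functions of `c`, `c'` and these powers
  generalize ((-1 : ℂ) ^ (c + 1)) = p at *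
  generalize ((-1 : ℂ) ^ (c' + 1)) = q at *
  generalize ((1 / 2 : ℂ) ^ (c + 1)) = P
  generalize ((1 / 2 : ℂ) ^ (c' + 1)) = Q
  generalize ((c + c').choose c : ℂ) = ch
  field_simp
  have t1 : q * p * (1 - q * p) = q * p - 1 := by linear_combination (-q^2) * s1 - s2
  have t2 : q * p * (1 - p) = q * p - q := by linear_combination (-q) * s1
  linear_combination ch * P * Q * (((c : ℂ) + 1) * t1 - (c + c' + 2) * t2)

/-- Repeated derivatives of the components of the flux form along a ray. -/
lemma iterate_dd_fluxH {B : Fin d → Fin d → Config d → ℝ} (hB : ∀ k l, IsBCInfty (B k l))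
    (k l : Fin d) (x y z : Config d) (m : ℕ) :
    (dd 1)^[m] (fun ε : ℝ => fluxH B k l (x, ε • (y, z))) 0 =
      ∑ c ∈ Finset.range (m + 1), (m.choose c : ℂ) *
        ((∫ t : Tri, (t.1 : ℝ) * triA t ^ c * triB t ^ (m - c) : ℝ) : ℂ) *
        (dd y)^[c] ((dd z)^[m - c] (fun x => (B k l x : ℂ))) x := by
  set b : Config d → ℂ := fun x => (B k l x : ℂ) with hb
  have hbb : BCInfty b := bcInfty_ofReal (hB k l)
  have hit : ∀ (v : Config d) (n : ℕ) {b : Config d → ℂ}, BCInfty b → BCInfty ((dd v)^[n] b) := by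
    intro v n
    induction n with
    | zero => exact fun h => h
    | succ n ih => exact fun h => ih (h.dd v)
  set w : ℕ → ℕ → Tri → ℝ := fun c c' t => (t.1 : ℝ) * triA t ^ c * triB t ^ c' with hw
  have hwc : ∀ c c', Continuous (w c c') := fun c c' => by simp only [hw]; fun_prop
  have hbc : ∀ c c', BCInfty ((dd y)^[c] ((dd z)^[c'] b)) := fun c c' => hit _ _ (hit _ _ hbb)
  have hray : ∀ h : Config d × Phase d → ℂ, ContDiff ℝ ∞ h →
      (dd 1)^[m] (fun ε : ℝ => h (x, ε • (y, z))) =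
        fun ε : ℝ => (dd ((0 : Config d), (y, z)))^[m] h (x, ε • (y, z)) := by
    have hA : ∀ ε : ℝ, HasFDerivAt (fun ε : ℝ => (x, ε • ((y, z) : Phase d)))
        ((0 : ℝ →L[ℝ] Config d).prod ((ContinuousLinearMap.id ℝ ℝ).smulRight (y, z))) ε :=
      fun ε => (hasFDerivAt_const x ε).prodMk
        (((ContinuousLinearMap.id ℝ ℝ).smulRight ((y, z) : Phase d)).hasFDerivAt)
    induction m with
    | zero => exact fun h _ => rfl
    | succ m ih =>
      intro h hh
      rw [Function.iterate_succ, Function.comp, dd_comp_clm hh hA]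
      simp only [ContinuousLinearMap.prod_apply, zero_apply, ContinuousLinearMap.smulRight_apply,
        ContinuousLinearMap.id_apply, one_smul]
      exact ih _ (contDiff_dd hh _)
  have hG : fluxH B k l = triAvg ((dd y)^[0] ((dd z)^[0] b)) (w 0 0) := by
    simp [fluxH, hw, hb]
  have hsG : ∀ c c', ContDiff ℝ ∞ (triAvg ((dd y)^[c] ((dd z)^[c'] b)) (w c c')) :=
    fun c c' => contDiff_triAvg (hbc c c') (hwc c c')
  -- each derivative along the ray hits one of the two sides `y`, `z`, with weight `triA` or `triB`
  rw [hray _ (by rw [hG]; exact hsG 0 0), hG, iterate_dd_binomial _ (G := fun c c' =>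
    triAvg ((dd y)^[c] ((dd z)^[c'] b)) (w c c')) hsG]
  · beta_reduce
    rw [Finset.Nat.sum_antidiagonal_eq_sum_range_succ_mk]
    refine Finset.sum_congr rfl fun c _ => ?_
    have hx : ∀ t : Tri, triL t (x, (0 : ℝ) • (y, z)) = x := by
      intro t
      simp [triL_apply]
    rw [mul_assoc]
    congr 1
    simp only [triAvg, hx]
    rw [integral_mul_const, integral_complex_ofReal]
  · intro c c'
    rw [dd_triAvg (hbc c c') (hwc c c')]
    funext q
    simp only [dd_zero_dir, triAvg_zero, zero_add]
    rw [dd_iterate_comm (hit z c' hbb).1 z y, ← Function.iterate_succ_apply' (dd y),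
      ← Function.iterate_succ_apply' (dd z)]
    congr 2 <;> (funext t; simp only [hw]; ring)

/-- The Taylor coefficients of the flux at `ε = 0`. -/
lemma iterate_dd_fluxForm {B : Fin d → Fin d → Config d → ℝ} (hB : ∀ k l, IsBCInfty (B k l))
    (x : Config d) (Y Z : Phase d) (m : ℕ) :
    (dd 1)^[m] (fun ε : ℝ => (fluxForm B ε x (Y.1, Z.1) : ℂ)) 0 =
      -(m.factorial * calLValue B x Y Z (m + 1)) := by
  have hc : ∀ k l, ContDiff ℝ ∞ fun ε : ℝ => fluxH B k l (x, ε • (Y.1, Z.1)) := fun k l =>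
    (BoundedAmp.fluxH hB k l).1.comp (contDiff_const.prodMk (contDiff_id.smul contDiff_const))
  simp only [ofReal_fluxForm]
  rw [iterate_dd_sum _ _ _ (fun k _ => ContDiff.sum fun l _ => contDiff_const.mul (hc k l))]
  beta_reduce
  rw [calLValue, if_neg m.succ_ne_zero, calL, ← mul_neg, ← Finset.sum_neg_distrib, Finset.mul_sum]
  refine Finset.sum_congr rfl fun k _ => ?_
  rw [iterate_dd_sum _ _ _ (fun l _ => contDiff_const.mul (hc k l))]
  beta_reduce
  rw [← Finset.sum_neg_distrib, Finset.mul_sum]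
  refine Finset.sum_congr rfl fun l _ => ?_
  rw [iterate_dd_const_mul (hc k l)]
  beta_reduce
  rw [iterate_dd_fluxH hB, Finset.sum_comm, ← Finset.sum_neg_distrib, Finset.mul_sum,
    Finset.mul_sum, Finset.range_eq_Ico,
    show Finset.Icc 1 (m + 1) = Finset.Ico (0 + 1) (m + 1 + 1) by ext; simp,
    ← Finset.sum_Ico_add']
  refine Finset.sum_congr rfl fun c hc => ?_
  obtain ⟨c', rfl⟩ : ∃ c', m = c + c' := ⟨m - c, by have := (Finset.mem_Ico.1 hc).2; omega⟩
  rw [Nat.add_sub_cancel_left, iterate_dd_eq_sum (hB k l).1, choose_mul_moment c c' _ rfl,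
    Finset.mul_sum, Finset.mul_sum, ← Finset.sum_neg_distrib, Finset.mul_sum]
  refine Finset.sum_congr rfl fun μ _ => ?_
  simp only [Nat.add_lt_add_iff_right, smul_eq_mul]
  change _ = _ * -(_ * ((iteratedFDeriv ℝ (c + c') (B k l) x fun i => stdVec (μ i) : ℝ) : ℂ) *
    _ * _ * _ * _ * (_ * ∏ i : Fin (c + c'), _))
  ring

/-- Multiplication by the variable determines one more derivative. -/
lemma JetEq.id_mul {f g : ℝ → ℂ} (hf : ContDiff ℝ ∞ f) (hg : ContDiff ℝ ∞ g) {n : ℕ}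
    (h : JetEq n f g) : JetEq (n + 1) (fun x => (x : ℂ) * f x) (fun x => (x : ℂ) * g x) := by
  have hd : ∀ {f : ℝ → ℂ}, ContDiff ℝ ∞ f →
      dd 1 (fun x : ℝ => (x : ℂ) * f x) = fun x : ℝ => f x + (x : ℂ) * dd 1 f x := by
    intro f hf
    have h1 := dd_ofReal_clm (ContinuousLinearMap.id ℝ ℝ) 1
    simp only [ContinuousLinearMap.id_apply] at h1
    rw [dd_mul contDiff_ofReal_id hf, h1]
    simp
  induction n generalizing f g with
  | zero =>
    refine ⟨by simp, ?_⟩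
    rw [hd hf, hd hg]
    simpa [JetEq] using h
  | succ n ih =>
    refine ⟨by simp, ?_⟩
    rw [hd hf, hd hg]
    have df := contDiff_dd hf 1
    have dg := contDiff_dd hg 1
    exact JetEq.add hf (contDiff_ofReal_id.mul df) hg (contDiff_ofReal_id.mul dg) h (ih df dg h.2)

lemma calLValue_zero (B : Fin d → Fin d → Config d → ℝ) (x : Config d) (Y Z : Phase d) :
    calLValue B x Y Z 0 = ((symp Y Z / 2 : ℝ) : ℂ) := by
  simp only [calLValue, if_pos, calLZero, symp, smul_eq_mul]
  push_cast
  ring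

/-- The Taylor coefficients of the oscillating factor at `ε = 0` are the terms of the expansion
of the twister. -/
lemma iterate_dd_parExp {B : Fin d → Fin d → Config d → ℝ} (hB : ∀ k l, IsBCInfty (B k l))
    (lam : ℝ) (X : Phase d) (P : Phase d × Phase d) (n : ℕ) :
    (dd 1)^[n] (fun ε : ℝ => parExp B (ε, lam, X) P) 0 =
      Complex.exp (Complex.I * symp X (P.1 + P.2)) * (n.factorial *
        ∑ k ∈ Finset.range (n + 1), (lam : ℂ) ^ k *
          twisterCoeff n k (calLValue B X.1 P.1 P.2)) := by
  set L := calLValue B X.1 P.1 P.2 with hL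
  set φ : ℝ → ℂ := fun ε => (fluxForm B ε X.1 (P.1.1, P.2.1) : ℂ) with hφ
  have hφs : ContDiff ℝ ∞ φ := by
    simp only [hφ, ofReal_fluxForm]
    exact ContDiff.sum fun k _ => ContDiff.sum fun l _ => contDiff_const.mul
      ((BoundedAmp.fluxH hB k l).1.comp (contDiff_const.prodMk (contDiff_id.smul contDiff_const)))
  set S : ℝ → ℂ := fun ε => (ε : ℂ) * L 0 + lam * ((ε : ℂ) * -φ ε) with hS
  have hSs : ContDiff ℝ ∞ S := (contDiff_ofReal_id.mul contDiff_const).add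
    (contDiff_const.mul (contDiff_ofReal_id.mul hφs.neg))
  have hj : JetEq n S (fun ε => (ε : ℂ) * L 0 +
      lam * ∑ j : Fin n, (ε : ℂ) ^ ((j : ℕ) + 1) * L ((j : ℕ) + 1)) := by
    cases n with
    | zero => simp [JetEq, hS]
    | succ n =>
      have hps : ContDiff ℝ ∞ fun x : ℝ => ∑ k ∈ Finset.range (n + 1),
          ((dd 1)^[k] (fun ε => -φ ε) 0 / (k.factorial : ℂ)) * (x : ℂ) ^ k :=
        ContDiff.sum fun k _ => contDiff_const.mul (contDiff_ofReal_id.pow k)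
      -- the factor `ε` in front of the flux raises the order of agreement by one
      have h1 := ((JetEq.taylor hφs.neg n).id_mul hφs.neg hps)
      have h2 := JetEq.add (contDiff_ofReal_id.mul contDiff_const)
        (contDiff_const.mul (contDiff_ofReal_id.mul hφs.neg))
        (contDiff_ofReal_id.mul contDiff_const)
        (contDiff_const.mul (contDiff_ofReal_id.mul hps))
        (JetEq.refl (n + 1) (fun x : ℝ => (x : ℂ) * L 0))
        (JetEq.mul contDiff_const (contDiff_ofReal_id.mul hφs.neg) contDiff_const
          (contDiff_ofReal_id.mul hps) (JetEq.refl (n + 1) (fun _ => (lam : ℂ))) h1)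
      convert h2 using 1
      funext x
      congr 2
      rw [Fin.sum_univ_eq_sum_range (fun j => (x : ℂ) ^ (j + 1) * L (j + 1)), Finset.mul_sum]
      refine Finset.sum_congr rfl fun k _ => ?_
      have h3 : (dd 1)^[k] (fun ε => -φ ε) 0 = k.factorial * L (k + 1) := by
        have h4 : (fun ε => -φ ε) = fun ε => (-1) * φ ε := by funext ε; ring
        rw [h4, iterate_dd_const_mul hφs]
        beta_reduce
        rw [iterate_dd_fluxForm hB]
        ring
      have hk : (k.factorial : ℂ) ≠ 0 := by exact_mod_cast k.factorial_ne_zero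
      rw [h3, mul_div_cancel_left₀ _ hk]
      ring
  have e1 : (fun ε : ℝ => parExp B (ε, lam, X) P) = fun ε =>
      Complex.exp (Complex.I * symp X (P.1 + P.2)) * Complex.exp (Complex.I * S ε) := by
    funext ε
    rw [parExp, parPhase, ← Complex.exp_add, hS, hL, calLValue_zero]
    congr 1
    simp only [hφ]
    push_cast
    ring
  rw [e1, iterate_dd_const_mul (contDiff_const.mul hSs).cexp]
  beta_reduce
  rw [iterate_dd_cexp hSs _ L n hj]

end TaylorCoefficients

end MagneticMoyal

/-! ### Multi-indices and bidifferential operators -/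

namespace MagneticMoyal

section MultiIndices

variable {d : ℕ}

/-- The word of directions of the partial derivative `∂_x^a ∂_ξ^α`. -/
def wordOf (a α : Fin d → ℕ) : List (Fin d ⊕ Fin d) :=
  (List.finRange d).flatMap (fun l => List.replicate (a l) (Sum.inl l)) ++
    (List.finRange d).flatMap (fun l => List.replicate (α l) (Sum.inr l))

/-- On smooth functions the iterated partial derivatives, defined by `lineDeriv`, are those by
`fderiv`. -/
lemma phaseDeriv_eq_ddw {f : Phase d → ℂ} (hf : ContDiff ℝ ∞ f) (a α : Fin d → ℕ) :
    phaseDeriv a α f = ddw phDir (wordOf a α) f := by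
  have h1 : ∀ (D : Fin d → (Phase d → ℂ) → Phase d → ℂ) (s : Fin d → Fin d ⊕ Fin d),
      (∀ l {h : Phase d → ℂ}, ContDiff ℝ ∞ h → D l h = dd (phDir (s l)) h) →
      ∀ (a : Fin d → ℕ) (L : List (Fin d)) {h : Phase d → ℂ}, ContDiff ℝ ∞ h →
        L.foldr (fun l h => (D l)^[a l] h) h =
          ddw phDir (L.flatMap fun l => List.replicate (a l) (s l)) h := by
    intro D s hD a L h hh
    induction L with
    | nil => rfl
    | cons l L ih =>
      rw [List.foldr_cons, ih, List.flatMap_cons, ddw_append, ddw_replicate]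
      have h2 : ∀ (n : ℕ) {h : Phase d → ℂ}, ContDiff ℝ ∞ h →
          (D l)^[n] h = (dd (phDir (s l)))^[n] h := by
        intro n
        induction n with
        | zero => exact fun _ => rfl
        | succ n ih =>
          intro h hh
          rw [Function.iterate_succ_apply, Function.iterate_succ_apply, hD l hh,
            ih (contDiff_dd hh _)]
      exact h2 _ (contDiff_ddw _ _ hh)
  have hx : ∀ l {h : Phase d → ℂ}, ContDiff ℝ ∞ h → partialX l h = dd (phDir (.inl l)) h :=
    fun l h hh => funext fun X => (hh.differentiable_infty X).lineDeriv_eq_fderiv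
  have hxi : ∀ l {h : Phase d → ℂ}, ContDiff ℝ ∞ h → partialXi l h = dd (phDir (.inr l)) h :=
    fun l h hh => funext fun X => (hh.differentiable_infty X).lineDeriv_eq_fderiv
  rw [phaseDeriv, h1 partialXi Sum.inr hxi α _ hf, h1 partialX Sum.inl hx a _ (contDiff_ddw _ _ hf),
    wordOf, ddw_append]

lemma freq_wordOf (a α : Fin d → ℕ) : freq (wordOf a α) = ∑ l, α l := by
  have h1 : ∀ (L : List (Fin d)),
      freq (L.flatMap fun l => List.replicate (a l) (Sum.inl l)) = 0 := by
    intro L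
    induction L with
    | nil => rfl
    | cons l L ih => simp [List.flatMap_cons, ih]; simp [freq]
  have h2 : ∀ (L : List (Fin d)),
      freq (L.flatMap fun l => List.replicate (α l) (Sum.inr l)) = (L.map α).sum := by
    intro L
    induction L with
    | nil => rfl
    | cons l L ih => simp [List.flatMap_cons, ih]; simp [freq]
  rw [wordOf, freq_append, h1, h2, Fin.sum_univ_def, zero_add]

instance instLawfulBEqSum {α β : Type*} [BEq α] [BEq β] [LawfulBEq α] [LawfulBEq β] :
    LawfulBEq (α ⊕ β) where
  eq_of_beq {a b} h := by
    cases a <;> cases b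
    · exact congrArg Sum.inl (eq_of_beq h)
    · exact absurd h Bool.false_ne_true
    · exact absurd h Bool.false_ne_true
    · exact congrArg Sum.inr (eq_of_beq h)
  rfl {a} := by
    cases a with
    | inl a => exact (beq_self_eq_true a)
    | inr a => exact (beq_self_eq_true a)

/-- Every word of directions is a rearrangement of the word of its multi-indices. -/
lemma perm_wordOf (W : List (Fin d ⊕ Fin d)) :
    W.Perm (wordOf (fun l => W.count (.inl l)) (fun l => W.count (.inr l))) := by
  rw [List.perm_iff_count]
  intro b
  have h1 : ∀ (n : Fin d → ℕ) (s : Fin d → Fin d ⊕ Fin d),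
      ((List.finRange d).flatMap fun l => List.replicate (n l) (s l)).count b =
        ∑ l, if s l = b then n l else 0 := by
    intro n s
    rw [List.count_flatMap, Fin.sum_univ_def]
    congr 2
    funext l
    simp [List.count_replicate]
  rw [wordOf, List.count_append, h1, h1]
  cases b <;> simp

lemma IsSymbol.symFamily {m ρ : ℝ} {f : Phase d → ℂ} (hf : IsSymbol m ρ f) :
    SymFamily ρ m (fun _ : Unit => f) := by
  refine symFamily_of_bound (fun _ => hf.1) fun W => ?_
  obtain ⟨C, hC, hb⟩ := hf.2 (fun l => W.count (.inl l)) (fun l => W.count (.inr l))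
  refine ⟨C, hC.le, fun _ Y => ?_⟩
  have h1 := hb Y
  rw [phaseDeriv_eq_ddw hf.1, ← ddw_perm phDir (perm_wordOf W) hf.1, ← Nat.cast_sum,
    ← freq_wordOf (fun l => W.count (.inl l)) (fun l => W.count (.inr l))] at h1
  have h2 : freq (wordOf (fun l => W.count (.inl l)) (fun l => W.count (.inr l))) = freq W :=
    ((perm_wordOf W).symm.map _).sum_eq
  rwa [h2] at h1

/-- The seminorm bounds of the symbol classes in terms of words of directions. -/
lemma seminormLE_of_ddw {m ρ : ℝ} {f : Phase d → ℂ} (hf : ContDiff ℝ ∞ f) {a α : Fin d → ℕ} {C : ℝ}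
    (h : ∀ X, ‖ddw phDir (wordOf a α) f X‖ ≤ C * japanese X.2 ^ (m - freq (wordOf a α) * ρ)) :
    SeminormLE m ρ a α f C := by
  intro X
  have := h X
  rwa [freq_wordOf, Nat.cast_sum, ← phaseDeriv_eq_ddw hf] at this

lemma IsSymbol.of_ddw {m ρ : ℝ} {f : Phase d → ℂ} (hf : ContDiff ℝ ∞ f)
    (h : ∀ W, ∃ C, 0 ≤ C ∧ ∀ X, ‖ddw phDir W f X‖ ≤ C * japanese X.2 ^ (m - freq W * ρ)) :
    IsSymbol m ρ f := by
  refine ⟨hf, fun a α => ?_⟩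
  obtain ⟨C, hC, hb⟩ := h (wordOf a α)
  refine ⟨C + 1, by positivity, seminormLE_of_ddw hf fun X => (hb X).trans ?_⟩
  exact mul_le_mul_of_nonneg_right (by linarith) (Real.rpow_nonneg (japanese_pos _).le _)

end MultiIndices

section Bidiff

variable {d : ℕ}

/-- The sum over all formal partial derivatives, split into the four groups. -/
noncomputable def dSymEquiv (d : ℕ) : (Fin d ⊕ Fin d) ⊕ (Fin d ⊕ Fin d) ≃ DSym d where
  toFun := Sum.elim (Sum.elim DSym.dy DSym.deta) (Sum.elim DSym.dz DSym.dzeta)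
  invFun
    | .dy l => .inl (.inl l)
    | .deta l => .inl (.inr l)
    | .dz l => .inr (.inl l)
    | .dzeta l => .inr (.inr l)
  left_inv b := by rcases b with (b | b) | (b | b) <;> rfl
  right_inv b := by cases b <;> rfl

/-- The values that the formal partial derivatives take under the Fourier transform. -/
noncomputable def dSymValue (P : Phase d × Phase d) : DSym d → ℂ
  | .dy l => Complex.I * dualCoord (.inl l) P.1
  | .deta l => Complex.I * dualCoord (.inr l) P.1
  | .dz l => Complex.I * dualCoord (.inl l) P.2
  | .dzeta l => Complex.I * dualCoord (.inr l) P.2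

lemma evw_wordOf (a α : Fin d → ℕ) (Y : Phase d) :
    evw (wordOf a α) Y = (∏ l, (Complex.I * dualCoord (.inl l) Y) ^ a l) *
      ∏ l, (Complex.I * dualCoord (.inr l) Y) ^ α l := by
  have h1 : ∀ (n : Fin d → ℕ) (s : Fin d → Fin d ⊕ Fin d) (L : List (Fin d)),
      evw (L.flatMap fun l => List.replicate (n l) (s l)) Y =
        (L.map fun l => (Complex.I * (dualCoord (s l) Y : ℂ)) ^ n l).prod := by
    intro n s L
    induction L with
    | nil => rfl
    | cons l L ih =>
      rw [List.flatMap_cons, evw_append, ih, List.map_cons, List.prod_cons]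
      simp [evw]
  rw [wordOf, evw_append, h1, h1, Fin.prod_univ_def, Fin.prod_univ_def]

lemma aeval_dSymValue (p : MvPolynomial (DSym d) ℂ) (P : Phase d × Phase d) :
    MvPolynomial.aeval (dSymValue P) p = ∑ s ∈ p.support, p.coeff s *
      (evw (wordOf (fun l => s (.dy l)) (fun l => s (.deta l))) P.1 *
        evw (wordOf (fun l => s (.dz l)) (fun l => s (.dzeta l))) P.2) := by
  let _ : Fintype (DSym d) := Fintype.ofEquiv _ (dSymEquiv d)
  rw [MvPolynomial.aeval_def, MvPolynomial.eval₂_eq']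
  refine Finset.sum_congr rfl fun s _ => ?_
  rw [← Equiv.prod_comp (dSymEquiv d), Fintype.prod_sum_type, Fintype.prod_sum_type,
    Fintype.prod_sum_type, evw_wordOf, evw_wordOf]
  rfl

lemma integrable_evw {F G : Phase d → ℂ} (hF : Rapid F) (hG : Rapid G) (a b : List (Fin d ⊕ Fin d))
    (X : Phase d) : Integrable fun P : Phase d × Phase d =>
      Complex.exp (Complex.I * symp X (P.1 + P.2)) * (evw a P.1 * evw b P.2) *
        (sympFourier F P.1 * sympFourier G P.2) := by
  have h := (integrable_kernelIntegrand (hF.ddw a) (hG.ddw b) (K := fun _ _ _ => 1) (X := X)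
    continuous_const (C := 1) (p := 0) (fun P => by simp))
  refine h.congr (ae_of_all _ fun P => ?_)
  simp only [kernelIntegrand, sympFourier_ddw hF, sympFourier_ddw hG]
  ring

/-- Multiplication by monomials on the Fourier side is differentiation. -/
lemma integral_evw {F G : Phase d → ℂ} (hF : Rapid F) (hG : Rapid G) (a b : List (Fin d ⊕ Fin d))
    (X : Phase d) :
    1 / (2 * (Real.pi : ℂ)) ^ (2 * d) * ∫ P : Phase d × Phase d,
      Complex.exp (Complex.I * symp X (P.1 + P.2)) * (evw a P.1 * evw b P.2) *
        (sympFourier F P.1 * sympFourier G P.2) = ddw phDir a F X * ddw phDir b G X := by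
  have h1 : ∀ P : Phase d × Phase d,
      Complex.exp (Complex.I * symp X (P.1 + P.2)) * (evw a P.1 * evw b P.2) *
        (sympFourier F P.1 * sympFourier G P.2) =
      (Complex.exp (Complex.I * symp X P.1) * sympFourier (ddw phDir a F) P.1) *
        (Complex.exp (Complex.I * symp X P.2) * sympFourier (ddw phDir b G) P.2) := by
    intro P
    rw [sympFourier_ddw hF, sympFourier_ddw hG, symp_add_right, Complex.ofReal_add, mul_add,
      Complex.exp_add]
    ring
  simp only [h1]
  rw [Measure.volume_eq_prod, integral_prod_mul
    (fun Y => Complex.exp (Complex.I * symp X Y) * sympFourier (ddw phDir a F) Y)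
    (fun Z => Complex.exp (Complex.I * symp X Z) * sympFourier (ddw phDir b G) Z),
    ← sympFourier_sympFourier (hF.ddw a) X, ← sympFourier_sympFourier (hG.ddw b) X]
  conv_rhs => rw [sympFourier, sympFourier]
  rw [mul_comm 2 d, pow_mul]
  ring

lemma integrable_aeval {F G : Phase d → ℂ} (hF : Rapid F) (hG : Rapid G)
    (p : MvPolynomial (DSym d) ℂ) (X : Phase d) : Integrable fun P : Phase d × Phase d =>
      Complex.exp (Complex.I * symp X (P.1 + P.2)) * MvPolynomial.aeval (dSymValue P) p *
        (sympFourier F P.1 * sympFourier G P.2) := by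
  simp only [aeval_dSymValue, Finset.mul_sum, Finset.sum_mul]
  refine integrable_finsetSum _ fun s _ => ?_
  refine ((integrable_evw hF hG (wordOf (fun l => s (.dy l)) fun l => s (.deta l))
    (wordOf (fun l => s (.dz l)) fun l => s (.dzeta l)) X).const_mul (p.coeff s)).congr
    (ae_of_all _ fun P => ?_)
  beta_reduce
  ring

/-- The kernel integral of a polynomial is a bidifferential operator. -/
lemma integral_aeval {F G : Phase d → ℂ} (hF : Rapid F) (hG : Rapid G)
    (p : MvPolynomial (DSym d) ℂ) (X : Phase d) :
    1 / (2 * (Real.pi : ℂ)) ^ (2 * d) * ∫ P : Phase d × Phase d,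
      Complex.exp (Complex.I * symp X (P.1 + P.2)) * MvPolynomial.aeval (dSymValue P) p *
        (sympFourier F P.1 * sympFourier G P.2) = applyBidiff p F G X := by
  have h1 : ∀ P : Phase d × Phase d, Complex.exp (Complex.I * symp X (P.1 + P.2)) *
      MvPolynomial.aeval (dSymValue P) p * (sympFourier F P.1 * sympFourier G P.2) =
      ∑ s ∈ p.support, p.coeff s * (Complex.exp (Complex.I * symp X (P.1 + P.2)) *
        (evw (wordOf (fun l => s (.dy l)) (fun l => s (.deta l))) P.1 *
          evw (wordOf (fun l => s (.dz l)) (fun l => s (.dzeta l))) P.2) *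
        (sympFourier F P.1 * sympFourier G P.2)) := by
    intro P
    rw [aeval_dSymValue, Finset.mul_sum, Finset.sum_mul]
    exact Finset.sum_congr rfl fun s _ => by ring
  simp only [h1]
  rw [integral_finsetSum _ fun s _ => (integrable_evw hF hG _ _ X).const_mul _, Finset.mul_sum,
    applyBidiff]
  refine Finset.sum_congr rfl fun s _ => ?_
  rw [integral_const_mul, phaseDeriv_eq_ddw hF.1, phaseDeriv_eq_ddw hG.1, mul_left_comm,
    integral_evw hF hG, mul_assoc]

section AlgHom

variable {R S : Type} [CommRing R] [Algebra ℂ R] [CommRing S] [Algebra ℂ S]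

lemma map_twisterCoeff (φ : R →ₐ[ℂ] S) (n k : ℕ) (L : ℕ → R) :
    φ (twisterCoeff n k L) = twisterCoeff n k fun j => φ (L j) := by
  simp only [twisterCoeff, map_sum, map_smul, map_mul, map_pow, map_prod]

lemma map_calL (φ : R →ₐ[ℂ] S) (B : Fin d → Fin d → Config d → ℝ) (j : ℕ) (x : Config d)
    (y z : Fin d → R) : φ (calL B j x y z) = calL B j x (fun l => φ (y l)) fun l => φ (z l) := by
  simp only [calL, map_sum, map_smul, map_mul, map_prod, apply_ite φ]

lemma map_calLZero (φ : R →ₐ[ℂ] S) (y η z ζ : Fin d → R) :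
    φ (calLZero y η z ζ) = calLZero (fun l => φ (y l)) (fun l => φ (η l)) (fun l => φ (z l))
      fun l => φ (ζ l) := by
  simp only [calLZero, map_smul, map_sub, map_sum, map_mul]

end AlgHom

/-- The symbol of the bidifferential operator of order `(n, k)`. -/
lemma aeval_twisterCoeff (B : Fin d → Fin d → Config d → ℝ) (x : Config d) (n k : ℕ)
    (P : Phase d × Phase d) :
    MvPolynomial.aeval (dSymValue P) (twisterCoeff n k (diffOp B x)) =
      twisterCoeff n k (calLValue B x P.1 P.2) := by
  rw [map_twisterCoeff]
  congr 1
  funext j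
  have hI : ∀ a : ℂ, -Complex.I * (Complex.I * a) = a := fun a => by
    linear_combination (-a) * Complex.I_mul_I
  rw [diffOp, calLValue]
  split_ifs with hj
  · rw [map_calLZero]
    simp only [MvPolynomial.aeval_X, dSymValue, calLZero, dualCoord, Sum.elim_inl, Sum.elim_inr,
      smul_eq_mul, ← Finset.sum_sub_distrib]
    congr 1
    refine Finset.sum_congr rfl fun l _ => ?_
    push_cast
    linear_combination ((P.1.2 l : ℂ) * P.2.1 l - P.1.1 l * P.2.2 l) * (- Complex.I_mul_I)
  · rw [map_calL]
    simp only [map_smul, MvPolynomial.aeval_X, dSymValue, smul_eq_mul, hI]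
    rfl

end Bidiff

end MagneticMoyal

/-! ### The expansion for rapidly decreasing functions -/

namespace MagneticMoyal

section Expansion

variable {d : ℕ} {B : Fin d → Fin d → Config d → ℝ}

lemma ddw_comp_clm {E E' κ : Type*} [NormedAddCommGroup E] [NormedSpace ℝ E]
    [NormedAddCommGroup E'] [NormedSpace ℝ E'] {f : E' → ℂ} (hf : ContDiff ℝ ∞ f) {A : E → E'}
    {L : E →L[ℝ] E'} (hA : ∀ e, HasFDerivAt A L e) (dir : κ → E) (W : List κ) :
    ddw dir W (fun e => f (A e)) = fun e => ddw (fun b => L (dir b)) W f (A e) := by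
  induction W with
  | nil => rfl
  | cons b W ih => rw [ddw_cons, ih, dd_comp_clm (contDiff_ddw _ _ hf) hA]; rfl

lemma ddw_map {E κ κ' : Type*} [NormedAddCommGroup E] [NormedSpace ℝ E] (dir : κ → E) (s : κ' → κ)
    (W : List κ') (f : E → ℂ) : ddw dir (W.map s) f = ddw (fun b => dir (s b)) W f := by
  simp [ddw, List.foldr_map]

lemma ddw_const_mul {E κ : Type*} [NormedAddCommGroup E] [NormedSpace ℝ E] (dir : κ → E)
    (W : List κ) {f : E → ℂ} (hf : ContDiff ℝ ∞ f) (c : ℂ) :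
    ddw dir W (fun x => c * f x) = fun x => c * ddw dir W f x := by
  induction W with
  | nil => rfl
  | cons b W ih => rw [ddw_cons, ih, dd_const_mul (contDiff_ddw _ _ hf)]; rfl

lemma ddw_sub {E κ : Type*} [NormedAddCommGroup E] [NormedSpace ℝ E] (dir : κ → E)
    (W : List κ) {f g : E → ℂ} (hf : ContDiff ℝ ∞ f) (hg : ContDiff ℝ ∞ g) :
    ddw dir W (fun x => f x - g x) = fun x => ddw dir W f x - ddw dir W g x := by
  induction W with
  | nil => rfl
  | cons b W ih => rw [ddw_cons, ih, dd_sub (contDiff_ddw _ _ hf) (contDiff_ddw _ _ hg)]; rfl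

lemma ddw_sum {E κ α : Type*} [NormedAddCommGroup E] [NormedSpace ℝ E] (dir : κ → E)
    (W : List κ) (s : Finset α) {f : α → E → ℂ} (hf : ∀ a ∈ s, ContDiff ℝ ∞ (f a)) :
    ddw dir W (fun x => ∑ a ∈ s, f a x) = fun x => ∑ a ∈ s, ddw dir W (f a) x := by
  induction W with
  | nil => rfl
  | cons b W ih => rw [ddw_cons, ih, dd_sum s (fun a ha => contDiff_ddw _ _ (hf a ha))]; rfl

lemma hasFDerivAt_par_eps (lam : ℝ) (X : Phase d) (ε : ℝ) :
    HasFDerivAt (fun ε : ℝ => ((ε, lam, X) : Par d))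
      ((ContinuousLinearMap.id ℝ ℝ).prod (0 : ℝ →L[ℝ] ℝ × Phase d)) ε :=
  (hasFDerivAt_id ε).prodMk (hasFDerivAt_const (lam, X) ε)

lemma hasFDerivAt_par_lam (ε : ℝ) (X : Phase d) (lam : ℝ) :
    HasFDerivAt (fun lam : ℝ => ((ε, lam, X) : Par d))
      ((0 : ℝ →L[ℝ] ℝ).prod ((ContinuousLinearMap.id ℝ ℝ).prod (0 : ℝ →L[ℝ] Phase d))) lam :=
  (hasFDerivAt_const ε lam).prodMk ((hasFDerivAt_id lam).prodMk (hasFDerivAt_const X lam))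

lemma hasFDerivAt_par_phase (ε lam : ℝ) (X : Phase d) :
    HasFDerivAt (fun X : Phase d => ((ε, lam, X) : Par d))
      ((0 : Phase d →L[ℝ] ℝ).prod ((0 : Phase d →L[ℝ] ℝ).prod (ContinuousLinearMap.id ℝ _))) X :=
  (hasFDerivAt_const ε X).prodMk ((hasFDerivAt_const lam X).prodMk (hasFDerivAt_id X))

/-- The derivative `∂_ε^n` as a word. -/
abbrev epsWord (d n : ℕ) : List (Bool ⊕ (Fin d ⊕ Fin d)) := List.replicate n (.inl false)

/-- The derivative `∂_λ^k` as a word. -/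
abbrev lamWord (d k : ℕ) : List (Bool ⊕ (Fin d ⊕ Fin d)) := List.replicate k (.inl true)

lemma ddw_epsWord {h : Par d → ℂ} (hh : ContDiff ℝ ∞ h) (n : ℕ) (ε lam : ℝ) (X : Phase d) :
    ddw parDir (epsWord d n) h (ε, lam, X) = (dd 1)^[n] (fun ε : ℝ => h (ε, lam, X)) ε := by
  have h1 := ddw_comp_clm hh (hasFDerivAt_par_eps lam X) (fun _ : Unit => (1 : ℝ))
    (List.replicate n ())
  rw [ddw_replicate, ddw_replicate] at h1
  rw [h1, ddw_replicate]
  rfl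

lemma ddw_lamWord {h : Par d → ℂ} (hh : ContDiff ℝ ∞ h) (n : ℕ) (ε lam : ℝ) (X : Phase d) :
    ddw parDir (lamWord d n) h (ε, lam, X) = (dd 1)^[n] (fun lam : ℝ => h (ε, lam, X)) lam := by
  have h1 := ddw_comp_clm hh (hasFDerivAt_par_lam ε X) (fun _ : Unit => (1 : ℝ))
    (List.replicate n ())
  rw [ddw_replicate, ddw_replicate] at h1
  rw [h1, ddw_replicate]
  rfl

lemma ddw_phaseWord {h : Par d → ℂ} (hh : ContDiff ℝ ∞ h) (W : List (Fin d ⊕ Fin d)) (ε lam : ℝ) :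
    ddw phDir W (fun X => h (ε, lam, X)) = fun X => ddw parDir (W.map Sum.inr) h (ε, lam, X) := by
  rw [ddw_comp_clm hh (hasFDerivAt_par_phase ε lam), ddw_map]
  rfl

variable {F G : Phase d → ℂ}

/-- The `ε`-derivatives of the product at `ε = 0`. -/
lemma ddw_eps_moyalInt (hB : ∀ k l, IsBCInfty (B k l)) (hF : Rapid F) (hG : Rapid G) (n : ℕ)
    (lam : ℝ) (X : Phase d) :
    ddw parDir (epsWord d n) (moyalInt B F G) (0, lam, X) =
      n.factorial * ∑ k ∈ Finset.range (n + 1), (lam : ℂ) ^ k * moyalTerm B F G n k X := by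
  obtain ⟨k', -, h1, h2⟩ := (NF.one (d := d)).ddw_parInt hB (epsWord d n)
  rw [moyalInt, h2 F G hF hG, parInt]
  have h3 : ∀ P : Phase d × Phase d,
      k' (0, lam, X) P * parExp B (0, lam, X) P * (sympFourier F P.1 * sympFourier G P.2) =
      ∑ k ∈ Finset.range (n + 1), n.factorial * (lam : ℂ) ^ k *
        (Complex.exp (Complex.I * symp X (P.1 + P.2)) *
          MvPolynomial.aeval (dSymValue P) (twisterCoeff n k (diffOp B X.1)) *
            (sympFourier F P.1 * sympFourier G P.2)) := by
    intro P
    have h4 := congrFun (h1 P) (0, lam, X)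
    simp only [one_mul] at h4
    rw [← h4, ddw_epsWord (contDiff_parExp hB P), iterate_dd_parExp hB, Finset.mul_sum,
      Finset.mul_sum, Finset.sum_mul]
    refine Finset.sum_congr rfl fun k _ => ?_
    rw [aeval_twisterCoeff]
    ring
  simp only [h3]
  rw [integral_finsetSum _ fun k _ => (integrable_aeval hF hG _ X).const_mul _, Finset.mul_sum,
    Finset.mul_sum]
  refine Finset.sum_congr rfl fun k _ => ?_
  rw [integral_const_mul, mul_left_comm, integral_aeval hF hG, moyalTerm]
  ring

lemma expIndices_eq_empty {n k : ℕ} (h : n < k) : expIndices n k = ∅ := by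
  refine Finset.filter_eq_empty_iff.2 fun κ _ hκ => ?_
  have h5 : ∑ j : Fin n, κ j.succ ≤ ∑ j : Fin n, ((j : ℕ) + 1) * κ j.succ :=
    Finset.sum_le_sum fun j _ => Nat.le_mul_of_pos_left _ (Nat.succ_pos _)
  omega

lemma moyalTerm_eq_zero (B : Fin d → Fin d → Config d → ℝ) (f g : Phase d → ℂ) {n k : ℕ}
    (h : n < k) : moyalTerm B f g n k = fun _ => 0 := by
  funext X
  rw [moyalTerm, twisterCoeff, expIndices_eq_empty h, Finset.sum_empty, applyBidiff,
    MvPolynomial.support_zero, Finset.sum_empty]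

/-- The terms of the expansion are mixed derivatives of the product at `ε = λ = 0`. -/
lemma moyalTerm_eq_ddw (hB : ∀ k l, IsBCInfty (B k l)) (hF : Rapid F) (hG : Rapid G) (n k : ℕ) :
    moyalTerm B F G n k = fun X => (n.factorial * k.factorial : ℂ)⁻¹ *
      ddw parDir (lamWord d k ++ epsWord d n) (moyalInt B F G) (0, 0, X) := by
  have hs := contDiff_moyalInt hB hF hG
  funext X
  rw [ddw_append, ddw_lamWord (contDiff_ddw _ _ hs)]
  simp only [ddw_eps_moyalInt hB hF hG]
  have h1 : (fun lam : ℝ => (n.factorial : ℂ) *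
      ∑ k ∈ Finset.range (n + 1), (lam : ℂ) ^ k * moyalTerm B F G n k X) =
      fun lam : ℝ => ∑ k ∈ Finset.range (n + 1),
        (n.factorial * moyalTerm B F G n k X) * (lam : ℂ) ^ k := by
    funext lam
    rw [Finset.mul_sum]
    exact Finset.sum_congr rfl fun k _ => by ring
  rw [h1, iterate_dd_sum _ _ _ fun k _ => contDiff_const.mul (contDiff_ofReal_id.pow k)]
  simp only [iterate_dd_ofReal_pow]
  have hn : (n.factorial : ℂ) ≠ 0 := by exact_mod_cast n.factorial_ne_zero
  have hk : (k.factorial : ℂ) ≠ 0 := by exact_mod_cast k.factorial_ne_zero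
  rw [Finset.sum_ite_eq' (Finset.range (n + 1)) k]
  split_ifs with h
  · field_simp
  · rw [moyalTerm_eq_zero B F G (by simpa using h)]
    simp

lemma contDiff_par_phase {h : Par d → ℂ} (hh : ContDiff ℝ ∞ h) (ε lam : ℝ) :
    ContDiff ℝ ∞ fun X : Phase d => h (ε, lam, X) :=
  hh.comp (contDiff_const.prodMk (contDiff_const.prodMk contDiff_id))

lemma sum_parGain_inr (W : List (Fin d ⊕ Fin d)) : ((W.map Sum.inr).map parGain).sum = freq W := by
  rw [freq, List.map_map]
  rfl

lemma symFamily_moyalTerm (hB : ∀ k l, IsBCInfty (B k l)) {I : Type*} {F G : I → Phase d → ℂ}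
    {ρ m₁ m₂ : ℝ} (hρ : 0 ≤ ρ) (hF : ∀ i, Rapid (F i)) (hG : ∀ i, Rapid (G i))
    (bF : SymFamily ρ m₁ F) (bG : SymFamily ρ m₂ G) (n k : ℕ) :
    SymFamily ρ (m₁ + m₂ - ((n : ℝ) + k) * ρ) (fun i => moyalTerm B (F i) (G i) n k) := by
  have hs := fun i => contDiff_ddw parDir (lamWord d k ++ epsWord d n)
    (contDiff_moyalInt hB (hF i) (hG i))
  simp only [moyalTerm_eq_ddw hB (hF _) (hG _)]
  refine symFamily_of_bound (fun i => contDiff_const.mul (contDiff_par_phase (hs i) 0 0))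
    fun W => ?_
  obtain ⟨C, hC, hb⟩ := moyalInt_bound hB hρ hF hG bF bG
    (W.map Sum.inr ++ (lamWord d k ++ epsWord d n))
  refine ⟨‖(n.factorial * k.factorial : ℂ)⁻¹‖ * C, by positivity, fun i X => ?_⟩
  rw [ddw_const_mul _ _ (contDiff_par_phase (hs i) 0 0), ddw_phaseWord (hs i), norm_mul,
    mul_assoc, ← ddw_append]
  refine mul_le_mul_of_nonneg_left ((hb i (0, 0, X) (by simp) (by simp)).trans_eq ?_)
    (norm_nonneg _)
  congr 2
  rw [List.map_append, List.sum_append, sum_parGain_inr]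
  simp [parGain]
  ring

/-- The difference of the product and its expansion up to order `N` in `ε`. -/
noncomputable def expansionError (B : Fin d → Fin d → Config d → ℝ) (F G : Phase d → ℂ) (N : ℕ)
    (ε lam : ℝ) (X : Phase d) : ℂ :=
  moyalInt B F G (ε, lam, X) - ∑ n ∈ Finset.range (N + 1), ∑ k ∈ Finset.range (n + 1),
    (ε : ℂ) ^ n * (lam : ℂ) ^ k * moyalTerm B F G n k X

lemma expansionError_eq (hB : ∀ k l, IsBCInfty (B k l)) (hF : Rapid F) (hG : Rapid G) (N : ℕ)
    (ε lam : ℝ) : expansionError B F G N ε lam = fun X => moyalInt B F G (ε, lam, X) -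
      ∑ n ∈ Finset.range (N + 1), (ε : ℂ) ^ n / (n.factorial : ℂ) *
        ddw parDir (epsWord d n) (moyalInt B F G) (0, lam, X) := by
  funext X
  rw [expansionError]
  congr 1
  refine Finset.sum_congr rfl fun n _ => ?_
  have hn : (n.factorial : ℂ) ≠ 0 := by exact_mod_cast n.factorial_ne_zero
  rw [ddw_eps_moyalInt hB hF hG, ← mul_assoc, div_mul_cancel₀ _ hn, Finset.mul_sum]
  exact Finset.sum_congr rfl fun k _ => by ring

lemma contDiff_expansionError (hB : ∀ k l, IsBCInfty (B k l)) (hF : Rapid F) (hG : Rapid G) (N : ℕ)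
    (ε lam : ℝ) : ContDiff ℝ ∞ (expansionError B F G N ε lam) := by
  have hs := contDiff_moyalInt hB hF hG
  rw [expansionError_eq hB hF hG]
  exact (contDiff_par_phase hs ε lam).sub (ContDiff.sum fun n _ =>
    contDiff_const.mul (contDiff_par_phase (contDiff_ddw _ _ hs) 0 lam))

/-- The bounds for the remainder, from Taylor's formula in `ε`: each derivative in `ε` improves the
symbol order. -/
lemma expansionError_bound (hB : ∀ k l, IsBCInfty (B k l)) {I : Type*} {F G : I → Phase d → ℂ}
    {ρ m₁ m₂ : ℝ} (hρ : 0 ≤ ρ) (hF : ∀ i, Rapid (F i)) (hG : ∀ i, Rapid (G i))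
    (bF : SymFamily ρ m₁ F) (bG : SymFamily ρ m₂ G) (N : ℕ) (W : List (Fin d ⊕ Fin d)) :
    ∃ C, 0 ≤ C ∧ ∀ i (ε lam : ℝ), 0 ≤ ε → ε ≤ 1 → |lam| ≤ 1 → ∀ X,
      ‖ddw phDir W (expansionError B (F i) (G i) N ε lam) X‖ ≤
        C * ε ^ (N + 1) * japanese X.2 ^ (m₁ + m₂ - ((N : ℝ) + 1) * ρ - freq W * ρ) := by
  obtain ⟨C, hC, hb⟩ := moyalInt_bound hB hρ hF hG bF bG (epsWord d (N + 1) ++ W.map Sum.inr)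
  refine ⟨C, hC, fun i ε lam h0 h1 hlam X => ?_⟩
  have hs := contDiff_moyalInt hB (hF i) (hG i)
  have hsn := fun n => contDiff_ddw parDir (epsWord d n) hs
  have hsp : ∀ n, ContDiff ℝ ∞ fun X : Phase d =>
      ddw parDir (epsWord d n) (moyalInt B (F i) (G i)) (0, lam, X) :=
    fun n => contDiff_par_phase (hsn n) 0 lam
  rw [expansionError_eq hB (hF i) (hG i), ddw_sub _ _ (contDiff_par_phase hs ε lam)
    (ContDiff.sum fun n _ => contDiff_const.mul (hsp n)),
    ddw_sum _ _ _ fun n _ => contDiff_const.mul (hsp n), ddw_phaseWord hs]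
  simp only [ddw_const_mul _ _ (hsp _), ddw_phaseWord (hsn _)]
  have h2 := taylor_bound (contDiff_ddw parDir (W.map Sum.inr) hs) (parDir (.inl false))
    ((0, lam, X) : Par d) N (C := C * japanese X.2 ^
      (m₁ + m₂ - ((N : ℝ) + 1) * ρ - freq W * ρ)) (fun s hs => ?_) (ε := ε) ⟨h0, h1⟩
  · refine (le_of_eq ?_).trans (h2.trans_eq (by ring))
    congr 2
    · simp [parDir]
    · refine Finset.sum_congr rfl fun n _ => ?_
      rw [← ddw_append, ← ddw_replicate, ← ddw_append]
      exact congrArg (_ * · ) (congrFun (ddw_perm parDir List.perm_append_comm hs) _)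
  · rw [← ddw_replicate, ← ddw_append]
    refine (hb i _ ?_ ?_).trans_eq ?_
    · simp [parDir, abs_of_nonneg hs.1, hs.2]
    · simpa [parDir] using hlam
    · rw [List.map_append, List.sum_append, sum_parGain_inr]
      simp [parDir, parGain]
      left
      congr 1
      ring

end Expansion

end MagneticMoyal

/-! ### Passage to the limit in oscillatory integrals -/

namespace MagneticMoyal

section Limits

variable {d : ℕ}

lemma tendsto_ddw_oneSubD {E ι κ : Type*} [NormedAddCommGroup E] [NormedSpace ℝ E] {dir : κ → E}
    {f : ι → E → ℂ} {u : E → ℂ} {l : Filter ι} (hs : ∀ i, ContDiff ℝ ∞ (f i))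
    (hu : ContDiff ℝ ∞ u) (h : ∀ W e, Tendsto (fun i => ddw dir W (f i) e) l (𝓝 (ddw dir W u e)))
    (L : List κ) (W : List κ) (e : E) :
    Tendsto (fun i => ddw dir W (oneSubD dir L (f i)) e) l (𝓝 (ddw dir W (oneSubD dir L u) e)) := by
  induction L generalizing W with
  | nil => exact h W e
  | cons b L ih =>
    have h1 : ∀ {f : E → ℂ}, ContDiff ℝ ∞ f → ddw dir W (oneSubD dir (b :: L) f) e =
        ddw dir W (oneSubD dir L f) e - ddw dir (W ++ [b]) (oneSubD dir L f) e := by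
      intro f hf
      have hf' := contDiff_oneSubD dir L hf
      have h2 : oneSubD dir (b :: L) f =
          fun e => oneSubD dir L f e - dd (dir b) (oneSubD dir L f) e := rfl
      rw [h2, ddw_sub _ _ hf' (contDiff_dd hf' _), ddw_append]
      rfl
    simp only [h1 (hs _), h1 hu]
    exact (ih W).sub (ih (W ++ [b]))

lemma continuous_japanese : Continuous (japanese : Config d → ℝ) := by
  unfold japanese
  fun_prop

lemma continuous_japanese_rpow (s : ℝ) : Continuous fun X : Phase d => japanese X.2 ^ s :=
  (continuous_japanese.comp continuous_snd).rpow_const fun X => Or.inl (japanese_pos X.2).ne'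

lemma SymFamily.locBound {I : Type*} {ρ m : ℝ} {F : I → Phase d → ℂ} (hF : SymFamily ρ m F) :
    LocBound phDir F := by
  refine LocBound.of_continuous fun W => ?_
  obtain ⟨C, -, hb⟩ := hF.bound W
  exact ⟨_, continuous_const.mul (continuous_japanese_rpow _), hb⟩

lemma sum_coordL_smul_phDir (X : Phase d) : ∑ b, coordL b X • phDir b = X := by
  simpa only [coordL_apply] using sum_coord_smul_phDir X

variable {I : Type*} {l : Filter I} [l.NeBot] {F G : I → Phase d → ℂ} {f g : Phase d → ℂ}
  {ρ m₁ m₂ : ℝ}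

/-- Pointwise convergence of families with uniform symbol bounds implies convergence of the
amplitudes, with all derivatives in `w`. -/
lemma tendsto_ddw_regAmp (hρ : 0 ≤ ρ) (bF : SymFamily ρ m₁ F) (bG : SymFamily ρ m₂ G)
    (hf : ∀ X, Tendsto (fun i => F i X) l (𝓝 (f X)))
    (hg : ∀ X, Tendsto (fun i => G i X) l (𝓝 (g X)))
    {c : Phase d → ℂ} (hc : PolyGrowth phDir (fun w => ‖w‖) (fun _ : Unit => c)) (R : ℕ) {ε : ℝ}
    (hε : |ε| ≤ 1) (X θ : Phase d) :
    (ContDiff ℝ ∞ fun w => regAmp R c f g ε X (w, θ)) ∧ ∀ W w,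
      Tendsto (fun i => ddw phDir W (fun w => regAmp R c (F i) (G i) ε X (w, θ)) w) l
        (𝓝 (ddw phDir W (fun w => regAmp R c f g ε X (w, θ)) w)) := by
  have hA : ∀ w : Phase d, HasFDerivAt (fun w => (w, θ))
      (ContinuousLinearMap.inl ℝ (Phase d) (Phase d)) w := fun w => hasFDerivAt_prodMk_left w θ
  have hFl := bF.locBound.limit sum_coordL_smul_phDir bF.1 hf
  have hGl := bG.locBound.limit sum_coordL_smul_phDir bG.1 hg
  have hs : ∀ i, ContDiff ℝ ∞ (regAmp R c (F i) (G i) ε X) :=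
    fun i => contDiff_regAmp R (hc.1 ()) (bF.1 i) (bG.1 i) ε X
  refine LocBound.limit sum_coordL_smul_phDir (fun i => (hs i).comp (by fun_prop)) ?_ fun w => ?_
  · refine LocBound.of_continuous fun W => ?_
    obtain ⟨p, hp⟩ := hc.2 (0 + W.length)
    have h := derivBound_regAmp (I := I) (K := 0 + W.length) (R := R) (p := p) (c := fun _ => c)
      (F := F) (G := G) (μ := fun _ ξ => japanese ξ ^ m₁) (ν := fun _ ξ => japanese ξ ^ m₂)
      (ε := fun _ => ε) (X := fun _ => X) (fun _ => hε) (fun _ => hc.1 ()) bF.1 bG.1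
      (fun _ _ => Real.rpow_nonneg (japanese_pos _).le _)
      (fun _ _ => Real.rpow_nonneg (japanese_pos _).le _) (hp.comp_index fun _ => ())
      (bF.flat hρ _) (bG.flat hρ _)
    have h1 := DerivBound.comp_affine (dir := phDir) (fun _ e => mul_nonneg (by positivity)
        (mul_nonneg (Real.rpow_nonneg (japanese_pos _).le _)
          (Real.rpow_nonneg (japanese_pos _).le _))) hs h
      (fun _ w => (w, θ)) (fun _ => ContinuousLinearMap.inl ℝ (Phase d) (Phase d))
      (fun _ => hA) (fun _ b b' => if b' = b then 1 else 0) (M := 1)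
      (fun _ b b' => by split_ifs <;> simp) (fun _ b => by simp [wDir])
    obtain ⟨C, -, hb⟩ := (h1.ddw W).bound
    refine ⟨fun w => C * (((1 + ‖w‖) ^ R)⁻¹ * (1 + ‖w‖) ^ p * (japanese (X.2 + θ.1) ^ m₁ *
      japanese (X.2 + θ.2) ^ m₂)), ?_, fun i w => (hb i w).trans_eq (by simp)⟩
    have : ∀ w : Phase d, (1 + ‖w‖) ^ R ≠ 0 := fun w => by positivity
    fun_prop (disch := assumption)
  · exact tendsto_const_nhds.mul
      ((tendsto_ddw_oneSubD bF.1 hFl.1 hFl.2 _ [] _).mul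
        (tendsto_ddw_oneSubD bG.1 hGl.1 hGl.2 _ [] _))

/-- Kernel integrals of rapidly decreasing functions converge to the regularized integral of
the limits. -/
lemma tendsto_kernelIntegral [l.IsCountablyGenerated] (hρ : 0 ≤ ρ) (bF : SymFamily ρ m₁ F)
    (bG : SymFamily ρ m₂ G) (rF : ∀ i, Rapid (F i)) (rG : ∀ i, Rapid (G i))
    (hf : ∀ X, Tendsto (fun i => F i X) l (𝓝 (f X)))
    (hg : ∀ X, Tendsto (fun i => G i X) l (𝓝 (g X)))
    {c : Phase d → ℂ} (hc : PolyGrowth phDir (fun w => ‖w‖) (fun _ : Unit => c)) {p : ℕ}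
    (hp : DerivBound phDir (fun _ _ => 1) (fullList d (regExp d m₁ m₂)).length
      (fun (_ : Unit) w => (1 + ‖w‖) ^ p) (fun _ => c)) {ε : ℝ}
    (hε : |ε| ≤ 1) {K : Config d → Phase d → Phase d → ℂ} (X : Phase d)
    (hK : ∀ Y Z, K X.1 Y Z = Complex.exp (Complex.I * (ε / 2 * symp Y Z : ℝ)) * c (Y.1, Z.1)) :
    Tendsto (fun i => kernelIntegral K (F i) (G i) X) l
      (𝓝 (1 / (2 * (Real.pi : ℂ)) ^ (2 * d) *
        ∫ e, regIntegrand (regExp d m₁ m₂) (p + decayExp d) c f g ε X e)) := by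
  have h1 : ∀ i, kernelIntegral K (F i) (G i) X = 1 / (2 * (Real.pi : ℂ)) ^ (2 * d) *
      ∫ e, regIntegrand (regExp d m₁ m₂) (p + decayExp d) c (F i) (G i) ε X e :=
    fun i => kernelIntegral_eq_regularized (rF i) (rG i) hε (hc.1 ()) le_rfl hp hK
  simp only [h1]
  refine Tendsto.const_mul _ ?_
  obtain ⟨C, -, hb⟩ := regIntegrand_bound (c := fun _ : I => c) (F := F) (G := G)
    (ε := fun _ => ε) (X := fun _ => X) (fun _ => hε) (fun _ => hc.1 ()) (hp.comp_index fun _ => ())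
    bF.1 bG.1 (bF.flat hρ) (bG.flat hρ)
  refine tendsto_integral_filter_of_dominated_convergence _
    (Eventually.of_forall fun i => (continuous_regIntegrand _ _ (hc.1 ()) (bF.1 i) (bG.1 i) ε
      X).aestronglyMeasurable) (Eventually.of_forall fun i => ae_of_all _ (hb i))
    (integrable_prodWeight.const_mul _) (ae_of_all _ fun e => ?_)
  have hsf := (bF.locBound.limit sum_coordL_smul_phDir bF.1 hf).1
  have hsg := (bG.locBound.limit sum_coordL_smul_phDir bG.1 hg).1
  have h2 : ∀ {F G : Phase d → ℂ}, ContDiff ℝ ∞ F → ContDiff ℝ ∞ G →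
      oneSubD wDir (fullList d (regExp d m₁ m₂)) (regAmp (p + decayExp d) c F G ε X) e =
      oneSubD phDir (fullList d (regExp d m₁ m₂))
        (fun w => regAmp (p + decayExp d) c F G ε X (w, e.2)) e.1 := by
    intro F G hF hG
    rw [oneSubD_comp (dir := phDir) (dir' := wDir) (contDiff_regAmp _ (hc.1 ()) hF hG ε X)
      (fun w => hasFDerivAt_prodMk_left w e.2) (fun b => rfl)]
  obtain ⟨h3, h4⟩ := tendsto_ddw_regAmp hρ bF bG hf hg hc (p + decayExp d) hε X e.2
  simp only [regIntegrand, h2 (bF.1 _) (bG.1 _), h2 hsf hsg]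
  refine Tendsto.const_mul _ (Tendsto.const_mul _ ?_)
  exact tendsto_ddw_oneSubD (fun i => (contDiff_regAmp _ (hc.1 ()) (bF.1 i) (bG.1 i) ε X).comp
    (by fun_prop)) h3 h4 _ [] _

end Limits

end MagneticMoyal

/-! ### Regularized symbols -/

namespace MagneticMoyal

section Cutoffs

variable {d : ℕ}

lemma rapid_of_ddw {F : Phase d → ℂ} (hF : ContDiff ℝ ∞ F)
    (h : ∀ (p : ℕ) (W : List (Fin d ⊕ Fin d)), ∃ C, 0 ≤ C ∧ ∀ X,
      ‖ddw phDir W F X‖ ≤ C * ((1 + ‖X‖) ^ p)⁻¹) : Rapid F := by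
  refine ⟨hF, fun K p => derivBound_of_ddw fun W => ?_⟩
  obtain ⟨C, hC, hb⟩ := h p W
  exact ⟨C, hC, fun _ X => by simpa using hb X⟩

lemma Rapid.ddw_bound {F : Phase d → ℂ} (hF : Rapid F) (p : ℕ) (W : List (Fin d ⊕ Fin d)) :
    ∃ C, 0 ≤ C ∧ ∀ X, ‖MagneticMoyal.ddw phDir W F X‖ ≤ C * ((1 + ‖X‖) ^ p)⁻¹ :=
  (hF.ddw W).bound p

lemma rapid_schwartz (χ : SchwartzMap (Phase d) ℂ) : Rapid (χ : Phase d → ℂ) := by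
  have hs : ContDiff ℝ ∞ (χ : Phase d → ℂ) := χ.smooth ⊤
  have h1 : ∀ (W : List (Fin d ⊕ Fin d)) (n : ℕ) X, ‖iteratedFDeriv ℝ n (ddw phDir W χ) X‖ ≤
      ‖iteratedFDeriv ℝ (n + W.length) χ X‖ := by
    intro W
    induction W with
    | nil => exact fun n X => le_rfl
    | cons b W ih =>
      intro n X
      refine (norm_iteratedFDeriv_dd_le (contDiff_ddw phDir W hs) (phDir b) n X).trans ?_
      refine (mul_le_of_le_one_left (norm_nonneg _) (norm_phDir_le b)).trans ((ih _ X).trans_eq ?_)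
      rw [List.length_cons, Nat.add_right_comm, Nat.add_assoc]
  refine rapid_of_ddw hs fun p W => ?_
  set C := 2 ^ p * (Finset.Iic (p, W.length)).sup
    (fun m => SchwartzMap.seminorm ℝ m.1 m.2) χ with hC
  have h2 : ∀ X, (1 + ‖X‖) ^ p * ‖iteratedFDeriv ℝ W.length χ X‖ ≤ C := fun X =>
    SchwartzMap.one_add_le_sup_seminorm_apply (𝕜 := ℝ) (m := (p, W.length)) le_rfl le_rfl χ X
  refine ⟨C, (by positivity : (0 : ℝ) ≤ _).trans (h2 0), fun X => ?_⟩
  rw [← div_eq_mul_inv, le_div_iff₀ (by positivity), mul_comm]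
  refine (mul_le_mul_of_nonneg_left ?_ (by positivity)).trans (h2 X)
  have h3 := h1 W 0 X
  rwa [norm_iteratedFDeriv_zero, zero_add] at h3

lemma ddw_dilate {F : Phase d → ℂ} (hF : ContDiff ℝ ∞ F) (δ : ℝ) (W : List (Fin d ⊕ Fin d)) :
    ddw phDir W (fun X => F (δ • X)) = fun X => (δ : ℂ) ^ W.length * ddw phDir W F (δ • X) := by
  induction W with
  | nil => simp
  | cons b W ih =>
    have hA : ∀ X : Phase d, HasFDerivAt (fun X : Phase d => δ • X)
        (δ • ContinuousLinearMap.id ℝ (Phase d)) X := fun X => (hasFDerivAt_id X).const_smul δ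
    have hW := contDiff_ddw phDir W hF
    have hc : ContDiff ℝ ∞ fun X : Phase d => ddw phDir W F (δ • X) :=
      hW.comp (contDiff_const_smul δ)
    rw [ddw_cons, ih, dd_const_mul hc, dd_comp_clm hW hA]
    funext X
    simp only [dd, smul_apply, ContinuousLinearMap.id_apply, map_smul, ddw_cons, List.length_cons,
      pow_succ, Complex.real_smul]
    ring

lemma Rapid.dilate {F : Phase d → ℂ} (hF : Rapid F) {δ : ℝ} (hδ : 0 < δ) :
    Rapid fun X => F (δ • X) := by
  refine rapid_of_ddw (hF.1.comp (contDiff_const_smul δ)) fun p W => ?_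
  obtain ⟨C, hC, hb⟩ := hF.ddw_bound p W
  refine ⟨δ ^ W.length * C * (1 + δ⁻¹) ^ p, by positivity, fun X => ?_⟩
  rw [ddw_dilate hF.1, norm_mul, norm_pow, Complex.norm_real, Real.norm_of_nonneg hδ.le, mul_assoc,
    mul_assoc]
  refine mul_le_mul_of_nonneg_left ((hb _).trans (mul_le_mul_of_nonneg_left ?_ hC)) (by positivity)
  rw [norm_smul, Real.norm_of_nonneg hδ.le, ← div_eq_mul_inv, le_div_iff₀ (by positivity),
    inv_mul_le_iff₀ (by positivity), ← mul_pow]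
  refine pow_le_pow_left₀ (by positivity) ?_ p
  have h1 : δ * δ⁻¹ = 1 := mul_inv_cancel₀ hδ.ne'
  have h2 := norm_nonneg X
  have h3 : 0 < δ⁻¹ := inv_pos.2 hδ
  nlinarith [mul_nonneg hδ.le h2]

/-- The dilations of a rapidly decreasing function are uniformly bounded in the symbol class of
order `0`: derivatives of `F(δ X)` that are small in `δ` are also concentrated where
`⟨ξ⟩ ≲ 1/δ`. -/
lemma Rapid.symFamily_dilate {F : Phase d → ℂ} (hF : Rapid F) {ρ : ℝ} (hρ : ρ ≤ 1) :
    SymFamily ρ 0 (fun (δ : Set.Ioc (0 : ℝ) 1) X => F ((δ : ℝ) • X)) := by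
  refine symFamily_of_bound (fun δ => hF.1.comp (contDiff_const_smul _)) fun W => ?_
  have hfreq : freq W ≤ W.length := by
    induction W with
    | nil => simp
    | cons b W ih => cases b <;> simp <;> omega
  obtain ⟨C, hC, hb⟩ := hF.ddw_bound (freq W) W
  refine ⟨C, hC, fun δ X => ?_⟩
  obtain ⟨δ, hδ, hδ1⟩ := δ
  rw [ddw_dilate hF.1, norm_mul, norm_pow, Complex.norm_real, Real.norm_of_nonneg hδ.le]
  have hj := one_le_japanese X.2
  have hj0 := japanese_pos X.2
  have h0 := norm_nonneg X
  have h1 : japanese X.2 ≤ 1 + ‖X‖ := by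
    have := norm_snd_le X
    refine (Real.sqrt_le_left (by positivity)).2 ?_
    nlinarith [norm_nonneg X.2]
  have h2 : δ * japanese X.2 ≤ 1 + ‖δ • X‖ := by
    rw [norm_smul, Real.norm_of_nonneg hδ.le]
    nlinarith
  calc δ ^ W.length * ‖MagneticMoyal.ddw phDir W F (δ • X)‖
      ≤ δ ^ freq W * (C * ((1 + ‖δ • X‖) ^ freq W)⁻¹) :=
        mul_le_mul (pow_le_pow_of_le_one hδ.le hδ1 hfreq) (hb _) (norm_nonneg _) (by positivity)
    _ = C * (δ ^ freq W * ((1 + ‖δ • X‖) ^ freq W)⁻¹) := by ring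
    _ ≤ C * ((japanese X.2) ^ freq W)⁻¹ := by
        refine mul_le_mul_of_nonneg_left ?_ hC
        rw [← div_eq_mul_inv, div_le_iff₀ (by positivity), inv_mul_eq_div,
          le_div_iff₀ (by positivity), ← mul_pow]
        exact pow_le_pow_left₀ (by positivity) h2 _
    _ ≤ _ := by
        refine mul_le_mul_of_nonneg_left ?_ hC
        rw [← Real.rpow_natCast, ← Real.rpow_neg hj0.le]
        refine Real.rpow_le_rpow_of_exponent_le hj ?_
        have : (0 : ℝ) ≤ freq W := Nat.cast_nonneg _
        nlinarith

lemma SymFamily.mul {I : Type*} {ρ m₁ m₂ : ℝ} {F G : I → Phase d → ℂ} (hF : SymFamily ρ m₁ F)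
    (hG : SymFamily ρ m₂ G) : SymFamily ρ (m₁ + m₂) (fun i X => F i X * G i X) := by
  refine ⟨fun i => (hF.1 i).mul (hG.1 i), fun K => ?_⟩
  refine (DerivBound.mul (symGain_nonneg ρ) (fun _ _ => Real.rpow_nonneg (japanese_pos _).le _)
    hF.1 hG.1 (hF.2 K) (hG.2 K)).mono (symGain_nonneg ρ) zero_le_one fun i Y => le_of_eq ?_
  rw [Real.rpow_add (japanese_pos _), one_mul]

lemma Rapid.mul_symbol {F f : Phase d → ℂ} {ρ m : ℝ} (hρ : 0 ≤ ρ) (hF : Rapid F)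
    (hf : SymFamily ρ m (fun _ : Unit => f)) : Rapid fun X => F X * f X := by
  refine ⟨hF.1.mul (hf.1 ()), fun K p => ?_⟩
  refine (DerivBound.mul (fun _ _ => zero_le_one) (fun _ _ => by positivity) (fun _ => hF.1) hf.1
    (hF.2 K (p + ⌈|m|⌉₊)) (hf.flat hρ K)).mono (fun _ _ => zero_le_one) zero_le_one fun _ X => ?_
  have h1 := japanese_add_rpow_le m 0 X.2
  have h2 : japanese (0 : Config d) = 1 := by simp [japanese]
  rw [zero_add, h2, Real.one_rpow, one_mul] at h1
  have h3 : (1 + ‖X.2‖) ^ ⌈|m|⌉₊ ≤ (1 + ‖X‖) ^ ⌈|m|⌉₊ := by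
    have := norm_snd_le X
    gcongr
  rw [one_mul, pow_add, mul_inv, mul_assoc]
  refine mul_le_of_le_one_right (by positivity) ?_
  rw [inv_mul_le_iff₀ (by positivity), mul_one]
  exact h1.trans h3

lemma IsSymbol.rapid_cutoff {ρ m : ℝ} (hρ : 0 ≤ ρ) {f : Phase d → ℂ} (hf : IsSymbol m ρ f)
    (χ : SchwartzMap (Phase d) ℂ) {δ : ℝ} (hδ : 0 < δ) : Rapid (cutoff χ δ f) :=
  ((rapid_schwartz χ).dilate hδ).mul_symbol hρ hf.symFamily

lemma IsSymbol.symFamily_cutoff {ρ m : ℝ} (hρ : ρ ≤ 1) {f : Phase d → ℂ} (hf : IsSymbol m ρ f)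
    (χ : SchwartzMap (Phase d) ℂ) :
    SymFamily ρ m (fun δ : Set.Ioc (0 : ℝ) 1 => cutoff χ δ f) := by
  have h1 : SymFamily ρ m (fun _ : Set.Ioc (0 : ℝ) 1 => f) :=
    ⟨fun _ => hf.1, fun K => (hf.symFamily.2 K).comp_index fun _ => ()⟩
  have h2 := ((rapid_schwartz χ).symFamily_dilate hρ).mul h1
  rwa [zero_add] at h2

/-- The filter `δ ↓ 0` on the parameters `0 < δ ≤ 1`. -/
noncomputable def cutoffFilter : Filter (Set.Ioc (0 : ℝ) 1) :=
  comap (fun δ : Set.Ioc (0 : ℝ) 1 => (δ : ℝ)) (𝓝[>] 0)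

lemma range_mem_nhdsGT : Set.range (fun δ : Set.Ioc (0 : ℝ) 1 => (δ : ℝ)) ∈ 𝓝[>] (0 : ℝ) := by
  rw [Subtype.range_coe_subtype]
  exact Ioc_mem_nhdsGT one_pos

instance : cutoffFilter.NeBot := comap_neBot_iff_compl_range.2 fun h =>
  (NeBot.ne inferInstance : 𝓝[>] (0 : ℝ) ≠ ⊥) <| by
    have := inter_mem h range_mem_nhdsGT
    rwa [Set.compl_inter_self, empty_mem_iff_bot] at this

instance : cutoffFilter.IsCountablyGenerated := comap.isCountablyGenerated _ _

lemma tendsto_cutoffFilter_iff {u : ℝ → ℂ} {l : Filter ℂ} :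
    Tendsto (fun δ : Set.Ioc (0 : ℝ) 1 => u δ) cutoffFilter l ↔ Tendsto u (𝓝[>] 0) l :=
  tendsto_comap'_iff range_mem_nhdsGT

lemma tendsto_cutoff {χ : SchwartzMap (Phase d) ℂ} (hχ : χ 0 = 1) (f : Phase d → ℂ) (X : Phase d) :
    Tendsto (fun δ : Set.Ioc (0 : ℝ) 1 => cutoff χ δ f X) cutoffFilter (𝓝 (f X)) := by
  have h1 : Tendsto (fun δ : ℝ => cutoff χ δ f X) (𝓝 0) (𝓝 (cutoff χ 0 f X)) := by
    refine Continuous.tendsto ?_ 0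
    have := χ.continuous
    unfold cutoff
    fun_prop
  have h2 : cutoff χ 0 f X = f X := by simp [cutoff, hχ]
  rw [h2] at h1
  exact tendsto_cutoffFilter_iff.2 (h1.mono_left nhdsWithin_le_nhds)

/-- There are cutoff functions. -/
lemma exists_schwartz_eq_one (d : ℕ) : ∃ χ : SchwartzMap (Phase d) ℂ, χ 0 = 1 := by
  let φ : ContDiffBump (0 : Phase d) := default
  have h1 : HasCompactSupport fun X : Phase d => (φ X : ℂ) :=
    φ.hasCompactSupport.comp_left (g := fun t : ℝ => (t : ℂ)) Complex.ofReal_zero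
  refine ⟨h1.toSchwartzMap (Complex.ofRealCLM.contDiff.comp φ.contDiff), ?_⟩
  change ((φ 0 : ℝ) : ℂ) = 1
  rw [φ.one_of_mem_closedBall (Metric.mem_closedBall_self φ.rIn_pos.le), Complex.ofReal_one]

/-- Oscillatory integrals have at most one value. -/
lemma HasOscIntegral.unique {K : Config d → Phase d → Phase d → ℂ} {f g h h' : Phase d → ℂ}
    (H : HasOscIntegral K f g h) (H' : HasOscIntegral K f g h') : h = h' := by
  obtain ⟨χ, hχ⟩ := exists_schwartz_eq_one d
  funext X
  exact tendsto_nhds_unique (H χ χ hχ hχ X).2 (H' χ χ hχ hχ X).2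

lemma HasOscIntegral.oscIntegral_eq {K : Config d → Phase d → Phase d → ℂ} {f g h : Phase d → ℂ}
    (H : HasOscIntegral K f g h) : oscIntegral K f g = h := by
  have hex : ∃ p, HasOscIntegral K f g p := ⟨h, H⟩
  rw [oscIntegral, dif_pos hex]
  exact hex.choose_spec.unique H

/-- Symbol bounds pass to pointwise limits. -/
lemma SymFamily.limit {I : Type*} {l : Filter I} [l.NeBot] {ρ m : ℝ} {F : I → Phase d → ℂ}
    {f : Phase d → ℂ} (hF : SymFamily ρ m F) (hf : ∀ X, Tendsto (fun i => F i X) l (𝓝 (f X))) :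
    ContDiff ℝ ∞ f ∧ ∀ (W : List (Fin d ⊕ Fin d)) (M : Phase d → ℝ),
      (∀ i X, ‖MagneticMoyal.ddw phDir W (F i) X‖ ≤ M X) →
      ∀ X, ‖MagneticMoyal.ddw phDir W f X‖ ≤ M X := by
  obtain ⟨h1, h2⟩ := hF.locBound.limit sum_coordL_smul_phDir hF.1 hf
  exact ⟨h1, fun W M hM X => le_of_tendsto (h2 W X).norm (Eventually.of_forall fun i => hM i X)⟩

lemma SymFamily.isSymbol_limit {I : Type*} {l : Filter I} [l.NeBot] {ρ m : ℝ}
    {F : I → Phase d → ℂ} {f : Phase d → ℂ} (hF : SymFamily ρ m F)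
    (hf : ∀ X, Tendsto (fun i => F i X) l (𝓝 (f X))) : IsSymbol m ρ f := by
  obtain ⟨h1, h2⟩ := hF.limit hf
  refine IsSymbol.of_ddw h1 fun W => ?_
  obtain ⟨C, hC, hb⟩ := hF.bound W
  exact ⟨C, hC, h2 W _ hb⟩

end Cutoffs

end MagneticMoyal

/-! ### The remainder kernel -/

namespace MagneticMoyal

section Remainder

variable {d : ℕ} {B : Fin d → Fin d → Config d → ℝ}

/-- Taylor's formula for `e^{iT}`, with the remainder in integral form. -/
lemma cexp_eq_sum_add_integral (T : ℂ) (N : ℕ) :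
    Complex.exp (Complex.I * T) =
      (∑ n ∈ Finset.range (N + 1), Complex.I ^ n / (n.factorial : ℂ) * T ^ n) +
      Complex.I ^ (N + 1) / (N.factorial : ℂ) * T ^ (N + 1) *
        ∫ τ in (0 : ℝ)..1, (1 - (τ : ℂ)) ^ N * Complex.exp (Complex.I * τ * T) := by
  -- the sum `∑ (iT(1-τ))^n / n! e^{iτT}` interpolates between the polynomial and the exponential
  have hτ : ∀ τ : ℝ, HasDerivAt (fun τ : ℝ => (τ : ℂ)) 1 τ := fun τ => Complex.ofRealCLM.hasDerivAt
  have hE : ∀ τ : ℝ, HasDerivAt (fun τ : ℝ => Complex.exp (Complex.I * τ * T))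
      (Complex.exp (Complex.I * τ * T) * (Complex.I * T)) τ := by
    intro τ
    have := (((hτ τ).const_mul Complex.I).mul_const T).cexp
    simpa using this
  have key : ∀ N : ℕ, ∀ τ : ℝ, HasDerivAt (fun τ : ℝ => ∑ n ∈ Finset.range (N + 1),
      Complex.I ^ n / (n.factorial : ℂ) * T ^ n * (1 - (τ : ℂ)) ^ n *
        Complex.exp (Complex.I * τ * T))
      (Complex.I ^ (N + 1) / (N.factorial : ℂ) * T ^ (N + 1) *
        ((1 - (τ : ℂ)) ^ N * Complex.exp (Complex.I * τ * T))) τ := by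
    intro N τ
    induction N with
    | zero =>
      simp only [zero_add, Finset.sum_range_one, pow_zero, Nat.factorial_zero, Nat.cast_one,
        div_one, one_mul, pow_one]
      convert hE τ using 1
      ring
    | succ N ih =>
      simp only [Finset.sum_range_succ _ (N + 1)]
      have h1 := (((((hτ τ).const_sub 1).pow (N + 1)).const_mul
        (Complex.I ^ (N + 1) / ((N + 1).factorial : ℂ) * T ^ (N + 1)))).mul (hE τ)
      refine HasDerivAt.congr_deriv (ih.add h1) ?_
      have hN : (N.factorial : ℂ) ≠ 0 := by exact_mod_cast N.factorial_ne_zero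
      have hN' : (N : ℂ) + 1 ≠ 0 := by exact_mod_cast N.succ_ne_zero
      simp only [Nat.factorial_succ, Nat.add_sub_cancel, Pi.pow_apply]
      push_cast
      field_simp
      ring
  have h2 := intervalIntegral.integral_eq_sub_of_hasDerivAt (a := 0) (b := 1)
    (fun τ _ => key N τ) (Continuous.intervalIntegrable (by fun_prop) _ _)
  rw [intervalIntegral.integral_const_mul] at h2
  rw [h2, Finset.sum_range_succ' (fun n => Complex.I ^ n / (n.factorial : ℂ) * T ^ n *
    (1 - ((1 : ℝ) : ℂ)) ^ n * Complex.exp (Complex.I * (1 : ℝ) * T))]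
  simp

lemma remainderKernel_eq (B : Fin d → Fin d → Config d → ℝ) (ε lam : ℝ) (N : ℕ) (x : Config d)
    (Y Z : Phase d) : remainderKernel B ε lam N x Y Z = twister B ε lam x Y Z -
      ∑ n ∈ Finset.range (N + 1), ∑ k ∈ Finset.range (n + 1),
        (ε : ℂ) ^ n * (lam : ℂ) ^ k * twisterCoeff n k (calLValue B x Y Z) := by
  have h1 := cexp_eq_sum_add_integral (twisterPhase B ε lam x Y Z : ℂ) N
  have h2 : fluxRemainder B ε lam N x Y Z = ∑ n ∈ Finset.range (N + 1),
      Complex.I ^ n / (n.factorial : ℂ) *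
        ((twisterPhase B ε lam x Y Z : ℂ) ^ n - truncPhase B ε lam N x Y Z ^ n) := by
    rw [fluxRemainder, Finset.range_eq_Ico, Finset.sum_eq_sum_Ico_succ_bot (Nat.succ_pos N)]
    simp only [pow_zero, sub_self, mul_zero, zero_add]
    rfl
  rw [remainderKernel, h2, surplus, twister, h1, expRemainder]
  simp only [mul_sub, Finset.sum_sub_distrib]
  ring

lemma twister_eq (hB : ∀ k l, IsBCInfty (B k l)) {ε : ℝ} (hε : ε ≠ 0) (lam : ℝ) (x : Config d)
    (Y Z : Phase d) : twister B ε lam x Y Z = Complex.exp (Complex.I * (ε / 2 * symp Y Z : ℝ)) *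
      magAmp B (fun _ => 1) ε lam x (Y.1, Z.1) := by
  rw [twister, twisterPhase, scaledFlux_eq (fun k l => (hB k l).1.continuous) hε, magAmp, mul_one,
    ← Complex.exp_add]
  congr 1
  push_cast
  ring

lemma polyGrowth_magAmp_one (hB : ∀ k l, IsBCInfty (B k l)) {ε lam : ℝ} (hε : |ε| ≤ 1)
    (hlam : |lam| ≤ 1) (x : Config d) :
    PolyGrowth phDir (fun w => ‖w‖) (fun _ : Unit => magAmp B (fun _ => 1) ε lam x) :=
  polyGrowth_magAmp hB (BoundedAmp.const 1) (fun _ => hε) (fun _ => hlam) fun _ => x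

variable {F G : Phase d → ℂ}

lemma integrable_twister (hB : ∀ k l, IsBCInfty (B k l)) (hF : Rapid F) (hG : Rapid G) {ε lam : ℝ}
    (hε : ε ≠ 0) (hε1 : |ε| ≤ 1) (hlam : |lam| ≤ 1) (X : Phase d) :
    Integrable (kernelIntegrand (twister B ε lam) F G X) := by
  have hc := ((polyGrowth_magAmp_one hB hε1 hlam X.1).1 ()).continuous
  refine integrable_kernelIntegrand hF hG (C := 1) (p := 0) ?_ fun P => ?_
  · simp only [twister_eq hB hε]
    fun_prop
  · rw [twister, norm_cexp_I_mul, pow_zero, one_mul]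

lemma kernelIntegrand_remainder (N : ℕ) (ε lam : ℝ) (X : Phase d) (P : Phase d × Phase d) :
    kernelIntegrand (remainderKernel B ε lam N) F G X P =
      kernelIntegrand (twister B ε lam) F G X P -
      ∑ n ∈ Finset.range (N + 1), ∑ k ∈ Finset.range (n + 1), (ε : ℂ) ^ n * (lam : ℂ) ^ k *
        (Complex.exp (Complex.I * symp X (P.1 + P.2)) *
          MvPolynomial.aeval (dSymValue P) (twisterCoeff n k (diffOp B X.1)) *
            (sympFourier F P.1 * sympFourier G P.2)) := by
  simp only [kernelIntegrand, remainderKernel_eq, aeval_twisterCoeff, mul_sub, sub_mul,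
    Finset.mul_sum, Finset.sum_mul]
  congr 1
  exact Finset.sum_congr rfl fun n _ => Finset.sum_congr rfl fun k _ => by ring

/-- For rapidly decreasing functions, the integral of the remainder kernel is the error of the
expansion. -/
lemma kernelIntegral_remainder (hB : ∀ k l, IsBCInfty (B k l)) (hF : Rapid F) (hG : Rapid G)
    {ε lam : ℝ} (hε : ε ≠ 0) (hε1 : |ε| ≤ 1) (hlam : |lam| ≤ 1) (N : ℕ) (X : Phase d) :
    Integrable (kernelIntegrand (remainderKernel B ε lam N) F G X) ∧
      kernelIntegral (remainderKernel B ε lam N) F G X = expansionError B F G N ε lam X := by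
  have h1 := integrable_twister hB hF hG hε hε1 hlam X
  have h2 := fun n k => (integrable_aeval hF hG (twisterCoeff n k (diffOp B X.1)) X).const_mul
    ((ε : ℂ) ^ n * (lam : ℂ) ^ k)
  have h3 := fun n : ℕ => integrable_finsetSum (Finset.range (n + 1)) fun k _ => h2 n k
  have h4 := integrable_finsetSum (Finset.range (N + 1)) fun n _ => h3 n
  have h5 : kernelIntegrand (remainderKernel B ε lam N) F G X = _ :=
    funext (kernelIntegrand_remainder N ε lam X)
  refine ⟨?_, ?_⟩
  · rw [h5]
    exact h1.sub h4
  · rw [kernelIntegral, h5, integral_sub h1 h4, mul_sub, expansionError, moyalInt_eq hB F G hε,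
      kernelIntegral, integral_finsetSum _ fun n _ => h3 n, Finset.mul_sum]
    congr 1
    refine Finset.sum_congr rfl fun n _ => ?_
    rw [integral_finsetSum _ fun k _ => h2 n k, Finset.mul_sum]
    refine Finset.sum_congr rfl fun k _ => ?_
    rw [integral_const_mul, mul_left_comm, integral_aeval hF hG, moyalTerm]

end Remainder

section Symbols

variable {d : ℕ} {B : Fin d → Fin d → Config d → ℝ} {f g : Phase d → ℂ} {ρ m₁ m₂ : ℝ}

lemma IsSymbol.tendsto_ddw_cutoff (hρ : ρ ≤ 1) (hf : IsSymbol m₁ ρ f)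
    {χ : SchwartzMap (Phase d) ℂ} (hχ : χ 0 = 1) (W : List (Fin d ⊕ Fin d)) (X : Phase d) :
    Tendsto (fun δ : Set.Ioc (0 : ℝ) 1 => ddw phDir W (cutoff χ δ f) X) cutoffFilter
      (𝓝 (ddw phDir W f X)) :=
  ((hf.symFamily_cutoff hρ χ).locBound.limit sum_coordL_smul_phDir
    (hf.symFamily_cutoff hρ χ).1 (tendsto_cutoff hχ f)).2 W X

lemma tendsto_moyalTerm (hρ : ρ ≤ 1) (hf : IsSymbol m₁ ρ f) (hg : IsSymbol m₂ ρ g)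
    {χ₁ χ₂ : SchwartzMap (Phase d) ℂ} (h₁ : χ₁ 0 = 1) (h₂ : χ₂ 0 = 1) (n k : ℕ) (X : Phase d) :
    Tendsto (fun δ : Set.Ioc (0 : ℝ) 1 => moyalTerm B (cutoff χ₁ δ f) (cutoff χ₂ δ g) n k X)
      cutoffFilter (𝓝 (moyalTerm B f g n k X)) := by
  simp only [moyalTerm, applyBidiff]
  refine tendsto_finsetSum _ fun s _ => ?_
  simp only [phaseDeriv_eq_ddw ((hf.symFamily_cutoff hρ χ₁).1 _),
    phaseDeriv_eq_ddw ((hg.symFamily_cutoff hρ χ₂).1 _), phaseDeriv_eq_ddw hf.1,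
    phaseDeriv_eq_ddw hg.1]
  exact (tendsto_const_nhds.mul (hf.tendsto_ddw_cutoff hρ h₁ _ X)).mul
    (hg.tendsto_ddw_cutoff hρ h₂ _ X)

/-- The product of symbols exists as an oscillatory integral. -/
lemma exists_hasOscIntegral_twister (hB : ∀ k l, IsBCInfty (B k l)) (hρ₀ : 0 ≤ ρ) (hρ₁ : ρ ≤ 1)
    (hf : IsSymbol m₁ ρ f) (hg : IsSymbol m₂ ρ g) {ε lam : ℝ} (hε : ε ≠ 0) (hε1 : |ε| ≤ 1)
    (hlam : |lam| ≤ 1) : ∃ h, HasOscIntegral (twister B ε lam) f g h := by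
  have hX : ∀ X : Phase d, ∃ L : ℂ, ∀ χ₁ χ₂ : SchwartzMap (Phase d) ℂ, χ₁ 0 = 1 → χ₂ 0 = 1 →
      Tendsto (fun δ : Set.Ioc (0 : ℝ) 1 => kernelIntegral (twister B ε lam) (cutoff χ₁ δ f)
        (cutoff χ₂ δ g) X) cutoffFilter (𝓝 L) := by
    intro X
    have hc := polyGrowth_magAmp_one hB hε1 hlam X.1
    obtain ⟨p, hp⟩ := hc.2 (fullList d (regExp d m₁ m₂)).length
    exact ⟨_, fun χ₁ χ₂ h₁ h₂ => tendsto_kernelIntegral hρ₀ (hf.symFamily_cutoff hρ₁ χ₁)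
      (hg.symFamily_cutoff hρ₁ χ₂) (fun δ => hf.rapid_cutoff hρ₀ χ₁ δ.2.1)
      (fun δ => hg.rapid_cutoff hρ₀ χ₂ δ.2.1) (tendsto_cutoff h₁ f) (tendsto_cutoff h₂ g) hc hp
      hε1 X (twister_eq hB hε lam X.1)⟩
  choose h hh using hX
  refine ⟨h, fun χ₁ χ₂ h₁ h₂ X => ⟨fun δ hδ => ?_, ?_⟩⟩
  · exact integrable_twister hB (hf.rapid_cutoff hρ₀ χ₁ hδ) (hg.rapid_cutoff hρ₀ χ₂ hδ) hε hε1
      hlam X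
  · exact tendsto_cutoffFilter_iff.1 (hh X χ₁ χ₂ h₁ h₂)

/-- The difference of the product of symbols and its expansion up to order `N`. -/
noncomputable def moyalError (B : Fin d → Fin d → Config d → ℝ) (f g : Phase d → ℂ) (N : ℕ)
    (ε lam : ℝ) (X : Phase d) : ℂ :=
  moyal B ε lam f g X - ∑ n ∈ Finset.range (N + 1), ∑ k ∈ Finset.range (n + 1),
    (ε : ℂ) ^ n * (lam : ℂ) ^ k * moyalTerm B f g n k X


end Symbols

end MagneticMoyal

/-! ### The expansion of the product of symbols -/

namespace MagneticMoyal

section Expansion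

variable {d : ℕ} {B : Fin d → Fin d → Config d → ℝ} {f g : Phase d → ℂ} {ρ m₁ m₂ : ℝ}

/-- The value of `moyal` is not the junk value `0` of `oscIntegral`. -/
lemma hasOscIntegral_moyal (hB : ∀ k l, IsBCInfty (B k l)) (hρ₀ : 0 ≤ ρ) (hρ₁ : ρ ≤ 1)
    (hf : IsSymbol m₁ ρ f) (hg : IsSymbol m₂ ρ g) {ε lam : ℝ} (hε : ε ≠ 0) (hε1 : |ε| ≤ 1)
    (hlam : |lam| ≤ 1) : HasOscIntegral (twister B ε lam) f g (moyal B ε lam f g) := by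
  obtain ⟨h, H⟩ := exists_hasOscIntegral_twister hB hρ₀ hρ₁ hf hg hε hε1 hlam
  rwa [moyal, H.oscIntegral_eq]

lemma tendsto_moyalInt_cutoff (hB : ∀ k l, IsBCInfty (B k l)) (hρ₀ : 0 ≤ ρ) (hρ₁ : ρ ≤ 1)
    (hf : IsSymbol m₁ ρ f) (hg : IsSymbol m₂ ρ g) {χ₁ χ₂ : SchwartzMap (Phase d) ℂ}
    (h₁ : χ₁ 0 = 1) (h₂ : χ₂ 0 = 1) {ε lam : ℝ} (hε : ε ≠ 0) (hε1 : |ε| ≤ 1) (hlam : |lam| ≤ 1)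
    (X : Phase d) :
    Tendsto (fun δ : Set.Ioc (0 : ℝ) 1 => moyalInt B (cutoff χ₁ δ f) (cutoff χ₂ δ g) (ε, lam, X))
      cutoffFilter (𝓝 (moyal B ε lam f g X)) := by
  simp only [moyalInt_eq hB _ _ hε]
  exact tendsto_cutoffFilter_iff.2
    (hasOscIntegral_moyal hB hρ₀ hρ₁ hf hg hε hε1 hlam χ₁ χ₂ h₁ h₂ X).2

lemma tendsto_expansionError (hB : ∀ k l, IsBCInfty (B k l)) (hρ₀ : 0 ≤ ρ) (hρ₁ : ρ ≤ 1)
    (hf : IsSymbol m₁ ρ f) (hg : IsSymbol m₂ ρ g) {χ₁ χ₂ : SchwartzMap (Phase d) ℂ}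
    (h₁ : χ₁ 0 = 1) (h₂ : χ₂ 0 = 1) {ε lam : ℝ} (hε : ε ≠ 0) (hε1 : |ε| ≤ 1) (hlam : |lam| ≤ 1)
    (N : ℕ) (X : Phase d) :
    Tendsto (fun δ : Set.Ioc (0 : ℝ) 1 =>
        expansionError B (cutoff χ₁ δ f) (cutoff χ₂ δ g) N ε lam X)
      cutoffFilter (𝓝 (moyalError B f g N ε lam X)) :=
  (tendsto_moyalInt_cutoff hB hρ₀ hρ₁ hf hg h₁ h₂ hε hε1 hlam X).sub <|
    tendsto_finsetSum _ fun n _ => tendsto_finsetSum _ fun k _ =>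
      (tendsto_moyalTerm hρ₁ hf hg h₁ h₂ n k X).const_mul _

/-- The remainder of the product exists, and it is the error of the expansion. -/
lemma hasOscIntegral_moyalError (hB : ∀ k l, IsBCInfty (B k l)) (hρ₀ : 0 ≤ ρ) (hρ₁ : ρ ≤ 1)
    (hf : IsSymbol m₁ ρ f) (hg : IsSymbol m₂ ρ g) {ε lam : ℝ} (hε : ε ≠ 0) (hε1 : |ε| ≤ 1)
    (hlam : |lam| ≤ 1) (N : ℕ) :
    HasOscIntegral (remainderKernel B ε lam N) f g (moyalError B f g N ε lam) := by
  have h := fun (χ₁ χ₂ : SchwartzMap (Phase d) ℂ) (δ : ℝ) (hδ : 0 < δ) =>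
    kernelIntegral_remainder hB (hf.rapid_cutoff hρ₀ χ₁ hδ) (hg.rapid_cutoff hρ₀ χ₂ hδ) hε hε1
      hlam N
  refine fun χ₁ χ₂ h₁ h₂ X =>
    ⟨fun δ hδ => (h χ₁ χ₂ δ hδ X).1, tendsto_cutoffFilter_iff.1 ?_⟩
  exact (tendsto_expansionError hB hρ₀ hρ₁ hf hg h₁ h₂ hε hε1 hlam N X).congr fun δ =>
    (h χ₁ χ₂ δ δ.2.1 X).2.symm

/-- The bounds for the error of the expansion of the product of symbols, by passage to the limit in
the regularization. -/
lemma moyalError_bound (hB : ∀ k l, IsBCInfty (B k l)) (hρ₀ : 0 ≤ ρ) (hρ₁ : ρ ≤ 1)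
    (hf : IsSymbol m₁ ρ f) (hg : IsSymbol m₂ ρ g) (N : ℕ) (W : List (Fin d ⊕ Fin d)) :
    ∃ C, 0 ≤ C ∧ ∀ ε lam : ℝ, 0 < ε → ε ≤ 1 → |lam| ≤ 1 →
      ContDiff ℝ ∞ (moyalError B f g N ε lam) ∧ ∀ X, ‖ddw phDir W (moyalError B f g N ε lam) X‖ ≤
        C * ε ^ (N + 1) * japanese X.2 ^ (m₁ + m₂ - ((N : ℝ) + 1) * ρ - freq W * ρ) := by
  obtain ⟨χ, hχ⟩ := exists_schwartz_eq_one d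
  have hF := fun δ : Set.Ioc (0 : ℝ) 1 => hf.rapid_cutoff hρ₀ χ δ.2.1
  have hG := fun δ : Set.Ioc (0 : ℝ) 1 => hg.rapid_cutoff hρ₀ χ δ.2.1
  have hb := expansionError_bound hB hρ₀ hF hG (hf.symFamily_cutoff hρ₁ χ)
    (hg.symFamily_cutoff hρ₁ χ) N
  obtain ⟨C, hC, hW⟩ := hb W
  refine ⟨C, hC, fun ε lam h0 h1 hlam => ?_⟩
  have hs : SymFamily ρ (m₁ + m₂ - ((N : ℝ) + 1) * ρ) (fun δ : Set.Ioc (0 : ℝ) 1 =>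
      expansionError B (cutoff χ δ f) (cutoff χ δ g) N ε lam) := by
    refine symFamily_of_bound (fun δ => contDiff_expansionError hB (hF δ) (hG δ) N ε lam)
      fun V => ?_
    obtain ⟨C, hC, hV⟩ := hb V
    exact ⟨C * ε ^ (N + 1), by positivity, fun δ X => hV δ ε lam h0.le h1 hlam X⟩
  have hl := hs.limit (tendsto_expansionError hB hρ₀ hρ₁ hf hg hχ hχ h0.ne'
    (by rwa [abs_of_pos h0]) hlam N)
  exact ⟨hl.1, hl.2 W _ fun δ X => hW δ ε lam h0.le h1 hlam X⟩

/-- The symbol class of the terms is inherited from the regularized symbols. -/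
lemma isSymbol_moyalTerm (hB : ∀ k l, IsBCInfty (B k l)) (hρ₀ : 0 ≤ ρ) (hρ₁ : ρ ≤ 1)
    (hf : IsSymbol m₁ ρ f) (hg : IsSymbol m₂ ρ g) (n k : ℕ) :
    IsSymbol (m₁ + m₂ - ((n : ℝ) + k) * ρ) ρ (moyalTerm B f g n k) := by
  obtain ⟨χ, hχ⟩ := exists_schwartz_eq_one d
  exact (symFamily_moyalTerm hB hρ₀ (fun δ : Set.Ioc (0 : ℝ) 1 => hf.rapid_cutoff hρ₀ χ δ.2.1)
    (fun δ => hg.rapid_cutoff hρ₀ χ δ.2.1) (hf.symFamily_cutoff hρ₁ χ)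
    (hg.symFamily_cutoff hρ₁ χ) n k).isSymbol_limit (tendsto_moyalTerm hρ₁ hf hg hχ hχ n k)

lemma isSymbol_moyal (hB : ∀ k l, IsBCInfty (B k l)) (hρ₀ : 0 ≤ ρ) (hρ₁ : ρ ≤ 1)
    (hf : IsSymbol m₁ ρ f) (hg : IsSymbol m₂ ρ g) {ε lam : ℝ} (hε : ε ≠ 0) (hε1 : |ε| ≤ 1)
    (hlam : |lam| ≤ 1) : IsSymbol (m₁ + m₂) ρ (moyal B ε lam f g) := by
  obtain ⟨χ, hχ⟩ := exists_schwartz_eq_one d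
  have hF := fun δ : Set.Ioc (0 : ℝ) 1 => hf.rapid_cutoff hρ₀ χ δ.2.1
  have hG := fun δ : Set.Ioc (0 : ℝ) 1 => hg.rapid_cutoff hρ₀ χ δ.2.1
  have hs : SymFamily ρ (m₁ + m₂) (fun (δ : Set.Ioc (0 : ℝ) 1) X =>
      moyalInt B (cutoff χ δ f) (cutoff χ δ g) (ε, lam, X)) := by
    refine symFamily_of_bound
      (fun δ => contDiff_par_phase (contDiff_moyalInt hB (hF δ) (hG δ)) ε lam) fun W => ?_
    obtain ⟨C, hC, hb⟩ := moyalInt_bound hB hρ₀ hF hG (hf.symFamily_cutoff hρ₁ χ)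
      (hg.symFamily_cutoff hρ₁ χ) (W.map Sum.inr)
    refine ⟨C, hC, fun δ X => ?_⟩
    have := hb δ (ε, lam, X) hε1 hlam
    rw [sum_parGain_inr] at this
    rwa [ddw_phaseWord (contDiff_moyalInt hB (hF δ) (hG δ))]
  exact hs.isSymbol_limit (tendsto_moyalInt_cutoff hB hρ₀ hρ₁ hf hg hχ hχ hε hε1 hlam)

lemma ddw_add {E κ : Type*} [NormedAddCommGroup E] [NormedSpace ℝ E] (dir : κ → E)
    (W : List κ) {f g : E → ℂ} (hf : ContDiff ℝ ∞ f) (hg : ContDiff ℝ ∞ g) :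
    ddw dir W (fun x => f x + g x) = fun x => ddw dir W f x + ddw dir W g x := by
  induction W with
  | nil => rfl
  | cons b W ih => rw [ddw_cons, ih, dd_add (contDiff_ddw _ _ hf) (contDiff_ddw _ _ hg)]; rfl

/-- Linear combinations of symbols of orders at most `m` are bounded as symbols of order `m`, by a
bound for their coefficients. -/
lemma IsSymbol.sum_ddw_bound {α : Type*} (s : Finset α) {m : ℝ} {c : α → Phase d → ℂ}
    {n : α → ℝ} (hc : ∀ a ∈ s, IsSymbol (n a) ρ (c a)) (hn : ∀ a ∈ s, n a ≤ m)
    (W : List (Fin d ⊕ Fin d)) : ∃ C, 0 ≤ C ∧ ∀ (z : α → ℂ) (r : ℝ), (∀ a ∈ s, ‖z a‖ ≤ r) →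
      ∀ X, ‖ddw phDir W (fun X => ∑ a ∈ s, z a * c a X) X‖ ≤
        C * r * japanese X.2 ^ (m - freq W * ρ) := by
  have hb : ∀ a, ∃ C, 0 ≤ C ∧ (a ∈ s → ∀ X, ‖ddw phDir W (c a) X‖ ≤
      C * japanese X.2 ^ (n a - freq W * ρ)) := by
    intro a
    by_cases ha : a ∈ s
    · obtain ⟨C, hC, h⟩ := (hc a ha).symFamily.bound W
      exact ⟨C, hC, fun _ => h ()⟩
    · exact ⟨0, le_rfl, fun h => absurd h ha⟩
  choose C hC hCb using hb
  refine ⟨∑ a ∈ s, C a, Finset.sum_nonneg fun a _ => hC a, fun z r hz X => ?_⟩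
  rw [ddw_sum _ _ _ fun a ha => contDiff_const.mul (hc a ha).1, Finset.sum_mul, Finset.sum_mul]
  refine norm_sum_le_of_le _ fun a ha => ?_
  rw [ddw_const_mul _ _ (hc a ha).1, norm_mul, mul_comm (C a), mul_assoc]
  refine mul_le_mul (hz a ha) ((hCb a ha X).trans ?_) (norm_nonneg _)
    ((norm_nonneg _).trans (hz a ha))
  exact mul_le_mul_of_nonneg_left (Real.rpow_le_rpow_of_exponent_le (one_le_japanese _)
    (by linarith [hn a ha])) (hC a)

/-- A sum over total degrees `n + k ≤ N` of terms that vanish for `k > n` consists of the terms with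
`0 ≤ k ≤ n ≤ N`, without those with `n + k > N`. -/
lemma sum_antidiagonal_eq {c : ℕ → ℕ → ℂ} (hc : ∀ n k, n < k → c n k = 0) (N : ℕ) :
    ∑ l ∈ Finset.range (N + 1), ∑ p ∈ Finset.HasAntidiagonal.antidiagonal l, c p.1 p.2 =
      ∑ n ∈ Finset.range (N + 1), ∑ k ∈ Finset.range (n + 1), c n k -
      ∑ p ∈ (Finset.range (N + 1) ×ˢ Finset.range (N + 1)).filter (fun p => ¬ p.1 + p.2 ≤ N),
        c p.1 p.2 := by
  have h1 : ∑ n ∈ Finset.range (N + 1), ∑ k ∈ Finset.range (n + 1), c n k =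
      ∑ p ∈ Finset.range (N + 1) ×ˢ Finset.range (N + 1), c p.1 p.2 := by
    rw [Finset.sum_product]
    refine Finset.sum_congr rfl fun n hn => Finset.sum_subset ?_ fun k _ hk => hc n k ?_
    · exact Finset.range_mono (by simpa using hn)
    · simpa using hk
  have h2 : ∑ l ∈ Finset.range (N + 1), ∑ p ∈ Finset.HasAntidiagonal.antidiagonal l, c p.1 p.2 =
      ∑ p ∈ (Finset.range (N + 1) ×ˢ Finset.range (N + 1)).filter (fun p => p.1 + p.2 ≤ N),
        c p.1 p.2 := by
    rw [← Finset.sum_fiberwise_of_maps_to (g := fun p : ℕ × ℕ => p.1 + p.2)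
      (t := Finset.range (N + 1))]
    · refine Finset.sum_congr rfl fun l hl => Finset.sum_congr ?_ fun _ _ => rfl
      ext p
      simp only [Finset.HasAntidiagonal.mem_antidiagonal, Finset.mem_filter, Finset.mem_product,
        Finset.mem_range] at hl ⊢
      omega
    · intro p hp
      simp only [Finset.mem_filter, Finset.mem_range] at hp ⊢
      omega
  rw [h1, h2, eq_sub_iff_add_eq, Finset.sum_filter_add_sum_filter_not]

/-- The error of the expansion by total degree in `ε` and `λ`. -/
lemma moyal_sub_antidiagonal_bound (hB : ∀ k l, IsBCInfty (B k l)) (hρ₀ : 0 ≤ ρ) (hρ₁ : ρ ≤ 1)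
    (hf : IsSymbol m₁ ρ f) (hg : IsSymbol m₂ ρ g) (N : ℕ) (W : List (Fin d ⊕ Fin d)) :
    ∃ C, 0 ≤ C ∧ ∀ ε lam : ℝ, 0 < ε → ε ≤ 1 → 0 ≤ lam → lam ≤ 1 → ∀ h : Phase d → ℂ,
      h = (fun X => moyal B ε lam f g X -
        ∑ l ∈ Finset.range (N + 1), ∑ p ∈ Finset.HasAntidiagonal.antidiagonal l,
          (ε : ℂ) ^ p.1 * (lam : ℂ) ^ p.2 * moyalTerm B f g p.1 p.2 X) →
      ContDiff ℝ ∞ h ∧ ∀ X, ‖ddw phDir W h X‖ ≤ C * max ε lam ^ (N + 1) *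
        japanese X.2 ^ (m₁ + m₂ - ((N : ℝ) + 1) * ρ - freq W * ρ) := by
  set s := (Finset.range (N + 1) ×ˢ Finset.range (N + 1)).filter (fun p => ¬ p.1 + p.2 ≤ N) with hs
  have hN : ∀ p ∈ s, N + 1 ≤ p.1 + p.2 := fun p hp => by
    have := (Finset.mem_filter.1 hp).2
    omega
  have ht := fun p : ℕ × ℕ => isSymbol_moyalTerm hB hρ₀ hρ₁ hf hg p.1 p.2
  obtain ⟨C₁, hC₁, hb₁⟩ := moyalError_bound hB hρ₀ hρ₁ hf hg N W
  obtain ⟨C₂, hC₂, hb₂⟩ := IsSymbol.sum_ddw_bound (m := m₁ + m₂ - ((N : ℝ) + 1) * ρ) s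
    (fun p _ => ht p) (fun p hp => by
      have : (N : ℝ) + 1 ≤ p.1 + p.2 := by exact_mod_cast hN p hp
      linarith [mul_le_mul_of_nonneg_right this hρ₀]) W
  refine ⟨C₁ + C₂, by positivity, fun ε lam h0 h1 hl0 hl1 h hh => ?_⟩
  have hlam : |lam| ≤ 1 := by rwa [abs_of_nonneg hl0]
  have hM : max ε lam ≤ 1 := max_le h1 hl1
  have hM0 : 0 ≤ max ε lam := h0.le.trans (le_max_left _ _)
  have h3 : h = fun X => moyalError B f g N ε lam X +
      ∑ p ∈ s, (ε : ℂ) ^ p.1 * (lam : ℂ) ^ p.2 * moyalTerm B f g p.1 p.2 X := by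
    rw [hh]
    funext X
    rw [sum_antidiagonal_eq (c := fun n k => (ε : ℂ) ^ n * (lam : ℂ) ^ k * moyalTerm B f g n k X)
      (fun n k hnk => by rw [moyalTerm_eq_zero B f g hnk, mul_zero]), moyalError]
    ring
  obtain ⟨hd, hb⟩ := hb₁ ε lam h0 h1 hlam
  have hd' : ContDiff ℝ ∞ fun X =>
      ∑ p ∈ s, (ε : ℂ) ^ p.1 * (lam : ℂ) ^ p.2 * moyalTerm B f g p.1 p.2 X :=
    ContDiff.sum fun p _ => contDiff_const.mul (ht p).1
  rw [h3]
  refine ⟨hd.add hd', fun X => ?_⟩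
  rw [ddw_add _ _ hd hd', add_mul C₁, add_mul (C₁ * _)]
  refine norm_add_le_of_le ((hb X).trans ?_) (hb₂ _ _ (fun p hp => ?_) X)
  · refine mul_le_mul_of_nonneg_right (mul_le_mul_of_nonneg_left ?_ hC₁)
      (Real.rpow_nonneg (japanese_pos _).le _)
    exact pow_le_pow_left₀ h0.le (le_max_left _ _) _
  · rw [norm_mul, norm_pow, norm_pow, Complex.norm_real, Complex.norm_real,
      Real.norm_of_nonneg h0.le, Real.norm_of_nonneg hl0]
    calc ε ^ p.1 * lam ^ p.2 ≤ max ε lam ^ p.1 * max ε lam ^ p.2 := by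
          gcongr
          · exact le_max_left _ _
          · exact le_max_right _ _
      _ = max ε lam ^ (p.1 + p.2) := (pow_add _ _ _).symm
      _ ≤ max ε lam ^ (N + 1) := pow_le_pow_of_le_one hM0 hM (hN p hp)

lemma isSemiclassicalSymbol_moyal (hB : ∀ k l, IsBCInfty (B k l)) (hρ₀ : 0 ≤ ρ) (hρ₁ : ρ ≤ 1)
    (hf : IsSymbol m₁ ρ f) (hg : IsSymbol m₂ ρ g) :
    IsSemiclassicalSymbol (m₁ + m₂) ρ 1 1 (fun ε lam => moyal B ε lam f g)
      (moyalTerm B f g) where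
  mem ε lam h0 h1 hl0 hl1 := isSymbol_moyal hB hρ₀ hρ₁ hf hg h0.ne'
    (by rw [abs_of_pos h0]; exact h1.le) (by rw [abs_of_nonneg hl0]; exact hl1.le)
  coeff_mem := isSymbol_moyalTerm hB hρ₀ hρ₁ hf hg
  remainder_mem N ε lam h0 h1 hl0 hl1 := by
    have hb := fun W => moyal_sub_antidiagonal_bound hB hρ₀ hρ₁ hf hg N W
    refine IsSymbol.of_ddw ?_ fun W => ?_
    · obtain ⟨C, -, h⟩ := hb []
      exact (h ε lam h0 h1.le hl0 hl1.le _ rfl).1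
    · obtain ⟨C, hC, h⟩ := hb W
      exact ⟨C * max ε lam ^ (N + 1),
        mul_nonneg hC (pow_nonneg (h0.le.trans (le_max_left _ _)) _),
        (h ε lam h0 h1.le hl0 hl1.le _ rfl).2⟩
  remainder_le N a α := by
    obtain ⟨C, hC, h⟩ := moyal_sub_antidiagonal_bound hB hρ₀ hρ₁ hf hg N (wordOf a α)
    refine ⟨C + 1, by positivity, fun ε lam h0 h1 hl0 hl1 => ?_⟩
    obtain ⟨hd, hb⟩ := h ε lam h0 h1.le hl0 hl1.le _ rfl
    have hM0 : 0 ≤ max ε lam ^ (N + 1) := pow_nonneg (h0.le.trans (le_max_left _ _)) _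
    refine seminormLE_of_ddw hd fun X => (hb X).trans ?_
    refine mul_le_mul (mul_le_mul_of_nonneg_right (by linarith) hM0)
      (Real.rpow_le_rpow_of_exponent_le (one_le_japanese _) ?_)
      (Real.rpow_nonneg (japanese_pos _).le _) (by positivity)
    have : 0 ≤ ((N : ℝ) + 1) * ρ := by positivity
    linarith

/-- The exponents `n_c` and `k_c`; for `t = 0` the convention `0 ^ 0 = 1` gives `0`. -/
lemma exists_precision_exponent {t prec : ℝ} (hp : 0 < prec) (hp1 : prec ≤ 1) (ht : 0 ≤ t)
    (ht1 : t < 1) : ∃ n : ℕ, t ^ (n + 1) < prec ∧ prec ≤ t ^ n := by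
  rcases ht.eq_or_lt with rfl | h0
  · exact ⟨0, by simpa using hp, by simpa using hp1⟩
  · exact exists_nat_pow_near_of_lt_one hp hp1 h0 ht1

end Expansion

end MagneticMoyal

open MagneticMoyal

theorem mainTheorem1 {d : ℕ} (ρ m₁ m₂ : ℝ) (hρ₀ : 0 ≤ ρ) (hρ₁ : ρ ≤ 1)
    (B : Fin d → Fin d → Config d → ℝ) (hB : IsMagneticField B)
    (hBC : ∀ k l, IsBCInfty (B k l))
    (f g : Phase d → ℂ) (hf : IsSymbol m₁ ρ f) (hg : IsSymbol m₂ ρ g) :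
    -- the product exists as an oscillatory integral
    (∀ ε lam : ℝ, 0 < ε → ε ≤ 1 → 0 ≤ lam → lam ≤ 1 →
      HasOscIntegral (twister B ε lam) f g (moyal B ε lam f g)) ∧
    -- the terms lie in the correct symbol classes
    (∀ n k : ℕ, k ≤ n → IsSymbol (m₁ + m₂ - ((n : ℝ) + k) * ρ) ρ (moyalTerm B f g n k)) ∧
    -- the product is a semiclassical two-parameter symbol with these terms
    IsSemiclassicalSymbol (m₁ + m₂) ρ 1 1 (fun ε lam => moyal B ε lam f g) (moyalTerm B f g) ∧
    -- the constants depend neither on `ε`, `λ` nor on the precision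
    ∃ C : ℕ → (Fin d → ℕ) → (Fin d → ℕ) → ℝ,
      -- the expansion to arbitrary order, with remainder
      (∀ (N : ℕ) (ε lam : ℝ), 0 < ε → ε ≤ 1 → 0 ≤ lam → lam ≤ 1 →
        HasOscIntegral (remainderKernel B ε lam N) f g (moyalRemainder B ε lam f g N) ∧
        (∀ X : Phase d, moyal B ε lam f g X =
          (∑ n ∈ Finset.range (N + 1), ∑ k ∈ Finset.range (n + 1),
            (ε : ℂ) ^ n * (lam : ℂ) ^ k * moyalTerm B f g n k X)
          + moyalRemainder B ε lam f g N X) ∧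
        IsSymbol (m₁ + m₂ - ((N : ℝ) + 1) * ρ) ρ (moyalRemainder B ε lam f g N) ∧
        ∀ a α : Fin d → ℕ, SeminormLE (m₁ + m₂ - ((N : ℝ) + 1) * ρ) ρ a α
          (moyalRemainder B ε lam f g N) (C N a α * ε ^ (N + 1))) ∧
      -- the remainder is of the order of any prescribed precision
      (∀ prec ε lam : ℝ, 0 < prec → prec ≤ 1 → 0 < ε → ε < 1 → 0 ≤ lam → lam < 1 →
        ∃ N : ℕ, IsPrecisionOrder ε lam prec N ∧
          IsPrecisionClose (m₁ + m₂) ρ ε lam prec (moyal B ε lam f g) (moyalTerm B f g) N N ∧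
          ∀ a α : Fin d → ℕ, SeminormLE (m₁ + m₂ - ((N : ℝ) + 1) * ρ) ρ a α
            (moyalRemainder B ε lam f g N) (C N a α * prec)) := by
  have hmoyal := fun (ε lam : ℝ) (h0 : 0 < ε) (h1 : ε ≤ 1) (hl0 : 0 ≤ lam) (hl1 : lam ≤ 1) =>
    hasOscIntegral_moyal hBC hρ₀ hρ₁ hf hg h0.ne' (by rwa [abs_of_pos h0])
      (by rwa [abs_of_nonneg hl0])
  have hrem : ∀ (N : ℕ) (ε lam : ℝ), 0 < ε → ε ≤ 1 → 0 ≤ lam → lam ≤ 1 →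
      HasOscIntegral (remainderKernel B ε lam N) f g (moyalError B f g N ε lam) ∧
        moyalRemainder B ε lam f g N = moyalError B f g N ε lam := by
    intro N ε lam h0 h1 hl0 hl1
    have H := hasOscIntegral_moyalError hBC hρ₀ hρ₁ hf hg h0.ne' (by rwa [abs_of_pos h0])
      (by rwa [abs_of_nonneg hl0]) N
    exact ⟨H, H.oscIntegral_eq⟩
  have hb := moyalError_bound hBC hρ₀ hρ₁ hf hg
  have hsym : ∀ (N : ℕ) (ε lam : ℝ), 0 < ε → ε ≤ 1 → 0 ≤ lam → lam ≤ 1 →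
      IsSymbol (m₁ + m₂ - ((N : ℝ) + 1) * ρ) ρ (moyalError B f g N ε lam) := by
    intro N ε lam h0 h1 hl0 hl1
    have hlam : |lam| ≤ 1 := by rwa [abs_of_nonneg hl0]
    refine IsSymbol.of_ddw ?_ fun W => ?_
    · obtain ⟨C, -, h⟩ := hb N []
      exact (h ε lam h0 h1 hlam).1
    · obtain ⟨C, hC, h⟩ := hb N W
      exact ⟨C * ε ^ (N + 1), by positivity, (h ε lam h0 h1 hlam).2⟩
  choose C hC hCb using hb
  have hle : ∀ (N : ℕ) (a α : Fin d → ℕ) (ε lam : ℝ), 0 < ε → ε ≤ 1 → 0 ≤ lam → lam ≤ 1 →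
      SeminormLE (m₁ + m₂ - ((N : ℝ) + 1) * ρ) ρ a α (moyalError B f g N ε lam)
        (C N (wordOf a α) * ε ^ (N + 1)) := by
    intro N a α ε lam h0 h1 hl0 hl1
    obtain ⟨hd, h⟩ := hCb N (wordOf a α) ε lam h0 h1 (by rwa [abs_of_nonneg hl0])
    exact seminormLE_of_ddw hd h
  refine ⟨hmoyal, fun n k _ => isSymbol_moyalTerm hBC hρ₀ hρ₁ hf hg n k,
    isSemiclassicalSymbol_moyal hBC hρ₀ hρ₁ hf hg, fun N a α => C N (wordOf a α), ?_, ?_⟩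
  · intro N ε lam h0 h1 hl0 hl1
    obtain ⟨H, he⟩ := hrem N ε lam h0 h1 hl0 hl1
    rw [he]
    exact ⟨H, fun X => (add_sub_cancel _ _).symm, hsym N ε lam h0 h1 hl0 hl1,
      fun a α => hle N a α ε lam h0 h1 hl0 hl1⟩
  · intro prec ε lam hp hp1 h0 h1 hl0 hl1
    obtain ⟨nc, hn, hn'⟩ := exists_precision_exponent hp hp1 h0.le h1
    obtain ⟨kc, hk, hk'⟩ := exists_precision_exponent hp hp1 hl0 hl1
    have hN : IsPrecisionOrder ε lam prec (max nc kc) := ⟨nc, kc, hn, hn', hk, hk', rfl⟩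
    refine ⟨max nc kc, hN, ⟨max nc kc, hN, le_rfl, le_rfl, ?_⟩, fun a α => ?_⟩
    · convert hsym (max nc kc) ε lam h0 h1.le hl0 hl1.le using 1
      funext X
      rw [moyalError]
      congr 1
      -- the terms with `k > n` vanish
      refine Finset.sum_congr rfl fun n hn => (Finset.sum_subset ?_ fun k _ hk => ?_).symm
      · exact Finset.range_mono (by simpa using hn)
      · rw [moyalTerm_eq_zero B f g (by simpa using hk), mul_zero]
    · rw [(hrem (max nc kc) ε lam h0 h1.le hl0 hl1.le).2]
      intro X
      refine (hle (max nc kc) a α ε lam h0 h1.le hl0 hl1.le X).trans ?_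
      refine mul_le_mul_of_nonneg_right (mul_le_mul_of_nonneg_left ?_ (hC _ _))
        (Real.rpow_nonneg (japanese_pos _).le _)
      exact (pow_le_pow_of_le_one h0.le h1.le (by simp)).trans hn.le
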